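/- Let $A$ be an arbitrary ring (modules are left modules). Let $\sigma_1,\dots,\sigma_n$ be automorphisms of $A$ and $\xi_{ij}$ ($1\le i<j\le n$) invertible elements of $A$ forming a \emph{type}: $\sigma_i\sigma_j(a)=\xi_{ij}\,\sigma_j\sigma_i(a)\,\xi_{ij}^{-1}$ for all $a\in A$ and $i<j$, and $\xi_{ij}\,\sigma_j(\xi_{ik})\,\xi_{jk}=\sigma_i(\xi_{jk})\,\xi_{ik}\,\sigma_k(\xi_{ij})$ for all $i<j<k$. Let $(\omega_1,\dots,\omega_n)$ be a \emph{regular sequence of type} $(\sigma_i;\xi_{ij})$: each $\omega_i$ is regular and normal modulo the two-sided ideal $(\omega_1,\dots,\omega_{i-1})$; $\omega_i a=\sigma_i(a)\omega_i$ for all $a \in A$, and $\sigma_i(\omega_i)=\omega_i$; and $\sigma_i(\omega_j)=\xi_{ij}\omega_j$, $\sigma_j(\omega_i)=\xi_{ij}^{-1}\omega_i$ for $i<j$. Set $B=A/(\omega_1,\dots,\omega_n)$. Let ${}^{\sigma}M$ denote the $A$-module $M$ with action twisted by $\sigma$. An \emph{$n$-dimensional module factorization} $X$ consists of $A$-modules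 $X^\alpha$, $\alpha\in\{0,1\}^n$, and, for each $i$ and each $\alpha$ with $\alpha_i=0$, homomorphisms $d_i^\alpha\colon X^\alpha\to X^{\alpha+\epsilon_i}$ and $d_i^{\alpha+\epsilon_i}\colon X^{\alpha+\epsilon_i}\to{}^{\sigma_i}(X^\alpha)$ whose two composites are multiplication by $\omega_i$, such that all two-dimensional faces commute; the composites of two maps to twisted modules are compared through the isomorphisms ${}^{\sigma_i}({}^{\sigma_j}M)\to{}^{\sigma_j}({}^{\sigma_i}M)$, $i<j$, given by multiplication by $\xi_{ij}$. Morphisms are families of homomorphisms $X^\alpha\to Y^\alpha$ commuting with all structure maps, and conflations are the componentwise short exact sequences. Let $\mathbf{GF}$ (resp. $\mathbf{MF}$) be the category of $n$-dimensional module factorizations with Gorenstein projective (resp. finitely generated projective) components. Let $\mathbf{GF}^{0^n}(A;\omega_1,\dots,\omega_n)$ (resp. $\mathbf{MF}^{0^n}(A;\omega_1,\dots,\omega_n)$) be the full subcategory of those $X$ each of whose $n$ facets containing $X^{\mathbf 1}$, $\mathbf 1=(1,\dots,1)$, is a projective object of the corresponding exact category of $(n-1)$-dimensional factorizations. The \emph{total-cokernel}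 $\mathrm{TCok}(X)$ is the cokernel of $\bigoplus_{i=1}^n X^{\mathbf 1-\epsilon_i}\to X^{\mathbf 1}$; it is naturally a $B$-module. Then $\mathbf{GF}^{0^n}(A;\omega_1,\dots,\omega_n)$ and the category $B\text{-}\mathrm{GProj}$ of Gorenstein projective $B$-modules are Frobenius exact categories, and the total-cokernel functor induces a triangle equivalence of stable categories $$\mathrm{TCok}\colon \underline{\mathbf{GF}}^{0^n}(A;\omega_1,\dots,\omega_n)\stackrel{\sim}{\longrightarrow}B\text{-}\underline{\mathrm{GProj}}.$$ If $A$ is left noetherian, then $\mathbf{MF}^{0^n}(A;\omega_1,\dots,\omega_n)$ and the category $B\text{-}\mathrm{Gproj}^{<+\infty}$ of finitely generated Gorenstein projective $B$-modules whose underlying $A$-modules have finite projective dimension are Frobenius exact categories, their stable categories are full subcategories of the two stable categories above, and the equivalence restricts to a triangle equivalence $$\mathrm{TCok}\colon \underline{\mathbf{MF}}^{0^n}(A;\omega_1,\dots,\omega_n)\stackrel{\sim}{\longrightarrow}B\text{-}\underline{\mathrm{Gproj}}^{<+\infty}.$$ -/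

import Mathlib

open CategoryTheory CategoryTheory.Limits

universe u v u' v'

/-! # Exact categories, Frobenius categories, stable categories -/

namespace ExactCat

section Exact

variable {C : Type u} [Category.{v} C] [Preadditive C]

/-- `i` is an inflation for the class `E` of conflations. -/
def IsInflation (E : ObjectProperty (ShortComplex C)) {X Y : C} (i : X ⟶ Y) : Prop :=
  ∃ (Z : C) (p : Y ⟶ Z) (w : i ≫ p = 0), E (ShortComplex.mk i p w)

/-- `d` is a deflation for the class `E` of conflations. -/
def IsDeflation (E : ObjectProperty (ShortComplex C)) {Y Z : C} (d : Y ⟶ Z) : Prop :=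
  ∃ (X : C) (i : X ⟶ Y) (w : i ≫ d = 0), E (ShortComplex.mk i d w)

/-- The class `E` of conflations is an exact structure (in the sense of Quillen)
on the additive category `C`. -/
structure IsExactStructure (E : ObjectProperty (ShortComplex C)) : Prop where
  additive : HasFiniteBiproducts C
  of_iso : E.IsClosedUnderIsomorphisms
  isKernel : ∀ S : ShortComplex C, E S → Nonempty (IsLimit (KernelFork.ofι S.f S.zero))
  isCokernel : ∀ S : ShortComplex C, E S → Nonempty (IsColimit (CokernelCofork.ofπ S.g S.zero))
  deflation_id_zero : ∀ Z : C, IsZero Z → IsDeflation E (𝟙 Z)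
  deflation_comp : ∀ {X Y Z : C} (f : X ⟶ Y) (g : Y ⟶ Z),
    IsDeflation E f → IsDeflation E g → IsDeflation E (f ≫ g)
  inflation_comp : ∀ {X Y Z : C} (f : X ⟶ Y) (g : Y ⟶ Z),
    IsInflation E f → IsInflation E g → IsInflation E (f ≫ g)
  deflation_pullback : ∀ {Y Z Z' : C} (d : Y ⟶ Z) (f : Z' ⟶ Z), IsDeflation E d →
    ∃ (Y' : C) (f' : Y' ⟶ Y) (d' : Y' ⟶ Z'), IsPullback f' d' d f ∧ IsDeflation E d'
  inflation_pushout : ∀ {X Y X' : C} (i : X ⟶ Y) (f : X ⟶ X'), IsInflation E i →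
    ∃ (Y' : C) (f' : Y ⟶ Y') (i' : X' ⟶ Y'), IsPushout i f f' i' ∧ IsInflation E i'

/-- Projective objects with respect to the conflations in `E`. -/
def IsProj (E : ObjectProperty (ShortComplex C)) (P : C) : Prop :=
  ∀ S : ShortComplex C, E S → ∀ f : P ⟶ S.X₃, ∃ g : P ⟶ S.X₂, g ≫ S.g = f

/-- Injective objects with respect to the conflations in `E`. -/
def IsInj (E : ObjectProperty (ShortComplex C)) (I : C) : Prop :=
  ∀ S : ShortComplex C, E S → ∀ f : S.X₁ ⟶ I, ∃ g : S.X₂ ⟶ I, S.f ≫ g = f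

/-- `C` with the conflations in `E` is a Frobenius exact category. -/
structure IsFrobenius (E : ObjectProperty (ShortComplex C)) : Prop extends
    IsExactStructure E where
  enough_proj : ∀ X : C, ∃ (P : C) (p : P ⟶ X), IsProj E P ∧ IsDeflation E p
  enough_inj : ∀ X : C, ∃ (I : C) (i : X ⟶ I), IsInj E I ∧ IsInflation E i
  proj_iff_inj : ∀ X : C, IsProj E X ↔ IsInj E X

/-- Two parallel morphisms are identified in the stable category when their difference
factors through a projective object. -/
def stableRel (E : ObjectProperty (ShortComplex C)) : HomRel C := fun X Y f g =>
  ∃ (P : C) (_ : IsProj E P) (s : X ⟶ P) (t : P ⟶ Y), f - g = s ≫ t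

/-- The stable category. -/
abbrev Stable (E : ObjectProperty (ShortComplex C)) : Type u :=
  CategoryTheory.Quotient (stableRel E)

/-- The canonical functor to the stable category. -/
abbrev toStable (E : ObjectProperty (ShortComplex C)) : C ⥤ Stable E :=
  CategoryTheory.Quotient.functor (stableRel E)

/-- A conflation `X ⟶ I ⟶ Z` with `I` injective. -/
structure InjHull (E : ObjectProperty (ShortComplex C)) (X : C) where
  I : C
  Z : C
  i : X ⟶ I
  p : I ⟶ Z
  zero : i ≫ p = 0
  conf : E (ShortComplex.mk i p zero)
  inj : IsInj E I

variable {E : ObjectProperty (ShortComplex C)}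

/-- A chosen conflation `X ⟶ I(X) ⟶ ΣX` with `I(X)` injective. -/
noncomputable def IsFrobenius.hull (hE : IsFrobenius E) (X : C) : InjHull E X :=
  Classical.choice (by
    obtain ⟨I, i, hI, Z, p, w, h⟩ := hE.enough_inj X
    exact ⟨⟨I, Z, i, p, w, h, hI⟩⟩)

theorem IsFrobenius.exists_susp (hE : IsFrobenius E) {X Y : C} (f : X ⟶ Y) :
    ∃ z : (hE.hull X).Z ⟶ (hE.hull Y).Z, ∃ a : (hE.hull X).I ⟶ (hE.hull Y).I,
      (hE.hull X).i ≫ a = f ≫ (hE.hull Y).i ∧ a ≫ (hE.hull Y).p = (hE.hull X).p ≫ z := by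
  obtain ⟨a, ha⟩ := (hE.hull Y).inj _ (hE.hull X).conf (f ≫ (hE.hull Y).i)
  have hc := (hE.isCokernel _ (hE.hull X).conf).some
  obtain ⟨z, hz⟩ := CokernelCofork.IsColimit.desc' hc (a ≫ (hE.hull Y).p) (by
    have h0 : (hE.hull X).i ≫ a = f ≫ (hE.hull Y).i := ha
    change (hE.hull X).i ≫ a ≫ (hE.hull Y).p = 0
    rw [← Category.assoc, h0, Category.assoc, (hE.hull Y).zero, comp_zero])
  exact ⟨z, a, ha, hz.symm⟩

theorem IsFrobenius.susp_unique (hE : IsFrobenius E) {X Y : C} {f f' : X ⟶ Y}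
    (hf : stableRel E f f') {z z' : (hE.hull X).Z ⟶ (hE.hull Y).Z}
    {a a' : (hE.hull X).I ⟶ (hE.hull Y).I}
    (h₁ : (hE.hull X).i ≫ a = f ≫ (hE.hull Y).i)
    (h₂ : a ≫ (hE.hull Y).p = (hE.hull X).p ≫ z)
    (h₁' : (hE.hull X).i ≫ a' = f' ≫ (hE.hull Y).i)
    (h₂' : a' ≫ (hE.hull Y).p = (hE.hull X).p ≫ z') :
    (toStable E).map z = (toStable E).map z' := by
  apply CategoryTheory.Quotient.sound
  obtain ⟨P, hP, s, t, hst⟩ := hf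
  obtain ⟨s', hs'⟩ := ((hE.proj_iff_inj P).1 hP) _ (hE.hull X).conf s
  have hs'' : (hE.hull X).i ≫ s' = s := hs'
  have hc := (hE.isCokernel _ (hE.hull X).conf).some
  obtain ⟨b, hb⟩ := CokernelCofork.IsColimit.desc' hc (a - a' - s' ≫ t ≫ (hE.hull Y).i) (by
    change (hE.hull X).i ≫ (a - a' - s' ≫ t ≫ (hE.hull Y).i) = 0
    rw [Preadditive.comp_sub, Preadditive.comp_sub, h₁, h₁', ← Preadditive.sub_comp, hst,
      ← Category.assoc (hE.hull X).i s', hs'', Category.assoc, sub_self])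
  have hb' : (hE.hull X).p ≫ b = a - a' - s' ≫ t ≫ (hE.hull Y).i := hb
  refine ⟨(hE.hull Y).I, (hE.proj_iff_inj _).2 (hE.hull Y).inj, b, (hE.hull Y).p, ?_⟩
  apply Cofork.IsColimit.hom_ext hc
  change (hE.hull X).p ≫ (z - z') = (hE.hull X).p ≫ b ≫ (hE.hull Y).p
  rw [Preadditive.comp_sub, ← h₂, ← h₂', ← Category.assoc, hb']
  simp [Preadditive.sub_comp, (hE.hull Y).zero]

theorem IsFrobenius.stableRel_refl (hE : IsFrobenius E) {X Y : C} (f : X ⟶ Y) :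
    stableRel E f f := by
  obtain ⟨P, p, hP, -⟩ := hE.enough_proj X
  exact ⟨P, hP, 0, 0, by simp⟩

/-- The functor underlying the suspension, before passing to the stable category. -/
noncomputable def IsFrobenius.preSusp (hE : IsFrobenius E) : C ⥤ Stable E where
  obj X := (toStable E).obj (hE.hull X).Z
  map f := (toStable E).map (hE.exists_susp f).choose
  map_id X := by
    obtain ⟨a, h₁, h₂⟩ := (hE.exists_susp (𝟙 X)).choose_spec
    refine (hE.susp_unique (hE.stableRel_refl (𝟙 X)) h₁ h₂
      (a' := 𝟙 _) (z' := 𝟙 _) (by simp) (by simp)).trans ?_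
    exact (toStable E).map_id _
  map_comp {X Y W} f g := by
    obtain ⟨a, h₁, h₂⟩ := (hE.exists_susp (f ≫ g)).choose_spec
    obtain ⟨a', h₁', h₂'⟩ := (hE.exists_susp f).choose_spec
    obtain ⟨a'', h₁'', h₂''⟩ := (hE.exists_susp g).choose_spec
    rw [← Functor.map_comp]
    refine hE.susp_unique (hE.stableRel_refl (f ≫ g)) h₁ h₂ (a' := a' ≫ a'') ?_ ?_
    · rw [← Category.assoc, h₁', Category.assoc, h₁'', Category.assoc]
    · rw [Category.assoc, h₂'', ← Category.assoc, h₂', Category.assoc]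

/-- The suspension functor `Σ` of the stable category of a Frobenius category. -/
noncomputable def IsFrobenius.susp (hE : IsFrobenius E) : Stable E ⥤ Stable E :=
  CategoryTheory.Quotient.lift _ hE.preSusp (by
    intro X Y f f' hf
    obtain ⟨a, h₁, h₂⟩ := (hE.exists_susp f).choose_spec
    obtain ⟨a', h₁', h₂'⟩ := (hE.exists_susp f').choose_spec
    exact hE.susp_unique hf h₁ h₂ h₁' h₂')

/-- The distinguished triangles of the stable category of a Frobenius category:
those isomorphic to a standard triangle `X ⟶ Y ⟶ Cn ⟶ ΣX`, where `Cn` is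
the pushout of the chosen inflation `X ⟶ I(X)` along a morphism `u : X ⟶ Y` and where
`Cn ⟶ ΣX` is induced by `0 : Y ⟶ ΣX` and `I(X) ⟶ ΣX`. -/
def IsFrobenius.Distinguished (hE : IsFrobenius E) {U V W : Stable E}
    (f : U ⟶ V) (g : V ⟶ W) (h : W ⟶ hE.susp.obj U) : Prop :=
  ∃ (X Y Cn : C) (u : X ⟶ Y) (c : Y ⟶ Cn) (j : (hE.hull X).I ⟶ Cn) (w : Cn ⟶ (hE.hull X).Z)
    (_ : IsPushout (hE.hull X).i u j c) (_ : c ≫ w = 0) (_ : j ≫ w = (hE.hull X).p)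
    (α : U ≅ (toStable E).obj X) (β : V ≅ (toStable E).obj Y) (γ : W ≅ (toStable E).obj Cn),
    f ≫ β.hom = α.hom ≫ (toStable E).map u ∧
    g ≫ γ.hom = β.hom ≫ (toStable E).map c ∧
    h ≫ hE.susp.map α.hom = γ.hom ≫ (toStable E).map w

end Exact

section Functors

variable {C : Type u} [Category.{v} C] [Preadditive C]
variable {C' : Type u'} [Category.{v'} C'] [Preadditive C']
variable {E : ObjectProperty (ShortComplex C)} {E' : ObjectProperty (ShortComplex C')}

/-- `F` is (the underlying functor of) a triangle functor between stable categories: it commutes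
with the suspensions, up to a natural isomorphism with which it sends distinguished triangles to
distinguished triangles. -/
def IsTriangleFunctor (hE : IsFrobenius E) (hE' : IsFrobenius E') (F : Stable E ⥤ Stable E') :
    Prop :=
  ∃ φ : hE.susp ⋙ F ≅ F ⋙ hE'.susp, ∀ {U V W : Stable E} (f : U ⟶ V) (g : V ⟶ W)
    (h : W ⟶ hE.susp.obj U), hE.Distinguished f g h →
      hE'.Distinguished (F.map f) (F.map g) (F.map h ≫ φ.hom.app U)

/-- `F` is a triangle equivalence between stable categories. -/
def IsTriangleEquivalence (hE : IsFrobenius E) (hE' : IsFrobenius E')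
    (F : Stable E ⥤ Stable E') : Prop :=
  F.IsEquivalence ∧ IsTriangleFunctor hE hE' F

/-- The functor `F` between stable categories is induced by the functor `G`. -/
def IsInducedBy (E : ObjectProperty (ShortComplex C)) (E' : ObjectProperty (ShortComplex C'))
    (F : Stable E ⥤ Stable E') (G : C ⥤ C') : Prop :=
  Nonempty (toStable E ⋙ F ≅ G ⋙ toStable E')

end Functors

end ExactCat

/-! # Gorenstein projective modules -/

section GProj

variable (R : Type u) [Ring R]

/-- Gorenstein projective modules: the first cocycles of the totally acyclic complexes of
projective modules. -/
def IsGProj : ObjectProperty (ModuleCat.{u} R) := fun G =>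
  ∃ K : CochainComplex (ModuleCat.{u} R) ℤ,
    (∀ n, Projective (K.X n)) ∧ K.Acyclic ∧
    (∀ Q : ModuleCat.{u} R, Projective Q → ∀ (n : ℤ) (f : K.X n ⟶ Q), K.d (n - 1) n ≫ f = 0 →
      ∃ g : K.X (n + 1) ⟶ Q, K.d n (n + 1) ≫ g = f) ∧
    Nonempty (G ≅ K.cycles 1)

/-- Finitely generated projective modules. -/
def IsFGProj : ObjectProperty (ModuleCat.{u} R) := fun P => Projective P ∧ Module.Finite R P

variable {R}

/-- The conflations in a full subcategory of a module category: the short exact sequences of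
modules all of whose terms belong to the subcategory. -/
def modConflations (P : ObjectProperty (ModuleCat.{u} R)) :
    ObjectProperty (ShortComplex P.FullSubcategory) := fun S =>
  (ShortComplex.mk S.f.hom S.g.hom (congrArg (fun f => f.hom) S.zero)).ShortExact

/-- Finitely generated Gorenstein projective modules over `S` whose underlying modules over `R`
(along the ring homomorphism `f`) have finite projective dimension. -/
def IsGProjFin {S : Type u} [Ring S] (f : R →+* S) : ObjectProperty (ModuleCat.{u} S) := fun M =>
  IsGProj S M ∧ Module.Finite S M ∧
    ∃ n : ℕ, HasProjectiveDimensionLE ((ModuleCat.restrictScalars.{u} f).obj M) n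

end GProj

/-! # Higher-dimensional module factorizations -/

section Cube

variable {ι : Type}

/-- `α` and `β` are the initial and the terminal vertex of an edge in direction `i` of the cube
`{0, 1}^ι`. -/
def IsEdge (i : ι) (α β : ι → Bool) : Prop :=
  α i = false ∧ β i = true ∧ ∀ j, j ≠ i → α j = β j

open Classical in
/-- The vertex of the facet `{α | α i = 1}` with the other coordinates given by `β`. -/
noncomputable def facetVertex (i : ι) (β : {j : ι // j ≠ i} → Bool) : ι → Bool := fun j =>
  if h : j = i then true else β ⟨j, h⟩

theorem IsEdge.facetVertex {i : ι} {j : {j : ι // j ≠ i}} {α β : {j : ι // j ≠ i} → Bool}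
    (h : IsEdge j α β) : IsEdge j.1 (facetVertex i α) (facetVertex i β) := by
  obtain ⟨h₁, h₂, h₃⟩ := h
  refine ⟨by simp [_root_.facetVertex, j.2, h₁], by simp [_root_.facetVertex, j.2, h₂], ?_⟩
  intro k hk
  by_cases hki : k = i
  · simp [_root_.facetVertex, hki]
  · simp only [_root_.facetVertex, hki, dif_neg, not_false_iff]
    exact h₃ ⟨k, hki⟩ (fun h => hk (congrArg Subtype.val h))

end Cube

/-- Higher-dimensional module factorizations over the ring `A` with respect to the elements `ω i`,
the automorphisms `σ i` and the units `ξ i j` (`i < j`): commutative cubes of `A`-modules `X α`,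
`α ∈ {0, 1}^ι`, each of whose edges `α → β` in direction `i` is a module factorization
`X α ⟶ X β ⟶ ^(σ i)(X α)` of `ω i`. The homomorphisms `X β ⟶ ^(σ i)(X α)` to the twisted
module are the same thing as the `σ i`-semilinear maps from `X β` to `X α`.
Each two-dimensional face, with edges `α → β`, `γ → δ` in direction `i` and
`α → γ`, `β → δ` in direction `j`, gives four commutative squares. -/
structure ModFac {A : Type u} [Ring A] {ι : Type} [LinearOrder ι]
    (ω : ι → A) (σ : ι → A ≃+* A) (ξ : ι → ι → Aˣ) : Type (u + 1) where
  X : (ι → Bool) → ModuleCat.{u} A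
  d : ∀ (i : ι) (α β : ι → Bool), IsEdge i α β → (X α ⟶ X β)
  e : ∀ (i : ι) (α β : ι → Bool), IsEdge i α β → (X β →ₛₗ[((σ i : A ≃+* A) : A →+* A)] X α)
  e_d : ∀ (i : ι) (α β : ι → Bool) (h : IsEdge i α β) (x : X α), e i α β h (d i α β h x) = ω i • x
  d_e : ∀ (i : ι) (α β : ι → Bool) (h : IsEdge i α β) (x : X β), d i α β h (e i α β h x) = ω i • x
  d_d : ∀ (i j : ι) (α β γ δ : ι → Bool) (hαβ : IsEdge i α β) (hγδ : IsEdge i γ δ)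
    (hαγ : IsEdge j α γ) (hβδ : IsEdge j β δ), i ≠ j →
    ∀ x : X α, d j β δ hβδ (d i α β hαβ x) = d i γ δ hγδ (d j α γ hαγ x)
  d_e_comm : ∀ (i j : ι) (α β γ δ : ι → Bool) (hαβ : IsEdge i α β) (hγδ : IsEdge i γ δ)
    (hαγ : IsEdge j α γ) (hβδ : IsEdge j β δ), i ≠ j →
    ∀ x : X β, d j α γ hαγ (e i α β hαβ x) = e i γ δ hγδ (d j β δ hβδ x)
  e_e : ∀ (i j : ι) (α β γ δ : ι → Bool) (hαβ : IsEdge i α β) (hγδ : IsEdge i γ δ)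
    (hαγ : IsEdge j α γ) (hβδ : IsEdge j β δ), i < j →
    ∀ x : X δ, (ξ i j : A) • e j α γ hαγ (e i γ δ hγδ x) = e i α β hαβ (e j β δ hβδ x)

namespace ModFac

variable {A : Type u} [Ring A] {ι : Type} [LinearOrder ι]
variable {ω : ι → A} {σ : ι → A ≃+* A} {ξ : ι → ι → Aˣ}

/-- Morphisms of module factorizations. -/
@[ext]
structure Hom (X Y : ModFac ω σ ξ) : Type u where
  app : ∀ α, X.X α ⟶ Y.X α
  app_d : ∀ (i : ι) (α β : ι → Bool) (h : IsEdge i α β) (x : X.X α),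
    Y.d i α β h (app α x) = app β (X.d i α β h x)
  app_e : ∀ (i : ι) (α β : ι → Bool) (h : IsEdge i α β) (x : X.X β),
    Y.e i α β h (app β x) = app α (X.e i α β h x)

instance : Category (ModFac ω σ ξ) where
  Hom := Hom
  id X := ⟨fun α => 𝟙 _, by intros; rfl, by intros; rfl⟩
  comp f g := ⟨fun α => f.app α ≫ g.app α,
    by intros; simp [f.app_d, g.app_d], by intros; simp [f.app_e, g.app_e]⟩

@[ext]
theorem hom_ext {X Y : ModFac ω σ ξ} {f g : X ⟶ Y} (h : ∀ α, Hom.app f α = Hom.app g α) :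
    f = g := Hom.ext (funext h)

@[simp] theorem id_app (X : ModFac ω σ ξ) (α : ι → Bool) : Hom.app (𝟙 X) α = 𝟙 (X.X α) := rfl

@[simp] theorem comp_app {X Y Z : ModFac ω σ ξ} (f : X ⟶ Y) (g : Y ⟶ Z) (α : ι → Bool) :
    Hom.app (f ≫ g) α = Hom.app f α ≫ Hom.app g α := rfl

section Additive

variable (X Y : ModFac ω σ ξ)

instance : Zero (X ⟶ Y) := ⟨⟨fun _ => 0, by intros; simp, by intros; simp⟩⟩

instance : Add (X ⟶ Y) := ⟨fun f g => ⟨fun α => Hom.app f α + Hom.app g α,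
  by intros; simp [Hom.app_d], by intros; simp [Hom.app_e]⟩⟩

instance : Neg (X ⟶ Y) := ⟨fun f => ⟨fun α => - Hom.app f α,
  by intros; simp [Hom.app_d], by intros; simp [Hom.app_e]⟩⟩

instance : Sub (X ⟶ Y) := ⟨fun f g => ⟨fun α => Hom.app f α - Hom.app g α,
  by intros; simp [Hom.app_d], by intros; simp [Hom.app_e]⟩⟩

instance : SMul ℕ (X ⟶ Y) := ⟨fun n f => ⟨fun α => n • Hom.app f α,
  by intros; simp [Hom.app_d], by intros; simp [Hom.app_e]⟩⟩

instance : SMul ℤ (X ⟶ Y) := ⟨fun n f => ⟨fun α => n • Hom.app f α,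
  by intros; simp [Hom.app_d], by intros; simp [Hom.app_e]⟩⟩

theorem app_injective : Function.Injective
    (fun (f : X ⟶ Y) => (fun α => Hom.app f α : ∀ α, X.X α ⟶ Y.X α)) :=
  fun _ _ h => hom_ext (fun α => congrFun h α)

instance : AddCommGroup (X ⟶ Y) :=
  (app_injective X Y).addCommGroup _ rfl (fun _ _ => rfl) (fun _ => rfl) (fun _ _ => rfl)
    (fun _ _ => rfl) (fun _ _ => rfl)

end Additive

@[simp] theorem add_app {X Y : ModFac ω σ ξ} (f g : X ⟶ Y) (α : ι → Bool) :
    Hom.app (f + g) α = Hom.app f α + Hom.app g α := rfl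

@[simp] theorem zero_app {X Y : ModFac ω σ ξ} (α : ι → Bool) :
    Hom.app (0 : X ⟶ Y) α = 0 := rfl

instance : Preadditive (ModFac ω σ ξ) where
  add_comp := by intros; ext1; simp
  comp_add := by intros; ext1; simp

/-- Module factorizations with components in the full subcategory `P` of `A`-modules. -/
def HasComponents (ω : ι → A) (σ : ι → A ≃+* A) (ξ : ι → ι → Aˣ)
    (P : ObjectProperty (ModuleCat.{u} A)) : ObjectProperty (ModFac ω σ ξ) := fun X =>
  ∀ α, P (X.X α)

/-- The conflations in a full subcategory of the category of module factorizations: the sequences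
with terms in the subcategory that are short exact sequences of modules in each component. -/
def conflations (Q : ObjectProperty (ModFac ω σ ξ)) :
    ObjectProperty (ShortComplex Q.FullSubcategory) := fun S =>
  ∀ α, (ShortComplex.mk (Hom.app S.f.hom α) (Hom.app S.g.hom α)
    (congrArg (fun f => Hom.app f.hom α) S.zero)).ShortExact

/-- The facet `{X α | α i = 1}` of a module factorization, which is a module factorization of one
dimension less. -/
noncomputable def facet (i : ι) (X : ModFac ω σ ξ) :
    ModFac (ι := {j : ι // j ≠ i}) (fun j => ω j) (fun j => σ j) (fun j k => ξ j k) where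
  X β := X.X (facetVertex i β)
  d j _ _ h := X.d j _ _ h.facetVertex
  e j _ _ h := X.e j _ _ h.facetVertex
  e_d _ _ _ _ := X.e_d _ _ _ _
  d_e _ _ _ _ := X.d_e _ _ _ _
  d_d _ _ _ _ _ _ _ _ _ _ hij := X.d_d _ _ _ _ _ _ _ _ _ _ (fun h => hij (Subtype.ext h))
  d_e_comm _ _ _ _ _ _ _ _ _ _ hij :=
    X.d_e_comm _ _ _ _ _ _ _ _ _ _ (fun h => hij (Subtype.ext h))
  e_e _ _ _ _ _ _ _ _ _ _ hij := X.e_e _ _ _ _ _ _ _ _ _ _ hij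

/-- Module factorizations with components in `P`, each of whose facets `{X α | α i = 1}` is a
projective object of the exact category of module factorizations, of one dimension less, with
components in `P`. -/
def IsZeroType (ω : ι → A) (σ : ι → A ≃+* A) (ξ : ι → ι → Aˣ)
    (P : ObjectProperty (ModuleCat.{u} A)) : ObjectProperty (ModFac ω σ ξ) := fun X =>
  ∃ hX : HasComponents ω σ ξ P X, ∀ i : ι,
    ExactCat.IsProj
      (conflations (HasComponents (ι := {j : ι // j ≠ i})
        (fun j => ω j) (fun j => σ j) (fun j k => ξ j k) P))
      ⟨X.facet i, fun β => hX (facetVertex i β)⟩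

/-- The category of module factorizations with Gorenstein projective components whose facets
through `X (1, …, 1)` are projective. -/
abbrev GF0 (ω : ι → A) (σ : ι → A ≃+* A) (ξ : ι → ι → Aˣ) : ObjectProperty (ModFac ω σ ξ) :=
  IsZeroType ω σ ξ (IsGProj A)

/-- The category of matrix factorizations, that is, of module factorizations with finitely
generated projective components, whose facets through `X (1, …, 1)` are projective. -/
abbrev MF0 (ω : ι → A) (σ : ι → A ≃+* A) (ξ : ι → ι → Aˣ) : ObjectProperty (ModFac ω σ ξ) :=
  IsZeroType ω σ ξ (IsFGProj A)

/-! ## The total cokernel -/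

variable (ω) in
/-- The two-sided ideal generated by the elements `ω i`. -/
abbrev ideal : Ideal A := (TwoSidedIdeal.span (Set.range ω)).asIdeal

/-- The submodule of `X (1, …, 1)` generated by the images of all edges that end at
`X (1, …, 1)`. -/
def edgeRange (X : ModFac ω σ ξ) : Submodule A (X.X fun _ => true) :=
  ⨆ (i : ι) (α : ι → Bool) (h : IsEdge i α (fun _ => true)), LinearMap.range (X.d i α _ h).hom

/-- The module underlying the total cokernel. -/
def TCokType (X : ModFac ω σ ξ) : Type u := (X.X fun _ => true) ⧸ X.edgeRange

instance (X : ModFac ω σ ξ) : AddCommGroup X.TCokType :=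
  inferInstanceAs (AddCommGroup ((X.X fun _ => true) ⧸ X.edgeRange))

instance (X : ModFac ω σ ξ) : Module A X.TCokType :=
  inferInstanceAs (Module A ((X.X fun _ => true) ⧸ X.edgeRange))

open Classical in
theorem isTorsionBySet (X : ModFac ω σ ξ) :
    Module.IsTorsionBySet A X.TCokType (ideal ω) := by
  rw [Module.isTorsionBySet_iff_subset_annihilator]
  have key : TwoSidedIdeal.span (Set.range ω) ≤
      (Module.annihilator A X.TCokType).toTwoSided := by
    rw [TwoSidedIdeal.span_le]
    rintro _ ⟨i, rfl⟩
    simp only [SetLike.mem_coe, Ideal.mem_toTwoSided, Module.mem_annihilator]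
    intro m
    obtain ⟨x, rfl⟩ := Submodule.mkQ_surjective X.edgeRange m
    have hi : IsEdge i (Function.update (fun _ => true) i false) (fun _ => true) :=
      ⟨by simp, rfl, fun j hj => by simp [hj]⟩
    change X.edgeRange.mkQ (ω i • x) = 0
    rw [Submodule.mkQ_apply, Submodule.Quotient.mk_eq_zero, ← X.d_e i _ _ hi x]
    exact Submodule.mem_iSup_of_mem i (Submodule.mem_iSup_of_mem _
      (Submodule.mem_iSup_of_mem hi ⟨_, rfl⟩))
  intro a ha
  exact Ideal.mem_toTwoSided.1 (key (TwoSidedIdeal.mem_asIdeal.1 ha))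

instance (X : ModFac ω σ ξ) : Module (A ⧸ ideal ω) X.TCokType :=
  (isTorsionBySet X).module

/-- The map induced on total cokernels. -/
def tcokMap {X Y : ModFac ω σ ξ} (f : X ⟶ Y) : X.TCokType →ₗ[A ⧸ ideal ω] Y.TCokType where
  toFun := Submodule.mapQ X.edgeRange Y.edgeRange (Hom.app f fun _ => true).hom (by
    refine iSup_le fun i => iSup_le fun α => iSup_le fun h => ?_
    rintro _ ⟨x, rfl⟩
    refine Submodule.mem_iSup_of_mem i (Submodule.mem_iSup_of_mem α
      (Submodule.mem_iSup_of_mem h ⟨Hom.app f α x, ?_⟩))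
    exact f.app_d i α _ h x)
  map_add' x y := map_add _ x y
  map_smul' b x := by
    obtain ⟨a, rfl⟩ := Ideal.Quotient.mk_surjective b
    exact map_smul (Submodule.mapQ X.edgeRange Y.edgeRange (Hom.app f fun _ => true).hom _) a x

/-- The total-cokernel functor, which sends `X` to the cokernel of
`⨁ᵢ X (1 - εᵢ) ⟶ X (1, …, 1)`, as a module over the quotient of `A` by the ideal generated
by the elements `ω i`. -/
def TCok (ω : ι → A) (σ : ι → A ≃+* A) (ξ : ι → ι → Aˣ) :
    ModFac ω σ ξ ⥤ ModuleCat.{u} (A ⧸ ideal ω) where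
  obj X := ModuleCat.of _ X.TCokType
  map f := ModuleCat.ofHom (tcokMap f)
  map_id X := by
    ext x
    obtain ⟨x, rfl⟩ := Submodule.mkQ_surjective X.edgeRange x
    rfl
  map_comp {X Y Z} f g := by
    ext x
    obtain ⟨x, rfl⟩ := Submodule.mkQ_surjective X.edgeRange x
    rfl

end ModFac

/-! # Regular sequences and types -/

section Regular

variable {A : Type u} [Ring A] {n : ℕ}

/-- Normal elements of a ring: `A w = w A`. -/
def IsNormalElem {R : Type u} [Ring R] (w : R) : Prop :=
  (∀ a : R, ∃ b : R, a * w = w * b) ∧ (∀ a : R, ∃ b : R, w * a = b * w)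

/-- Each `ω i` is regular and normal modulo the two-sided ideal generated by the preceding
elements. -/
def IsRegularSeq (ω : Fin n → A) : Prop :=
  ∀ i : Fin n,
    let I := (TwoSidedIdeal.span {a | ∃ j, j < i ∧ ω j = a}).asIdeal
    IsRegular (Ideal.Quotient.mk I (ω i)) ∧ IsNormalElem (Ideal.Quotient.mk I (ω i))

/-- The automorphisms `σ i` and the units `ξ i j` (`i < j`) form a type of length `n`. The second
condition says that the two isomorphisms from `^(σ i)(^(σ j)(^(σ k)M))` to
`^(σ k)(^(σ j)(^(σ i)M))` composed of `ξ i j`, `ξ i k` and `ξ j k` coincide. -/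
structure IsFacType (σ : Fin n → A ≃+* A) (ξ : Fin n → Fin n → Aˣ) : Prop where
  comm : ∀ i j, i < j → ∀ a : A, σ i (σ j a) = (ξ i j : A) * σ j (σ i a) * ((ξ i j)⁻¹ : Aˣ)
  coherent : ∀ i j k, i < j → j < k →
    (ξ i j : A) * σ j (ξ i k : A) * (ξ j k : A) = σ i (ξ j k : A) * (ξ i k : A) * σ k (ξ i j : A)

/-- The sequence `ω` is of type `(σ; ξ)`. -/
structure IsOfFacType (ω : Fin n → A) (σ : Fin n → A ≃+* A) (ξ : Fin n → Fin n → Aˣ) : Prop where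
  mul_eq : ∀ i, ∀ a : A, ω i * a = σ i a * ω i
  fix : ∀ i, σ i (ω i) = ω i
  left : ∀ i j, i < j → σ i (ω j) = (ξ i j : A) * ω j
  right : ∀ i j, i < j → σ j (ω i) = ((ξ i j)⁻¹ : Aˣ) * ω i

end Regular

/-! # Gorenstein projective modules over the quotient by a regular sequence

The functor `TCok` has the right adjoint `skyTop`, which places a module over the quotient ring at
the vertex `(1, …, 1)`. The proof that it is an equivalence of stable categories rests on the
vanishing of `Ext` groups in the abelian category of all module factorizations.

*Frobenius structures.* For every vertex `γ` of the cube and every projective module `M`, there are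
module factorizations through which all homomorphisms from `M` to components at `γ`, respectively
from such components to `M`, extend to morphisms (`exists_gen_hom`, `exists_gen_cohom`). Both are
obtained by shifts, which interchange the two ends of the edges of one direction, from the constant
module factorization with value `M`. Sums of these are projective, and they are injective relative
to module factorizations with components in a Frobenius class of modules, such as the Gorenstein
projective ones. Hence the latter form a Frobenius category, and its projective objects are those of
the abelian category (`frobClass_hasComponents`). The functor to a facet is exact with an exact
right adjoint (`facetAdjunction`), so the facets of a projective object are projective, and the
subcategory defined by projective facets inherits the structure (`frobClass_isZeroType`).

*Full faithfulness.* For a regular module factorization `Y` (`RegularUpTo n Y`), such as one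
with Gorenstein projective components (`regularUpTo_of_hasComponents`), the kernel of
`Y ⟶ skyTop (TCok Y)` is the sum `lower n` of subobjects `layer i` generated by the images of the
maps `d` in one direction. The partial sums `lower k` filter it, and by regularity the `k`-th
subquotient has bijective maps `d` in the `k`-th direction. Objects with projective facets have no
extensions by the latter (`ext_of_bijective`), hence none by the kernel (`ext_lowerFac`). It follows
that morphisms between total cokernels lift (`tcok_full`), that total cokernels are Gorenstein
projective (`isGProj_tcok`), and that a morphism whose total cokernel is zero in the stable category
is itself zero there (`exists_factor_of_tcok`).

*Density.* A module `M` over the quotient, placed at the vertex `(0, …, 0)`, is moved along the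
vertices `(1, …, 1, 0, …, 0)` by `n` syzygies, with respect to covers which are generated by their
maps `d` in the first directions (`IsStage.succ`). The last syzygy has total cokernel `M`, its
facets are projective since those of the first object vanish, and its only component which may fail
to be projective is an `n`-th syzygy of `M` over the ring (`exists_tcok_iso`). If `M` is Gorenstein
projective over the quotient, then this syzygy is Gorenstein projective over the ring
(`isGProj_of_isSyzygy`), and projective if `M` has finite projective dimension over the ring.
-/

universe w

/-! ### Extensions and short exact sequences in abelian categories -/

namespace ExactCat

open CategoryTheory.Abelian

section Ext

variable {C : Type u} [Category.{v} C] [Abelian C]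

lemma shortExact_of_isPushout {S : ShortComplex C} (hS : S.ShortExact) {Y Q : C}
    {f : S.X₁ ⟶ Y} {f' : S.X₂ ⟶ Q} {i : Y ⟶ Q} (h : IsPushout S.f f f' i) :
    ∃ (q : Q ⟶ S.X₃) (w : i ≫ q = 0), f' ≫ q = S.g ∧ (ShortComplex.mk i q w).ShortExact := by
  have := hS.mono_f
  have := hS.epi_g
  refine ⟨h.desc S.g 0 (by simp), by simp, by simp, ?_⟩
  have hm : Mono i := (MorphismProperty.monomorphisms C).of_isPushout h.flip ‹Mono S.f›
  have he : Epi (h.desc S.g 0 (by simp)) := by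
    have : Epi (f' ≫ h.desc S.g 0 (by simp)) := by simpa using hS.epi_g
    exact epi_of_epi f' _
  refine ShortComplex.ShortExact.mk' (ShortComplex.exact_of_g_is_cokernel _
    (CokernelCofork.IsColimit.ofπ' _ _ fun {Z} k hk => ?_)) hm he
  dsimp at k hk ⊢
  obtain ⟨l, hl⟩ := CokernelCofork.IsColimit.desc' hS.gIsCokernel (f' ≫ k) (by
    rw [← Category.assoc, h.w, Category.assoc, hk, comp_zero])
  refine ⟨l, h.hom_ext ?_ ?_⟩
  · simpa using hl
  · simp [hk]

lemma shortExact_of_isPullback {S : ShortComplex C} (hS : S.ShortExact) {X Q : C}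
    {f : X ⟶ S.X₃} {f' : Q ⟶ S.X₂} {q : Q ⟶ X} (h : IsPullback f' q S.g f) :
    ∃ (i : S.X₁ ⟶ Q) (w : i ≫ q = 0), i ≫ f' = S.f ∧ (ShortComplex.mk i q w).ShortExact := by
  have := hS.mono_f
  have := hS.epi_g
  refine ⟨h.lift S.f 0 (by simp), by simp, by simp, ?_⟩
  have he : Epi q := (MorphismProperty.epimorphisms C).of_isPullback h ‹Epi S.g›
  have hm : Mono (h.lift S.f 0 (by simp)) := by
    have : Mono (h.lift S.f 0 (by simp) ≫ f') := by simpa using hS.mono_f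
    exact mono_of_mono _ f'
  refine ShortComplex.ShortExact.mk' (ShortComplex.exact_of_f_is_kernel _
    (KernelFork.IsLimit.ofι' _ _ fun {Z} k hk => ?_)) hm he
  dsimp at k hk ⊢
  obtain ⟨l, hl⟩ := KernelFork.IsLimit.lift' hS.fIsKernel (k ≫ f') (by
    rw [Category.assoc, h.w, ← Category.assoc, hk, zero_comp])
  refine ⟨l, h.hom_ext ?_ ?_⟩
  · simpa using hl
  · simp [hk]

lemma shortExact_kernel {X Y : C} (f : X ⟶ Y) [Epi f] :
    (ShortComplex.mk (kernel.ι f) f (kernel.condition f)).ShortExact :=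
  ShortComplex.ShortExact.mk' (ShortComplex.exact_kernel f) inferInstance ‹_›

lemma shortExact_cokernel {X Y : C} (f : X ⟶ Y) [Mono f] :
    (ShortComplex.mk f (cokernel.π f) (cokernel.condition f)).ShortExact :=
  ShortComplex.ShortExact.mk' (ShortComplex.exact_cokernel f) ‹_› inferInstance

/-- A short exact sequence `0 ⟶ Ω ⟶ P ⟶ X ⟶ 0` with `P` projective. -/
lemma exists_syzygy [EnoughProjectives C] (X : C) :
    ∃ S : ShortComplex C, S.ShortExact ∧ S.X₃ = X ∧ Projective S.X₂ :=
  ⟨_, shortExact_kernel (Projective.π X), rfl, inferInstance⟩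

variable [HasExt.{w} C]

lemma extend_of_ext {S : ShortComplex C} (hS : S.ShortExact) {Y : C}
    (h : Subsingleton (Ext.{w} S.X₃ Y 1)) (f : S.X₁ ⟶ Y) : ∃ g : S.X₂ ⟶ Y, S.f ≫ g = f := by
  obtain ⟨x, hx⟩ := Ext.contravariant_sequence_exact₁ hS Y (Ext.mk₀ f) (n₁ := 1) rfl
    (Subsingleton.elim _ _)
  obtain ⟨g, rfl⟩ := (Ext.mk₀_bijective _ _).2 x
  rw [Ext.mk₀_comp_mk₀] at hx
  exact ⟨g, (Ext.mk₀_bijective _ _).1 hx⟩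

lemma lift_of_ext {S : ShortComplex C} (hS : S.ShortExact) {X : C}
    (h : Subsingleton (Ext.{w} X S.X₁ 1)) (f : X ⟶ S.X₃) : ∃ g : X ⟶ S.X₂, g ≫ S.g = f := by
  obtain ⟨x, hx⟩ := Ext.covariant_sequence_exact₃ X hS (Ext.mk₀ f) (n₁ := 1) rfl
    (Subsingleton.elim _ _)
  obtain ⟨g, rfl⟩ := (Ext.mk₀_bijective _ _).2 x
  rw [Ext.mk₀_comp_mk₀] at hx
  exact ⟨g, (Ext.mk₀_bijective _ _).1 hx⟩

lemma ext_one_of_extend {S : ShortComplex C} (hS : S.ShortExact) {Y : C}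
    (h₂ : Subsingleton (Ext.{w} S.X₂ Y 1)) (h : ∀ f : S.X₁ ⟶ Y, ∃ g : S.X₂ ⟶ Y, S.f ≫ g = f) :
    Subsingleton (Ext.{w} S.X₃ Y 1) := by
  refine subsingleton_of_forall_eq 0 fun x => ?_
  obtain ⟨y, rfl⟩ := Ext.contravariant_sequence_exact₃ hS Y x (Subsingleton.elim _ _) (n₀ := 0) rfl
  obtain ⟨f, rfl⟩ := (Ext.mk₀_bijective _ _).2 y
  obtain ⟨g, rfl⟩ := h f
  rw [← Ext.mk₀_comp_mk₀]
  exact hS.extClass_comp_assoc _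

lemma ext_contra_X₁ {S : ShortComplex C} (hS : S.ShortExact) {Y : C} {n : ℕ}
    (h₂ : Subsingleton (Ext.{w} S.X₂ Y n)) (h₃ : Subsingleton (Ext.{w} S.X₃ Y (n + 1))) :
    Subsingleton (Ext.{w} S.X₁ Y n) := by
  refine subsingleton_of_forall_eq 0 fun x => ?_
  obtain ⟨y, rfl⟩ := Ext.contravariant_sequence_exact₁ hS Y x (add_comm 1 n) (Subsingleton.elim _ _)
  rw [Subsingleton.elim y 0, Ext.comp_zero]

lemma ext_contra_X₂ {S : ShortComplex C} (hS : S.ShortExact) {Y : C} {n : ℕ}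
    (h₁ : Subsingleton (Ext.{w} S.X₁ Y n)) (h₃ : Subsingleton (Ext.{w} S.X₃ Y n)) :
    Subsingleton (Ext.{w} S.X₂ Y n) := by
  refine subsingleton_of_forall_eq 0 fun x => ?_
  obtain ⟨y, rfl⟩ := Ext.contravariant_sequence_exact₂ hS Y x (Subsingleton.elim _ _)
  rw [Subsingleton.elim y 0, Ext.comp_zero]

lemma ext_contra_X₃ {S : ShortComplex C} (hS : S.ShortExact) {Y : C} {n : ℕ}
    (h₁ : Subsingleton (Ext.{w} S.X₁ Y n)) (h₂ : Subsingleton (Ext.{w} S.X₂ Y (n + 1))) :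
    Subsingleton (Ext.{w} S.X₃ Y (n + 1)) := by
  refine subsingleton_of_forall_eq 0 fun x => ?_
  obtain ⟨y, rfl⟩ := Ext.contravariant_sequence_exact₃ hS Y x (Subsingleton.elim _ _) (add_comm 1 n)
  rw [Subsingleton.elim y 0, Ext.comp_zero]

lemma ext_co_X₁ {S : ShortComplex C} (hS : S.ShortExact) {X : C} {n : ℕ}
    (h₂ : Subsingleton (Ext.{w} X S.X₂ (n + 1))) (h₃ : Subsingleton (Ext.{w} X S.X₃ n)) :
    Subsingleton (Ext.{w} X S.X₁ (n + 1)) := by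
  refine subsingleton_of_forall_eq 0 fun x => ?_
  obtain ⟨y, rfl⟩ := Ext.covariant_sequence_exact₁ X hS x (Subsingleton.elim _ _) rfl
  rw [Subsingleton.elim y 0, Ext.zero_comp]

lemma ext_co_X₂ {S : ShortComplex C} (hS : S.ShortExact) {X : C} {n : ℕ}
    (h₁ : Subsingleton (Ext.{w} X S.X₁ n)) (h₃ : Subsingleton (Ext.{w} X S.X₃ n)) :
    Subsingleton (Ext.{w} X S.X₂ n) := by
  refine subsingleton_of_forall_eq 0 fun x => ?_
  obtain ⟨y, rfl⟩ := Ext.covariant_sequence_exact₂ X hS x (Subsingleton.elim _ _)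
  rw [Subsingleton.elim y 0, Ext.zero_comp]

lemma ext_co_X₃ {S : ShortComplex C} (hS : S.ShortExact) {X : C} {n : ℕ}
    (h₂ : Subsingleton (Ext.{w} X S.X₂ n)) (h₁ : Subsingleton (Ext.{w} X S.X₁ (n + 1))) :
    Subsingleton (Ext.{w} X S.X₃ n) := by
  refine subsingleton_of_forall_eq 0 fun x => ?_
  obtain ⟨y, rfl⟩ := Ext.covariant_sequence_exact₃ X hS x rfl (Subsingleton.elim _ _)
  rw [Subsingleton.elim y 0, Ext.zero_comp]

lemma ext_retract_right {X Y Y' : C} {n : ℕ} (r : Retract Y Y')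
    (h : Subsingleton (Ext.{w} X Y' n)) : Subsingleton (Ext.{w} X Y n) := by
  refine subsingleton_of_forall_eq 0 fun x => ?_
  rw [← Ext.comp_mk₀_id x, ← r.retract, ← Ext.mk₀_comp_mk₀,
    ← Ext.comp_assoc_of_third_deg_zero, Subsingleton.elim (x.comp _ _) 0, Ext.zero_comp]

lemma ext_retract_left {X X' Y : C} {n : ℕ} (r : Retract X X')
    (h : Subsingleton (Ext.{w} X' Y n)) : Subsingleton (Ext.{w} X Y n) := by
  refine subsingleton_of_forall_eq 0 fun x => ?_
  rw [← Ext.mk₀_id_comp x, ← r.retract, ← Ext.mk₀_comp_mk₀,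
    Ext.comp_assoc_of_second_deg_zero, Subsingleton.elim ((Ext.mk₀ r.r).comp x _) 0,
    Ext.comp_zero]

lemma ext_of_isZero_right {X Y : C} (n : ℕ) (h : IsZero Y) : Subsingleton (Ext.{w} X Y n) := by
  refine subsingleton_of_forall_eq 0 fun x => ?_
  rw [← Ext.comp_mk₀_id x, h.eq_of_src (𝟙 Y) 0, Ext.mk₀_zero, Ext.comp_zero]

lemma ext_one_of_split [EnoughProjectives C] {X Y : C}
    (h : ∀ S : ShortComplex C, S.ShortExact → S.X₁ = Y → S.X₃ = X →
      ∃ r : S.X₂ ⟶ S.X₁, S.f ≫ r = 𝟙 _) : Subsingleton (Ext.{w} X Y 1) := by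
  obtain ⟨S, hS, rfl, hP⟩ := exists_syzygy X
  refine ext_one_of_extend hS (Ext.subsingleton_of_projective _ _ 0) fun f => ?_
  obtain ⟨q, w, hq, hT⟩ := shortExact_of_isPushout hS (IsPushout.of_hasPushout S.f f)
  obtain ⟨r, hr⟩ := h _ hT rfl rfl
  dsimp at r hr
  refine ⟨pushout.inl _ _ ≫ r, ?_⟩
  rw [← Category.assoc, pushout.condition, Category.assoc, hr, Category.comp_id]

/-- For an exact functor `G` with right adjoint `R` which preserves projective objects,
`Ext (G X) Y` and `Ext X (R Y)` vanish simultaneously in positive degrees. -/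
lemma ext_adjunction [EnoughProjectives C] {D : Type u'} [Category.{v'} D] [Abelian D]
    [HasExt.{w} D] {G : C ⥤ D} {R : D ⥤ C} (adj : G ⊣ R) [G.PreservesZeroMorphisms]
    (hG : ∀ S : ShortComplex C, S.ShortExact → (S.map G).ShortExact)
    (hGP : ∀ P : C, Projective P → Projective (G.obj P)) (Y : D) (n : ℕ) :
    ∀ X : C, Subsingleton (Ext.{w} (G.obj X) Y (n + 1)) ↔
      Subsingleton (Ext.{w} X (R.obj Y) (n + 1)) := by
  induction n with
  | zero =>
    intro X
    obtain ⟨S, hS, rfl, hP⟩ := exists_syzygy X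
    have hP' := hGP _ hP
    have hGS := hG S hS
    constructor
    · intro h
      refine ext_one_of_extend hS (Ext.subsingleton_of_projective _ _ 0) fun f => ?_
      obtain ⟨g, hg⟩ : ∃ g : G.obj S.X₂ ⟶ Y, G.map S.f ≫ g = (adj.homEquiv _ _).symm f :=
        extend_of_ext hGS h ((adj.homEquiv _ _).symm f)
      refine ⟨adj.homEquiv _ _ g, ?_⟩
      rw [← adj.homEquiv_naturality_left, hg, Equiv.apply_symm_apply]
    · intro h
      refine ext_one_of_extend (S := S.map G) hGS
        (Ext.subsingleton_of_projective (G.obj S.X₂) Y 0) fun f => ?_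
      obtain ⟨g, hg⟩ := extend_of_ext hS h (adj.homEquiv _ _ f)
      refine ⟨(adj.homEquiv _ _).symm g, ?_⟩
      refine (adj.homEquiv_naturality_left_symm _ _).symm.trans ?_
      rw [hg]
      exact Equiv.symm_apply_apply _ _
  | succ n ih =>
    intro X
    obtain ⟨S, hS, rfl, hP⟩ := exists_syzygy X
    have hP' : Projective (S.map G).X₂ := hGP _ hP
    have hGS := hG S hS
    have h1 : Subsingleton (Ext.{w} (S.map G).X₁ Y (n + 1)) ↔
        Subsingleton (Ext.{w} (S.map G).X₃ Y (n + 2)) :=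
      ⟨fun h => ext_contra_X₃ hGS h (Ext.subsingleton_of_projective _ _ _),
        fun h => ext_contra_X₁ hGS (Ext.subsingleton_of_projective _ _ _) h⟩
    have h2 : Subsingleton (Ext.{w} S.X₁ (R.obj Y) (n + 1)) ↔
        Subsingleton (Ext.{w} S.X₃ (R.obj Y) (n + 2)) :=
      ⟨fun h => ext_contra_X₃ hS h (Ext.subsingleton_of_projective _ _ _),
        fun h => ext_contra_X₁ hS (Ext.subsingleton_of_projective _ _ _) h⟩
    exact h1.symm.trans ((ih S.X₁).trans h2)

end Ext

end ExactCat

/-! ### Frobenius classes of objects of an abelian category -/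

namespace ExactCat

open CategoryTheory.Abelian

section FrobClass

variable {C : Type u} [Category.{v} C]

lemma projective_of_retract {X Y : C} (r : Retract X Y) (hY : Projective Y) : Projective X :=
  ⟨fun {E Z} f e _ => ⟨r.i ≫ Projective.factorThru (r.r ≫ f) e, by
    rw [Category.assoc, Projective.factorThru_comp, ← Category.assoc, r.retract,
      Category.id_comp]⟩⟩

variable [Abelian C]

attribute [local instance] Abelian.hasFiniteBiproducts

/-- The conflations in a full subcategory of an abelian category: the short exact sequences
with terms in the subcategory. -/
def shortExactIn (P : ObjectProperty C) : ObjectProperty (ShortComplex P.FullSubcategory) :=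
  fun S => (S.map P.ι).ShortExact

/-- A class `P` of objects, closed under extensions and retracts, for which the projective objects
of the abelian category that lie in `P` are enough projectives and enough injectives of `P`. -/
structure FrobClass (P : ObjectProperty C) : Prop where
  zero : ∀ X : C, IsZero X → P X
  ext : ∀ S : ShortComplex C, S.ShortExact → P S.X₁ → P S.X₃ → P S.X₂
  retract : ∀ {X Y : C}, Retract X Y → P Y → P X
  cover : ∀ X : C, P X → ∃ (K W : C) (i : K ⟶ W) (p : W ⟶ X) (w : i ≫ p = 0),
    (ShortComplex.mk i p w).ShortExact ∧ Projective W ∧ P W ∧ P K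
  hull : ∀ X : C, P X → ∃ (W Z : C) (i : X ⟶ W) (p : W ⟶ Z) (w : i ≫ p = 0),
    (ShortComplex.mk i p w).ShortExact ∧ Projective W ∧ P W ∧ P Z
  extend : ∀ S : ShortComplex C, S.ShortExact → P S.X₃ → ∀ Q : C, P Q → Projective Q →
    ∀ f : S.X₁ ⟶ Q, ∃ g : S.X₂ ⟶ Q, S.f ≫ g = f

/-- A split monomorphism has its cokernel as a retract of the middle term. -/
lemma retract_X₃_of_split {S : ShortComplex C} (hS : S.ShortExact)
    (h : ∃ r : S.X₂ ⟶ S.X₁, S.f ≫ r = 𝟙 _) : Nonempty (Retract S.X₃ S.X₂) := by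
  obtain ⟨r, hr⟩ := h
  have := hS.epi_g
  let s := ShortComplex.Splitting.ofExactOfRetraction S hS.exact r hr this
  exact ⟨⟨s.s, S.g, s.s_g⟩⟩

lemma retract_X₁_of_split {S : ShortComplex C} (hS : S.ShortExact)
    (h : ∃ s : S.X₃ ⟶ S.X₂, s ≫ S.g = 𝟙 _) : Nonempty (Retract S.X₁ S.X₂) := by
  obtain ⟨r, hr⟩ := h
  have := hS.mono_f
  let s := ShortComplex.Splitting.ofExactOfSection S hS.exact r hr this
  exact ⟨⟨S.f, s.r, s.f_r⟩⟩

lemma split_of_projective {S : ShortComplex C} (hS : S.ShortExact) (h : Projective S.X₃) :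
    ∃ s : S.X₃ ⟶ S.X₂, s ≫ S.g = 𝟙 _ := by
  have := hS.epi_g
  exact ⟨Projective.factorThru (𝟙 _) S.g, Projective.factorThru_comp _ _⟩

namespace FrobClass

variable {P : ObjectProperty C} (hP : FrobClass P)

include hP

lemma of_iso {X Y : C} (e : X ≅ Y) (h : P X) : P Y := hP.retract e.symm.retract h

lemma biprod {X Y : C} (hX : P X) (hY : P Y) : P (X ⊞ Y) :=
  hP.ext _ (ShortComplex.Splitting.ofHasBinaryBiproduct X Y).shortExact hX hY

lemma biproduct {J : Type*} [Finite J] (X : J → C) (h : ∀ j, P (X j)) : P (⨁ X) := by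
  have : Limits.HasFiniteProducts C := inferInstance
  have h0 : P.IsClosedUnderLimitsOfShape (Discrete.{0} PEmpty) := by
    refine ⟨?_⟩
    rintro X ⟨p⟩
    refine hP.zero _ ?_
    have hX : IsTerminal X := by
      refine (IsLimit.equivOfNatIsoOfIso p.diag.uniqueFromEmpty _ _
        (by exact Cone.ext (Iso.refl _) (by rintro ⟨⟨⟩⟩))).1 p.isLimit
    exact IsZero.of_iso (isZero_zero C) (hX.uniqueUpToIso (isZero_zero C).isTerminal)
  have h1 : P.IsClosedUnderBinaryProducts := by
    refine ⟨?_⟩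
    rintro X ⟨p⟩
    refine hP.of_iso (IsLimit.conePointUniqueUpToIso
      ((BinaryBiproduct.isLimit (p.diag.obj ⟨WalkingPair.left⟩)
        (p.diag.obj ⟨WalkingPair.right⟩))) ((IsLimit.postcomposeHomEquiv (diagramIsoPair p.diag) _).symm
          p.isLimit))
      (hP.biprod (p.prop_diag_obj _) (p.prop_diag_obj _))
  have h2 : P.IsClosedUnderFiniteProducts := .mk'
  exact P.prop_of_isLimit_fan (biproduct.isLimit X) h

lemma isClosedUnderFiniteProducts : P.IsClosedUnderFiniteProducts where
  isClosedUnderLimitsOfShape J _ := by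
    refine ⟨?_⟩
    rintro X ⟨p⟩
    have : p.diag ≅ Discrete.functor (fun j => p.diag.obj ⟨j⟩) := Discrete.natIsoFunctor
    exact hP.of_iso (IsLimit.conePointUniqueUpToIso (biproduct.isLimit fun j => p.diag.obj ⟨j⟩)
      ((IsLimit.postcomposeHomEquiv this _).symm p.isLimit))
      (hP.biproduct _ fun j => p.prop_diag_obj _)

/-- A Frobenius class is closed under kernels of epimorphisms. -/
lemma kernel {S : ShortComplex C} (hS : S.ShortExact) (h₂ : P S.X₂) (h₃ : P S.X₃) : P S.X₁ := by
  obtain ⟨K, W, j, g, w₀, hT, hW, hW', hK⟩ := hP.cover _ h₃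
  have sq := IsPullback.of_hasPullback S.g g
  obtain ⟨i, w, hi, hU⟩ := shortExact_of_isPullback hS sq
  obtain ⟨i', w', hi', hU'⟩ := shortExact_of_isPullback hT sq.flip
  obtain ⟨r⟩ := retract_X₁_of_split hU (split_of_projective hU hW)
  have hM : P (pullback S.g g) := hP.ext _ hU' hK h₂
  exact hP.retract r hM

/-- If a monomorphism in a Frobenius class becomes, after composition with a morphism of the class,
a monomorphism with cokernel in the class, then its own cokernel is in the class. -/
lemma cokernel_of_comp {S : ShortComplex C} (hS : S.ShortExact) (h₂ : P S.X₂) {Q Z : C}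
    (f : S.X₂ ⟶ Q) {p : Q ⟶ Z} {w : (S.f ≫ f) ≫ p = 0}
    (hT : (ShortComplex.mk (S.f ≫ f) p w).ShortExact) (hZ : P Z) : P S.X₃ := by
  -- the pushout of `S` along `S.f ≫ f` is an extension of `S.X₃` by `Q`, split by `f`
  have sq := IsPushout.of_hasPushout S.f (S.f ≫ f)
  obtain ⟨q, w, hq, hU⟩ := shortExact_of_isPushout hS sq
  obtain ⟨q', w', hq', hU'⟩ := shortExact_of_isPushout hT sq.flip
  have hM : P (pushout S.f (S.f ≫ f)) := hP.ext _ hU' h₂ hZ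
  obtain ⟨r⟩ := retract_X₃_of_split hU ⟨sq.desc f (𝟙 _) (by simp), by simp⟩
  exact hP.retract r hM

end FrobClass

section Exact

variable {P : ObjectProperty C}

lemma isInflation_iff {X Y : P.FullSubcategory} (i : X ⟶ Y) :
    IsInflation (shortExactIn P) i ↔ ∃ (Z : C) (p : Y.obj ⟶ Z) (w : i.hom ≫ p = 0),
      P Z ∧ (ShortComplex.mk i.hom p w).ShortExact := by
  constructor
  · rintro ⟨Z, p, w, h⟩
    exact ⟨Z.obj, p.hom, congrArg (fun f => f.hom) w, Z.2, h⟩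
  · rintro ⟨Z, p, w, hZ, h⟩
    exact ⟨⟨Z, hZ⟩, ObjectProperty.homMk p, ObjectProperty.hom_ext _ w, h⟩

lemma isDeflation_iff {X Y : P.FullSubcategory} (p : X ⟶ Y) :
    IsDeflation (shortExactIn P) p ↔ ∃ (K : C) (i : K ⟶ X.obj) (w : i ≫ p.hom = 0),
      P K ∧ (ShortComplex.mk i p.hom w).ShortExact := by
  constructor
  · rintro ⟨Z, p, w, h⟩
    exact ⟨Z.obj, p.hom, congrArg (fun f => f.hom) w, Z.2, h⟩
  · rintro ⟨Z, p, w, hZ, h⟩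
    exact ⟨⟨Z, hZ⟩, ObjectProperty.homMk p, ObjectProperty.hom_ext _ w, h⟩

/-- The kernel of a composite of epimorphisms is an extension of the kernels. -/
lemma shortExact_kernel_comp {X Y Z : C} (f : X ⟶ Y) (g : Y ⟶ Z) [Epi f] :
    ∃ (a : kernel f ⟶ kernel (f ≫ g)) (b : kernel (f ≫ g) ⟶ kernel g) (w : a ≫ b = 0),
      (ShortComplex.mk a b w).ShortExact := by
  have sq : IsPullback (kernel.ι (f ≫ g)) (kernel.lift g (kernel.ι (f ≫ g) ≫ f) (by simp)) f
      (kernel.ι g) := by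
    refine IsPullback.of_isLimit' ⟨by simp⟩ (PullbackCone.IsLimit.mk _
      (fun s => kernel.lift (f ≫ g) s.fst (by
        rw [← Category.assoc, s.condition, Category.assoc, kernel.condition, comp_zero]))
      (by simp) (fun s => ?_) (fun s m h₁ h₂ => ?_))
    · rw [← cancel_mono (kernel.ι g)]; simp [s.condition]
    · rw [← cancel_mono (kernel.ι (f ≫ g))]; simp [h₁]
  obtain ⟨i, w, _, h⟩ := shortExact_of_isPullback (shortExact_kernel f) sq
  exact ⟨i, _, w, h⟩

lemma shortExact_cokernel_comp {X Y Z : C} (f : X ⟶ Y) (g : Y ⟶ Z) [Mono g] :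
    ∃ (a : cokernel f ⟶ cokernel (f ≫ g)) (b : cokernel (f ≫ g) ⟶ cokernel g) (w : a ≫ b = 0),
      (ShortComplex.mk a b w).ShortExact := by
  have sq : IsPushout g (cokernel.π f) (cokernel.π (f ≫ g))
      (cokernel.desc f (g ≫ cokernel.π (f ≫ g)) (by rw [← Category.assoc]; simp)) := by
    refine IsPushout.of_isColimit' ⟨by simp⟩ (PushoutCocone.IsColimit.mk _
      (fun s => cokernel.desc (f ≫ g) s.inl (by
        rw [Category.assoc, s.condition, ← Category.assoc, cokernel.condition, zero_comp]))
      (by simp) (fun s => ?_) (fun s m h₁ h₂ => ?_))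
    · rw [← cancel_epi (cokernel.π f)]; simp [s.condition]
    · rw [← cancel_epi (cokernel.π (f ≫ g))]; simp [h₁]
  obtain ⟨i, w, _, h⟩ := shortExact_of_isPushout (shortExact_cokernel g) sq
  exact ⟨_, i, w, h⟩

lemma mono_of_isInflation {X Y : P.FullSubcategory} {i : X ⟶ Y}
    (h : IsInflation (shortExactIn P) i) : Mono i.hom := by
  obtain ⟨_, _, _, _, h⟩ := (isInflation_iff i).1 h
  exact h.mono_f

lemma epi_of_isDeflation {X Y : P.FullSubcategory} {p : X ⟶ Y}
    (h : IsDeflation (shortExactIn P) p) : Epi p.hom := by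
  obtain ⟨_, _, _, _, h⟩ := (isDeflation_iff p).1 h
  exact h.epi_g

variable (hP : FrobClass P)
include hP

lemma isInflation_iff_cokernel {X Y : P.FullSubcategory} (i : X ⟶ Y) :
    IsInflation (shortExactIn P) i ↔ Mono i.hom ∧ P (cokernel i.hom) := by
  rw [isInflation_iff]
  constructor
  · rintro ⟨Z, p, w, hZ, h⟩
    exact ⟨h.mono_f, hP.of_iso (h.gIsCokernel.coconePointUniqueUpToIso (colimit.isColimit _)) hZ⟩
  · rintro ⟨h, h'⟩
    exact ⟨_, _, _, h', shortExact_cokernel i.hom⟩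

lemma isDeflation_iff_kernel {X Y : P.FullSubcategory} (p : X ⟶ Y) :
    IsDeflation (shortExactIn P) p ↔ Epi p.hom ∧ P (kernel p.hom) := by
  rw [isDeflation_iff]
  constructor
  · rintro ⟨Z, i, w, hZ, h⟩
    exact ⟨h.epi_g, hP.of_iso (h.fIsKernel.conePointUniqueUpToIso (limit.isLimit _)) hZ⟩
  · rintro ⟨h, h'⟩
    exact ⟨_, _, _, h', shortExact_kernel p.hom⟩

/-- A Frobenius class is an exact category. Deflations are the epimorphisms with kernel in the class;
base changes and composites of these exist because the class is closed under extensions. -/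
theorem FrobClass.isExactStructure : IsExactStructure (shortExactIn P) where
  additive := by
    have := hP.isClosedUnderFiniteProducts
    exact HasFiniteBiproducts.of_hasFiniteProducts
  of_iso := ⟨fun e h => ShortComplex.shortExact_of_iso (P.ι.mapShortComplex.mapIso e) h⟩
  isKernel S hS := by
    have : Mono S.f := P.ι.mono_of_mono_map hS.mono_f
    refine ⟨KernelFork.IsLimit.ofι' _ _ fun {W} k hk => ?_⟩
    have h := KernelFork.IsLimit.lift' hS.fIsKernel k.hom (congrArg (fun f => f.hom) hk)
    exact ⟨ObjectProperty.homMk h.1, ObjectProperty.hom_ext _ h.2⟩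
  isCokernel S hS := by
    have : Epi S.g := P.ι.epi_of_epi_map hS.epi_g
    refine ⟨CokernelCofork.IsColimit.ofπ' _ _ fun {W} k hk => ?_⟩
    have h := CokernelCofork.IsColimit.desc' hS.gIsCokernel k.hom (congrArg (fun f => f.hom) hk)
    exact ⟨ObjectProperty.homMk h.1, ObjectProperty.hom_ext _ h.2⟩
  deflation_id_zero Z hZ := by
    rw [isDeflation_iff_kernel hP]
    refine ⟨?_, hP.zero _ ?_⟩
    · change Epi (𝟙 Z.obj); infer_instance
    · exact isZero_kernel_of_mono (𝟙 Z.obj)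
  deflation_comp f g hf hg := by
    have := epi_of_isDeflation hf
    have := epi_of_isDeflation hg
    rw [isDeflation_iff_kernel hP] at hf hg ⊢
    obtain ⟨a, b, w, h⟩ := shortExact_kernel_comp f.hom g.hom
    exact ⟨epi_comp f.hom g.hom, hP.ext _ h hf.2 hg.2⟩
  inflation_comp f g hf hg := by
    have := mono_of_isInflation hf
    have := mono_of_isInflation hg
    rw [isInflation_iff_cokernel hP] at hf hg ⊢
    obtain ⟨a, b, w, h⟩ := shortExact_cokernel_comp f.hom g.hom
    exact ⟨mono_comp f.hom g.hom, hP.ext _ h hf.2 hg.2⟩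
  deflation_pullback {Y Z Z'} d f hd := by
    obtain ⟨K, i, w, hK, h⟩ := (isDeflation_iff d).1 hd
    have sq := IsPullback.of_hasPullback d.hom f.hom
    obtain ⟨i', w', _, h'⟩ := shortExact_of_isPullback h sq
    refine ⟨⟨_, hP.ext _ h' hK Z'.2⟩, ObjectProperty.homMk (pullback.fst _ _),
      ObjectProperty.homMk (pullback.snd _ _), ?_, (isDeflation_iff _).2 ⟨_, _, _, hK, h'⟩⟩
    exact IsPullback.of_map P.ι (ObjectProperty.hom_ext _ pullback.condition) sq
  inflation_pushout {X Y X'} i f hi := by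
    obtain ⟨K, p, w, hK, h⟩ := (isInflation_iff i).1 hi
    have sq := IsPushout.of_hasPushout i.hom f.hom
    obtain ⟨i', w', _, h'⟩ := shortExact_of_isPushout h sq
    refine ⟨⟨_, hP.ext _ h' X'.2 hK⟩, ObjectProperty.homMk (pushout.inl _ _),
      ObjectProperty.homMk (pushout.inr _ _), ?_, (isInflation_iff _).2 ⟨_, _, _, hK, h'⟩⟩
    exact IsPushout.of_map P.ι (ObjectProperty.hom_ext _ pushout.condition) sq

lemma FrobClass.isProj_iff (X : P.FullSubcategory) :
    IsProj (shortExactIn P) X ↔ Projective X.obj := by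
  constructor
  · intro h
    obtain ⟨K, W, i, p, w, hS, hW, hW', hK⟩ := hP.cover X.obj X.2
    obtain ⟨s, hs⟩ := h (ShortComplex.mk (X₁ := ⟨K, hK⟩) (X₂ := ⟨W, hW'⟩) (X₃ := X)
      (ObjectProperty.homMk i) (ObjectProperty.homMk p) (ObjectProperty.hom_ext _ w)) hS (𝟙 X)
    exact projective_of_retract ⟨s.hom, p, congrArg (fun f => f.hom) hs⟩ hW
  · intro h S hS f
    have : Epi S.g.hom := hS.epi_g
    exact ⟨ObjectProperty.homMk (Projective.factorThru f.hom S.g.hom),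
      ObjectProperty.hom_ext _ (Projective.factorThru_comp _ _)⟩

lemma FrobClass.isInj_iff (X : P.FullSubcategory) :
    IsInj (shortExactIn P) X ↔ Projective X.obj := by
  constructor
  · intro h
    obtain ⟨W, Z, i, p, w, hS, hW, hW', hK⟩ := hP.hull X.obj X.2
    obtain ⟨s, hs⟩ := h (ShortComplex.mk (X₃ := ⟨Z, hK⟩) (X₂ := ⟨W, hW'⟩) (X₁ := X)
      (ObjectProperty.homMk i) (ObjectProperty.homMk p) (ObjectProperty.hom_ext _ w)) hS (𝟙 X)
    exact projective_of_retract ⟨i, s.hom, congrArg (fun f => f.hom) hs⟩ hW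
  · intro h S hS f
    obtain ⟨g, hg⟩ := hP.extend _ hS S.X₃.2 X.obj X.2 h f.hom
    exact ⟨ObjectProperty.homMk g, ObjectProperty.hom_ext _ hg⟩

/-- A Frobenius class with its short exact sequences is a Frobenius exact category. -/
theorem FrobClass.isFrobenius : IsFrobenius (shortExactIn P) where
  toIsExactStructure := hP.isExactStructure
  enough_proj X := by
    obtain ⟨K, W, i, p, w, hS, hW, hW', hK⟩ := hP.cover X.obj X.2
    exact ⟨⟨W, hW'⟩, ObjectProperty.homMk p, (hP.isProj_iff _).2 hW,
      (isDeflation_iff _).2 ⟨K, i, w, hK, hS⟩⟩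
  enough_inj X := by
    obtain ⟨W, Z, i, p, w, hS, hW, hW', hK⟩ := hP.hull X.obj X.2
    exact ⟨⟨W, hW'⟩, ObjectProperty.homMk i, (hP.isInj_iff _).2 hW,
      (isInflation_iff _).2 ⟨Z, p, w, hK, hS⟩⟩
  proj_iff_inj X := (hP.isProj_iff X).trans (hP.isInj_iff X).symm

end Exact

end FrobClass

end ExactCat

/-! ### Functors between stable categories -/

namespace ExactCat

section Stable

variable {C : Type u} [Category.{v} C] [Preadditive C] {E : ObjectProperty (ShortComplex C)}

lemma IsProj.biprod [HasBinaryBiproducts C] {X Y : C} (hX : IsProj E X) (hY : IsProj E Y) :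
    IsProj E (X ⊞ Y) := by
  intro S hS f
  obtain ⟨a, ha⟩ := hX S hS (biprod.inl ≫ f)
  obtain ⟨b, hb⟩ := hY S hS (biprod.inr ≫ f)
  exact ⟨biprod.desc a b, by ext <;> simp [ha, hb]⟩

theorem IsFrobenius.congruence (hE : IsFrobenius E) : Congruence (stableRel E) where
  equivalence {X Y} :=
    { refl := fun f => hE.stableRel_refl f
      symm := by
        rintro f g ⟨P, hP, s, t, h⟩
        exact ⟨P, hP, -s, t, by rw [Preadditive.neg_comp, ← h, neg_sub]⟩
      trans := by
        rintro f g k ⟨P, hP, s, t, h⟩ ⟨Q, hQ, s', t', h'⟩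
        have := hE.additive
        have := HasBinaryBiproducts.of_hasBinaryProducts (C := C)
        exact ⟨P ⊞ Q, hP.biprod hQ, biprod.lift s s', biprod.desc t t', by
          rw [biprod.lift_desc, ← h, ← h', sub_add_sub_cancel]⟩ }
  comp_left := by
    rintro X Y Z f g g' ⟨P, hP, s, t, h⟩
    exact ⟨P, hP, f ≫ s, t, by rw [← Preadditive.comp_sub, h, Category.assoc]⟩
  comp_right := by
    rintro X Y Z f g g' ⟨P, hP, s, t, h⟩
    exact ⟨P, hP, s, t ≫ g', by rw [← Preadditive.sub_comp, h, Category.assoc]⟩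

lemma IsFrobenius.toStable_map_eq_iff (hE : IsFrobenius E) {X Y : C} (f g : X ⟶ Y) :
    (toStable E).map f = (toStable E).map g ↔ stableRel E f g := by
  have := hE.congruence
  exact CategoryTheory.Quotient.functor_map_eq_iff _ f g

lemma toStable_map_eq_of_factor {X Y : C} {f g : X ⟶ Y} {P : C} (hP : IsProj E P) (s : X ⟶ P)
    (t : P ⟶ Y) (h : f - g = s ≫ t) : (toStable E).map f = (toStable E).map g :=
  CategoryTheory.Quotient.sound _ ⟨P, hP, s, t, h⟩

/-- The standard exact sequence of maps out of a conflation. -/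
lemma IsFrobenius.exists_desc (hE : IsFrobenius E) {S : ShortComplex C} (hS : E S) {Y : C}
    (f : S.X₂ ⟶ Y) (h : S.f ≫ f = 0) : ∃ g : S.X₃ ⟶ Y, S.g ≫ g = f := by
  obtain ⟨g, hg⟩ := CokernelCofork.IsColimit.desc' (hE.isCokernel S hS).some f h
  exact ⟨g, hg⟩

lemma IsFrobenius.epi_p (hE : IsFrobenius E) {S : ShortComplex C} (hS : E S) : Epi S.g :=
  ⟨fun _ _ h => Cofork.IsColimit.hom_ext (hE.isCokernel S hS).some h⟩

/-- Comparison of two conflations with injective middle term along a morphism. -/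
lemma IsFrobenius.exists_hull_map (hE : IsFrobenius E) {X Y : C} (H : InjHull E X)
    (K : InjHull E Y) (f : X ⟶ Y) : ∃ (a : H.I ⟶ K.I) (z : H.Z ⟶ K.Z),
      H.i ≫ a = f ≫ K.i ∧ a ≫ K.p = H.p ≫ z := by
  obtain ⟨a, ha⟩ := K.inj _ H.conf (f ≫ K.i)
  have ha' : H.i ≫ a = f ≫ K.i := ha
  obtain ⟨z, hz⟩ := hE.exists_desc H.conf (a ≫ K.p) (by
    change H.i ≫ a ≫ K.p = 0
    rw [← Category.assoc, ha', Category.assoc, K.zero, comp_zero])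
  exact ⟨a, z, ha', hz.symm⟩

/-- The map between cosyzygies induced by a morphism is unique in the stable category, and depends
only on the class of the morphism there. -/
lemma IsFrobenius.hull_map_unique (hE : IsFrobenius E) {X Y : C} {H : InjHull E X}
    {K : InjHull E Y} {f f' : X ⟶ Y} (hf : (toStable E).map f = (toStable E).map f')
    {a a' : H.I ⟶ K.I} {z z' : H.Z ⟶ K.Z}
    (h₁ : H.i ≫ a = f ≫ K.i) (h₂ : a ≫ K.p = H.p ≫ z)
    (h₁' : H.i ≫ a' = f' ≫ K.i) (h₂' : a' ≫ K.p = H.p ≫ z') :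
    (toStable E).map z = (toStable E).map z' := by
  obtain ⟨P, hP, s, t, hst⟩ := (hE.toStable_map_eq_iff _ _).1 hf
  obtain ⟨s', hs'⟩ := ((hE.proj_iff_inj P).1 hP) _ H.conf s
  have hs'' : H.i ≫ s' = s := hs'
  obtain ⟨b, hb⟩ := hE.exists_desc H.conf (a - a' - s' ≫ t ≫ K.i) (by
    change H.i ≫ (a - a' - s' ≫ t ≫ K.i) = 0
    rw [Preadditive.comp_sub, Preadditive.comp_sub, h₁, h₁', ← Preadditive.sub_comp, hst,
      ← Category.assoc H.i s', hs'', Category.assoc, sub_self])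
  have hb' : H.p ≫ b = a - a' - s' ≫ t ≫ K.i := hb
  refine toStable_map_eq_of_factor ((hE.proj_iff_inj _).2 K.inj) b K.p ?_
  have : Epi H.p := hE.epi_p H.conf
  rw [← cancel_epi H.p, Preadditive.comp_sub, ← h₂, ← h₂', ← Category.assoc, hb']
  simp [Preadditive.sub_comp, K.zero]

lemma IsFrobenius.susp_map_eq (hE : IsFrobenius E) {X Y : C} (f : X ⟶ Y)
    {a : (hE.hull X).I ⟶ (hE.hull Y).I} {z : (hE.hull X).Z ⟶ (hE.hull Y).Z}
    (h₁ : (hE.hull X).i ≫ a = f ≫ (hE.hull Y).i) (h₂ : a ≫ (hE.hull Y).p = (hE.hull X).p ≫ z) :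
    hE.susp.map ((toStable E).map f) = (toStable E).map z := by
  obtain ⟨a', h₁', h₂'⟩ := (hE.exists_susp f).choose_spec
  exact hE.hull_map_unique rfl h₁' h₂' h₁ h₂

/-- Comparison morphisms over the identity are isomorphisms in the stable category. -/
lemma IsFrobenius.hull_map_comp_id (hE : IsFrobenius E) {X : C} {H K : InjHull E X}
    {a : H.I ⟶ K.I} {z : H.Z ⟶ K.Z} {b : K.I ⟶ H.I} {y : K.Z ⟶ H.Z}
    (h₁ : H.i ≫ a = K.i) (h₂ : a ≫ K.p = H.p ≫ z)
    (h₁' : K.i ≫ b = H.i) (h₂' : b ≫ H.p = K.p ≫ y) :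
    (toStable E).map z ≫ (toStable E).map y = 𝟙 _ := by
  refine ((toStable E).map_comp _ _).symm.trans (Eq.trans ?_ ((toStable E).map_id _))
  refine hE.hull_map_unique (H := H) (K := H) (f := 𝟙 X) rfl (a := a ≫ b) (a' := 𝟙 _) ?_ ?_ ?_ ?_
  · rw [← Category.assoc, h₁, h₁', Category.id_comp]
  · rw [Category.assoc, h₂', ← Category.assoc, h₂, Category.assoc]
  · simp
  · simp

/-- Pushouts along any inflation into an injective object give distinguished triangles. -/
lemma IsFrobenius.distinguished_of_hull (hE : IsFrobenius E) {X Y Cn : C} (H : InjHull E X)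
    {u : X ⟶ Y} {j : H.I ⟶ Cn} {c : Y ⟶ Cn} (sq : IsPushout H.i u j c) {w : Cn ⟶ H.Z}
    (hc : c ≫ w = 0) (hj : j ≫ w = H.p) {a : H.I ⟶ (hE.hull X).I} {z : H.Z ⟶ (hE.hull X).Z}
    (h₁ : H.i ≫ a = (hE.hull X).i) (h₂ : a ≫ (hE.hull X).p = H.p ≫ z) :
    hE.Distinguished ((toStable E).map u) ((toStable E).map c)
      ((toStable E).map (w ≫ z) : _ ⟶ hE.susp.obj ((toStable E).obj X)) := by
  obtain ⟨Cn', j', c', sq', -⟩ := hE.inflation_pushout (hE.hull X).i u ⟨(hE.hull X).Z, (hE.hull X).p, (hE.hull X).zero, (hE.hull X).conf⟩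
  obtain ⟨b, y, hb, -⟩ := hE.exists_hull_map (hE.hull X) H (𝟙 X)
  rw [Category.id_comp] at hb
  have hz : (hE.hull X).i ≫ (hE.hull X).p = u ≫ 0 := by rw [(hE.hull X).zero, comp_zero]
  let w' : Cn' ⟶ (hE.hull X).Z := sq'.desc (hE.hull X).p 0 hz
  have hj' : j' ≫ w' = (hE.hull X).p := sq'.inl_desc _ _ hz
  have hc' : c' ≫ w' = 0 := sq'.inr_desc _ _ hz
  have hθ : H.i ≫ a ≫ j' = u ≫ c' := by rw [← Category.assoc, h₁, sq'.w]
  have hθ' : (hE.hull X).i ≫ b ≫ j = u ≫ c := by rw [← Category.assoc, hb, sq.w]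
  let θ : Cn ⟶ Cn' := sq.desc (a ≫ j') c' hθ
  let θ' : Cn' ⟶ Cn := sq'.desc (b ≫ j) c hθ'
  have e1 : j ≫ θ = a ≫ j' := sq.inl_desc _ _ hθ
  have e2 : c ≫ θ = c' := sq.inr_desc _ _ hθ
  have e3 : j' ≫ θ' = b ≫ j := sq'.inl_desc _ _ hθ'
  have e4 : c' ≫ θ' = c := sq'.inr_desc _ _ hθ'
  obtain ⟨t, ht⟩ := hE.exists_desc H.conf (a ≫ b - 𝟙 _) (by
    change H.i ≫ (a ≫ b - 𝟙 _) = 0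
    rw [Preadditive.comp_sub, ← Category.assoc, h₁, hb, Category.comp_id, sub_self])
  obtain ⟨t', ht'⟩ := hE.exists_desc (hE.hull X).conf (b ≫ a - 𝟙 _) (by
    change (hE.hull X).i ≫ (b ≫ a - 𝟙 _) = 0
    rw [Preadditive.comp_sub, ← Category.assoc, hb, h₁, Category.comp_id, sub_self])
  replace ht : H.p ≫ t = a ≫ b - 𝟙 _ := ht
  replace ht' : (hE.hull X).p ≫ t' = b ≫ a - 𝟙 _ := ht'
  have i1 : (toStable E).map θ ≫ (toStable E).map θ' = 𝟙 _ := by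
    refine ((toStable E).map_comp _ _).symm.trans (Eq.trans ?_ ((toStable E).map_id _))
    refine toStable_map_eq_of_factor ((hE.proj_iff_inj _).2 H.inj) (w ≫ t) j (sq.hom_ext ?_ ?_)
    · rw [Preadditive.comp_sub, ← Category.assoc, e1, Category.assoc, e3, Category.comp_id,
        ← Category.assoc, ← Category.assoc j, ← Category.assoc j, hj, ht, Preadditive.sub_comp,
        Category.id_comp]
    · rw [Preadditive.comp_sub, ← Category.assoc, e2, e4, Category.comp_id, sub_self,
        ← Category.assoc, ← Category.assoc c, hc, zero_comp, zero_comp]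
  have i2 : (toStable E).map θ' ≫ (toStable E).map θ = 𝟙 _ := by
    refine ((toStable E).map_comp _ _).symm.trans (Eq.trans ?_ ((toStable E).map_id _))
    refine toStable_map_eq_of_factor ((hE.proj_iff_inj _).2 (hE.hull X).inj) (w' ≫ t') j'
      (sq'.hom_ext ?_ ?_)
    · rw [Preadditive.comp_sub, ← Category.assoc, e3, Category.assoc, e1, Category.comp_id,
        ← Category.assoc, ← Category.assoc j', ← Category.assoc j', hj', ht', Preadditive.sub_comp,
        Category.id_comp]
    · rw [Preadditive.comp_sub, ← Category.assoc, e4, e2, Category.comp_id, sub_self,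
        ← Category.assoc, ← Category.assoc c', hc', zero_comp, zero_comp]
  refine ⟨X, Y, Cn', u, c', j', w', sq', hc', hj', Iso.refl _, Iso.refl _, ⟨_, _, i1, i2⟩, ?_, ?_, ?_⟩
  · exact (Category.comp_id _).trans (Category.id_comp _).symm
  · refine Eq.trans ?_ (Category.id_comp _).symm
    refine ((toStable E).map_comp _ _).symm.trans ?_
    rw [e2]
  · refine (congrArg _ (hE.susp.map_id _)).trans ((Category.comp_id _).trans ?_)
    refine Eq.trans ?_ ((toStable E).map_comp _ _)
    refine congrArg _ (sq.hom_ext ?_ ?_)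
    · rw [← Category.assoc, hj, ← h₂, ← Category.assoc, e1, Category.assoc, hj']
    · rw [← Category.assoc, hc, zero_comp, ← Category.assoc, e2, hc']

/-- Distinguished triangles are closed under isomorphisms. -/
lemma IsFrobenius.Distinguished.of_iso {hE : IsFrobenius E} {U V W U' V' W' : Stable E}
    {f : U ⟶ V} {g : V ⟶ W} {h : W ⟶ hE.susp.obj U} {f' : U' ⟶ V'} {g' : V' ⟶ W'}
    {h' : W' ⟶ hE.susp.obj U'} (H : hE.Distinguished f' g' h') (α : U ≅ U') (β : V ≅ V')
    (γ : W ≅ W') (h₁ : f ≫ β.hom = α.hom ≫ f') (h₂ : g ≫ γ.hom = β.hom ≫ g')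
    (h₃ : h ≫ hE.susp.map α.hom = γ.hom ≫ h') : hE.Distinguished f g h := by
  obtain ⟨X, Y, Cn, u, c, j, w, sq, hc, hj, α', β', γ', hf, hg, hh⟩ := H
  refine ⟨X, Y, Cn, u, c, j, w, sq, hc, hj, α ≪≫ α', β ≪≫ β', γ ≪≫ γ', ?_, ?_, ?_⟩
  · rw [Iso.trans_hom, Iso.trans_hom, Category.assoc, ← hf, ← Category.assoc, h₁, Category.assoc]
  · rw [Iso.trans_hom, Iso.trans_hom, Category.assoc, ← hg, ← Category.assoc, h₂, Category.assoc]
  · rw [Iso.trans_hom, Iso.trans_hom, Category.assoc, ← hh, Functor.map_comp, ← Category.assoc,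
      h₃, Category.assoc]
    rfl

end Stable

section StableFunctor

variable {C : Type u} [Category.{v} C] [Preadditive C]
variable {C' : Type u'} [Category.{v'} C'] [Preadditive C']
variable {E : ObjectProperty (ShortComplex C)} {E' : ObjectProperty (ShortComplex C')}

/-- An additive functor that preserves projective objects induces a functor between the stable
categories. -/
def stableFunctor (G : C ⥤ C') [G.Additive] (hG : ∀ X, IsProj E X → IsProj E' (G.obj X)) :
    Stable E ⥤ Stable E' :=
  CategoryTheory.Quotient.lift _ (G ⋙ toStable E') (by
    rintro X Y f g ⟨P, hP, s, t, h⟩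
    exact toStable_map_eq_of_factor (hG P hP) (G.map s) (G.map t)
      (by rw [← Functor.map_sub, h, Functor.map_comp]))

variable (G : C ⥤ C') [G.Additive] (hG : ∀ X, IsProj E X → IsProj E' (G.obj X))

lemma stableFunctor_isInducedBy : IsInducedBy E E' (stableFunctor G hG) G :=
  ⟨CategoryTheory.Quotient.lift.isLift _ _ _⟩

lemma stableFunctor_full
    (h : ∀ (X Y : C) (g : G.obj X ⟶ G.obj Y), ∃ f : X ⟶ Y, G.map f = g) :
    (stableFunctor (E := E) (E' := E') G hG).Full where
  map_surjective {X Y} g := by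
    obtain ⟨g, rfl⟩ := (toStable E').map_surjective (X := G.obj X.as) (Y := G.obj Y.as) g
    obtain ⟨f, rfl⟩ := h X.as Y.as g
    exact ⟨(toStable E).map f, rfl⟩

lemma stableFunctor_faithful (hE : IsFrobenius E) (hE' : IsFrobenius E')
    (h : ∀ (X Y : C) (f : X ⟶ Y) (Q : C') (_ : IsProj E' Q) (s : G.obj X ⟶ Q) (t : Q ⟶ G.obj Y),
      G.map f = s ≫ t → ∃ (P : C) (_ : IsProj E P) (s : X ⟶ P) (t : P ⟶ Y), f = s ≫ t) :
    (stableFunctor (E := E) (E' := E') G hG).Faithful where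
  map_injective {X Y} f g hfg := by
    obtain ⟨f, rfl⟩ := (toStable E).map_surjective (X := X.as) (Y := Y.as) f
    obtain ⟨g, rfl⟩ := (toStable E).map_surjective (X := X.as) (Y := Y.as) g
    have hfg' : (toStable E').map (G.map f) = (toStable E').map (G.map g) := hfg
    obtain ⟨Q, hQ, s, t, hst⟩ := (hE'.toStable_map_eq_iff _ _).1 hfg'
    obtain ⟨P, hP, s, t, h⟩ := h _ _ (f - g) Q hQ s t (by rw [Functor.map_sub, hst])
    exact (hE.toStable_map_eq_iff _ _).2 ⟨P, hP, s, t, h⟩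

lemma stableFunctor_essSurj (h : ∀ Y : C', ∃ X : C, Nonempty (G.obj X ≅ Y)) :
    (stableFunctor (E := E) (E' := E') G hG).EssSurj where
  mem_essImage Y := by
    obtain ⟨X, ⟨e⟩⟩ := h Y.as
    exact ⟨(toStable E).obj X, ⟨(toStable E').mapIso e⟩⟩

/-- An additive functor between Frobenius exact categories that preserves conflations, pushouts
of inflations and projective objects induces a triangle functor. -/
theorem stableFunctor_isTriangleFunctor (hE : IsFrobenius E) (hE' : IsFrobenius E')
    (hconf : ∀ S, E S → E' (S.map G))
    (hpush : ∀ (S : ShortComplex C) (_ : E S) {Y Q : C} (f : S.X₁ ⟶ Y) (f' : S.X₂ ⟶ Q)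
      (i : Y ⟶ Q), IsPushout S.f f f' i → IsPushout (G.map S.f) (G.map f) (G.map f') (G.map i)) :
    IsTriangleFunctor hE hE' (stableFunctor (E := E) (E' := E') G hG) := by
  have hinj : ∀ X, IsInj E X → IsInj E' (G.obj X) := fun X h =>
    (hE'.proj_iff_inj _).1 (hG X ((hE.proj_iff_inj _).2 h))
  let H : ∀ X : C, InjHull E' (G.obj X) := fun X =>
    { I := G.obj (hE.hull X).I
      Z := G.obj (hE.hull X).Z
      i := G.map (hE.hull X).i
      p := G.map (hE.hull X).p
      zero := by rw [← Functor.map_comp, (hE.hull X).zero, Functor.map_zero]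
      conf := hconf _ (hE.hull X).conf
      inj := hinj _ (hE.hull X).inj }
  have hex : ∀ X : C, ∃ (a : (H X).I ⟶ (hE'.hull (G.obj X)).I)
      (z : (H X).Z ⟶ (hE'.hull (G.obj X)).Z),
      (H X).i ≫ a = (hE'.hull (G.obj X)).i ∧ a ≫ (hE'.hull (G.obj X)).p = (H X).p ≫ z := by
    intro X
    obtain ⟨a, z, h, h'⟩ := hE'.exists_hull_map (H X) (hE'.hull (G.obj X)) (𝟙 _)
    exact ⟨a, z, by rw [h, Category.id_comp], h'⟩
  have hex' : ∀ X : C, ∃ (a : (hE'.hull (G.obj X)).I ⟶ (H X).I)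
      (z : (hE'.hull (G.obj X)).Z ⟶ (H X).Z),
      (hE'.hull (G.obj X)).i ≫ a = (H X).i ∧ a ≫ (H X).p = (hE'.hull (G.obj X)).p ≫ z := by
    intro X
    obtain ⟨a, z, h, h'⟩ := hE'.exists_hull_map (hE'.hull (G.obj X)) (H X) (𝟙 _)
    exact ⟨a, z, by rw [h, Category.id_comp], h'⟩
  choose a z h₁ h₂ using hex
  choose b y h₁' h₂' using hex'
  let e : ∀ X : C, (toStable E').obj (H X).Z ≅ (toStable E').obj (hE'.hull (G.obj X)).Z := fun X =>
    ⟨(toStable E').map (z X), (toStable E').map (y X),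
      hE'.hull_map_comp_id (h₁ X) (h₂ X) (h₁' X) (h₂' X),
      hE'.hull_map_comp_id (h₁' X) (h₂' X) (h₁ X) (h₂ X)⟩
  let F := stableFunctor (E := E) (E' := E') G hG
  let φ : hE.susp ⋙ F ≅ F ⋙ hE'.susp := CategoryTheory.Quotient.natIsoLift _
    (NatIso.ofComponents (F := toStable E ⋙ hE.susp ⋙ F) (G := toStable E ⋙ F ⋙ hE'.susp)
      (fun X => e X) (by
        intro X Y f
        obtain ⟨p, q, hp, hq⟩ := hE.exists_hull_map (hE.hull X) (hE.hull Y) f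
        obtain ⟨p', q', hp', hq'⟩ :=
          hE'.exists_hull_map (hE'.hull (G.obj X)) (hE'.hull (G.obj Y)) (G.map f)
        change F.map (hE.susp.map ((toStable E).map f)) ≫ (toStable E').map (z Y) =
          (toStable E').map (z X) ≫ hE'.susp.map ((toStable E').map (G.map f))
        have k1 : F.map (hE.susp.map ((toStable E).map f)) = (toStable E').map (G.map q) :=
          congrArg F.map (hE.susp_map_eq f hp hq)
        refine (congrArg (· ≫ (toStable E').map (z Y)) k1).trans ?_
        refine Eq.trans ?_ (congrArg ((toStable E').map (z X) ≫ ·)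
          (hE'.susp_map_eq (G.map f) hp' hq')).symm
        refine ((toStable E').map_comp _ _).symm.trans
          (Eq.trans ?_ ((toStable E').map_comp _ _))
        refine hE'.hull_map_unique (H := H X) (K := hE'.hull (G.obj Y)) (f := G.map f) rfl
          (a := G.map p ≫ a Y) (a' := a X ≫ p') ?_ ?_ ?_ ?_
        · rw [← h₁ Y]
          change G.map _ ≫ G.map _ ≫ _ = G.map _ ≫ G.map _ ≫ _
          rw [← Category.assoc, ← Functor.map_comp, hp, Functor.map_comp, Category.assoc]
        · rw [Category.assoc, h₂]
          change G.map _ ≫ G.map _ ≫ _ = G.map _ ≫ G.map _ ≫ _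
          rw [← Category.assoc, ← Functor.map_comp, hq, Functor.map_comp, Category.assoc]
        · rw [← Category.assoc, h₁, hp']
        · rw [Category.assoc, hq', ← Category.assoc, h₂, Category.assoc]))
  refine ⟨φ, ?_⟩
  rintro U V W f g h ⟨X, Y, Cn, u, c, j, w, sq, hc, hj, α, β, γ, hf, hg, hh⟩
  have hφ : φ.hom.app ((toStable E).obj X) = (toStable E').map (z X) := rfl
  refine (hE'.distinguished_of_hull (H X) (u := G.map u) (j := G.map j) (c := G.map c)
      (hpush _ (hE.hull X).conf _ _ _ sq) (w := G.map w)
      (by rw [← Functor.map_comp, hc, Functor.map_zero])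
      (by rw [← Functor.map_comp, hj]) (h₁ X) (h₂ X)).of_iso (F.mapIso α) (F.mapIso β)
      (F.mapIso γ) ?_ ?_ ?_
  · exact (F.map_comp _ _).symm.trans ((congrArg F.map hf).trans (F.map_comp _ _))
  · exact (F.map_comp _ _).symm.trans ((congrArg F.map hg).trans (F.map_comp _ _))
  · have h3 : F.map h ≫ F.map (hE.susp.map α.hom) = F.map γ.hom ≫ (toStable E').map (G.map w) :=
      (F.map_comp _ _).symm.trans ((congrArg F.map hh).trans (F.map_comp _ _))
    have h4 : F.map (hE.susp.map α.hom) ≫ (toStable E').map (z X) =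
      φ.hom.app U ≫ hE'.susp.map (F.map α.hom) := φ.hom.naturality α.hom
    refine (Category.assoc _ _ _).trans ((congrArg (F.map h ≫ ·) h4.symm).trans ?_)
    refine (Category.assoc _ _ _).symm.trans ((congrArg (· ≫ (toStable E').map (z X)) h3).trans ?_)
    exact (Category.assoc _ _ _).trans
      (congrArg (F.map γ.hom ≫ ·) ((toStable E').map_comp _ _).symm)

end StableFunctor

section Abelian

variable {C : Type u} [Category.{v} C] [Abelian C]
variable {C' : Type u'} [Category.{v'} C'] [Abelian C']

/-- A morphism of short exact sequences that is an isomorphism on the third terms has a cocartesian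
left square. -/
lemma isPushout_of_shortExact {S T : ShortComplex C} (hS : S.ShortExact) (hT : T.ShortExact)
    (φ : S ⟶ T) [IsIso φ.τ₃] : IsPushout S.f φ.τ₁ φ.τ₂ T.f := by
  have sq := IsPushout.of_hasPushout S.f φ.τ₁
  obtain ⟨q, w, hq, hU⟩ := shortExact_of_isPushout hS sq
  let U := ShortComplex.mk _ _ w
  let ψ : U ⟶ T :=
    { τ₁ := 𝟙 _
      τ₂ := sq.desc φ.τ₂ T.f φ.comm₁₂.symm
      τ₃ := φ.τ₃
      comm₁₂ := by simp [U]
      comm₂₃ := by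
        refine sq.hom_ext ?_ ?_
        · change _ ≫ _ ≫ T.g = _ ≫ q ≫ _
          rw [← Category.assoc, sq.inl_desc, ← Category.assoc, hq, φ.comm₂₃]
        · change _ ≫ _ ≫ T.g = _ ≫ q ≫ _
          rw [← Category.assoc, sq.inr_desc, ← Category.assoc, w, T.zero, zero_comp] }
  have : IsIso ψ.τ₁ := inferInstanceAs (IsIso (𝟙 _))
  have : IsIso ψ.τ₃ := inferInstanceAs (IsIso φ.τ₃)
  have : IsIso ψ.τ₂ := ShortComplex.isIso₂_of_shortExact_of_isIso₁₃ ψ hU hT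
  exact sq.of_iso (Iso.refl _) (Iso.refl _) (Iso.refl _) (asIso ψ.τ₂) (by simp) (by simp)
    (by simp [ψ]) (by simp [ψ])

variable {P : ObjectProperty C} {P' : ObjectProperty C'}

/-- Pushouts of inflations along arbitrary morphisms are formed in the ambient abelian category, with
the same cokernel. -/
lemma FrobClass.isPushout_obj (hP : FrobClass P) {S : ShortComplex P.FullSubcategory}
    (hS : shortExactIn P S) {Y Q : P.FullSubcategory} {f : S.X₁ ⟶ Y} {f' : S.X₂ ⟶ Q} {i : Y ⟶ Q}
    (h : IsPushout S.f f f' i) : ∃ (q : Q ⟶ S.X₃) (w : i ≫ q = 0), f' ≫ q = S.g ∧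
      shortExactIn P (ShortComplex.mk i q w) := by
  have sq := IsPushout.of_hasPushout S.f.hom f.hom
  obtain ⟨q, w, hq, hU⟩ := shortExact_of_isPushout hS sq
  let Q' : P.FullSubcategory := ⟨pushout S.f.hom f.hom, hP.ext _ hU Y.2 S.X₃.2⟩
  let l : S.X₂ ⟶ Q' := ObjectProperty.homMk (pushout.inl _ _)
  let r : Y ⟶ Q' := ObjectProperty.homMk (pushout.inr _ _)
  have sq' : IsPushout S.f f l r := IsPushout.of_map P.ι (ObjectProperty.hom_ext _ sq.w) sq
  let e : Q ≅ Q' := h.isoIsPushout _ _ sq'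
  have he₁ : f' ≫ e.hom = l := h.inl_isoIsPushout_hom _ _ sq'
  have he₂ : i ≫ e.hom = r := h.inr_isoIsPushout_hom _ _ sq'
  let q' : Q' ⟶ S.X₃ := ObjectProperty.homMk q
  have hw : i ≫ e.hom ≫ q' = 0 := by
    rw [← Category.assoc, he₂]
    exact ObjectProperty.hom_ext _ w
  refine ⟨e.hom ≫ q', hw, ?_, ?_⟩
  · rw [← Category.assoc, he₁]
    exact ObjectProperty.hom_ext _ hq
  · refine ShortComplex.shortExact_of_iso (ShortComplex.isoMk (S₁ := ShortComplex.mk _ _ w)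
      (S₂ := (ShortComplex.mk i (e.hom ≫ q') hw).map P.ι) (Iso.refl _) (P.ι.mapIso e).symm
      (Iso.refl _) ?_ ?_) hU
    · change 𝟙 _ ≫ i.hom = pushout.inr _ _ ≫ e.inv.hom
      have : i = r ≫ e.inv := by
        rw [← he₂, Category.assoc, e.hom_inv_id, Category.comp_id]
      rw [Category.id_comp]
      exact congrArg (fun f => f.hom) this
    · change e.inv.hom ≫ e.hom.hom ≫ q = q ≫ 𝟙 _
      have : e.inv.hom ≫ e.hom.hom = 𝟙 _ := congrArg (fun f => f.hom) e.inv_hom_id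
      rw [← Category.assoc, this, Category.id_comp, Category.comp_id]

/-- An additive functor between Frobenius classes that preserves short exact sequences and
projective objects induces a triangle functor between the stable categories. -/
theorem FrobClass.isTriangleFunctor (hP : FrobClass P) (hP' : FrobClass P')
    (G : P.FullSubcategory ⥤ P'.FullSubcategory) [G.Additive]
    (hG : ∀ X, IsProj (shortExactIn P) X → IsProj (shortExactIn P') (G.obj X))
    (hconf : ∀ S, shortExactIn P S → shortExactIn P' (S.map G)) :
    IsTriangleFunctor hP.isFrobenius hP'.isFrobenius (stableFunctor G hG) := by
  refine stableFunctor_isTriangleFunctor G hG _ _ hconf fun S hS Y Q f f' i h => ?_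
  obtain ⟨q, w, hq, hT⟩ := hP.isPushout_obj hS h
  let φ : S ⟶ ShortComplex.mk i q w :=
    { τ₁ := f, τ₂ := f', τ₃ := 𝟙 _, comm₁₂ := h.w.symm, comm₂₃ := by simpa using hq }
  let ψ := (P'.ι.mapShortComplex).map (G.mapShortComplex.map φ)
  have : IsIso ψ.τ₃ := by
    have : IsIso (P'.ι.map (G.map (𝟙 S.X₃))) := inferInstance
    exact this
  exact IsPushout.of_map P'.ι (by rw [← Functor.map_comp, h.w, Functor.map_comp])
    (@isPushout_of_shortExact _ _ _ _ _ (hconf _ hS) (hconf _ hT) ψ this)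

lemma ιOfLE_isProj {P P' : ObjectProperty C} (hP : FrobClass P) (hP' : FrobClass P')
    (hle : P ≤ P') (X : P.FullSubcategory) (hX : IsProj (shortExactIn P) X) :
    IsProj (shortExactIn P') ((ObjectProperty.ιOfLE hle).obj X) :=
  (hP'.isProj_iff _).2 ((hP.isProj_iff X).1 hX)

instance {P P' : ObjectProperty C} (hle : P ≤ P') : (ObjectProperty.ιOfLE hle).Additive where
  map_add := rfl

/-- The stable category of a Frobenius class contained in another one is a full subcategory. -/
lemma FrobClass.full_faithful_ιOfLE {P P' : ObjectProperty C} (hP : FrobClass P)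
    (hP' : FrobClass P') (hle : P ≤ P') :
    (stableFunctor (ObjectProperty.ιOfLE hle) (ιOfLE_isProj hP hP' hle)).Full ∧
    (stableFunctor (ObjectProperty.ιOfLE hle) (ιOfLE_isProj hP hP' hle)).Faithful := by
  refine ⟨stableFunctor_full _ _ fun X Y g => ⟨ObjectProperty.homMk g.hom, rfl⟩,
    stableFunctor_faithful _ _ hP.isFrobenius hP'.isFrobenius fun X Y f Q hQ s t h => ?_⟩
  obtain ⟨W, Z, i, p, w, hS, hW, hW', hK⟩ := hP.hull X.obj X.2
  obtain ⟨s', hs'⟩ := hP'.extend _ hS (hle _ hK) Q.obj Q.2 ((hP'.isProj_iff Q).1 hQ) s.hom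
  refine ⟨⟨W, hW'⟩, (hP.isProj_iff _).2 hW, ObjectProperty.homMk i,
    ObjectProperty.homMk (s' ≫ t.hom), ObjectProperty.hom_ext _ ?_⟩
  change f.hom = i ≫ s' ≫ t.hom
  have h' : f.hom = s.hom ≫ t.hom := congrArg (fun f => f.hom) h
  have hs'' : i ≫ s' = s.hom := hs'
  rw [h', ← Category.assoc, hs'']

end Abelian

end ExactCat

/-! ### Gorenstein projective modules -/

namespace ExactCat

section Horseshoe

variable {C : Type u} [Category.{v} C] [Abelian C]

lemma shortExact_of_isos {X₁ X₂ X₃ Y₁ Y₂ Y₃ : C} {f : X₁ ⟶ X₂} {g : X₂ ⟶ X₃} {w : f ≫ g = 0}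
    (h : (ShortComplex.mk f g w).ShortExact) {f' : Y₁ ⟶ Y₂} {g' : Y₂ ⟶ Y₃} (e₁ : X₁ ≅ Y₁)
    (e₂ : X₂ ≅ Y₂) (e₃ : X₃ ≅ Y₃) (c₁ : e₁.hom ≫ f' = f ≫ e₂.hom)
    (c₂ : e₂.hom ≫ g' = g ≫ e₃.hom) (w' : f' ≫ g' = 0) : (ShortComplex.mk f' g' w').ShortExact :=
  ShortComplex.shortExact_of_iso (S₁ := ShortComplex.mk f g w) (S₂ := ShortComplex.mk f' g' w')
    (ShortComplex.isoMk e₁ e₂ e₃ c₁ c₂) h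

lemma shortExact_id_zero (X : C) {Z : C} (hZ : IsZero Z) :
    (ShortComplex.mk (𝟙 X) (0 : X ⟶ Z) (by simp)).ShortExact :=
  ShortComplex.ShortExact.mk'
    (ShortComplex.exact_of_f_is_kernel _ (KernelFork.IsLimit.ofι' _ _ fun k _ => ⟨k, by simp⟩))
    (inferInstanceAs (Mono (𝟙 X))) ⟨fun _ _ _ => hZ.eq_of_src _ _⟩

lemma shortExact_zero_id (X : C) {Z : C} (hZ : IsZero Z) :
    (ShortComplex.mk (0 : Z ⟶ X) (𝟙 X) (by simp)).ShortExact :=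
  ShortComplex.ShortExact.mk'
    (ShortComplex.exact_of_g_is_cokernel _ (CokernelCofork.IsColimit.ofπ' _ _ fun k _ =>
      ⟨k, by simp⟩)) ⟨fun _ _ _ => hZ.eq_of_tgt _ _⟩ (inferInstanceAs (Epi (𝟙 X)))

attribute [local instance] Abelian.hasFiniteBiproducts

/-- The horseshoe lemma for embeddings of the outer terms of a short exact sequence. -/
lemma exists_horseshoe {S : ShortComplex C} (hS : S.ShortExact) {P₁ C₁ P₃ C₃ : C}
    {i₁ : S.X₁ ⟶ P₁} {p₁ : P₁ ⟶ C₁} {w₁ : i₁ ≫ p₁ = 0}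
    (h₁ : (ShortComplex.mk i₁ p₁ w₁).ShortExact)
    {i₃ : S.X₃ ⟶ P₃} {p₃ : P₃ ⟶ C₃} {w₃ : i₃ ≫ p₃ = 0}
    (h₃ : (ShortComplex.mk i₃ p₃ w₃).ShortExact) (g : S.X₂ ⟶ P₁) (hg : S.f ≫ g = i₁) :
    ∃ (Z : C) (j : S.X₂ ⟶ P₁ ⊞ P₃) (q : P₁ ⊞ P₃ ⟶ Z) (w : j ≫ q = 0)
      (a : C₁ ⟶ Z) (b : Z ⟶ C₃) (w' : a ≫ b = 0),
      (ShortComplex.mk j q w).ShortExact ∧ (ShortComplex.mk a b w').ShortExact := by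
  have hB := (ShortComplex.Splitting.ofHasBinaryBiproduct P₁ S.X₃).shortExact
  have hB₁ := (ShortComplex.Splitting.ofHasBinaryBiproduct S.X₃ P₁).shortExact
  have hB₂ := (ShortComplex.Splitting.ofHasBinaryBiproduct P₃ P₁).shortExact
  let φ : S ⟶ ShortComplex.mk (biprod.inl : P₁ ⟶ P₁ ⊞ S.X₃) biprod.snd (by simp) :=
    { τ₁ := i₁, τ₂ := biprod.lift g S.g, τ₃ := 𝟙 _
      comm₁₂ := by ext <;> simp [hg]
      comm₂₃ := by simp }
  have : IsIso φ.τ₃ := inferInstanceAs (IsIso (𝟙 _))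
  have sq := isPushout_of_shortExact hS hB φ
  obtain ⟨q, w, -, hU⟩ := shortExact_of_isPushout h₁ sq.flip
  let ψ : ShortComplex.mk (biprod.inl : S.X₃ ⟶ S.X₃ ⊞ P₁) biprod.snd (by simp) ⟶
      ShortComplex.mk (biprod.inl : P₃ ⟶ P₃ ⊞ P₁) biprod.snd (by simp) :=
    { τ₁ := i₃, τ₂ := biprod.map i₃ (𝟙 _), τ₃ := 𝟙 _ }
  have : IsIso ψ.τ₃ := inferInstanceAs (IsIso (𝟙 _))
  have sq' := isPushout_of_shortExact hB₁ hB₂ ψ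
  obtain ⟨q', w', -, hU'⟩ := shortExact_of_isPushout h₃ sq'.flip
  let v : P₁ ⊞ S.X₃ ⟶ P₁ ⊞ P₃ := biprod.map (𝟙 _) i₃
  have hV : (ShortComplex.mk v ((biprod.braiding _ _).hom ≫ q') (by
      have : v ≫ (biprod.braiding _ _).hom = (biprod.braiding _ _).hom ≫ ψ.τ₂ := by
        ext <;> simp [v, ψ]
      rw [← Category.assoc, this, Category.assoc, w', comp_zero])).ShortExact := by
    refine shortExact_of_isos hU' (biprod.braiding _ _) (biprod.braiding _ _) (Iso.refl _) ?_ ?_ _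
    · change (biprod.braiding _ _).hom ≫ v = ψ.τ₂ ≫ (biprod.braiding _ _).hom
      ext <;> simp [v, ψ]
    · change (biprod.braiding _ _).hom ≫ (biprod.braiding _ _).hom ≫ q' = q' ≫ 𝟙 _
      rw [← Category.assoc, biprod.symmetry, Category.id_comp, Category.comp_id]
  have := hV.mono_f
  have := hU.mono_f
  obtain ⟨a, b, w'', hE⟩ := shortExact_cokernel_comp φ.τ₂ v
  let e₁ : cokernel φ.τ₂ ≅ C₁ := (colimit.isColimit _).coconePointUniqueUpToIso hU.gIsCokernel
  let e₃ : cokernel v ≅ C₃ := (colimit.isColimit _).coconePointUniqueUpToIso hV.gIsCokernel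
  have : Mono (φ.τ₂ ≫ v) := by
    have : Mono φ.τ₂ := hU.mono_f
    have : Mono v := hV.mono_f
    exact mono_comp _ _
  refine ⟨cokernel (φ.τ₂ ≫ v), φ.τ₂ ≫ v, cokernel.π _, cokernel.condition _, e₁.inv ≫ a, b ≫ e₃.hom,
    ?_, shortExact_cokernel _, ?_⟩
  · rw [Category.assoc, ← Category.assoc a, w'', zero_comp, comp_zero]
  · exact shortExact_of_isos hE e₁ (Iso.refl _) e₃ (by simp) (by simp) _

end Horseshoe

end ExactCat

section GProj

open ExactCat CategoryTheory.Abelian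

variable {R : Type u} [Ring R]

/-- A short exact sequence with projective middle term, all of whose maps from the first term to
projective modules extend to the middle term. -/
def IsTotallyExact (M N : ModuleCat.{u} R) : Prop :=
  ∃ (P : ModuleCat.{u} R) (i : M ⟶ P) (p : P ⟶ N) (w : i ≫ p = 0),
    (ShortComplex.mk i p w).ShortExact ∧ Projective P ∧
    ∀ Q : ModuleCat.{u} R, Projective Q → ∀ f : M ⟶ Q, ∃ g : P ⟶ Q, i ≫ g = f

/-- Sequences of modules indexed by the integers, constructed step by step in both directions. -/
lemma exists_int_sequence {X : Type*} {W : X → Prop} {r : X → X → Prop}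
    (h₁ : ∀ x, W x → ∃ y, W y ∧ r x y) (h₂ : ∀ x, W x → ∃ y, W y ∧ r y x) (x : X) (hx : W x) :
    ∃ N : ℤ → X, N 1 = x ∧ ∀ n, r (N n) (N (n + 1)) := by
  choose! a ha ha' using h₁
  choose! b hb hb' using h₂
  have hA : ∀ k : ℕ, W (a^[k] x) := fun k => by
    induction k with
    | zero => exact hx
    | succ k ih => rw [Function.iterate_succ_apply']; exact ha _ ih
  have hB : ∀ k : ℕ, W (b^[k] x) := fun k => by
    induction k with
    | zero => exact hx
    | succ k ih => rw [Function.iterate_succ_apply']; exact hb _ ih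
  let N : ℤ → X := fun n => match n with
    | Int.ofNat k => a^[k] x
    | Int.negSucc k => b^[k + 1] x
  have hN : ∀ n, r (N n) (N (n + 1)) := by
    rintro (k | k)
    · change r (a^[k] x) (a^[k + 1] x)
      rw [Function.iterate_succ_apply']
      exact ha' _ (hA k)
    · have : N (Int.negSucc k + 1) = b^[k] x := by
        rcases k with _ | k
        · rfl
        · rfl
      rw [this]
      change r (b^[k + 1] x) _
      rw [Function.iterate_succ_apply']
      exact hb' _ (hB k)
  refine ⟨fun n => N (n - 1), rfl, fun n => ?_⟩
  have : n + 1 - 1 = n - 1 + 1 := by ring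
  simp only [this]
  exact hN _

/-- Gorenstein projectivity is a coinductive notion: it is the largest class in which every
module has both a totally exact coresolution step and a totally exact resolution step. -/
theorem le_isGProj {W : ObjectProperty (ModuleCat.{u} R)}
    (h₁ : ∀ M, W M → ∃ N, W N ∧ IsTotallyExact M N)
    (h₂ : ∀ M, W M → ∃ N, W N ∧ IsTotallyExact N M) : W ≤ IsGProj R := by
  intro M hM
  obtain ⟨N, hN, h⟩ := exists_int_sequence h₁ h₂ M hM
  choose P i p w hS hP hext using h
  let K : CochainComplex (ModuleCat.{u} R) ℤ := CochainComplex.of P (fun n => p n ≫ i (n + 1))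
    (fun n => by rw [Category.assoc, ← Category.assoc (i _), w, zero_comp, comp_zero])
  have hd : ∀ n, K.d n (n + 1) = p n ≫ i (n + 1) := fun n =>
    CochainComplex.of_d P (fun n => p n ≫ i (n + 1)) n
  refine ⟨K, hP, fun n => ?_, fun Q hQ n f hf => ?_, ?_⟩
  · obtain ⟨n, rfl⟩ : ∃ m, n = m + 1 := ⟨n - 1, by ring⟩
    rw [HomologicalComplex.exactAt_iff' K n (n + 1) (n + 1 + 1) (by simp) (by simp),
      ShortComplex.moduleCat_exact_iff]
    intro x hx
    change K.d (n + 1) (n + 1 + 1) x = 0 at hx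
    change ∃ y : P n, K.d n (n + 1) y = x
    rw [hd] at hx ⊢
    have hx' : p (n + 1) x = 0 :=
      (hS _).moduleCat_injective_f (hx.trans (map_zero (i (n + 1 + 1)).hom).symm)
    obtain ⟨y, hy⟩ := (ShortComplex.moduleCat_exact_iff _).1 (hS (n + 1)).exact x hx'
    obtain ⟨z, hz⟩ := (hS n).moduleCat_surjective_g y
    refine ⟨z, ?_⟩
    rw [← hy, ← hz]
    rfl
  · have := (hS n).epi_g
    have h0 : i n ≫ f = 0 := by
      obtain ⟨n, rfl⟩ : ∃ m, n = m + 1 := ⟨n - 1, by ring⟩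
      rw [add_sub_cancel_right] at hf
      rw [hd, Category.assoc] at hf
      have := (hS n).epi_g
      exact (cancel_epi (p n)).1 (hf.trans comp_zero.symm)
    obtain ⟨g, hg⟩ := CokernelCofork.IsColimit.desc' (hS n).gIsCokernel f h0
    obtain ⟨k, hk⟩ := hext (n + 1) Q hQ g
    refine ⟨k, ?_⟩
    rw [hd, Category.assoc, hk]
    exact hg
  · have hk := K.cyclesIsKernel 1 2 (by simp)
    subst hN
    have : Mono (i 2) := (hS 2).mono_f
    have : Mono (i 1) := (hS 1).mono_f
    have hk' : IsLimit (KernelFork.ofι (f := K.d 1 2) (i 1) (by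
        have := hd 1
        refine (congrArg (i 1 ≫ ·) this).trans ?_
        change i 1 ≫ p 1 ≫ _ = 0
        rw [← Category.assoc, w, zero_comp])) := by
      refine KernelFork.IsLimit.ofι' (X := P 1) (Y := P 2) _ _ fun {Z} k h => ?_
      have e : k ≫ p 1 = 0 := by
        have h' : (k ≫ p 1) ≫ i 2 = 0 := by
          rw [Category.assoc]
          exact (congrArg (k ≫ ·) (hd 1).symm).trans h
        exact (cancel_mono (i 2)).1 (h'.trans zero_comp.symm)
      exact KernelFork.IsLimit.lift' (hS 1).fIsKernel k e
    exact ⟨hk'.conePointUniqueUpToIso hk⟩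

lemma IsGProj.of_iso {M N : ModuleCat.{u} R} (e : M ≅ N) (h : IsGProj R M) : IsGProj R N := by
  obtain ⟨K, h₁, h₂, h₃, ⟨f⟩⟩ := h
  exact ⟨K, h₁, h₂, h₃, ⟨e.symm ≪≫ f⟩⟩

/-- Consecutive cycles of a totally acyclic complex. -/
lemma isTotallyExact_cycles (K : CochainComplex (ModuleCat.{u} R) ℤ)
    (hP : ∀ n, Projective (K.X n)) (hK : K.Acyclic)
    (hQ : ∀ Q : ModuleCat.{u} R, Projective Q → ∀ (n : ℤ) (f : K.X n ⟶ Q), K.d (n - 1) n ≫ f = 0 →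
      ∃ g : K.X (n + 1) ⟶ Q, K.d n (n + 1) ≫ g = f) (n : ℤ) :
    IsTotallyExact (K.cycles n) (K.cycles (n + 1)) := by
  have hepi : ∀ n, Epi (K.toCycles n (n + 1)) := fun n =>
    Preadditive.epi_of_isZero_cokernel' _ (K.homologyIsCokernel n (n + 1) (by simp))
      ((HomologicalComplex.exactAt_iff_isZero_homology _ _).1 (hK (n + 1)))
  have w : K.iCycles n ≫ K.toCycles n (n + 1) = 0 := by
    rw [← cancel_mono (K.iCycles (n + 1)), Category.assoc, HomologicalComplex.toCycles_i,
      HomologicalComplex.iCycles_d, zero_comp]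
  refine ⟨K.X n, K.iCycles n, K.toCycles n (n + 1), w, ?_, hP n, ?_⟩
  · refine ShortComplex.ShortExact.mk' (ShortComplex.exact_of_f_is_kernel _
      (KernelFork.IsLimit.ofι' _ _ fun {Z} k hk => ?_)) (inferInstanceAs (Mono (K.iCycles n)))
      (hepi n)
    change k ≫ K.toCycles n (n + 1) = 0 at hk
    exact ⟨K.liftCycles k (n + 1) (by simp) (by
      rw [← HomologicalComplex.toCycles_i, ← Category.assoc, hk, zero_comp]),
      K.liftCycles_i _ _ _ _⟩
  · intro Q hQ' f
    obtain ⟨n, rfl⟩ : ∃ m, n = m + 1 := ⟨n - 1, by ring⟩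
    have := hepi n
    obtain ⟨g, hg⟩ := hQ Q hQ' n (K.toCycles n (n + 1) ≫ f) (by
      rw [← Category.assoc, HomologicalComplex.d_toCycles, zero_comp])
    refine ⟨g, ?_⟩
    rw [← cancel_epi (K.toCycles n (n + 1)), ← Category.assoc, HomologicalComplex.toCycles_i, hg]

lemma isTotallyExact_of_iso {M M' N N' : ModuleCat.{u} R} (e : M ≅ M') (f : N ≅ N')
    (h : IsTotallyExact M N) : IsTotallyExact M' N' := by
  obtain ⟨P, i, p, w, hS, hP, hext⟩ := h
  refine ⟨P, e.inv ≫ i, p ≫ f.hom, ?_, ?_, hP, fun Q hQ g => ?_⟩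
  · rw [Category.assoc, ← Category.assoc i, w, zero_comp, comp_zero]
  · exact shortExact_of_isos hS e (Iso.refl _) f (by simp) (by simp) _
  · obtain ⟨k, hk⟩ := hext Q hQ (e.hom ≫ g)
    exact ⟨k, by rw [Category.assoc, hk, Iso.inv_hom_id_assoc]⟩

lemma isGProj_cycles (K : CochainComplex (ModuleCat.{u} R) ℤ)
    (hP : ∀ n, Projective (K.X n)) (hK : K.Acyclic)
    (hQ : ∀ Q : ModuleCat.{u} R, Projective Q → ∀ (n : ℤ) (f : K.X n ⟶ Q), K.d (n - 1) n ≫ f = 0 →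
      ∃ g : K.X (n + 1) ⟶ Q, K.d n (n + 1) ≫ g = f) (n : ℤ) : IsGProj R (K.cycles n) := by
  refine le_isGProj (W := fun M => ∃ n : ℤ, M = K.cycles n) ?_ ?_ _ ⟨n, rfl⟩
  · rintro _ ⟨n, rfl⟩
    exact ⟨_, ⟨n + 1, rfl⟩, isTotallyExact_cycles K hP hK hQ n⟩
  · rintro _ ⟨n, rfl⟩
    refine ⟨_, ⟨n - 1, rfl⟩, ?_⟩
    have h := isTotallyExact_cycles K hP hK hQ (n - 1)
    rwa [sub_add_cancel] at h

lemma IsGProj.exists_hull {M : ModuleCat.{u} R} (h : IsGProj R M) :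
    ∃ N, IsGProj R N ∧ IsTotallyExact M N := by
  obtain ⟨K, hP, hK, hQ, ⟨f⟩⟩ := h
  exact ⟨_, isGProj_cycles K hP hK hQ 2,
    isTotallyExact_of_iso f.symm (Iso.refl _) (isTotallyExact_cycles K hP hK hQ 1)⟩

lemma IsGProj.exists_cover {M : ModuleCat.{u} R} (h : IsGProj R M) :
    ∃ N, IsGProj R N ∧ IsTotallyExact N M := by
  obtain ⟨K, hP, hK, hQ, ⟨f⟩⟩ := h
  exact ⟨_, isGProj_cycles K hP hK hQ 0,
    isTotallyExact_of_iso (Iso.refl _) f.symm (isTotallyExact_cycles K hP hK hQ 0)⟩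

lemma IsGProj.ext {M : ModuleCat.{u} R} (h : IsGProj R M) {Q : ModuleCat.{u} R}
    (hQ : Projective Q) (n : ℕ) : Subsingleton (Ext.{u} M Q (n + 1)) := by
  induction n generalizing M with
  | zero =>
    obtain ⟨N, -, P, i, p, w, hS, hP, hext⟩ := h.exists_cover
    exact ext_one_of_extend hS (Ext.subsingleton_of_projective _ _ 0) (hext Q hQ)
  | succ n ih =>
    obtain ⟨N, hN, P, i, p, w, hS, hP, hext⟩ := h.exists_cover
    exact ext_contra_X₃ hS (ih hN) (Ext.subsingleton_of_projective _ _ _)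

/-- The modules obtained from `W` by taking syzygies repeatedly. -/
inductive SyzygyClosure (W : ObjectProperty (ModuleCat.{u} R)) : ModuleCat.{u} R → Prop
  | base (M : ModuleCat.{u} R) : W M → SyzygyClosure W M
  | syzygy (S : ShortComplex (ModuleCat.{u} R)) : S.ShortExact → Projective S.X₂ →
      SyzygyClosure W S.X₃ → SyzygyClosure W S.X₁

/-- A module is Gorenstein projective if it is orthogonal to projective modules and embeds into a
projective module with cokernel of the same kind. -/
theorem le_isGProj_of_ext {W : ObjectProperty (ModuleCat.{u} R)}
    (hext : ∀ M, W M → ∀ Q : ModuleCat.{u} R, Projective Q → ∀ n,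
      Subsingleton (Ext.{u} M Q (n + 1)))
    (hull : ∀ M, W M → ∃ (P N : ModuleCat.{u} R) (i : M ⟶ P) (p : P ⟶ N) (w : i ≫ p = 0),
      (ShortComplex.mk i p w).ShortExact ∧ Projective P ∧ W N) : W ≤ IsGProj R := by
  have key : ∀ M, SyzygyClosure W M → ∀ Q : ModuleCat.{u} R, Projective Q → ∀ n,
      Subsingleton (Ext.{u} M Q (n + 1)) := by
    intro M hM
    induction hM with
    | base M hM => exact hext M hM
    | syzygy S hS hP _ ih =>
      exact fun Q hQ n => ext_contra_X₁ hS (Ext.subsingleton_of_projective _ _ _) (ih Q hQ (n + 1))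
  refine le_trans (fun M hM => SyzygyClosure.base M hM) (le_isGProj (W := SyzygyClosure W) ?_ ?_)
  · intro M hM
    induction hM with
    | base M hM =>
      obtain ⟨P, N, i, p, w, hS, hP, hN⟩ := hull M hM
      exact ⟨N, .base N hN, P, i, p, w, hS, hP, fun Q hQ f =>
        extend_of_ext hS (hext _ hN Q hQ 0) f⟩
    | syzygy S hS hP h _ =>
      exact ⟨S.X₃, h, S.X₂, S.f, S.g, S.zero, hS, hP, fun Q hQ f =>
        extend_of_ext hS (key _ h Q hQ 0) f⟩
  · intro M hM
    obtain ⟨S, hS, rfl, hP⟩ := exists_syzygy M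
    exact ⟨S.X₁, .syzygy S hS hP hM, S.X₂, S.f, S.g, S.zero, hS, hP, fun Q hQ f =>
      extend_of_ext hS (key _ hM Q hQ 0) f⟩

lemma isGProj_of_projective {P : ModuleCat.{u} R} (hP : Projective P) : IsGProj R P := by
  refine le_isGProj_of_ext (W := fun P => Projective P) (fun P hP Q _ n =>
    Ext.subsingleton_of_projective _ _ _) (fun P hP => ?_) _ hP
  exact ⟨P, _, _, _, _, shortExact_id_zero P (isZero_zero _), hP, inferInstance⟩

lemma IsGProj.extension {S : ShortComplex (ModuleCat.{u} R)} (hS : S.ShortExact)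
    (h₁ : IsGProj R S.X₁) (h₃ : IsGProj R S.X₃) : IsGProj R S.X₂ := by
  refine le_isGProj_of_ext (W := fun M => ∃ S : ShortComplex (ModuleCat.{u} R), S.ShortExact ∧
    IsGProj R S.X₁ ∧ IsGProj R S.X₃ ∧ S.X₂ = M) ?_ ?_ _ ⟨S, hS, h₁, h₃, rfl⟩
  · rintro _ ⟨S, hS, h₁, h₃, rfl⟩ Q hQ n
    exact ext_contra_X₂ hS (h₁.ext hQ n) (h₃.ext hQ n)
  · rintro _ ⟨S, hS, h₁, h₃, rfl⟩
    obtain ⟨N₁, hN₁, P₁, i₁, p₁, w₁, hS₁, hP₁, -⟩ := h₁.exists_hull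
    obtain ⟨N₃, hN₃, P₃, i₃, p₃, w₃, hS₃, hP₃, -⟩ := h₃.exists_hull
    obtain ⟨g, hg⟩ := extend_of_ext hS (h₃.ext hP₁ 0) i₁
    obtain ⟨Z, j, q, w, a, b, w', hT, hT'⟩ := exists_horseshoe hS hS₁ hS₃ g hg
    exact ⟨_, Z, j, q, w, hT, inferInstance, _, hT', hN₁, hN₃, rfl⟩

/-- Direct summands of Gorenstein projective modules are Gorenstein projective. The modules with a
Gorenstein projective complement satisfy the coinductive characterization `le_isGProj_of_ext`: the
cokernel `C` of `M ⟶ P` has the complement `M`, since `C ⊞ M` is an extension of Gorenstein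
projective modules. -/
lemma IsGProj.of_biprod {M N : ModuleCat.{u} R} (h : IsGProj R (M ⊞ N)) : IsGProj R M := by
  refine le_isGProj_of_ext (W := fun M => ∃ N, IsGProj R (M ⊞ N)) ?_ ?_ _ ⟨N, h⟩
  · rintro M ⟨N, h⟩ Q hQ n
    exact ext_retract_left ⟨biprod.inl, biprod.fst, by simp⟩ (h.ext hQ n)
  · rintro M ⟨N, h⟩
    obtain ⟨G, hG, P, i, p, w, hS, hP, -⟩ := h.exists_hull
    have := hS.mono_f
    have : Mono i := this
    obtain ⟨a, b, w', hT⟩ := shortExact_cokernel_comp (biprod.inl : M ⟶ M ⊞ N) i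
    let e₁ : cokernel (biprod.inl : M ⟶ M ⊞ N) ≅ N := (colimit.isColimit _).coconePointUniqueUpToIso
      (ShortComplex.Splitting.ofHasBinaryBiproduct M N).shortExact.gIsCokernel
    let e₃ : cokernel i ≅ G := (colimit.isColimit _).coconePointUniqueUpToIso hS.gIsCokernel
    have : Mono (biprod.inl ≫ i : M ⟶ P) := mono_comp _ _
    refine ⟨P, _, biprod.inl ≫ i, cokernel.π _, cokernel.condition _, shortExact_cokernel _, hP, M, ?_⟩
    -- adding `M` to the cokernel turns it into an extension of `G` by `N ⊞ M`
    have hB := (ShortComplex.Splitting.ofHasBinaryBiproduct (cokernel (biprod.inl ≫ i : M ⟶ P))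
      M).shortExact
    let U : ShortComplex (ModuleCat.{u} R) :=
      ShortComplex.mk (biprod.map a (𝟙 M)) (biprod.fst ≫ b) (by ext; all_goals simp [w'])
    have hU : U.ShortExact := by
      let φ : ShortComplex.mk a b w' ⟶ U :=
        { τ₁ := biprod.inl, τ₂ := biprod.inl, τ₃ := 𝟙 _ }
      have := hT.mono_f
      have := hT.epi_g
      have : Mono a := hT.mono_f
      have : Epi b := hT.epi_g
      refine ShortComplex.ShortExact.mk' (ShortComplex.exact_of_f_is_kernel _
        (KernelFork.IsLimit.ofι' _ _ fun {Z} k hk => ?_))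
        (inferInstanceAs (Mono (biprod.map a (𝟙 M)))) (epi_comp (biprod.fst) b)
      have hk' : (k ≫ biprod.fst) ≫ b = 0 := by rw [Category.assoc]; exact hk
      obtain ⟨l, hl⟩ := KernelFork.IsLimit.lift' hT.fIsKernel (k ≫ biprod.fst) hk'
      have hl' : l ≫ a = k ≫ biprod.fst := hl
      exact ⟨biprod.lift l (k ≫ biprod.snd), biprod.hom_ext _ _ (by simp [U, hl']) (by simp [U])⟩
    refine IsGProj.extension hU (IsGProj.of_iso ?_ h) (hG.of_iso e₃.symm)
    exact biprod.braiding _ _ ≪≫ biprod.mapIso e₁.symm (Iso.refl _)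

lemma IsGProj.of_retract {M N : ModuleCat.{u} R} (r : Retract M N) (h : IsGProj R N) :
    IsGProj R M := by
  have : IsSplitMono r.i := ⟨⟨r.r, r.retract⟩⟩
  have hS := shortExact_cokernel r.i
  let s := ShortComplex.Splitting.ofExactOfRetraction _ hS.exact r.r r.retract hS.epi_g
  exact IsGProj.of_biprod (h.of_iso s.isoBinaryBiproduct)

variable (R) in
theorem frobClass_isGProj : FrobClass (IsGProj R) where
  zero X hX := isGProj_of_projective hX.projective
  ext S hS h₁ h₃ := IsGProj.extension hS h₁ h₃
  retract r h := h.of_retract r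
  cover X hX := by
    obtain ⟨N, hN, P, i, p, w, hS, hP, -⟩ := hX.exists_cover
    exact ⟨N, P, i, p, w, hS, hP, isGProj_of_projective hP, hN⟩
  hull X hX := by
    obtain ⟨N, hN, P, i, p, w, hS, hP, -⟩ := hX.exists_hull
    exact ⟨P, N, i, p, w, hS, hP, isGProj_of_projective hP, hN⟩
  extend S hS h₃ Q _ hQ f := extend_of_ext hS (h₃.ext hQ 0) f

lemma IsGProj.ext_of_hasProjectiveDimensionLE {M : ModuleCat.{u} R} (h : IsGProj R M) (d : ℕ) :
    ∀ (L : ModuleCat.{u} R), HasProjectiveDimensionLE L d → ∀ n,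
      Subsingleton (Ext.{u} M L (n + 1)) := by
  induction d with
  | zero =>
    intro L hL n
    exact h.ext ((projective_iff_hasProjectiveDimensionLE_zero L).2 hL) n
  | succ d ih =>
    intro L hL n
    obtain ⟨S, hS, rfl, hP⟩ := exists_syzygy L
    exact ext_co_X₃ hS (h.ext hP n)
      (ih _ ((hS.hasProjectiveDimensionLT_X₃_iff d hP).1 hL) (n + 1))

/-- Gorenstein projective modules of finite projective dimension are projective. -/
lemma IsGProj.projective {M : ModuleCat.{u} R} (h : IsGProj R M) {d : ℕ}
    (hd : HasProjectiveDimensionLE M d) : Projective M := by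
  obtain ⟨S, hS, rfl, hP⟩ := exists_syzygy M
  have hd' : HasProjectiveDimensionLE S.X₁ d := by
    have : HasProjectiveDimensionLT S.X₃ (d + 1 + 1) := hasProjectiveDimensionLT_of_ge _ (d + 1) _ (by omega)
    exact (hS.hasProjectiveDimensionLT_X₃_iff d hP).1 this
  obtain ⟨s, hs⟩ := lift_of_ext hS (h.ext_of_hasProjectiveDimensionLE d _ hd' 0) (𝟙 _)
  exact projective_of_retract ⟨s, S.g, hs⟩ hP

/-- Closure of a class of modules under restriction of scalars along automorphisms of the ring. -/
def IsTwistClosed (P : ObjectProperty (ModuleCat.{u} R)) : Prop :=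
  ∀ (τ : R ≃+* R) (M : ModuleCat.{u} R), P M →
    P ((ModuleCat.restrictScalars.{u} (τ : R →+* R)).obj M)

lemma shortExact_restrictScalars {S : Type u} [Ring S] (f : R →+* S)
    {T : ShortComplex (ModuleCat.{u} S)} (hT : T.ShortExact) :
    (T.map (ModuleCat.restrictScalars.{u} f)).ShortExact :=
  have := hT.mono_f
  have := hT.epi_g
  { exact := by
      have h := hT.exact
      rw [ShortComplex.ShortExact.moduleCat_exact_iff_function_exact] at h ⊢
      exact h
    mono_f := (ModuleCat.mono_iff_injective _).2 hT.moduleCat_injective_f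
    epi_g := (ModuleCat.epi_iff_surjective _).2 hT.moduleCat_surjective_g }

lemma isTwistClosed_projective : IsTwistClosed (R := R) (fun P => Projective P) := fun τ M hM =>
  ((ModuleCat.restrictScalarsEquivalenceOfRingEquiv τ).map_projective_iff M).2 hM

lemma isTwistClosed_isGProj : IsTwistClosed (IsGProj R) := by
  intro τ M hM
  let F := ModuleCat.restrictScalarsEquivalenceOfRingEquiv.{u} τ
  refine le_isGProj_of_ext (W := fun N => ∃ M, IsGProj R M ∧
    N = (ModuleCat.restrictScalars.{u} (τ : R →+* R)).obj M) ?_ ?_ _ ⟨M, hM, rfl⟩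
  · rintro _ ⟨M, hM, rfl⟩ Q hQ n
    have h : Subsingleton (Ext.{u} M (F.inverse.obj Q) (n + 1)) :=
      hM.ext (F.symm.map_projective_iff Q |>.2 hQ) n
    have : F.functor.PreservesZeroMorphisms :=
      inferInstanceAs (ModuleCat.restrictScalars.{u} (τ : R →+* R)).PreservesZeroMorphisms
    exact (ext_adjunction F.toAdjunction (fun S hS => shortExact_restrictScalars _ hS)
      (fun P hP => isTwistClosed_projective τ P hP) Q n M).2 h
  · rintro _ ⟨M, hM, rfl⟩
    obtain ⟨N, hN, P, i, p, w, hS, hP, -⟩ := hM.exists_hull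
    exact ⟨_, _, _, _, _, shortExact_restrictScalars _ hS, isTwistClosed_projective τ P hP, N, hN, rfl⟩

lemma isTwistClosed_finite : IsTwistClosed (R := R) (fun P => Module.Finite R P) := by
  intro τ M hM
  obtain ⟨s, hs⟩ := hM.fg_top
  refine ⟨⟨s, ?_⟩⟩
  rw [eq_top_iff]
  rintro x -
  change M at x
  have hx : x ∈ Submodule.span R (s : Set M) := hs ▸ Submodule.mem_top
  induction hx using Submodule.span_induction with
  | mem x h => exact Submodule.subset_span h
  | zero => exact Submodule.zero_mem _
  | add x y _ _ h h' => exact Submodule.add_mem _ h h'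
  | smul a x _ h =>
    have := Submodule.smul_mem _ (τ.symm a) h
    have e : (τ.symm a • (show (ModuleCat.restrictScalars.{u} (τ : R →+* R)).obj M from x)) =
        a • x := by
      change τ (τ.symm a) • x = a • x
      rw [τ.apply_symm_apply]
    exact e ▸ this

lemma isTwistClosed_isFGProj : IsTwistClosed (IsFGProj R) := fun τ M hM =>
  ⟨isTwistClosed_projective τ M hM.1, isTwistClosed_finite τ M hM.2⟩

lemma finite_of_shortExact {S : ShortComplex (ModuleCat.{u} R)} (hS : S.ShortExact)
    (h₁ : Module.Finite R S.X₁) (h₃ : Module.Finite R S.X₃) : Module.Finite R S.X₂ :=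
  Module.Finite.of_exact (f := S.f.hom) (g := S.g.hom)
    ((ShortComplex.ShortExact.moduleCat_exact_iff_function_exact _).1 hS.exact)
    hS.moduleCat_surjective_g

lemma finite_of_retract {M N : ModuleCat.{u} R} (r : Retract M N) (h : Module.Finite R N) :
    Module.Finite R M :=
  Module.Finite.of_surjective r.r.hom fun x => ⟨r.i x, congrArg (fun f => f x) r.retract⟩

variable (R) in
theorem frobClass_isFGProj : FrobClass (IsFGProj R) where
  zero X hX := ⟨hX.projective, by
    have := ModuleCat.subsingleton_of_isZero hX
    infer_instance⟩
  ext S hS h₁ h₃ := by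
    refine ⟨?_, finite_of_shortExact hS h₁.2 h₃.2⟩
    have := h₃.1
    have := h₁.1
    rw [projective_iff_subsingleton_ext_one]
    exact fun {Y} => ext_contra_X₂ hS (Ext.subsingleton_of_projective _ _ _)
      (Ext.subsingleton_of_projective _ _ _)
  retract r h := ⟨projective_of_retract r h.1, finite_of_retract r h.2⟩
  cover X hX := ⟨_, X, _, _, _, shortExact_zero_id X (isZero_zero _), hX.1, hX, inferInstance,
    have := ModuleCat.subsingleton_of_isZero (isZero_zero (ModuleCat.{u} R))
    inferInstance⟩
  hull X hX := ⟨X, _, _, _, _, shortExact_id_zero X (isZero_zero _), hX.1, hX, inferInstance,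
    have := ModuleCat.subsingleton_of_isZero (isZero_zero (ModuleCat.{u} R))
    inferInstance⟩
  extend S hS h₃ Q _ _ f := by
    have := h₃.1
    exact extend_of_ext hS (Ext.subsingleton_of_projective _ _ 0) f

end GProj

/-! ### The abelian category of module factorizations -/

namespace ModFac

variable {A : Type u} [Ring A] {ι : Type} [LinearOrder ι]
variable {ω : ι → A} {σ : ι → A ≃+* A} {ξ : ι → ι → Aˣ}

lemma comp_app_apply {X Y Z : ModFac ω σ ξ} (f : X ⟶ Y) (g : Y ⟶ Z) (α : ι → Bool) (x : X.X α) :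
    Hom.app (f ≫ g) α x = Hom.app g α (Hom.app f α x) := rfl

lemma hom_ext' {X Y : ModFac ω σ ξ} {f g : X ⟶ Y} (h : ∀ α x, Hom.app f α x = Hom.app g α x) :
    f = g := hom_ext fun α => ModuleCat.hom_ext (LinearMap.ext (h α))

lemma app_apply_eq {X Y : ModFac ω σ ξ} {f g : X ⟶ Y} (h : f = g) (α : ι → Bool) (x : X.X α) :
    Hom.app f α x = Hom.app g α x := by rw [h]

/-- Sub-module factorizations: families of submodules stable under all structure maps. -/
structure SubFac (X : ModFac ω σ ξ) where
  N : ∀ α, Submodule A (X.X α)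
  d_mem : ∀ (i : ι) (α β : ι → Bool) (h : IsEdge i α β) (x : X.X α), x ∈ N α → X.d i α β h x ∈ N β
  e_mem : ∀ (i : ι) (α β : ι → Bool) (h : IsEdge i α β) (x : X.X β), x ∈ N β → X.e i α β h x ∈ N α

namespace SubFac

variable {X : ModFac ω σ ξ} (N : X.SubFac)

/-- The module factorization given by a sub-module factorization. -/
def toModFac : ModFac ω σ ξ where
  X α := ModuleCat.of A (N.N α)
  d i α β h := ModuleCat.ofHom ((X.d i α β h).hom.restrict (N.d_mem i α β h))
  e i α β h :=
    { toFun := fun x => ⟨X.e i α β h x.1, N.e_mem i α β h x.1 x.2⟩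
      map_add' := fun x y => Subtype.ext (map_add (X.e i α β h) x.1 y.1)
      map_smul' := fun a x => Subtype.ext (map_smulₛₗ (X.e i α β h) a x.1) }
  e_d i α β h x := Subtype.ext (X.e_d i α β h x.1)
  d_e i α β h x := Subtype.ext (X.d_e i α β h x.1)
  d_d _ _ _ _ _ _ h₁ h₂ h₃ h₄ hij x := Subtype.ext (X.d_d _ _ _ _ _ _ h₁ h₂ h₃ h₄ hij x.1)
  d_e_comm _ _ _ _ _ _ h₁ h₂ h₃ h₄ hij x :=
    Subtype.ext (X.d_e_comm _ _ _ _ _ _ h₁ h₂ h₃ h₄ hij x.1)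
  e_e _ _ _ _ _ _ h₁ h₂ h₃ h₄ hij x := Subtype.ext (X.e_e _ _ _ _ _ _ h₁ h₂ h₃ h₄ hij x.1)

/-- The inclusion of a sub-module factorization. -/
def incl : N.toModFac ⟶ X where
  app α := ModuleCat.ofHom (N.N α).subtype
  app_d _ _ _ _ _ := rfl
  app_e _ _ _ _ _ := rfl

/-- The quotient by a sub-module factorization. -/
def quot : ModFac ω σ ξ where
  X α := ModuleCat.of A (X.X α ⧸ N.N α)
  d i α β h := ModuleCat.ofHom (Submodule.mapQ _ _ (X.d i α β h).hom (N.d_mem i α β h))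
  e i α β h := Submodule.mapQ _ _ (X.e i α β h) (N.e_mem i α β h)
  e_d i α β h x := by
    obtain ⟨x, rfl⟩ := Submodule.mkQ_surjective _ x
    exact congrArg (N.N α).mkQ (X.e_d i α β h x)
  d_e i α β h x := by
    obtain ⟨x, rfl⟩ := Submodule.mkQ_surjective _ x
    exact congrArg (N.N β).mkQ (X.d_e i α β h x)
  d_d i j α β γ δ h₁ h₂ h₃ h₄ hij x := by
    obtain ⟨x, rfl⟩ := Submodule.mkQ_surjective _ x
    exact congrArg (N.N δ).mkQ (X.d_d i j α β γ δ h₁ h₂ h₃ h₄ hij x)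
  d_e_comm i j α β γ δ h₁ h₂ h₃ h₄ hij x := by
    obtain ⟨x, rfl⟩ := Submodule.mkQ_surjective _ x
    exact congrArg (N.N γ).mkQ (X.d_e_comm i j α β γ δ h₁ h₂ h₃ h₄ hij x)
  e_e i j α β γ δ h₁ h₂ h₃ h₄ hij x := by
    obtain ⟨x, rfl⟩ := Submodule.mkQ_surjective _ x
    exact congrArg (N.N α).mkQ (X.e_e i j α β γ δ h₁ h₂ h₃ h₄ hij x)

/-- The projection to the quotient by a sub-module factorization. -/
def proj : X ⟶ N.quot where
  app α := ModuleCat.ofHom (N.N α).mkQ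
  app_d _ _ _ _ _ := rfl
  app_e _ _ _ _ _ := rfl

lemma incl_injective (α : ι → Bool) : Function.Injective (Hom.app N.incl α) :=
  Subtype.val_injective

lemma proj_surjective (α : ι → Bool) : Function.Surjective (Hom.app N.proj α) :=
  Submodule.mkQ_surjective _

lemma incl_mem {α : ι → Bool} (x : N.toModFac.X α) : Hom.app N.incl α x ∈ N.N α := x.2

lemma exists_incl {α : ι → Bool} {x : X.X α} (h : x ∈ N.N α) :
    ∃ y : N.toModFac.X α, Hom.app N.incl α y = x := ⟨⟨x, h⟩, rfl⟩

lemma proj_eq_zero_iff {α : ι → Bool} (x : X.X α) : Hom.app N.proj α x = 0 ↔ x ∈ N.N α :=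
  Submodule.Quotient.mk_eq_zero _

end SubFac

/-- Factorization through a componentwise injective morphism. -/
lemma exists_lift {X Y Z : ModFac ω σ ξ} {f : X ⟶ Y}
    (hf : ∀ α, Function.Injective (Hom.app f α)) (k : Z ⟶ Y)
    (h : ∀ α z, ∃ x, Hom.app f α x = Hom.app k α z) : ∃ l : Z ⟶ X, l ≫ f = k := by
  choose l hl using h
  refine ⟨⟨fun α => ModuleCat.ofHom ⟨⟨l α, fun x y => hf α ?_⟩, fun a x => hf α ?_⟩,
    fun i α β h x => hf β ?_, fun i α β h x => hf α ?_⟩, hom_ext' fun α x => hl α x⟩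
  · rw [hl, map_add, map_add, hl, hl]
  · change Hom.app f α (l α (a • x)) = Hom.app f α (a • l α x)
    rw [hl, map_smul, map_smul, hl]
  · change Hom.app f β (X.d i α β h (l α x)) = Hom.app f β (l β _)
    rw [hl, ← f.app_d, hl, k.app_d]
  · change Hom.app f α (X.e i α β h (l β x)) = Hom.app f α (l α _)
    rw [hl, ← f.app_e, hl, k.app_e]

/-- Factorization through a componentwise surjective morphism. -/
lemma exists_desc {X Y Z : ModFac ω σ ξ} {f : X ⟶ Y}
    (hf : ∀ α, Function.Surjective (Hom.app f α)) (k : X ⟶ Z)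
    (h : ∀ α x, Hom.app f α x = 0 → Hom.app k α x = 0) : ∃ l : Y ⟶ Z, f ≫ l = k := by
  choose s hs using hf
  have hk : ∀ α x y, Hom.app f α x = Hom.app f α y → Hom.app k α x = Hom.app k α y := by
    intro α x y hxy
    rw [← sub_eq_zero, ← map_sub]
    exact h _ _ (by rw [map_sub, hxy, sub_self])
  refine ⟨⟨fun α => ModuleCat.ofHom ⟨⟨fun y => Hom.app k α (s α y), fun x y => ?_⟩, fun a x => ?_⟩,
    fun i α β h x => ?_, fun i α β h x => ?_⟩, hom_ext' fun α x => hk _ _ _ (hs α _)⟩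
  · rw [← map_add]
    exact hk _ _ _ (by rw [hs, map_add, hs, hs])
  · change Hom.app k α (s α (a • x)) = a • Hom.app k α (s α x)
    rw [← map_smul]
    exact hk _ _ _ (by rw [hs, map_smul, hs])
  · change Z.d i α β h (Hom.app k α (s α x)) = Hom.app k β (s β _)
    rw [k.app_d]
    exact hk _ _ _ (by rw [hs, ← f.app_d, hs])
  · change Z.e i α β h (Hom.app k β (s β x)) = Hom.app k α (s α _)
    rw [k.app_e]
    exact hk _ _ _ (by rw [hs, ← f.app_e, hs])

/-- The componentwise kernel of a morphism. -/
def ker {X Y : ModFac ω σ ξ} (f : X ⟶ Y) : X.SubFac where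
  N α := LinearMap.ker (Hom.app f α).hom
  d_mem i α β h x hx := by
    rw [LinearMap.mem_ker] at hx ⊢
    refine (f.app_d i α β h x).symm.trans ?_
    exact (congrArg _ hx).trans (map_zero (Y.d i α β h).hom)
  e_mem i α β h x hx := by
    rw [LinearMap.mem_ker] at hx ⊢
    refine (f.app_e i α β h x).symm.trans ?_
    exact (congrArg _ hx).trans (map_zero (Y.e i α β h))

/-- The componentwise range of a morphism. -/
def range {X Y : ModFac ω σ ξ} (f : X ⟶ Y) : Y.SubFac where
  N α := LinearMap.range (Hom.app f α).hom
  d_mem i α β h := by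
    rintro _ ⟨x, rfl⟩
    exact ⟨X.d i α β h x, (f.app_d i α β h x).symm⟩
  e_mem i α β h := by
    rintro _ ⟨x, rfl⟩
    exact ⟨X.e i α β h x, (f.app_e i α β h x).symm⟩

lemma mono_iff_injective {X Y : ModFac ω σ ξ} (f : X ⟶ Y) :
    Mono f ↔ ∀ α, Function.Injective (Hom.app f α) := by
  constructor
  · intro _ α
    rw [injective_iff_map_eq_zero]
    intro x hx
    have h0 : (ker f).incl = 0 := (cancel_mono f).1
      ((hom_ext' (f := (ker f).incl ≫ f) (g := 0) fun α x => x.2).trans zero_comp.symm)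
    exact app_apply_eq h0 α ⟨x, hx⟩
  · intro h
    exact ⟨fun g k hgk => hom_ext' fun α x => h α (app_apply_eq hgk α x)⟩

lemma epi_iff_surjective {X Y : ModFac ω σ ξ} (f : X ⟶ Y) :
    Epi f ↔ ∀ α, Function.Surjective (Hom.app f α) := by
  constructor
  · intro _ α y
    have h0 : (range f).proj = 0 := (cancel_epi f).1
      ((hom_ext' (f := f ≫ (range f).proj) (g := 0) fun α x =>
        ((range f).proj_eq_zero_iff _).2 ⟨x, rfl⟩).trans comp_zero.symm)
    exact ((range f).proj_eq_zero_iff y).1 (app_apply_eq h0 α y)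
  · intro h
    refine ⟨fun g k hgk => hom_ext' fun α y => ?_⟩
    obtain ⟨x, rfl⟩ := h α y
    exact app_apply_eq hgk α x

/-- A componentwise injective morphism whose ranges are the kernels of `g` is a kernel of `g`. -/
noncomputable def isLimitKernelFork {X Y Z : ModFac ω σ ξ} {f : X ⟶ Y} {g : Y ⟶ Z} (w : f ≫ g = 0)
    (hf : ∀ α, Function.Injective (Hom.app f α))
    (h : ∀ α y, Hom.app g α y = 0 → ∃ x, Hom.app f α x = y) :
    IsLimit (KernelFork.ofι f w) :=
  have := (mono_iff_injective f).2 hf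
  KernelFork.IsLimit.ofι' f w fun k hk =>
    ⟨(exists_lift hf k fun α z => h α _ (app_apply_eq hk α z)).choose,
      (exists_lift hf k fun α z => h α _ (app_apply_eq hk α z)).choose_spec⟩

/-- A componentwise surjective morphism whose kernels are the ranges of `f` is a cokernel of `f`. -/
noncomputable def isColimitCokernelCofork {X Y Z : ModFac ω σ ξ} {f : X ⟶ Y} {g : Y ⟶ Z}
    (w : f ≫ g = 0) (hg : ∀ α, Function.Surjective (Hom.app g α))
    (h : ∀ α y, Hom.app g α y = 0 → ∃ x, Hom.app f α x = y) :
    IsColimit (CokernelCofork.ofπ g w) :=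
  have := (epi_iff_surjective g).2 hg
  have key : ∀ {W : ModFac ω σ ξ} (k : Y ⟶ W), f ≫ k = 0 →
      ∀ α y, Hom.app g α y = 0 → Hom.app k α y = 0 := fun k hk α y hy => by
    obtain ⟨x, rfl⟩ := h α y hy
    exact app_apply_eq hk α x
  CokernelCofork.IsColimit.ofπ' g w fun k hk =>
    ⟨(exists_desc hg k (key k hk)).choose, (exists_desc hg k (key k hk)).choose_spec⟩

/-- Componentwise products of module factorizations. -/
def pi {J : Type} (X : J → ModFac ω σ ξ) : ModFac ω σ ξ where
  X α := ModuleCat.of A (∀ j, (X j).X α)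
  d i α β h := ModuleCat.ofHom (LinearMap.pi fun j => (((X j).d i α β h).hom.comp (LinearMap.proj j)))
  e i α β h :=
    { toFun := fun x j => (X j).e i α β h (x j)
      map_add' := fun _ _ => funext fun j => map_add ((X j).e i α β h) _ _
      map_smul' := fun a _ => funext fun j => map_smulₛₗ ((X j).e i α β h) a _ }
  e_d i α β h x := funext fun j => (X j).e_d i α β h (x j)
  d_e i α β h x := funext fun j => (X j).d_e i α β h (x j)
  d_d _ _ _ _ _ _ h₁ h₂ h₃ h₄ hij x := funext fun j => (X j).d_d _ _ _ _ _ _ h₁ h₂ h₃ h₄ hij (x j)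
  d_e_comm _ _ _ _ _ _ h₁ h₂ h₃ h₄ hij x := funext fun j =>
    (X j).d_e_comm _ _ _ _ _ _ h₁ h₂ h₃ h₄ hij (x j)
  e_e _ _ _ _ _ _ h₁ h₂ h₃ h₄ hij x := funext fun j => (X j).e_e _ _ _ _ _ _ h₁ h₂ h₃ h₄ hij (x j)

/-- The projections from a componentwise product. -/
def piProj {J : Type} (X : J → ModFac ω σ ξ) (j : J) : pi X ⟶ X j where
  app _ := ModuleCat.ofHom (LinearMap.proj j)
  app_d _ _ _ _ _ := rfl
  app_e _ _ _ _ _ := rfl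

/-- Morphisms to a componentwise product. -/
def piLift {J : Type} (X : J → ModFac ω σ ξ) {Z : ModFac ω σ ξ} (f : ∀ j, Z ⟶ X j) : Z ⟶ pi X where
  app α := ModuleCat.ofHom (LinearMap.pi fun j => (Hom.app (f j) α).hom)
  app_d i α β h x := funext fun j => (f j).app_d i α β h x
  app_e i α β h x := funext fun j => (f j).app_e i α β h x

instance {J : Type} (X : J → ModFac ω σ ξ) : HasProduct X :=
  ⟨⟨⟨Fan.mk (pi X) (piProj X), Fan.IsLimit.mk _ (fun s => piLift X s.proj) (fun _ _ => rfl)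
    (fun _ _ h => hom_ext' fun α x => funext fun j => app_apply_eq (h j) α x)⟩⟩⟩

instance : HasFiniteProducts (ModFac ω σ ξ) :=
  ⟨fun _ => ⟨fun _ => hasLimit_of_iso Discrete.natIsoFunctor.symm⟩⟩

instance : HasKernels (ModFac ω σ ξ) :=
  ⟨fun {_ _} f => ⟨⟨⟨_, isLimitKernelFork (f := (ker f).incl)
    (hom_ext' (f := (ker f).incl ≫ f) (g := 0) fun _ x => x.2)
    (ker f).incl_injective fun _ _ hy => (ker f).exists_incl hy⟩⟩⟩⟩

instance : HasCokernels (ModFac ω σ ξ) :=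
  ⟨fun {_ _} f => ⟨⟨⟨_, isColimitCokernelCofork (g := (range f).proj)
    (hom_ext' fun _ x => ((range f).proj_eq_zero_iff _).2 ⟨x, rfl⟩)
    (range f).proj_surjective fun _ y hy => ((range f).proj_eq_zero_iff y).1 hy⟩⟩⟩⟩

noncomputable instance : Abelian (ModFac ω σ ξ) where
  normalMonoOfMono f _ := ⟨⟨_, (range f).proj,
    hom_ext' fun _ x => ((range f).proj_eq_zero_iff _).2 ⟨x, rfl⟩,
    isLimitKernelFork _ ((mono_iff_injective f).1 inferInstance)
      fun _ y hy => ((range f).proj_eq_zero_iff y).1 hy⟩⟩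
  normalEpiOfEpi f _ := ⟨⟨_, (ker f).incl, hom_ext' fun _ x => x.2,
    isColimitCokernelCofork _ ((epi_iff_surjective f).1 inferInstance)
      fun _ _ hy => (ker f).exists_incl hy⟩⟩

lemma shortExact_iff (S : ShortComplex (ModFac ω σ ξ)) : S.ShortExact ↔
    (∀ α, Function.Injective (Hom.app S.f α)) ∧ (∀ α, Function.Surjective (Hom.app S.g α)) ∧
      ∀ α y, Hom.app S.g α y = 0 → ∃ x, Hom.app S.f α x = y := by
  constructor
  · intro h
    have := h.mono_f
    have := h.epi_g
    refine ⟨(mono_iff_injective _).1 ‹_›, (epi_iff_surjective _).1 ‹_›, fun α y hy => ?_⟩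
    obtain ⟨l, hl⟩ := KernelFork.IsLimit.lift' h.fIsKernel (ker S.g).incl (hom_ext' fun _ x => x.2)
    exact ⟨Hom.app l α ⟨y, hy⟩, app_apply_eq hl α ⟨y, hy⟩⟩
  · rintro ⟨h₁, h₂, h₃⟩
    have := (mono_iff_injective _).2 h₁
    have := (epi_iff_surjective _).2 h₂
    exact ShortComplex.ShortExact.mk'
      (ShortComplex.exact_of_f_is_kernel _ (isLimitKernelFork S.zero h₁ h₃)) ‹_› ‹_›

/-- Evaluation at a vertex of the cube. -/
@[simps]
def ev (α : ι → Bool) : ModFac ω σ ξ ⥤ ModuleCat.{u} A where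
  obj X := X.X α
  map f := Hom.app f α

instance (α : ι → Bool) : (ev (ω := ω) (σ := σ) (ξ := ξ) α).Additive where
  map_add := rfl

lemma shortExact_mk_iff {X Y Z : ModuleCat.{u} A} (f : X ⟶ Y) (g : Y ⟶ Z) (w : f ≫ g = 0) :
    (ShortComplex.mk f g w).ShortExact ↔ Function.Injective f ∧ Function.Surjective g ∧
      ∀ y, g y = 0 → ∃ x, f x = y := by
  constructor
  · intro h
    exact ⟨h.moduleCat_injective_f, h.moduleCat_surjective_g,
      (ShortComplex.moduleCat_exact_iff _).1 h.exact⟩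
  · rintro ⟨h₁, h₂, h₃⟩
    exact ShortComplex.ShortExact.mk' ((ShortComplex.moduleCat_exact_iff _).2 h₃)
      ((ModuleCat.mono_iff_injective _).2 h₁) ((ModuleCat.epi_iff_surjective _).2 h₂)

lemma shortExact_iff_ev (S : ShortComplex (ModFac ω σ ξ)) :
    S.ShortExact ↔ ∀ α, (S.map (ev α)).ShortExact := by
  rw [shortExact_iff]
  constructor
  · rintro ⟨h₁, h₂, h₃⟩ α
    exact (shortExact_mk_iff _ _ _).2 ⟨h₁ α, h₂ α, h₃ α⟩
  · intro h
    have h' := fun α => (shortExact_mk_iff _ _ _).1 (h α)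
    exact ⟨fun α => (h' α).1, fun α => (h' α).2.1, fun α => (h' α).2.2⟩

lemma conflations_eq (Q : ObjectProperty (ModFac ω σ ξ)) :
    conflations Q = ExactCat.shortExactIn Q := by
  ext S
  exact (shortExact_iff_ev (S.map Q.ι)).symm

end ModFac

/-! ### Shifts of module factorizations -/

namespace ModFac

variable {A : Type u} [Ring A] {ι : Type} [LinearOrder ι]

/-- The relations between elements `ω i`, automorphisms `σ i` and units `ξ i j` on which the
theory of module factorizations rests, for an arbitrary linearly ordered index set. -/
class TypeData (ω : ι → A) (σ : ι → A ≃+* A) (ξ : ι → ι → Aˣ) : Prop where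
  comm : ∀ i j, i < j → ∀ a : A, σ i (σ j a) = (ξ i j : A) * σ j (σ i a) * ((ξ i j)⁻¹ : Aˣ)
  coherent : ∀ i j k, i < j → j < k →
    (ξ i j : A) * σ j (ξ i k : A) * (ξ j k : A) = σ i (ξ j k : A) * (ξ i k : A) * σ k (ξ i j : A)
  mul_eq : ∀ i, ∀ a : A, ω i * a = σ i a * ω i
  fix : ∀ i, σ i (ω i) = ω i
  left : ∀ i j, i < j → σ i (ω j) = (ξ i j : A) * ω j
  right : ∀ i j, i < j → σ j (ω i) = ((ξ i j)⁻¹ : Aˣ) * ω i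

lemma TypeData.of_isFacType {n : ℕ} {ω : Fin n → A} {σ : Fin n → A ≃+* A} {ξ : Fin n → Fin n → Aˣ}
    (h : IsFacType σ ξ) (h' : IsOfFacType ω σ ξ) : TypeData ω σ ξ where
  comm := h.comm
  coherent := h.coherent
  mul_eq := h'.mul_eq
  fix := h'.fix
  left := h'.left
  right := h'.right

variable (ω : ι → A) (σ : ι → A ≃+* A) (ξ : ι → ι → Aˣ)

lemma TypeData.restrict [h : TypeData ω σ ξ] (i : ι) :
    TypeData (ι := {j : ι // j ≠ i}) (fun j => ω j) (fun j => σ j) (fun j k => ξ j k) where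
  comm _ _ hij := h.comm _ _ hij
  coherent _ _ _ hij hjk := h.coherent _ _ _ hij hjk
  mul_eq _ := h.mul_eq _
  fix _ := h.fix _
  left _ _ hij := h.left _ _ hij
  right _ _ hij := h.right _ _ hij

/-- The unit `w j` with `σ i (ω j) = w j * ω j`. -/
def unitOf (i j : ι) : Aˣ := if i < j then ξ i j else (ξ j i)⁻¹

section unitOf

variable [h : TypeData ω σ ξ] {i : ι}

include h

lemma sigma_omega {j : ι} (hj : j ≠ i) : σ i (ω j) = unitOf ξ i j * ω j := by
  unfold unitOf
  split_ifs with hij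
  · exact h.left i j hij
  · exact h.right j i (lt_of_le_of_ne (not_lt.1 hij) hj)

lemma unitOf_mul {j : ι} (hj : j ≠ i) (a : A) :
    unitOf ξ i j * σ j (σ i a) = σ i (σ j a) * unitOf ξ i j := by
  unfold unitOf
  split_ifs with hij
  · rw [h.comm i j hij, mul_assoc, Units.inv_mul, mul_one]
  · have hji := lt_of_le_of_ne (not_lt.1 hij) hj
    rw [h.comm j i hji, ← mul_assoc, ← mul_assoc, Units.inv_mul, one_mul]

lemma unitOf_coherent {j k : ι} (hj : j ≠ i) (hk : k ≠ i) (hjk : j < k) :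
    σ i (ξ j k : A) * unitOf ξ i k * σ k (unitOf ξ i j : A) =
      unitOf ξ i j * σ j (unitOf ξ i k : A) * ξ j k := by
  have key : ∀ (l : ι) (u : Aˣ), σ l (u : A) = ((Units.map (σ l : A →* A) u : Aˣ) : A) :=
    fun l u => rfl
  have coh : ∀ i j k, i < j → j < k → ξ i j * Units.map (σ j : A →* A) (ξ i k) * ξ j k =
      Units.map (σ i : A →* A) (ξ j k) * ξ i k * Units.map (σ k : A →* A) (ξ i j) :=
    fun i j k hij hjk => Units.ext (h.coherent i j k hij hjk)
  unfold unitOf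
  simp only [key, ← Units.val_mul]
  congr 1
  rcases lt_or_gt_of_ne hj with hji | hij
  · rcases lt_or_gt_of_ne hk with hki | hik
    · rw [if_neg hji.not_gt, if_neg hki.not_gt, map_inv, map_inv]
      have e := coh j k i hjk hki
      rw [eq_inv_mul_of_mul_eq e.symm]
      group
    · rw [if_neg hji.not_gt, if_pos hik, map_inv]
      have e := coh j i k hji hik
      rw [mul_inv_eq_iff_eq_mul, mul_assoc, mul_assoc, eq_inv_mul_iff_mul_eq, ← mul_assoc, e,
        mul_assoc]
  · rw [if_pos hij, if_pos (hij.trans hjk)]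
    exact (coh i j k hij hjk).symm

end unitOf

/-- The data of a shift in direction `i`: automorphisms `ρ false` and `ρ true` by which the
components are twisted, and units `v j b` by which the maps `e` in direction `j ≠ i` have to be
corrected. -/
@[ext]
structure ShiftData (i : ι) where
  ρ : Bool → A ≃+* A
  v : ι → Bool → Aˣ
  ρ_true : ∀ a, ρ true a = σ i (ρ false a)
  ρ_true' : ∀ a, ρ true a = ρ false (σ i a)
  ρ_ω : ∀ b, ρ b (ω i) = ω i
  v_σ : ∀ j, j ≠ i → ∀ b a, (v j b : A) * σ j (ρ b a) = ρ b (σ j a) * v j b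
  v_ω : ∀ j, j ≠ i → ∀ b, (v j b : A) * ω j = ρ b (ω j)
  v_ξ : ∀ j k, j ≠ i → k ≠ i → j < k → ∀ b,
    ρ b (ξ j k : A) * v k b * σ k (v j b : A) = v j b * σ j (v k b : A) * ξ j k
  lt₁ : ∀ j, i < j → σ i (v j false : A) * ξ i j = v j true
  lt₂ : ∀ j, i < j → ρ false (ξ i j : A) * v j false = v j true
  gt₁ : ∀ j, j < i → (v j true : A) * ξ j i = σ i (v j false : A)
  gt₂ : ∀ j, j < i → ρ false (ξ j i : A) * v j true = v j false

variable {ω σ ξ}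

/-- The shift which twists the components with `α i = true` by `σ i`. -/
def shiftData [h : TypeData ω σ ξ] (i : ι) : ShiftData ω σ ξ i where
  ρ b := match b with
    | true => σ i
    | false => RingEquiv.refl A
  v j b := match b with
    | true => unitOf ξ i j
    | false => 1
  ρ_true _ := rfl
  ρ_true' _ := rfl
  ρ_ω b := match b with
    | true => h.fix i
    | false => rfl
  v_σ j hj b a := match b with
    | true => unitOf_mul ω σ ξ hj a
    | false => by simp
  v_ω j hj b := match b with
    | true => (sigma_omega ω σ ξ hj).symm
    | false => by simp
  v_ξ j k hj hk hjk b := match b with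
    | true => unitOf_coherent ω σ ξ hj hk hjk
    | false => by simp
  lt₁ j hj := by simp [unitOf, hj]
  lt₂ j hj := by simp [unitOf, hj]
  gt₁ j hj := by simp [unitOf, hj.not_gt]
  gt₂ j hj := by simp [unitOf, hj.not_gt]

namespace ShiftData

variable {i : ι} (D : ShiftData ω σ ξ i)

/-- The shift inverse to a given one. -/
def inv : ShiftData ω σ ξ i where
  ρ b := (D.ρ !b).symm
  v j b := Units.map ((D.ρ !b).symm : A →* A) (D.v j !b)⁻¹
  ρ_true a := by
    apply (D.ρ false).injective
    change D.ρ false ((D.ρ false).symm a) = D.ρ false (σ i ((D.ρ true).symm a))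
    rw [← D.ρ_true', RingEquiv.apply_symm_apply, RingEquiv.apply_symm_apply]
  ρ_true' a := by
    apply (D.ρ true).injective
    change D.ρ true ((D.ρ false).symm a) = D.ρ true ((D.ρ true).symm (σ i a))
    rw [D.ρ_true, RingEquiv.apply_symm_apply, RingEquiv.apply_symm_apply]
  ρ_ω b := by
    rw [RingEquiv.symm_apply_eq, D.ρ_ω]
  v_σ j hj b a := by
    apply (D.ρ !b).injective
    have := D.v_σ j hj (!b) ((D.ρ !b).symm a)
    rw [RingEquiv.apply_symm_apply] at this
    simp only [Units.coe_map, MonoidHom.coe_coe, map_mul, RingEquiv.apply_symm_apply]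
    rw [Units.inv_mul_eq_iff_eq_mul, ← mul_assoc, this, mul_assoc, Units.mul_inv, mul_one]
  v_ω j hj b := by
    apply (D.ρ !b).injective
    simp only [Units.coe_map, MonoidHom.coe_coe, map_mul, RingEquiv.apply_symm_apply]
    rw [← D.v_ω j hj, Units.inv_mul_cancel_left]
  v_ξ j k hj hk hjk b := by
    apply (D.ρ !b).injective
    have key : ∀ j, j ≠ i → ∀ a, (D.ρ !b) (σ j ((D.ρ !b).symm a)) =
        D.v j (!b) * σ j a * ((D.v j !b)⁻¹ : Aˣ) := by
      intro j hj a
      have := D.v_σ j hj (!b) ((D.ρ !b).symm a)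
      rw [RingEquiv.apply_symm_apply] at this
      rw [this, mul_assoc, Units.mul_inv, mul_one]
    have e := D.v_ξ j k hj hk hjk (!b)
    simp only [Units.coe_map, MonoidHom.coe_coe, map_mul, RingEquiv.apply_symm_apply]
    rw [key k hk, key j hj]
    have key' : ∀ (l : ι) (u : Aˣ), σ l (u : A) = ((Units.map (σ l : A →* A) u : Aˣ) : A) :=
      fun l u => rfl
    have key'' : ∀ (u : Aˣ), D.ρ (!b) (u : A) =
        ((Units.map (D.ρ (!b) : A →* A) u : Aˣ) : A) := fun u => rfl
    simp only [key', key'', ← Units.val_mul] at e ⊢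
    congr 1
    replace e := Units.ext e
    rw [map_inv, map_inv, eq_mul_inv_of_mul_eq (eq_mul_inv_of_mul_eq e)]
    group
  lt₁ j hj := by
    apply (D.ρ false).injective
    simp only [Units.coe_map, MonoidHom.coe_coe, map_mul, Bool.not_false, Bool.not_true,
      RingEquiv.apply_symm_apply, ← D.ρ_true']
    rw [Units.inv_mul_eq_iff_eq_mul, ← D.lt₂ j hj, mul_assoc, Units.mul_inv, mul_one]
  lt₂ j hj := by
    apply (D.ρ true).injective
    simp only [Units.coe_map, MonoidHom.coe_coe, map_mul, Bool.not_false, Bool.not_true,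
      RingEquiv.apply_symm_apply]
    rw [D.ρ_true, RingEquiv.apply_symm_apply, Units.mul_inv_eq_iff_eq_mul, ← D.lt₁ j hj,
      ← mul_assoc, ← map_mul, Units.inv_mul, map_one, one_mul]
  gt₁ j hj := by
    apply (D.ρ false).injective
    simp only [Units.coe_map, MonoidHom.coe_coe, map_mul, Bool.not_false, Bool.not_true,
      RingEquiv.apply_symm_apply, ← D.ρ_true']
    rw [Units.inv_mul_eq_iff_eq_mul, ← D.gt₂ j hj, mul_assoc, Units.mul_inv, mul_one]
  gt₂ j hj := by
    apply (D.ρ true).injective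
    simp only [Units.coe_map, MonoidHom.coe_coe, map_mul, Bool.not_false, Bool.not_true,
      RingEquiv.apply_symm_apply]
    rw [D.ρ_true, RingEquiv.apply_symm_apply, eq_comm, ← mul_one (((D.v j true)⁻¹ : Aˣ) : A),
      Units.inv_mul_eq_iff_eq_mul, ← mul_assoc, D.gt₁ j hj,
      ← map_mul, Units.mul_inv, map_one]

lemma inv_inv : D.inv.inv = D := by
  have h₁ : ∀ b, D.inv.inv.ρ b = D.ρ b := fun b => by
    change (D.ρ !!b).symm.symm = D.ρ b
    rw [Bool.not_not, RingEquiv.symm_symm]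
  have h₂ : ∀ j b, D.inv.inv.v j b = D.v j b := fun j b => by
    refine Units.ext ?_
    change (D.ρ !!b) ((Units.map ((D.ρ !!b).symm : A →* A) (D.v j !!b)⁻¹)⁻¹ : Aˣ) = D.v j b
    rw [Bool.not_not, ← map_inv, _root_.inv_inv]
    exact (D.ρ b).apply_symm_apply _
  exact ShiftData.ext (funext h₁) (funext fun j => funext (h₂ j))

end ShiftData

end ModFac

/-! ### Vertices of the cube and shifts -/

section Cube

variable {ι : Type} [DecidableEq ι]

/-- The vertex adjacent to `α` in direction `i`. -/
def toggle (i : ι) (α : ι → Bool) : ι → Bool := Function.update α i (!α i)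

@[simp] lemma toggle_self (i : ι) (α : ι → Bool) : toggle i α i = !α i := by simp [toggle]

@[simp] lemma toggle_of_ne {i j : ι} (h : j ≠ i) (α : ι → Bool) : toggle i α j = α j := by
  simp [toggle, h]

@[simp] lemma toggle_toggle (i : ι) (α : ι → Bool) : toggle i (toggle i α) = α := by
  funext j
  by_cases h : j = i
  · subst h; simp
  · simp [h]

lemma IsEdge.toggle_eq {i : ι} {α β : ι → Bool} (h : IsEdge i α β) : toggle i α = β := by
  funext j
  by_cases hj : j = i
  · subst hj; simp [h.1, h.2.1]
  · simp [hj, h.2.2 j hj]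

lemma isEdge_toggle {i : ι} {α : ι → Bool} (h : α i = false) : IsEdge i α (toggle i α) :=
  ⟨h, by simp [h], fun j hj => by simp [hj]⟩

lemma isEdge_toggle' {i : ι} {α : ι → Bool} (h : α i = true) : IsEdge i (toggle i α) α :=
  ⟨by simp [h], h, fun j hj => by simp [hj]⟩

lemma IsEdge.toggle_same {i : ι} {α β : ι → Bool} (h : IsEdge i α β) :
    IsEdge i (toggle i β) (toggle i α) :=
  ⟨by simp [h.2.1], by simp [h.1], fun j hj => by simp [hj, h.2.2 j hj]⟩

lemma IsEdge.toggle_ne {i j : ι} (hij : j ≠ i) {α β : ι → Bool} (h : IsEdge j α β) :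
    IsEdge j (toggle i α) (toggle i β) := by
  refine ⟨by simp [hij, h.1], by simp [hij, h.2.1], fun k hk => ?_⟩
  by_cases hki : k = i
  · subst hki; simp [h.2.2 k hk]
  · simp [hki, h.2.2 k hk]

/-- Every vertex is reached from `α₀` by changing coordinates one at a time. -/
lemma toggle_induction [Finite ι] {motive : (ι → Bool) → Prop} (α₀ : ι → Bool) (base : motive α₀)
    (step : ∀ i α, α i = α₀ i → motive α → motive (toggle i α)) (α : ι → Bool) : motive α := by
  have := Fintype.ofFinite ι
  have key : ∀ s : Finset ι, motive (fun i => if i ∈ s then !α₀ i else α₀ i) := by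
    intro s
    induction s using Finset.induction_on with
    | empty => simpa using base
    | insert i s hi ih =>
      have := step i _ (by simp [hi]) ih
      convert this using 1
      funext j
      by_cases hj : j = i
      · subst hj; simp [hi]
      · simp [hj]
  convert key {i | α i ≠ α₀ i} using 1
  funext i
  by_cases h : α i = α₀ i
  · simp [h]
  · simp [Bool.eq_not_of_ne h]

end Cube

namespace ModFac

variable {A : Type u} [Ring A] {ι : Type} [LinearOrder ι]
variable {ω : ι → A} {σ : ι → A ≃+* A} {ξ : ι → ι → Aˣ}

/-- Transport of elements along an equality of vertices. -/
def cast (X : ModFac ω σ ξ) {α β : ι → Bool} (h : α = β) : X.X α →ₗ[A] X.X β :=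
  h ▸ LinearMap.id

section cast

variable (X : ModFac ω σ ξ)

@[simp] lemma cast_rfl {α : ι → Bool} (x : X.X α) : X.cast rfl x = x := rfl

@[simp] lemma cast_cast {α β γ : ι → Bool} (h : α = β) (h' : β = γ) (x : X.X α) :
    X.cast h' (X.cast h x) = X.cast (h.trans h') x := by
  subst h h'; rfl

lemma cast_d {α β α' β' : ι → Bool} (hα : α = α') (hβ : β = β') {i : ι} (h : IsEdge i α β)
    (h' : IsEdge i α' β') (x : X.X α) :
    X.cast hβ (X.d i α β h x) = X.d i α' β' h' (X.cast hα x) := by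
  subst hα hβ; rfl

lemma cast_e {α β α' β' : ι → Bool} (hα : α = α') (hβ : β = β') {i : ι} (h : IsEdge i α β)
    (h' : IsEdge i α' β') (x : X.X β) :
    X.cast hα (X.e i α β h x) = X.e i α' β' h' (X.cast hβ x) := by
  subst hα hβ; rfl

lemma app_cast {X Y : ModFac ω σ ξ} (f : X ⟶ Y) {α β : ι → Bool} (h : α = β) (x : X.X α) :
    Hom.app f β (X.cast h x) = Y.cast h (Hom.app f α x) := by
  subst h; rfl

lemma cast_injective {α β : ι → Bool} (h : α = β) : Function.Injective (X.cast h) := by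
  subst h; exact fun _ _ h => h

lemma cast_surjective {α β : ι → Bool} (h : α = β) : Function.Surjective (X.cast h) := by
  subst h; exact fun x => ⟨x, rfl⟩

end cast

/-- The module `M`, with the action of `A` twisted by the automorphism `ρ`. -/
def Twist (_ρ : A ≃+* A) (M : Type u) : Type u := M

instance (ρ : A ≃+* A) (M : Type u) [h : AddCommGroup M] : AddCommGroup (Twist ρ M) := h

instance (ρ : A ≃+* A) (M : Type u) [AddCommGroup M] [h : Module A M] : Module A (Twist ρ M) :=
  Module.compHom M (ρ : A →+* A)

namespace ShiftData

variable {i : ι} (D : ShiftData ω σ ξ i)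

/-- The components of the shift of a module factorization. -/
noncomputable def shiftX (X : ModFac ω σ ξ) (α : ι → Bool) : ModuleCat.{u} A :=
  ModuleCat.of A (Twist (D.ρ (α i)) (X.X (toggle i α)))

/-- The identification of the components of a shift with the original components, up to the twist
of the module structure. -/
noncomputable def of (X : ModFac ω σ ξ) (α : ι → Bool) : X.X (toggle i α) ≃+ D.shiftX X α :=
  AddEquiv.refl (X.X (toggle i α))

lemma smul_of (X : ModFac ω σ ξ) {α : ι → Bool} (a : A) (x : X.X (toggle i α)) :
    a • D.of X α x = D.of X α (D.ρ (α i) a • x) := rfl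

lemma d_smul (X : ModFac ω σ ξ) {j : ι} {α β : ι → Bool} (h : IsEdge j α β) (a : A) (x : X.X α) :
    X.d j α β h (a • x) = a • X.d j α β h x := map_smul (X.d j α β h).hom a x

lemma e_smul (X : ModFac ω σ ξ) {j : ι} {α β : ι → Bool} (h : IsEdge j α β) (a : A) (x : X.X β) :
    X.e j α β h (a • x) = σ j a • X.e j α β h x := map_smulₛₗ (X.e j α β h) a x

/-- The map `d` of a shift. -/
noncomputable def shiftD (X : ModFac ω σ ξ) (j : ι) (α β : ι → Bool) (h : IsEdge j α β) :
    D.shiftX X α →ₗ[A] D.shiftX X β :=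
  if hj : j = i then
    { toFun := fun x => D.of X β
        (X.e j _ _ (by subst hj; exact h.toggle_same) ((D.of X α).symm x))
      map_add' := fun x y => by simp only [map_add]
      map_smul' := fun a x => by
        subst hj
        obtain ⟨x, rfl⟩ := (D.of X α).surjective x
        rw [smul_of, AddEquiv.symm_apply_apply, AddEquiv.symm_apply_apply, e_smul, RingHom.id_apply,
          smul_of, h.1, h.2.1, D.ρ_true] }
  else
    { toFun := fun x => D.of X β (X.d j _ _ (h.toggle_ne hj) ((D.of X α).symm x))
      map_add' := fun x y => by simp only [map_add]
      map_smul' := fun a x => by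
        obtain ⟨x, rfl⟩ := (D.of X α).surjective x
        rw [smul_of, AddEquiv.symm_apply_apply, AddEquiv.symm_apply_apply, d_smul, RingHom.id_apply,
          smul_of, h.2.2 i (Ne.symm hj)] }

/-- The map `e` of a shift. -/
noncomputable def shiftE (X : ModFac ω σ ξ) (j : ι) (α β : ι → Bool) (h : IsEdge j α β) :
    D.shiftX X β →ₛₗ[((σ j : A ≃+* A) : A →+* A)] D.shiftX X α :=
  if hj : j = i then
    { toFun := fun x => D.of X α
        (X.d j _ _ (by subst hj; exact h.toggle_same) ((D.of X β).symm x))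
      map_add' := fun x y => by simp only [map_add]
      map_smul' := fun a x => by
        subst hj
        obtain ⟨x, rfl⟩ := (D.of X β).surjective x
        rw [smul_of, AddEquiv.symm_apply_apply, AddEquiv.symm_apply_apply, d_smul, smul_of, h.1,
          h.2.1, D.ρ_true']
        rfl }
  else
    { toFun := fun x => D.of X α
        ((D.v j (α i) : A) • X.e j _ _ (h.toggle_ne hj) ((D.of X β).symm x))
      map_add' := fun x y => by simp only [map_add, smul_add]
      map_smul' := fun a x => by
        obtain ⟨x, rfl⟩ := (D.of X β).surjective x
        rw [smul_of, AddEquiv.symm_apply_apply, AddEquiv.symm_apply_apply, e_smul, smul_of,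
          ← h.2.2 i (Ne.symm hj), smul_smul, smul_smul, D.v_σ j hj]
        rfl }

lemma shiftD_same (X : ModFac ω σ ξ) {α β : ι → Bool} (h : IsEdge i α β) (x : X.X (toggle i α)) :
    D.shiftD X i α β h (D.of X α x) = D.of X β (X.e i _ _ h.toggle_same x) := by
  unfold shiftD; rw [dif_pos rfl]; rfl

lemma shiftD_ne (X : ModFac ω σ ξ) {j : ι} (hj : j ≠ i) {α β : ι → Bool} (h : IsEdge j α β)
    (x : X.X (toggle i α)) :
    D.shiftD X j α β h (D.of X α x) = D.of X β (X.d j _ _ (h.toggle_ne hj) x) := by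
  unfold shiftD; rw [dif_neg hj]; rfl

lemma shiftE_same (X : ModFac ω σ ξ) {α β : ι → Bool} (h : IsEdge i α β) (x : X.X (toggle i β)) :
    D.shiftE X i α β h (D.of X β x) = D.of X α (X.d i _ _ h.toggle_same x) := by
  unfold shiftE; rw [dif_pos rfl]; rfl

lemma shiftE_ne (X : ModFac ω σ ξ) {j : ι} (hj : j ≠ i) {α β : ι → Bool} (h : IsEdge j α β)
    (x : X.X (toggle i β)) : D.shiftE X j α β h (D.of X β x) =
      D.of X α ((D.v j (α i) : A) • X.e j _ _ (h.toggle_ne hj) x) := by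
  unfold shiftE; rw [dif_neg hj]; rfl

/-- The shift of a module factorization: the components are interchanged in direction `i`, and
twisted, and the roles of the maps `d` and `e` in this direction are interchanged. -/
noncomputable abbrev shift (X : ModFac ω σ ξ) : ModFac ω σ ξ where
  X α := D.shiftX X α
  d j α β h := ModuleCat.ofHom (D.shiftD X j α β h)
  e j α β h := D.shiftE X j α β h
  e_d j α β h x := by
    change D.shiftE X j α β h (D.shiftD X j α β h x) = _
    obtain ⟨x, rfl⟩ := (D.of X α).surjective x
    rw [smul_of]
    by_cases hj : j = i
    · subst hj
      rw [shiftD_same, shiftE_same, D.ρ_ω, X.d_e]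
    · rw [D.shiftD_ne X hj, D.shiftE_ne X hj, X.e_d, smul_smul, D.v_ω j hj]
  d_e j α β h x := by
    change D.shiftD X j α β h (D.shiftE X j α β h x) = _
    obtain ⟨x, rfl⟩ := (D.of X β).surjective x
    rw [smul_of]
    by_cases hj : j = i
    · subst hj
      rw [shiftE_same, shiftD_same, D.ρ_ω, X.e_d]
    · rw [D.shiftE_ne X hj, D.shiftD_ne X hj, d_smul, X.d_e, smul_smul, D.v_ω j hj,
        h.2.2 i (Ne.symm hj)]
  d_d j k α β γ δ hαβ hγδ hαγ hβδ hjk x := by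
    change D.shiftD X k β δ hβδ (D.shiftD X j α β hαβ x) =
      D.shiftD X j γ δ hγδ (D.shiftD X k α γ hαγ x)
    obtain ⟨x, rfl⟩ := (D.of X α).surjective x
    by_cases hj : j = i
    · subst hj
      rw [shiftD_same, D.shiftD_ne X hjk.symm, D.shiftD_ne X hjk.symm, shiftD_same]
      exact congrArg _ (X.d_e_comm _ _ _ _ _ _ _ _ _ _ hjk _)
    · by_cases hk : k = i
      · subst hk
        rw [D.shiftD_ne X hj, shiftD_same, shiftD_same, D.shiftD_ne X hj]
        exact congrArg _ (X.d_e_comm _ _ _ _ _ _ _ _ _ _ hjk.symm _).symm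
      · rw [D.shiftD_ne X hj, D.shiftD_ne X hk, D.shiftD_ne X hk, D.shiftD_ne X hj]
        exact congrArg _ (X.d_d _ _ _ _ _ _ _ _ _ _ hjk _)
  d_e_comm j k α β γ δ hαβ hγδ hαγ hβδ hjk x := by
    change D.shiftD X k α γ hαγ (D.shiftE X j α β hαβ x) =
      D.shiftE X j γ δ hγδ (D.shiftD X k β δ hβδ x)
    obtain ⟨x, rfl⟩ := (D.of X β).surjective x
    by_cases hj : j = i
    · subst hj
      rw [shiftE_same, D.shiftD_ne X hjk.symm, D.shiftD_ne X hjk.symm, shiftE_same]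
      exact congrArg _ (X.d_d _ _ _ _ _ _ _ _ _ _ hjk _)
    · by_cases hk : k = i
      · subst hk
        rw [D.shiftE_ne X hj, shiftD_same, shiftD_same, D.shiftE_ne X hj, e_smul, hαγ.1, hαγ.2.1]
        refine congrArg _ ?_
        rcases lt_or_gt_of_ne hj with hlt | hlt
        · rw [← D.gt₁ j hlt, ← smul_smul]
          exact congrArg _ (X.e_e j k _ _ _ _ _ _ _ _ hlt _)
        · rw [← D.lt₁ j hlt, ← smul_smul]
          exact congrArg _ (X.e_e k j _ _ _ _ _ _ _ _ hlt _).symm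
      · rw [D.shiftE_ne X hj, D.shiftD_ne X hk, D.shiftD_ne X hk, D.shiftE_ne X hj, d_smul,
          hαγ.2.2 i (Ne.symm hk)]
        exact congrArg _ (congrArg _ (X.d_e_comm _ _ _ _ _ _ _ _ _ _ hjk _))
  e_e j k α β γ δ hαβ hγδ hαγ hβδ hjk x := by
    obtain ⟨x, rfl⟩ := (D.of X δ).surjective x
    by_cases hj : j = i
    · subst hj
      rw [shiftE_same, D.shiftE_ne X hjk.ne', D.shiftE_ne X hjk.ne', shiftE_same, smul_of, hαβ.1,
        hαβ.2.1, d_smul, ← D.lt₂ k hjk, smul_smul]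
      exact congrArg _ (congrArg _ (X.d_e_comm _ _ _ _ _ _ _ _ _ _ hjk.ne' _).symm)
    · by_cases hk : k = i
      · subst hk
        rw [D.shiftE_ne X hj, shiftE_same, shiftE_same, D.shiftE_ne X hj, smul_of, hαγ.1, hαγ.2.1,
          d_smul, ← D.gt₂ j hjk, smul_smul]
        exact congrArg _ (congrArg _ (X.d_e_comm _ _ _ _ _ _ _ _ _ _ hjk.ne _))
      · rw [D.shiftE_ne X hj, D.shiftE_ne X hk, D.shiftE_ne X hk, D.shiftE_ne X hj, e_smul, e_smul,
          ← hαγ.2.2 i (Ne.symm hk), ← hαβ.2.2 i (Ne.symm hj), smul_of, smul_smul, smul_smul,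
          smul_smul, D.v_ξ j k hj hk hjk, ← smul_smul]
        exact congrArg _ (congrArg _ (X.e_e _ _ _ _ _ _ _ _ _ _ hjk _))

lemma shift_d_same (X : ModFac ω σ ξ) {α β : ι → Bool} (h : IsEdge i α β) (x : X.X (toggle i α)) :
    (D.shift X).d i α β h (D.of X α x) = D.of X β (X.e i _ _ h.toggle_same x) :=
  D.shiftD_same X h x

lemma shift_d_ne (X : ModFac ω σ ξ) {j : ι} (hj : j ≠ i) {α β : ι → Bool} (h : IsEdge j α β)
    (x : X.X (toggle i α)) :
    (D.shift X).d j α β h (D.of X α x) = D.of X β (X.d j _ _ (h.toggle_ne hj) x) :=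
  D.shiftD_ne X hj h x

lemma shift_e_same (X : ModFac ω σ ξ) {α β : ι → Bool} (h : IsEdge i α β) (x : X.X (toggle i β)) :
    (D.shift X).e i α β h (D.of X β x) = D.of X α (X.d i _ _ h.toggle_same x) :=
  D.shiftE_same X h x

lemma shift_e_ne (X : ModFac ω σ ξ) {j : ι} (hj : j ≠ i) {α β : ι → Bool} (h : IsEdge j α β)
    (x : X.X (toggle i β)) : (D.shift X).e j α β h (D.of X β x) =
      D.of X α ((D.v j (α i) : A) • X.e j _ _ (h.toggle_ne hj) x) := D.shiftE_ne X hj h x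

lemma shift_smul (X : ModFac ω σ ξ) {α : ι → Bool} (a : A) (x : X.X (toggle i α)) :
    (show (D.shift X).X α from a • (show (D.shift X).X α from D.of X α x)) =
      D.of X α (D.ρ (α i) a • x) := rfl

lemma app_smul {X Y : ModFac ω σ ξ} (f : X ⟶ Y) (α : ι → Bool) (a : A) (x : X.X α) :
    Hom.app f α (a • x) = a • Hom.app f α x := map_smul (Hom.app f α).hom a x

/-- The shift functor. -/
noncomputable abbrev functor : ModFac ω σ ξ ⥤ ModFac ω σ ξ where
  obj X := D.shift X
  map {X Y} f :=
    { app := fun α => ModuleCat.ofHom (X := D.shiftX X α) (Y := D.shiftX Y α)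
        { toFun := fun x => D.of Y α (Hom.app f (toggle i α) ((D.of X α).symm x))
          map_add' := fun x y => by simp only [map_add]
          map_smul' := fun a x => congrArg (D.of Y α) (app_smul f _ (D.ρ (α i) a) _) }
      app_d := fun j α β h x => by
        obtain ⟨x, rfl⟩ := (D.of X α).surjective x
        change (D.shift Y).d j α β h (D.of Y α (Hom.app f (toggle i α) x)) = D.of Y β
          (Hom.app f (toggle i β) ((D.of X β).symm ((D.shift X).d j α β h (D.of X α x))))
        by_cases hj : j = i
        · subst hj
          rw [shift_d_same, shift_d_same, AddEquiv.symm_apply_apply, f.app_e]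
        · rw [D.shift_d_ne _ hj, D.shift_d_ne _ hj, AddEquiv.symm_apply_apply, f.app_d]
      app_e := fun j α β h x => by
        obtain ⟨x, rfl⟩ := (D.of X β).surjective x
        change (D.shift Y).e j α β h (D.of Y β (Hom.app f (toggle i β) x)) = D.of Y α
          (Hom.app f (toggle i α) ((D.of X α).symm ((D.shift X).e j α β h (D.of X β x))))
        by_cases hj : j = i
        · subst hj
          rw [shift_e_same, shift_e_same, AddEquiv.symm_apply_apply, f.app_d]
        · rw [D.shift_e_ne _ hj, D.shift_e_ne _ hj, AddEquiv.symm_apply_apply, app_smul, f.app_e] }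
  map_id _ := rfl
  map_comp _ _ := rfl

lemma functor_map_app {X Y : ModFac ω σ ξ} (f : X ⟶ Y) (α : ι → Bool) (x : X.X (toggle i α)) :
    Hom.app (D.functor.map f) α (D.of X α x) = D.of Y α (Hom.app f (toggle i α) x) := rfl

instance : D.functor.Additive where
  map_add := rfl

lemma functor_shortExact {S : ShortComplex (ModFac ω σ ξ)} (hS : S.ShortExact) :
    (S.map D.functor).ShortExact := by
  rw [shortExact_iff] at hS ⊢
  exact ⟨fun α => hS.1 (toggle i α), fun α => hS.2.1 (toggle i α), fun α => hS.2.2 (toggle i α)⟩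

lemma shift_cast (X : ModFac ω σ ξ) {α β : ι → Bool} (h : α = β) (x : X.X (toggle i α)) :
    (D.shift X).cast h (D.of X α x) = D.of X β (X.cast (congrArg (toggle i) h) x) := by
  subst h; rfl

/-- The transpose of a morphism from an inverse shift. -/
noncomputable def homTo {X Y : ModFac ω σ ξ} (f : D.inv.functor.obj X ⟶ Y) :
    X ⟶ D.functor.obj Y where
  app α := ModuleCat.ofHom (Y := D.shiftX Y α)
    { toFun := fun x => D.of Y α (Hom.app f (toggle i α)
        (D.inv.of X (toggle i α) (X.cast (toggle_toggle i α).symm x)))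
      map_add' := fun x y => by simp only [map_add]
      map_smul' := fun a x => by
        rw [map_smul]
        refine (congrArg (D.of Y α) ?_ : _ = D.of Y α (D.ρ (α i) a •
          Hom.app f _ (D.inv.of X _ (X.cast (toggle_toggle i α).symm x))))
        rw [← app_smul]
        congr 1
        refine Eq.trans ?_ (D.inv.shift_smul X _ _).symm
        congr 2
        change _ = (D.ρ (!(toggle i α i))).symm (D.ρ (α i) a)
        rw [toggle_self, Bool.not_not, RingEquiv.symm_apply_apply] }
  app_d j α β h x := by
    change (D.shift Y).d j α β h (D.of Y α _) = D.of Y β (Hom.app f (toggle i β)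
      (D.inv.of X (toggle i β) (X.cast (toggle_toggle i β).symm (X.d j α β h x))))
    by_cases hj : j = i
    · subst hj
      rw [shift_d_same, cast_d X (toggle_toggle j α).symm (toggle_toggle j β).symm h
        h.toggle_same.toggle_same, f.app_e]
      exact congrArg _ (congrArg _ (D.inv.shift_e_same X _ _))
    · rw [D.shift_d_ne Y hj, cast_d X (toggle_toggle i α).symm (toggle_toggle i β).symm h
        ((h.toggle_ne hj).toggle_ne hj), f.app_d]
      exact congrArg _ (congrArg _ (D.inv.shift_d_ne X hj _ _))
  app_e j α β h x := by
    change (D.shift Y).e j α β h (D.of Y β _) = D.of Y α (Hom.app f (toggle i α)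
      (D.inv.of X (toggle i α) (X.cast (toggle_toggle i α).symm (X.e j α β h x))))
    by_cases hj : j = i
    · subst hj
      rw [shift_e_same, cast_e X (toggle_toggle j α).symm (toggle_toggle j β).symm h
        h.toggle_same.toggle_same, f.app_d]
      exact congrArg _ (congrArg _ (D.inv.shift_d_same X _ _))
    · rw [D.shift_e_ne Y hj, cast_e X (toggle_toggle i α).symm (toggle_toggle i β).symm h
        ((h.toggle_ne hj).toggle_ne hj), f.app_e, ← app_smul]
      refine congrArg _ (congrArg _ ?_)
      refine (congrArg _ (D.inv.shift_e_ne X hj _ _)).trans ?_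
      refine (D.inv.shift_smul X _ _).trans (congrArg _ ?_)
      rw [smul_smul]
      refine (congrArg (· • _) ?_).trans (one_smul A _)
      change (D.ρ (!(toggle i α i))).symm (D.v j (α i)) *
        (D.ρ (!(toggle i α i))).symm ((D.v j (!(toggle i α i)))⁻¹ : Aˣ) = 1
      rw [toggle_self, Bool.not_not, ← map_mul, Units.mul_inv, map_one]

/-- The transpose of a morphism to a shift. -/
noncomputable def homFrom {X Y : ModFac ω σ ξ} (g : X ⟶ D.functor.obj Y) :
    D.inv.functor.obj X ⟶ Y where
  app α := ModuleCat.ofHom (X := D.inv.shiftX X α)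
    { toFun := fun x => Y.cast (toggle_toggle i α) ((D.of Y (toggle i α)).symm
        (Hom.app g (toggle i α) ((D.inv.of X α).symm x)))
      map_add' := fun x y => by simp only [map_add]
      map_smul' := fun a x => by
        obtain ⟨x, rfl⟩ := (D.inv.of X α).surjective x
        change Y.cast (toggle_toggle i α) ((D.of Y (toggle i α)).symm
          (Hom.app g (toggle i α) (D.inv.ρ (α i) a • x))) = a • Y.cast (toggle_toggle i α)
            ((D.of Y (toggle i α)).symm (Hom.app g (toggle i α) x))
        rw [← map_smul, app_smul]
        refine congrArg _ ?_
        obtain ⟨y, hy⟩ := (D.of Y (toggle i α)).surjective (Hom.app g (toggle i α) x)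
        rw [← hy, AddEquiv.symm_apply_apply, AddEquiv.symm_apply_eq]
        refine (D.shift_smul Y _ _).trans ?_
        congr 2
        change D.ρ (toggle i α i) ((D.ρ (!(α i))).symm a) = _
        rw [toggle_self, RingEquiv.apply_symm_apply] }
  app_d j α β h x := by
    obtain ⟨x, rfl⟩ := (D.inv.of X α).surjective x
    obtain ⟨y, hy⟩ := (D.of Y (toggle i α)).surjective (Hom.app g (toggle i α) x)
    change Y.d j α β h (Y.cast (toggle_toggle i α) ((D.of Y (toggle i α)).symm
        (Hom.app g (toggle i α) x))) = Y.cast (toggle_toggle i β) ((D.of Y (toggle i β)).symm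
        (Hom.app g (toggle i β) ((D.inv.of X β).symm ((D.inv.shift X).d j α β h
          (D.inv.of X α x)))))
    by_cases hj : j = i
    · subst hj
      rw [shift_d_same, AddEquiv.symm_apply_apply, ← g.app_e, ← hy, AddEquiv.symm_apply_apply,
        ← cast_d Y (toggle_toggle j α) (toggle_toggle j β) h.toggle_same.toggle_same h]
      refine congrArg _ ?_
      rw [AddEquiv.eq_symm_apply]
      exact (D.shift_e_same Y _ _).symm
    · rw [D.inv.shift_d_ne X hj, AddEquiv.symm_apply_apply, ← g.app_d, ← hy,
        AddEquiv.symm_apply_apply, ← cast_d Y (toggle_toggle i α) (toggle_toggle i β)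
          ((h.toggle_ne hj).toggle_ne hj) h]
      refine congrArg _ ?_
      rw [AddEquiv.eq_symm_apply]
      exact (D.shift_d_ne Y hj _ _).symm
  app_e j α β h x := by
    obtain ⟨x, rfl⟩ := (D.inv.of X β).surjective x
    obtain ⟨y, hy⟩ := (D.of Y (toggle i β)).surjective (Hom.app g (toggle i β) x)
    change Y.e j α β h (Y.cast (toggle_toggle i β) ((D.of Y (toggle i β)).symm
        (Hom.app g (toggle i β) x))) = Y.cast (toggle_toggle i α) ((D.of Y (toggle i α)).symm
        (Hom.app g (toggle i α) ((D.inv.of X α).symm ((D.inv.shift X).e j α β h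
          (D.inv.of X β x)))))
    by_cases hj : j = i
    · subst hj
      rw [shift_e_same, AddEquiv.symm_apply_apply, ← g.app_d, ← hy, AddEquiv.symm_apply_apply,
        ← cast_e Y (toggle_toggle j α) (toggle_toggle j β) h.toggle_same.toggle_same h]
      refine congrArg _ ?_
      rw [AddEquiv.eq_symm_apply]
      exact (D.shift_d_same Y _ _).symm
    · rw [D.inv.shift_e_ne X hj, AddEquiv.symm_apply_apply, app_smul, ← g.app_e, ← hy,
        AddEquiv.symm_apply_apply, ← cast_e Y (toggle_toggle i α) (toggle_toggle i β)
          ((h.toggle_ne hj).toggle_ne hj) h]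
      refine congrArg _ ?_
      rw [AddEquiv.eq_symm_apply]
      refine Eq.trans ?_ (congrArg _ (D.shift_e_ne Y hj _ _)).symm
      refine Eq.trans ?_ (D.shift_smul Y _ _).symm
      refine congrArg _ ?_
      rw [smul_smul]
      refine ((congrArg (· • _) ?_).trans (one_smul A _)).symm
      change D.ρ (toggle i α i) ((D.ρ (!(α i))).symm ((D.v j (!(α i)))⁻¹ : Aˣ)) *
        D.v j (toggle i α i) = 1
      rw [toggle_self, RingEquiv.apply_symm_apply, Units.inv_mul]

/-- The adjunction between a shift and its inverse, on morphisms. -/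
noncomputable def homEquiv (X Y : ModFac ω σ ξ) :
    (D.inv.functor.obj X ⟶ Y) ≃ (X ⟶ D.functor.obj Y) where
  toFun := D.homTo
  invFun := D.homFrom
  left_inv f := hom_ext' fun α x => by
    obtain ⟨x, rfl⟩ := (D.inv.of X α).surjective x
    change Y.cast (toggle_toggle i α) (Hom.app f (toggle i (toggle i α))
      (D.inv.of X _ (X.cast (toggle_toggle i (toggle i α)).symm x))) = _
    rw [← app_cast]
    congr 1
    refine (D.inv.shift_cast X _ _).trans ?_
    rw [cast_cast, cast_rfl]
  right_inv g := hom_ext' fun α x => by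
    change D.of Y α (Y.cast (toggle_toggle i (toggle i α)) ((D.of Y (toggle i (toggle i α))).symm
      (Hom.app g (toggle i (toggle i α)) (X.cast (toggle_toggle i α).symm x)))) = _
    obtain ⟨y, hy⟩ := (D.of Y α).surjective (Hom.app g α x)
    rw [app_cast, ← hy]
    have := D.shift_cast Y (toggle_toggle i α).symm y
    refine (congrArg (fun z => D.of Y α (Y.cast _ ((D.of Y _).symm z))) this).trans ?_
    rw [AddEquiv.symm_apply_apply, cast_cast, cast_rfl]

/-- The inverse shift is left adjoint to the shift. -/
noncomputable def adjunction : D.inv.functor ⊣ D.functor :=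
  Adjunction.mkOfHomEquiv
    { homEquiv := D.homEquiv
      homEquiv_naturality_left_symm := by
        intros; rfl
      homEquiv_naturality_right := by
        intros; rfl }

/-- The shift is left adjoint to its inverse. -/
noncomputable def adjunction' : D.functor ⊣ D.inv.functor := by
  have h := D.inv.adjunction
  rwa [D.inv_inv] at h

end ShiftData

end ModFac

/-! ### Constant module factorizations -/

namespace ModFac

variable {A : Type u} [Ring A] {ι : Type} [LinearOrder ι]
variable {ω : ι → A} {σ : ι → A ≃+* A} {ξ : ι → ι → Aˣ}

section Top

open Classical in
/-- The composites of maps `d` along paths from the bottom vertex, compatible because the faces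
commute. They are constructed on the vertices supported in a set of directions, by induction on that
set. -/
lemma exists_fromBot [Finite ι] (X : ModFac ω σ ξ) :
    ∃ φ : ∀ α, X.X (fun _ => false) ⟶ X.X α, φ (fun _ => false) = 𝟙 _ ∧
      ∀ i α β (h : IsEdge i α β), φ α ≫ X.d i α β h = φ β := by
  have := Fintype.ofFinite ι
  have key : ∀ s : Finset ι, ∃ φ : ∀ α, X.X (fun _ => false) ⟶ X.X α,
      φ (fun _ => false) = 𝟙 _ ∧ ∀ i ∈ s, ∀ α β (h : IsEdge i α β), (∀ j ∉ s, α j = false) →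
        φ α ≫ X.d i α β h = φ β := by
    intro s
    induction s using Finset.induction_on with
    | empty =>
      refine ⟨fun α => if h : (fun _ => false) = α then eqToHom (congrArg X.X h) else 0, ?_, ?_⟩
      · simp
      · simp
    | insert i s hi ih =>
      obtain ⟨φ, h₀, hφ⟩ := ih
      let ψ : ∀ α, X.X (fun _ => false) ⟶ X.X α := fun α =>
        if h : α i = true then φ (toggle i α) ≫ X.d i _ _ (isEdge_toggle' h) else φ α
      have ht : ∀ α (h : α i = true), ψ α = φ (toggle i α) ≫ X.d i _ _ (isEdge_toggle' h) :=
        fun α h => dif_pos h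
      have hf : ∀ α, α i = false → ψ α = φ α := fun α h => dif_neg (by simp [h])
      refine ⟨ψ, (hf _ rfl).trans h₀, ?_⟩
      intro j hj α β h hα
      rcases eq_or_ne j i with rfl | hji
      · rw [hf α h.1, ht β h.2.1]
        have : toggle j β = α := by rw [← h.toggle_eq, toggle_toggle]
        subst this
        rfl
      · have hjs : j ∈ s := (Finset.mem_insert.1 hj).resolve_left hji
        rcases hαi : α i with _ | _
        · rw [hf α hαi, hf β ((h.2.2 i hji.symm).symm.trans hαi)]
          refine hφ j hjs α β h fun k hk => ?_
          by_cases hki : k = i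
          · rw [hki, hαi]
          · exact hα k (by simp [hki, hk])
        · have hβi : β i = true := (h.2.2 i hji.symm).symm.trans hαi
          rw [ht α hαi, ht β hβi, ← hφ j hjs _ _ (h.toggle_ne hji) fun k hk => ?_]
          · ext x
            exact X.d_d _ _ _ _ _ _ _ _ _ _ hji.symm _
          · by_cases hki : k = i
            · rw [hki, toggle_self, hαi, Bool.not_true]
            · rw [toggle_of_ne hki, hα k (by simp [hki, hk])]
  obtain ⟨φ, h₀, hφ⟩ := key Finset.univ
  exact ⟨φ, h₀, fun i α β h => hφ i (Finset.mem_univ i) α β h (by simp)⟩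

open Classical in
/-- The composites of maps `d` along paths to the top vertex; see `exists_fromBot`. -/
lemma exists_toTop [Finite ι] (X : ModFac ω σ ξ) :
    ∃ φ : ∀ α, X.X α ⟶ X.X (fun _ => true), φ (fun _ => true) = 𝟙 _ ∧
      ∀ i α β (h : IsEdge i α β), X.d i α β h ≫ φ β = φ α := by
  have := Fintype.ofFinite ι
  have key : ∀ s : Finset ι, ∃ φ : ∀ α, X.X α ⟶ X.X (fun _ => true),
      φ (fun _ => true) = 𝟙 _ ∧ ∀ i ∈ s, ∀ α β (h : IsEdge i α β), (∀ j ∉ s, α j = true) →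
        X.d i α β h ≫ φ β = φ α := by
    intro s
    induction s using Finset.induction_on with
    | empty =>
      refine ⟨fun α => if h : α = (fun _ => true) then eqToHom (congrArg X.X h) else 0, ?_, ?_⟩
      · simp
      · simp
    | insert i s hi ih =>
      obtain ⟨φ, h₀, hφ⟩ := ih
      let ψ : ∀ α, X.X α ⟶ X.X (fun _ => true) := fun α =>
        if h : α i = false then X.d i _ _ (isEdge_toggle h) ≫ φ (toggle i α) else φ α
      have hf : ∀ α (h : α i = false), ψ α = X.d i _ _ (isEdge_toggle h) ≫ φ (toggle i α) :=
        fun α h => dif_pos h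
      have ht : ∀ α, α i = true → ψ α = φ α := fun α h => dif_neg (by simp [h])
      refine ⟨ψ, (ht _ rfl).trans h₀, ?_⟩
      intro j hj α β h hα
      rcases eq_or_ne j i with rfl | hji
      · rw [hf α h.1, ht β h.2.1]
        have := h.toggle_eq
        subst this
        rfl
      · have hjs : j ∈ s := (Finset.mem_insert.1 hj).resolve_left hji
        rcases hαi : α i with _ | _
        · have hβi : β i = false := (h.2.2 i hji.symm).symm.trans hαi
          rw [hf α hαi, hf β hβi, ← hφ j hjs _ _ (h.toggle_ne hji) fun k hk => ?_]
          · ext x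
            exact congrArg (φ _) (X.d_d _ _ _ _ _ _ _ _ _ _ hji _)
          · by_cases hki : k = i
            · rw [hki, toggle_self, hαi, Bool.not_false]
            · rw [toggle_of_ne hki, hα k (by simp [hki, hk])]
        · rw [ht α hαi, ht β ((h.2.2 i hji.symm).symm.trans hαi)]
          refine hφ j hjs α β h fun k hk => ?_
          by_cases hki : k = i
          · rw [hki, hαi]
          · exact hα k (by simp [hki, hk])
  obtain ⟨φ, h₀, hφ⟩ := key Finset.univ
  exact ⟨φ, h₀, fun i α β h => hφ i (Finset.mem_univ i) α β h (by simp)⟩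

variable [Finite ι]

/-- The composites of maps `d` to the last component. -/
noncomputable def toTop (X : ModFac ω σ ξ) (α : ι → Bool) : X.X α ⟶ X.X (fun _ => true) :=
  (exists_toTop X).choose α

lemma toTop_top (X : ModFac ω σ ξ) : X.toTop (fun _ => true) = 𝟙 _ :=
  (exists_toTop X).choose_spec.1

lemma d_toTop (X : ModFac ω σ ξ) {i : ι} {α β : ι → Bool} (h : IsEdge i α β) :
    X.d i α β h ≫ X.toTop β = X.toTop α := (exists_toTop X).choose_spec.2 i α β h

end Top

section Const

variable (ω σ ξ) [h : TypeData ω σ ξ]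

/-- The module factorization with all components equal to `M` whose maps `d` are identities. -/
@[reducible]
def const (M : ModuleCat.{u} A) : ModFac ω σ ξ where
  X _ := M
  d _ _ _ _ := 𝟙 M
  e i _ _ _ :=
    { toFun := fun x => ω i • x
      map_add' := fun x y => smul_add _ x y
      map_smul' := fun a x => by
        change ω i • a • x = σ i a • ω i • x
        rw [smul_smul, smul_smul, h.mul_eq] }
  e_d _ _ _ _ _ := rfl
  d_e _ _ _ _ _ := rfl
  d_d _ _ _ _ _ _ _ _ _ _ _ _ := rfl
  d_e_comm _ _ _ _ _ _ _ _ _ _ _ _ := rfl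
  e_e i j _ _ _ _ _ _ _ _ hij x := by
    change (ξ i j : A) • ω j • ω i • x = ω i • ω j • x
    rw [smul_smul, smul_smul, smul_smul, h.mul_eq i, h.left i j hij, mul_assoc]

/-- The functor `const`. -/
@[reducible]
def constFunctor : ModuleCat.{u} A ⥤ ModFac ω σ ξ where
  obj M := const ω σ ξ M
  map {M N} f :=
    { app := fun _ => f
      app_d := fun _ _ _ _ _ => rfl
      app_e := fun i _ _ _ x => (map_smul f.hom (ω i) x).symm }

variable {ω σ ξ} [Finite ι]

lemma exists_const_hom {M : ModuleCat.{u} A} {X : ModFac ω σ ξ} (f : M ⟶ X.X fun _ => false) :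
    ∃ g : const ω σ ξ M ⟶ X, Hom.app g (fun _ => false) = f := by
  obtain ⟨φ, h₀, hφ⟩ := exists_fromBot X
  have hd : ∀ i α β (h : IsEdge i α β) x, X.d i α β h (φ α x) = φ β x := fun i α β h x =>
    congrArg (fun (g : _ ⟶ X.X β) => g.hom x) (hφ i α β h)
  refine ⟨⟨fun α => f ≫ φ α, fun i α β h x => hd i α β h (f x), fun i α β h x => ?_⟩, ?_⟩
  · change X.e i α β h (φ β (f x)) = φ α (f (ω i • x))
    have h₁ : f (ω i • x) = ω i • f x := map_smul f.hom _ x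
    have h₂ : φ α (ω i • f x) = ω i • φ α (f x) := map_smul (φ α).hom _ _
    rw [← hd i α β h, X.e_d, h₁, h₂]
  · change f ≫ φ _ = f
    rw [h₀, Category.comp_id]

lemma const_hom_ext {M : ModuleCat.{u} A} {X : ModFac ω σ ξ} {f g : const ω σ ξ M ⟶ X}
    (h : Hom.app f (fun _ => false) = Hom.app g (fun _ => false)) : f = g := by
  refine hom_ext fun α => toggle_induction (motive := fun α => Hom.app f α = Hom.app g α)
    (fun _ => false) h (fun i α hα ih => ?_) α
  · ext x
    have hf := f.app_d i α _ (isEdge_toggle hα) x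
    have hg := g.app_d i α _ (isEdge_toggle hα) x
    rw [ih] at hf
    exact hf.symm.trans hg

/-- The morphism to a constant module factorization with a given last component. -/
noncomputable def toConst {M : ModuleCat.{u} A} {X : ModFac ω σ ξ} (f : X.X (fun _ => true) ⟶ M) :
    X ⟶ const ω σ ξ M where
  app α := X.toTop α ≫ f
  app_d i α β h x := by
    have := congrArg (fun (g : X.X α ⟶ _) => f (g.hom x)) (X.d_toTop h)
    exact this.symm
  app_e i α β h x := by
    have := congrArg (fun (g : X.X α ⟶ _) => f (g.hom (X.e i α β h x))) (X.d_toTop h)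
    refine Eq.trans ?_ this
    change ω i • f (X.toTop β x) = f (X.toTop β (X.d i α β h (X.e i α β h x)))
    have h₁ : X.toTop β (ω i • x) = ω i • X.toTop β x := map_smul (X.toTop β).hom _ x
    have h₂ : f (ω i • X.toTop β x) = ω i • f (X.toTop β x) := map_smul f.hom _ _
    rw [X.d_e, h₁, h₂]

lemma toConst_top {M : ModuleCat.{u} A} {X : ModFac ω σ ξ} (f : X.X (fun _ => true) ⟶ M) :
    Hom.app (toConst f) (fun _ => true) = f := by
  change X.toTop _ ≫ f = f
  rw [toTop_top, Category.id_comp]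

lemma hom_const_ext {M : ModuleCat.{u} A} {X : ModFac ω σ ξ} {f g : X ⟶ const ω σ ξ M}
    (h : Hom.app f (fun _ => true) = Hom.app g (fun _ => true)) : f = g := by
  refine hom_ext fun α => toggle_induction (motive := fun α => Hom.app f α = Hom.app g α)
    (fun _ => true) h (fun i α hα ih => ?_) α
  · ext x
    have hf := f.app_d i _ α (isEdge_toggle' hα) x
    have hg := g.app_d i _ α (isEdge_toggle' hα) x
    rw [ih] at hf
    exact hf.trans hg.symm

variable (ω σ ξ) in
/-- The last component is left adjoint to `const`. -/
noncomputable def evTopAdjunction : ev (ω := ω) (σ := σ) (ξ := ξ) (fun _ => true) ⊣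
    constFunctor ω σ ξ :=
  Adjunction.mkOfHomEquiv
    { homEquiv := fun _ _ =>
        { toFun := fun f => toConst f
          invFun := fun g => Hom.app g _
          left_inv := fun f => toConst_top f
          right_inv := fun g => hom_const_ext (toConst_top _) }
      homEquiv_naturality_left_symm := by intros; rfl
      homEquiv_naturality_right := fun f _ => hom_const_ext
        ((toConst_top _).trans (congrArg (· ≫ _) (toConst_top f)).symm) }

lemma projective_const {P : ModuleCat.{u} A} (hP : Projective P) :
    Projective (const ω σ ξ P) := by
  refine ⟨fun {E X} f e he => ?_⟩
  have : Epi (Hom.app e fun _ => false) :=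
    (ModuleCat.epi_iff_surjective _).2 ((epi_iff_surjective e).1 he _)
  obtain ⟨g, hg⟩ := exists_const_hom (X := E)
    (Projective.factorThru (Hom.app f fun _ => false) (Hom.app e fun _ => false))
  refine ⟨g, const_hom_ext ?_⟩
  rw [comp_app, hg]
  exact Projective.factorThru_comp _ _

end Const

namespace ShiftData

variable {i : ι} (D : ShiftData ω σ ξ i)

instance : D.functor.PreservesEpimorphisms :=
  Functor.preservesEpimorphisms_of_adjunction D.adjunction'

lemma projective_shift {U : ModFac ω σ ξ} (h : Projective U) : Projective (D.shift U) :=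
  D.adjunction'.map_projective U h

lemma hasComponents_shift {P : ObjectProperty (ModuleCat.{u} A)} (hP : IsTwistClosed P)
    {X : ModFac ω σ ξ} (hX : HasComponents ω σ ξ P X) : HasComponents ω σ ξ P (D.shift X) :=
  fun α => hP (D.ρ (α i)) _ (hX (toggle i α))

end ShiftData

end ModFac

/-! ### Generators -/

namespace ExactCat

lemma frobClass_projective {C : Type u} [Category.{v} C] [Abelian C] :
    FrobClass (fun X : C => Projective X) where
  zero X hX := hX.projective
  ext S hS h₁ h₃ := by
    obtain ⟨s, hs⟩ := split_of_projective hS h₃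
    let sp := hS.splittingOfProjective
    have := Abelian.hasFiniteBiproducts (C := C)
    exact Projective.of_iso sp.isoBinaryBiproduct.symm inferInstance
  retract r h := projective_of_retract r h
  cover X hX := by
    obtain ⟨Z, hZ⟩ := HasZeroObject.zero (C := C)
    exact ⟨_, _, _, _, _, shortExact_zero_id X hZ, hX, hX, hZ.projective⟩
  hull X hX := by
    obtain ⟨Z, hZ⟩ := HasZeroObject.zero (C := C)
    exact ⟨_, _, _, _, _, shortExact_id_zero X hZ, hX, hX, hZ.projective⟩
  extend S hS h₃ Q _ _ f := by
    let sp := hS.splittingOfProjective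
    exact ⟨sp.r ≫ f, by rw [← Category.assoc, sp.f_r, Category.id_comp]⟩

end ExactCat

namespace ModFac

open ExactCat

variable {A : Type u} [Ring A] {ι : Type} [LinearOrder ι]
variable {ω : ι → A} {σ : ι → A ≃+* A} {ξ : ι → ι → Aˣ} [TypeData ω σ ξ]

attribute [local instance] Abelian.hasFiniteBiproducts

/-- The module factorizations that arise from constant ones, with a projective value in the class
`P`, by shifts and finite direct sums. -/
inductive IsGen (P : ObjectProperty (ModuleCat.{u} A)) : ModFac ω σ ξ → Prop
  | const (M : ModuleCat.{u} A) : Projective M → P M → IsGen P (const ω σ ξ M)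
  | shift {i : ι} (D : ShiftData ω σ ξ i) {U : ModFac ω σ ξ} : IsGen P U → IsGen P (D.shift U)
  | sum {J : Type} [Finite J] (U : J → ModFac ω σ ξ) : (∀ j, IsGen P (U j)) → IsGen P (⨁ U)

namespace IsGen

variable {P : ObjectProperty (ModuleCat.{u} A)} {U : ModFac ω σ ξ}

lemma hasComponents (hU : IsGen P U) {Q : ObjectProperty (ModuleCat.{u} A)} (hPQ : P ≤ Q)
    (hQ : FrobClass Q) (hT : IsTwistClosed Q) : HasComponents ω σ ξ Q U := by
  induction hU with
  | const M h h' => exact fun α => hPQ _ h'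
  | shift D _ ih => exact D.hasComponents_shift hT ih
  | @sum J hJ U _ ih =>
    intro α
    exact hQ.of_iso ((ev (ω := ω) (σ := σ) (ξ := ξ) α).mapBiproduct U).symm
      (hQ.biproduct _ fun j => ih j α)

lemma hasComponents_projective (hU : IsGen P U) : ∀ α, Projective (U.X α) := by
  induction hU with
  | const M h h' => exact fun α => h
  | shift D _ ih => exact D.hasComponents_shift isTwistClosed_projective ih
  | @sum J hJ U _ ih =>
    intro α
    exact frobClass_projective.of_iso ((ev (ω := ω) (σ := σ) (ξ := ξ) α).mapBiproduct U).symm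
      (frobClass_projective.biproduct _ fun j => ih j α)

lemma projective [Finite ι] (hU : IsGen P U) : Projective U := by
  induction hU with
  | const M h h' => exact projective_const h
  | shift D _ ih => exact D.projective_shift ih
  | sum U _ ih => exact frobClass_projective.biproduct _ ih

/-- Relative injectivity of the generators. -/
lemma exists_extend [Finite ι] (hU : IsGen P U) {Q : ObjectProperty (ModuleCat.{u} A)}
    (hPQ : P ≤ Q) (hQ : FrobClass Q) (hT : IsTwistClosed Q) (S : ShortComplex (ModFac ω σ ξ))
    (hS : S.ShortExact) (h : HasComponents ω σ ξ Q S.X₃) (f : S.X₁ ⟶ U) :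
    ∃ g : S.X₂ ⟶ U, S.f ≫ g = f := by
  induction hU generalizing S with
  | const M hM hM' =>
    obtain ⟨g, hg⟩ := hQ.extend _ ((shortExact_iff_ev S).1 hS fun _ => true) (h _) M (hPQ _ hM') hM
      (Hom.app f fun _ => true)
    refine ⟨toConst g, hom_const_ext ?_⟩
    exact (congrArg (Hom.app S.f _ ≫ ·) (toConst_top _)).trans hg
  | @shift i D U _ ih =>
    obtain ⟨g, hg⟩ := ih (S.map D.inv.functor) (D.inv.functor_shortExact hS)
      (D.inv.hasComponents_shift hT h) ((D.adjunction.homEquiv _ _).symm f)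
    refine ⟨D.adjunction.homEquiv _ _ g, ?_⟩
    refine (D.adjunction.homEquiv_naturality_left S.f g).symm.trans ?_
    exact (Equiv.eq_symm_apply _).1 hg
  | @sum J hJ U _ ih =>
    choose g hg using fun j => ih j S hS h (f ≫ biproduct.π U j)
    refine ⟨biproduct.lift g, ?_⟩
    ext j
    simp [hg]

end IsGen

/-- Every homomorphism from the projective module `M` to the component at `γ` of a module
factorization extends to a morphism from one fixed generator `U`. At the bottom vertex, `U` is
constant; the other vertices are reached by shifts, since the component at `γ` of a module
factorization is the one at `toggle i γ` of its shift. The maps of `U` leading away from `γ` are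
surjective. -/
lemma exists_gen_hom [Finite ι] {P : ObjectProperty (ModuleCat.{u} A)} (γ : ι → Bool)
    (M : ModuleCat.{u} A) (hM : Projective M) (hM' : P M) :
    ∃ U : ModFac ω σ ξ, IsGen P U ∧ (∃ u : M ⟶ U.X γ, ∀ (X : ModFac ω σ ξ) (f : M ⟶ X.X γ),
      ∃ g : U ⟶ X, u ≫ Hom.app g γ = f) ∧
      (∀ j, γ j = false → ∀ α β h, Function.Surjective (U.d j α β h)) ∧
      (∀ j, γ j = true → ∀ α β h, Function.Surjective (U.e j α β h)) := by
  refine toggle_induction (motive := fun γ => ∃ U : ModFac ω σ ξ, IsGen P U ∧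
      (∃ u : M ⟶ U.X γ, ∀ (X : ModFac ω σ ξ) (f : M ⟶ X.X γ), ∃ g : U ⟶ X, u ≫ Hom.app g γ = f) ∧
      (∀ j, γ j = false → ∀ α β h, Function.Surjective (U.d j α β h)) ∧
      (∀ j, γ j = true → ∀ α β h, Function.Surjective (U.e j α β h)))
    (fun _ => false) ?_ (fun i γ hγ ih => ?_) γ
  · refine ⟨const ω σ ξ M, .const M hM hM', ⟨𝟙 M, fun X f => ?_⟩, fun j _ α β h x => ⟨x, rfl⟩,
      by simp⟩
    obtain ⟨g, hg⟩ := exists_const_hom f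
    exact ⟨g, (Category.id_comp _).trans hg⟩
  · obtain ⟨U, hU, ⟨u, hu⟩, hd, he⟩ := ih
    let D : ShiftData ω σ ξ i := shiftData i
    refine ⟨D.inv.shift U, .shift _ hU, ⟨ModuleCat.ofHom (Y := D.inv.shiftX U (toggle i γ))
      { toFun := fun x => D.inv.of U (toggle i γ) (U.cast (toggle_toggle i γ).symm (u x))
        map_add' := fun x y => by simp only [map_add]
        map_smul' := fun a x => ?_ }, fun X f => ?_⟩, ?_, ?_⟩
    · have : D.inv.ρ (toggle i γ i) a = a := by rw [toggle_self, hγ]; rfl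
      refine Eq.trans ?_ (D.inv.smul_of U a _).symm
      rw [this, ← map_smul]
      exact congrArg (fun y => D.inv.of U _ (U.cast _ y)) (map_smul u.hom a x)
    · obtain ⟨g, hg⟩ := hu (D.shift X) (ModuleCat.ofHom (Y := D.shiftX X γ)
        { toFun := fun x => D.of X γ (f x)
          map_add' := fun x y => by simp only [map_add]
          map_smul' := fun a x => by
            have : D.ρ (γ i) a = a := by rw [hγ]; rfl
            refine Eq.trans ?_ (D.smul_of X a _).symm
            rw [this]
            exact congrArg (D.of X γ) (map_smul f.hom a x) })
      refine ⟨D.homFrom g, ?_⟩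
      ext x
      change X.cast (toggle_toggle i (toggle i γ)) ((D.of X (toggle i (toggle i γ))).symm
        (Hom.app g _ (U.cast (toggle_toggle i γ).symm (u x)))) = f x
      have h₁ : Hom.app g γ (u x) = D.of X γ (f x) :=
        congrArg (fun (k : M ⟶ (D.shift X).X γ) => k.hom x) hg
      rw [app_cast, h₁]
      refine (congrArg (fun z => X.cast _ ((D.of X _).symm z)) (D.shift_cast X _ _)).trans ?_
      rw [AddEquiv.symm_apply_apply, cast_cast, cast_rfl]
    · intro j hj α β h x
      obtain ⟨x, rfl⟩ := (D.inv.of U β).surjective x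
      by_cases hji : j = i
      · subst hji
        simp [hγ] at hj
      · obtain ⟨y, hy⟩ := hd j (by rwa [toggle_of_ne hji] at hj) _ _ (h.toggle_ne hji) x
        exact ⟨D.inv.of U α y, (D.inv.shift_d_ne U hji h y).trans (congrArg _ hy)⟩
    · intro j hj α β h x
      obtain ⟨x, rfl⟩ := (D.inv.of U α).surjective x
      by_cases hji : j = i
      · subst hji
        obtain ⟨y, hy⟩ := hd j hγ _ _ h.toggle_same x
        exact ⟨D.inv.of U β y, (D.inv.shift_e_same U h y).trans (congrArg _ hy)⟩
      · obtain ⟨y, hy⟩ := he j (by rwa [toggle_of_ne hji] at hj) _ _ (h.toggle_ne hji)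
          (((D.inv.v j (α i))⁻¹ : Aˣ) • x)
        refine ⟨D.inv.of U β y, (D.inv.shift_e_ne U hji h y).trans (congrArg _ ?_)⟩
        rw [hy, Units.smul_def, smul_smul, Units.mul_inv, one_smul]

/-- Homomorphisms `f j` from projective modules to components of a module factorization `X` have
images contained in the image of a morphism from a sum of generators to `X`. -/
lemma exists_gen_epi [Finite ι] {P : ObjectProperty (ModuleCat.{u} A)} (X : ModFac ω σ ξ)
    {J : Type} [Finite J] (v : J → ι → Bool) (M : J → ModuleCat.{u} A)
    (hM : ∀ j, Projective (M j)) (hM' : ∀ j, P (M j)) (f : ∀ j, M j ⟶ X.X (v j)) :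
    ∃ (U : J → ModFac ω σ ξ) (g : ⨁ U ⟶ X), (∀ j, IsGen P (U j)) ∧
      (∀ j x, ∃ y, Hom.app g (v j) y = f j x) ∧
      (∀ j i, v j i = false → ∀ α β h, Function.Surjective ((U j).d i α β h)) := by
  choose U hU u hd _ using fun j => exists_gen_hom (ω := ω) (σ := σ) (ξ := ξ) (P := P) (v j) (M j)
    (hM j) (hM' j)
  choose u hu using u
  choose g hg using fun j => hu j X (f j)
  refine ⟨U, biproduct.desc g, hU, fun j x => ⟨Hom.app (biproduct.ι U j) _ (u j x), ?_⟩, hd⟩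
  rw [← comp_app_apply, biproduct.ι_desc]
  exact congrArg (fun (k : M j ⟶ X.X (v j)) => k.hom x) (hg j)

/-- Every module factorization is a quotient of a generator. -/
lemma exists_gen_cover [Finite ι] {P : ObjectProperty (ModuleCat.{u} A)} (X : ModFac ω σ ξ)
    (h : ∀ α, ∃ (M : ModuleCat.{u} A) (p : M ⟶ X.X α), Projective M ∧ P M ∧ Epi p) :
    ∃ (U : ModFac ω σ ξ) (g : U ⟶ X), IsGen P U ∧ Epi g := by
  choose M p hM hM' hp using h
  obtain ⟨U, g, hU, hg, -⟩ := exists_gen_epi X id M hM hM' p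
  refine ⟨_, g, .sum U hU, (epi_iff_surjective g).2 fun α x => ?_⟩
  obtain ⟨y, rfl⟩ := (ModuleCat.epi_iff_surjective _).1 (hp α) x
  exact hg α y

instance [Finite ι] : EnoughProjectives (ModFac ω σ ξ) where
  presentation X := by
    obtain ⟨U, g, hU, hg⟩ := exists_gen_cover (P := ⊤) X fun α =>
      ⟨Projective.over (X.X α), Projective.π _, inferInstance, trivial, inferInstance⟩
    have := hU.projective
    exact ⟨⟨U, g⟩⟩

noncomputable instance [Finite ι] : HasExt.{u} (ModFac ω σ ξ) :=
  hasExt_of_enoughProjectives _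

/-- The components of a projective module factorization are projective. -/
lemma projective_component [Finite ι] {X : ModFac ω σ ξ} (hX : Projective X) (α : ι → Bool) :
    Projective (X.X α) := by
  obtain ⟨U, g, hU, hg⟩ := exists_gen_cover (P := ⊤) X fun α =>
      ⟨Projective.over (X.X α), Projective.π _, inferInstance, trivial, inferInstance⟩
  have r : Retract X U := ⟨Projective.factorThru (𝟙 X) g, g, Projective.factorThru_comp _ _⟩
  exact projective_of_retract (r.map (ev α)) (hU.hasComponents_projective α)

end ModFac

/-! ### The Frobenius structure on module factorizations -/

namespace ModFac

open ExactCat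

variable {A : Type u} [Ring A] {ι : Type} [LinearOrder ι]
variable {ω : ι → A} {σ : ι → A ≃+* A} {ξ : ι → ι → Aˣ} [TypeData ω σ ξ] [Finite ι]

attribute [local instance] Abelian.hasFiniteBiproducts

lemma ShiftData.ext_shift {i : ι} (D : ShiftData ω σ ξ i) (X Y : ModFac ω σ ξ) (n : ℕ) :
    Subsingleton (Abelian.Ext.{u} (D.inv.shift X) Y (n + 1)) ↔
      Subsingleton (Abelian.Ext.{u} X (D.shift Y) (n + 1)) :=
  ext_adjunction D.adjunction (fun _ hS => D.inv.functor_shortExact hS)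
    (fun _ hP => D.inv.projective_shift hP) Y n X

/-- Every homomorphism to the projective module `M` from the component at `γ` of a module
factorization comes from a morphism to one fixed generator `R`, and the groups `Ext` into `M` and
into `R` vanish simultaneously. The construction is dual to `exists_gen_hom`. -/
lemma exists_gen_cohom {P : ObjectProperty (ModuleCat.{u} A)} (γ : ι → Bool)
    (M : ModuleCat.{u} A) (hM : Projective M) (hM' : P M) :
    ∃ R : ModFac ω σ ξ, IsGen P R ∧ (∃ ε : R.X γ ⟶ M, ∀ (X : ModFac ω σ ξ) (f : X.X γ ⟶ M),
      ∃ g : X ⟶ R, Hom.app g γ ≫ ε = f) ∧ ∀ (X : ModFac ω σ ξ) (n : ℕ),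
        Subsingleton (Abelian.Ext.{u} (X.X γ) M (n + 1)) ↔
          Subsingleton (Abelian.Ext.{u} X R (n + 1)) := by
  refine toggle_induction (motive := fun γ => ∃ R : ModFac ω σ ξ, IsGen P R ∧
      (∃ ε : R.X γ ⟶ M, ∀ (X : ModFac ω σ ξ) (f : X.X γ ⟶ M), ∃ g : X ⟶ R,
        Hom.app g γ ≫ ε = f) ∧ ∀ (X : ModFac ω σ ξ) (n : ℕ),
        Subsingleton (Abelian.Ext.{u} (X.X γ) M (n + 1)) ↔
          Subsingleton (Abelian.Ext.{u} X R (n + 1)))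
    (fun _ => true) ?_ (fun i γ hγ ih => ?_) γ
  · refine ⟨const ω σ ξ M, .const M hM hM', ⟨𝟙 M, fun X f => ⟨toConst f, ?_⟩⟩, fun X n => ?_⟩
    · exact (Category.comp_id _).trans (toConst_top f)
    · exact ext_adjunction (evTopAdjunction ω σ ξ) (fun S hS => (shortExact_iff_ev S).1 hS _)
        (fun X hX => projective_component hX _) M n X
  · obtain ⟨R, hR, ⟨ε, hε⟩, hext⟩ := ih
    let D : ShiftData ω σ ξ i := shiftData i
    have hD : ∀ a, D.inv.ρ (γ i) a = a := by rw [hγ]; exact fun a => rfl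
    have hD' : ∀ a, D.ρ (toggle i γ i) a = a := by rw [toggle_self, hγ]; exact fun a => rfl
    let e : ∀ X : ModFac ω σ ξ, X.X (toggle i γ) ≃ₗ[A] D.inv.shiftX X γ := fun X =>
      { D.inv.of X γ with
        map_smul' := fun a x => by
          refine Eq.trans ?_ (D.inv.smul_of X a x).symm
          rw [hD]
          rfl }
    have he : ∀ X x, e X x = D.inv.of X γ x := fun _ _ => rfl
    refine ⟨D.shift R, .shift _ hR, ⟨ModuleCat.ofHom (X := D.shiftX R (toggle i γ))
      { toFun := fun x => ε (R.cast (toggle_toggle i γ) ((D.of R (toggle i γ)).symm x))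
        map_add' := fun x y => by simp only [map_add]
        map_smul' := fun a x => ?_ }, fun X f => ?_⟩, fun X n => ?_⟩
    · obtain ⟨x, rfl⟩ := (D.of R (toggle i γ)).surjective x
      have h₁ : a • D.of R (toggle i γ) x = D.of R (toggle i γ) (a • x) :=
        (D.smul_of R a x).trans (by rw [hD'])
      refine (congrArg (fun z => ε (R.cast (toggle_toggle i γ) ((D.of R (toggle i γ)).symm z)))
        h₁).trans ?_
      rw [AddEquiv.symm_apply_apply, AddEquiv.symm_apply_apply, map_smul]
      exact map_smul ε.hom a _
    · obtain ⟨g, hg⟩ := hε (D.inv.shift X) (ModuleCat.ofHom (X := D.inv.shiftX X γ)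
        (f.hom ∘ₗ (e X).symm.toLinearMap))
      refine ⟨D.homTo g, ?_⟩
      ext x
      change ε (R.cast (toggle_toggle i γ) ((D.of R (toggle i γ)).symm (D.of R (toggle i γ)
        (Hom.app g (toggle i (toggle i γ)) (D.inv.of X _ (X.cast _ x)))))) = f x
      have h₁ : (D.inv.shift X).cast (toggle_toggle i γ) (D.inv.of X _ (X.cast
          (toggle_toggle i (toggle i γ)).symm x)) = D.inv.of X γ x :=
        (D.inv.shift_cast X _ _).trans (by rw [cast_cast, cast_rfl])
      rw [AddEquiv.symm_apply_apply]
      have h₂ := app_cast g (toggle_toggle i γ) (D.inv.of X _ (X.cast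
          (toggle_toggle i (toggle i γ)).symm x))
      refine (congrArg ε h₂.symm).trans ?_
      refine (congrArg (fun y => ε (Hom.app g γ y)) h₁).trans ?_
      refine (congrArg (fun (k : (D.inv.shift X).X γ ⟶ M) => k.hom (D.inv.of X γ x)) hg).trans ?_
      change f ((e X).symm (e X x)) = f x
      rw [LinearEquiv.symm_apply_apply]
    · have e' : (D.inv.shift X).X γ ≅ X.X (toggle i γ) :=
        (e X).toModuleIso.symm
      refine Iff.trans ?_ ((hext (D.inv.shift X) n).trans (D.ext_shift X R n))
      exact ⟨ext_retract_left e'.retract, ext_retract_left e'.symm.retract⟩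

/-- The module factorizations with components in a Frobenius class of modules form a
Frobenius class. -/
theorem frobClass_hasComponents {P : ObjectProperty (ModuleCat.{u} A)} (hP : FrobClass P)
    (hT : IsTwistClosed P) : FrobClass (HasComponents ω σ ξ P) := by
  have hcov : ∀ X : ModFac ω σ ξ, HasComponents ω σ ξ P X →
      ∃ (U : ModFac ω σ ξ) (g : U ⟶ X), IsGen P U ∧ Epi g := fun X hX =>
    exists_gen_cover X fun α => by
      obtain ⟨K, W, i, p, w, hS, hW, hW', hK⟩ := hP.cover _ (hX α)
      exact ⟨W, p, hW, hW', hS.epi_g⟩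
  refine ⟨fun X hX α => hP.zero _ ((ev α).map_isZero hX), fun S hS h₁ h₃ α =>
    hP.ext _ ((shortExact_iff_ev S).1 hS α) (h₁ α) (h₃ α), fun r h α =>
      hP.retract (r.map (ev α)) (h α), fun X hX => ?_, fun X hX => ?_, ?_⟩
  · obtain ⟨U, g, hU, hg⟩ := hcov X hX
    have hS := shortExact_kernel g
    have hUP := hU.hasComponents le_rfl hP hT
    exact ⟨_, U, _, g, _, hS, hU.projective, hUP, fun α =>
      hP.kernel ((shortExact_iff_ev _).1 hS α) (hUP α) (hX α)⟩
  · choose W Z i p w hS hW hWP hZ using fun α => hP.hull _ (hX α)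
    choose R hR hε _ using fun α => exists_gen_cohom (ω := ω) (σ := σ) (ξ := ξ) (P := P) α (W α)
      (hW α) (hWP α)
    choose ε hε using hε
    choose g hg using fun α => hε α X (i α)
    have hπ : ∀ α, Hom.app (biproduct.lift g) α ≫ Hom.app (biproduct.π R α) α ≫ ε α = i α :=
      fun α => by
        rw [← Category.assoc, ← comp_app, biproduct.lift_π, hg]
    have hmono : Mono (biproduct.lift g) := (mono_iff_injective _).2 fun α x y hxy => by
      have := (hS α).mono_f
      refine (ModuleCat.mono_iff_injective (i α)).1 this ?_
      rw [← hπ α]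
      exact congrArg (fun z => ε α (Hom.app (biproduct.π R α) α z)) hxy
    have hR' : IsGen P (⨁ R) := .sum R hR
    have hRP := hR'.hasComponents le_rfl hP hT
    have hT := shortExact_cokernel (biproduct.lift g)
    refine ⟨_, _, _, _, _, hT, hR'.projective, hRP, fun α => ?_⟩
    have hE := hS α
    have key : (ShortComplex.mk (Hom.app (biproduct.lift g) α ≫ Hom.app (biproduct.π R α) α ≫ ε α)
        (p α) (by rw [hπ, w])).ShortExact := by
      simpa only [hπ] using hE
    exact hP.cokernel_of_comp ((shortExact_iff_ev _).1 hT α) (hRP α) _ key (hZ α)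
  · intro S hS h₃ Q hQ hQ' f
    obtain ⟨U, g, hU, hg⟩ := hcov Q hQ
    obtain ⟨k, hk⟩ := hU.exists_extend le_rfl hP hT S hS h₃
      (f ≫ Projective.factorThru (𝟙 Q) g)
    exact ⟨k ≫ g, by rw [← Category.assoc, hk, Category.assoc, Projective.factorThru_comp,
      Category.comp_id]⟩

end ModFac

/-! ### Facets -/

section Cube

variable {ι : Type} {i : ι}

/-- The coordinates of a vertex in the directions other than `i`. -/
def restVertex (i : ι) (α : ι → Bool) : {j : ι // j ≠ i} → Bool := fun j => α j

@[simp] lemma facetVertex_self (i : ι) (β : {j : ι // j ≠ i} → Bool) :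
    facetVertex i β i = true := by simp [facetVertex]

@[simp] lemma facetVertex_of_ne {j : ι} (h : j ≠ i) (β : {j : ι // j ≠ i} → Bool) :
    facetVertex i β j = β ⟨j, h⟩ := by simp [facetVertex, h]

lemma restVertex_facetVertex (β : {j : ι // j ≠ i} → Bool) :
    restVertex i (facetVertex i β) = β := by
  funext j
  exact facetVertex_of_ne j.2 β

lemma facetVertex_restVertex {α : ι → Bool} (h : α i = true) :
    facetVertex i (restVertex i α) = α := by
  funext j
  by_cases hj : j = i
  · subst hj; simp [h]
  · simp [hj, restVertex]

lemma isEdge_facetVertex {α : ι → Bool} (h : α i = false) :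
    IsEdge i α (facetVertex i (restVertex i α)) :=
  ⟨h, facetVertex_self _ _, fun j hj => by simp [hj, restVertex]⟩

lemma IsEdge.restVertex {j : ι} (hj : j ≠ i) {α β : ι → Bool} (h : IsEdge j α β) :
    IsEdge ⟨j, hj⟩ (restVertex i α) (restVertex i β) :=
  ⟨h.1, h.2.1, fun k hk => h.2.2 k fun hkj => hk (Subtype.ext hkj)⟩

lemma IsEdge.restVertex_eq {α β : ι → Bool} (h : IsEdge i α β) :
    _root_.restVertex i α = _root_.restVertex i β := funext fun k => h.2.2 k k.2

end Cube

namespace ModFac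

open ExactCat

variable {A : Type u} [Ring A] {ι : Type} [LinearOrder ι]
variable {ω : ι → A} {σ : ι → A ≃+* A} {ξ : ι → ι → Aˣ}

section cast

lemma eq_cast_iff (X : ModFac ω σ ξ) {α β : ι → Bool} (h : α = β) (x : X.X α) (y : X.X β) :
    X.cast h x = y ↔ x = X.cast h.symm y := by
  subst h; rfl

lemma facet_cast (i : ι) (X : ModFac ω σ ξ) {α β : {j : ι // j ≠ i} → Bool} (h : α = β)
    (x : X.X (facetVertex i α)) :
    (X.facet i).cast h x = X.cast (congrArg (facetVertex i) h) x := by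
  subst h; rfl

end cast

instance [TypeData ω σ ξ] (i : ι) : TypeData (ι := {j : ι // j ≠ i}) (fun j => ω j) (fun j => σ j)
    (fun j k => ξ j k) := TypeData.restrict ω σ ξ i

/-- The facet functor. -/
noncomputable def facetFunctor (ω : ι → A) (σ : ι → A ≃+* A) (ξ : ι → ι → Aˣ) (i : ι) :
    ModFac ω σ ξ ⥤ ModFac (ι := {j : ι // j ≠ i}) (fun j => ω j) (fun j => σ j)
      (fun j k => ξ j k) where
  obj X := X.facet i
  map f :=
    { app := fun β => Hom.app f (facetVertex i β)
      app_d := fun j _ _ h x => f.app_d j _ _ h.facetVertex x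
      app_e := fun j _ _ h x => f.app_e j _ _ h.facetVertex x }
  map_id _ := rfl
  map_comp _ _ := rfl

instance (i : ι) : (facetFunctor ω σ ξ i).Additive where
  map_add := rfl

lemma facetFunctor_shortExact (i : ι) {S : ShortComplex (ModFac ω σ ξ)} (hS : S.ShortExact) :
    (S.map (facetFunctor ω σ ξ i)).ShortExact := by
  rw [shortExact_iff] at hS ⊢
  exact ⟨fun α => hS.1 _, fun α => hS.2.1 _, fun α => hS.2.2 _⟩

section facetProj

variable (i : ι) (X : ModFac ω σ ξ)

/-- The map from a component to the facet `{α | α i = 1}`. -/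
noncomputable def facetProj (α : ι → Bool) : X.X α →ₗ[A] X.X (facetVertex i (restVertex i α)) :=
  if h : α i = true then X.cast (facetVertex_restVertex h).symm
  else (X.d i _ _ (isEdge_facetVertex (Bool.eq_false_of_not_eq_true h))).hom

variable {i}

lemma facetProj_of_true {α : ι → Bool} (h : α i = true) (x : X.X α) :
    X.facetProj i α x = X.cast (facetVertex_restVertex h).symm x := by
  rw [facetProj, dif_pos h]

lemma facetProj_of_false {α : ι → Bool} (h : α i = false) (x : X.X α) :
    X.facetProj i α x = X.d i _ _ (isEdge_facetVertex h) x := by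
  rw [facetProj, dif_neg (by simp [h])]

lemma facetProj_d_same {α β : ι → Bool} (h : IsEdge i α β) (x : X.X α) :
    X.facetProj i β (X.d i α β h x) =
      X.cast (congrArg (facetVertex i) h.restVertex_eq) (X.facetProj i α x) := by
  rw [X.facetProj_of_true h.2.1, X.facetProj_of_false h.1,
    X.cast_d rfl _ h (h' := h.restVertex_eq ▸ isEdge_facetVertex h.1)]
  rw [X.cast_d rfl _ _ (h' := h.restVertex_eq ▸ isEdge_facetVertex h.1)]

lemma facetProj_e_same {α β : ι → Bool} (h : IsEdge i α β) (x : X.X β) :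
    X.facetProj i α (X.e i α β h x) =
      ω i • X.cast (congrArg (facetVertex i) h.restVertex_eq.symm) (X.facetProj i β x) := by
  have hβ : facetVertex i (restVertex i α) = β := by
    rw [h.restVertex_eq, facetVertex_restVertex h.2.1]
  have h' : X.cast hβ (X.d i _ _ (isEdge_facetVertex h.1) (X.e i α β h x)) = ω i • x := by
    rw [X.cast_d rfl _ _ h, cast_rfl, X.d_e]
  rw [X.facetProj_of_true h.2.1, X.facetProj_of_false h.1, cast_cast, ← map_smul]
  rw [eq_cast_iff] at h'
  exact h'

lemma facetProj_d_ne {j : ι} (hj : j ≠ i) {α β : ι → Bool} (h : IsEdge j α β) (x : X.X α) :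
    X.facetProj i β (X.d j α β h x) =
      X.d j _ _ (h.restVertex hj).facetVertex (X.facetProj i α x) := by
  rcases hα : α i with _ | _
  · rw [X.facetProj_of_false hα, X.facetProj_of_false ((h.2.2 i hj.symm).symm.trans hα)]
    exact X.d_d _ _ _ _ _ _ _ _ _ _ hj _
  · rw [X.facetProj_of_true hα, X.facetProj_of_true ((h.2.2 i hj.symm).symm.trans hα)]
    exact X.cast_d _ _ _ _ _

lemma facetProj_e_ne {j : ι} (hj : j ≠ i) {α β : ι → Bool} (h : IsEdge j α β) (x : X.X β) :
    X.facetProj i α (X.e j α β h x) =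
      X.e j _ _ (h.restVertex hj).facetVertex (X.facetProj i β x) := by
  rcases hα : α i with _ | _
  · rw [X.facetProj_of_false hα, X.facetProj_of_false ((h.2.2 i hj.symm).symm.trans hα)]
    exact X.d_e_comm _ _ _ _ _ _ _ _ _ _ hj _
  · rw [X.facetProj_of_true hα, X.facetProj_of_true ((h.2.2 i hj.symm).symm.trans hα)]
    exact X.cast_e _ _ _ _ _

end facetProj

section coface

variable {i : ι}

/-- The map `d` of `coface`. -/
noncomputable def cofaceD (W : ModFac (ι := {j : ι // j ≠ i}) (fun j => ω j) (fun j => σ j)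
    (fun j k => ξ j k)) (j : ι) (α β : ι → Bool) (h : IsEdge j α β) :
    W.X (restVertex i α) →ₗ[A] W.X (restVertex i β) :=
  if hj : j = i then W.cast (by subst hj; exact h.restVertex_eq)
  else (W.d ⟨j, hj⟩ _ _ (h.restVertex hj)).hom

section

variable (W : ModFac (ι := {j : ι // j ≠ i}) (fun j => ω j) (fun j => σ j) (fun j k => ξ j k))

lemma cofaceD_same {α β : ι → Bool} (h : IsEdge i α β) (x : W.X (restVertex i α)) :
    cofaceD W i α β h x = W.cast h.restVertex_eq x := by
  rw [cofaceD, dif_pos rfl]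

lemma cofaceD_ne {j : ι} (hj : j ≠ i) {α β : ι → Bool} (h : IsEdge j α β)
    (x : W.X (restVertex i α)) :
    cofaceD W j α β h x = W.d ⟨j, hj⟩ _ _ (h.restVertex hj) x := by
  rw [cofaceD, dif_neg hj]

end

variable [htd : TypeData ω σ ξ]

/-- The map `e` of `coface`. -/
noncomputable def cofaceE (W : ModFac (ι := {j : ι // j ≠ i}) (fun j => ω j) (fun j => σ j)
    (fun j k => ξ j k)) (j : ι) (α β : ι → Bool) (h : IsEdge j α β) :
    W.X (restVertex i β) →ₛₗ[((σ j : A ≃+* A) : A →+* A)] W.X (restVertex i α) :=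
  if hj : j = i then
    { toFun := fun x => ω j • W.cast (by subst hj; exact h.restVertex_eq.symm) x
      map_add' := fun x y => by rw [map_add, smul_add]
      map_smul' := fun a x => by
        rw [map_smul, smul_smul, htd.mul_eq, ← smul_smul]
        rfl }
  else W.e ⟨j, hj⟩ _ _ (h.restVertex hj)

section

variable (W : ModFac (ι := {j : ι // j ≠ i}) (fun j => ω j) (fun j => σ j) (fun j k => ξ j k))

lemma cofaceE_same {α β : ι → Bool} (h : IsEdge i α β) (x : W.X (restVertex i β)) :
    cofaceE W i α β h x = ω i • W.cast h.restVertex_eq.symm x := by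
  rw [cofaceE, dif_pos rfl]; rfl

lemma cofaceE_ne {j : ι} (hj : j ≠ i) {α β : ι → Bool} (h : IsEdge j α β)
    (x : W.X (restVertex i β)) :
    cofaceE W j α β h x = W.e ⟨j, hj⟩ _ _ (h.restVertex hj) x := by
  rw [cofaceE, dif_neg hj]

/-- The module factorization which is constant in direction `i`, with a given facet. -/
@[reducible]
noncomputable def coface : ModFac ω σ ξ where
  X α := W.X (restVertex i α)
  d j α β h := ModuleCat.ofHom (cofaceD W j α β h)
  e j α β h := cofaceE W j α β h
  e_d j α β h x := by
    change cofaceE W j α β h (cofaceD W j α β h x) = _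
    by_cases hj : j = i
    · subst hj
      rw [cofaceD_same, cofaceE_same, cast_cast, cast_rfl]
    · rw [cofaceD_ne W hj, cofaceE_ne W hj, W.e_d]
  d_e j α β h x := by
    change cofaceD W j α β h (cofaceE W j α β h x) = _
    by_cases hj : j = i
    · subst hj
      rw [cofaceE_same, cofaceD_same, map_smul, cast_cast, cast_rfl]
    · rw [cofaceE_ne W hj, cofaceD_ne W hj, W.d_e]
  d_d j k α β γ δ hαβ hγδ hαγ hβδ hjk x := by
    change cofaceD W k β δ hβδ (cofaceD W j α β hαβ x) =
      cofaceD W j γ δ hγδ (cofaceD W k α γ hαγ x)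
    by_cases hj : j = i
    · subst hj
      rw [cofaceD_same, cofaceD_same, cofaceD_ne W hjk.symm, cofaceD_ne W hjk.symm]
      exact (W.cast_d _ _ _ _ _).symm
    · by_cases hk : k = i
      · subst hk
        rw [cofaceD_same, cofaceD_same, cofaceD_ne W hj, cofaceD_ne W hj]
        exact W.cast_d _ _ _ _ _
      · rw [cofaceD_ne W hj, cofaceD_ne W hj, cofaceD_ne W hk, cofaceD_ne W hk]
        exact W.d_d _ _ _ _ _ _ _ _ _ _ (fun h => hjk (congrArg Subtype.val h)) _
  d_e_comm j k α β γ δ hαβ hγδ hαγ hβδ hjk x := by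
    change cofaceD W k α γ hαγ (cofaceE W j α β hαβ x) =
      cofaceE W j γ δ hγδ (cofaceD W k β δ hβδ x)
    by_cases hj : j = i
    · subst hj
      rw [cofaceE_same, cofaceE_same, cofaceD_ne W hjk.symm, cofaceD_ne W hjk.symm]
      refine (map_smul _ _ _).trans (congrArg _ ?_)
      exact (W.cast_d _ _ _ _ _).symm
    · by_cases hk : k = i
      · subst hk
        rw [cofaceD_same, cofaceD_same, cofaceE_ne W hj, cofaceE_ne W hj]
        exact W.cast_e _ _ _ _ _
      · rw [cofaceE_ne W hj, cofaceE_ne W hj, cofaceD_ne W hk, cofaceD_ne W hk]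
        exact W.d_e_comm _ _ _ _ _ _ _ _ _ _ (fun h => hjk (congrArg Subtype.val h)) _
  e_e j k α β γ δ hαβ hγδ hαγ hβδ hjk x := by
    by_cases hj : j = i
    · subst hj
      rw [cofaceE_same, cofaceE_same, cofaceE_ne W hjk.ne', cofaceE_ne W hjk.ne',
        W.cast_e _ hγδ.restVertex_eq.symm _ (hαγ.restVertex hjk.ne')]
      refine (congrArg _ (map_smulₛₗ (W.e _ _ _ _) _ _)).trans ?_
      rw [smul_smul]
      congr 1
      change (ξ j k : A) * σ k (ω j) = ω j
      rw [htd.right j k hjk, Units.mul_inv_cancel_left]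
    · by_cases hk : k = i
      · subst hk
        rw [cofaceE_same, cofaceE_same, cofaceE_ne W hj, cofaceE_ne W hj,
          W.cast_e _ hβδ.restVertex_eq.symm _ (hαβ.restVertex hj)]
        refine Eq.trans ?_ (map_smulₛₗ (W.e _ _ _ _) _ _).symm
        rw [smul_smul]
        congr 1
        exact (htd.left j k hjk).symm
      · rw [cofaceE_ne W hj, cofaceE_ne W hj, cofaceE_ne W hk, cofaceE_ne W hk]
        exact W.e_e ⟨j, hj⟩ ⟨k, hk⟩ _ _ _ _ _ _ _ _ hjk _

lemma coface_cast {α β : ι → Bool} (h : α = β) (x : W.X (restVertex i α)) :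
    (coface W).cast h x = W.cast (congrArg (restVertex i) h) x := by
  subst h; rfl

end

variable (ω σ ξ i)

/-- The functor `coface`. -/
@[reducible]
noncomputable def cofaceFunctor : ModFac (ι := {j : ι // j ≠ i}) (fun j => ω j) (fun j => σ j)
    (fun j k => ξ j k) ⥤ ModFac ω σ ξ where
  obj W := coface W
  map {W V} f :=
    { app := fun α => Hom.app f (restVertex i α)
      app_d := fun j α β h x => by
        change cofaceD V j α β h _ = Hom.app f _ (cofaceD W j α β h x)
        by_cases hj : j = i
        · subst hj
          rw [cofaceD_same, cofaceD_same, app_cast]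
        · rw [cofaceD_ne _ hj, cofaceD_ne _ hj, f.app_d]
      app_e := fun j α β h x => by
        change cofaceE V j α β h _ = Hom.app f _ (cofaceE W j α β h x)
        by_cases hj : j = i
        · subst hj
          rw [cofaceE_same, cofaceE_same, ← app_cast]
          exact (map_smul (Hom.app f _).hom _ _).symm
        · rw [cofaceE_ne _ hj, cofaceE_ne _ hj, f.app_e] }

variable {ω σ ξ i}

/-- The transpose of a morphism from a facet. -/
noncomputable def toCoface {X : ModFac ω σ ξ} {W : ModFac (ι := {j : ι // j ≠ i}) (fun j => ω j)
    (fun j => σ j) (fun j k => ξ j k)} (f : X.facet i ⟶ W) : X ⟶ coface W where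
  app α := ModuleCat.ofHom ((Hom.app f (restVertex i α)).hom ∘ₗ X.facetProj i α)
  app_d j α β h x := by
    change cofaceD W j α β h (Hom.app f _ (X.facetProj i α x)) =
      Hom.app f _ (X.facetProj i β (X.d j α β h x))
    by_cases hj : j = i
    · subst hj
      rw [cofaceD_same, facetProj_d_same, ← facet_cast j X h.restVertex_eq]
      exact (app_cast f h.restVertex_eq _).symm
    · rw [cofaceD_ne _ hj, X.facetProj_d_ne hj]
      exact f.app_d _ _ _ (h.restVertex hj) _
  app_e j α β h x := by
    change cofaceE W j α β h (Hom.app f _ (X.facetProj i β x)) =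
      Hom.app f _ (X.facetProj i α (X.e j α β h x))
    by_cases hj : j = i
    · subst hj
      rw [cofaceE_same, facetProj_e_same, ← facet_cast j X h.restVertex_eq.symm]
      refine Eq.trans ?_ (map_smul (Hom.app f _).hom _ _).symm
      exact congrArg _ (app_cast f h.restVertex_eq.symm _).symm
    · rw [cofaceE_ne _ hj, X.facetProj_e_ne hj]
      exact f.app_e _ _ _ (h.restVertex hj) _

/-- The transpose of a morphism to `coface W`. -/
noncomputable def fromCoface {X : ModFac ω σ ξ} {W : ModFac (ι := {j : ι // j ≠ i}) (fun j => ω j)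
    (fun j => σ j) (fun j k => ξ j k)} (g : X ⟶ coface W) : X.facet i ⟶ W where
  app β := ModuleCat.ofHom (W.cast (restVertex_facetVertex β) ∘ₗ (Hom.app g (facetVertex i β)).hom)
  app_d j α β h x := by
    have e := g.app_d j.1 _ _ h.facetVertex x
    have e' := (cofaceD_ne W j.2 h.facetVertex (Hom.app g _ x)).symm.trans e
    change W.d j α β h (W.cast _ (Hom.app g _ x)) = W.cast _ (Hom.app g _ (X.d j.1 _ _ _ x))
    rw [← W.cast_d (restVertex_facetVertex α) (restVertex_facetVertex β)
      (h.facetVertex.restVertex j.2)]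
    exact congrArg _ e'
  app_e j α β h x := by
    have e := g.app_e j.1 _ _ h.facetVertex x
    have e' := (cofaceE_ne W j.2 h.facetVertex (Hom.app g _ x)).symm.trans e
    change W.e j α β h (W.cast _ (Hom.app g _ x)) = W.cast _ (Hom.app g _ (X.e j.1 _ _ _ x))
    rw [← W.cast_e (restVertex_facetVertex α) (restVertex_facetVertex β)
      (h.facetVertex.restVertex j.2)]
    exact congrArg _ e'

variable (ω σ ξ i) in
/-- The facet functor is left adjoint to `coface`. -/
noncomputable def facetAdjunction : facetFunctor ω σ ξ i ⊣ cofaceFunctor ω σ ξ i :=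
  Adjunction.mkOfHomEquiv
    { homEquiv := fun X W =>
        { toFun := fun f => toCoface f
          invFun := fun g => fromCoface g
          left_inv := fun f => hom_ext' fun β x => by
            have e : X.facetProj i _ x = (X.facet i).cast (restVertex_facetVertex β).symm x :=
              (X.facetProj_of_true (facetVertex_self i β) x).trans (facet_cast i X _ x).symm
            refine (congrArg (fun z => W.cast (restVertex_facetVertex β) (Hom.app f _ z)) e).trans
              ((congrArg (W.cast _) (app_cast f _ x)).trans ?_)
            rw [cast_cast, cast_rfl]
            rfl
          right_inv := fun g => hom_ext' fun α x => by
            change W.cast (restVertex_facetVertex (restVertex i α))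
              (Hom.app g _ (X.facetProj i α x)) = Hom.app g α x
            rcases hα : α i with _ | _
            · rw [X.facetProj_of_false hα, ← g.app_d]
              refine (congrArg _ (cofaceD_same W (isEdge_facetVertex hα) _)).trans ?_
              rw [cast_cast, cast_rfl]
            · rw [X.facetProj_of_true hα, app_cast]
              refine (congrArg _ (coface_cast W _ _)).trans ?_
              rw [cast_cast, cast_rfl] }
      homEquiv_naturality_left_symm := by intros; rfl
      homEquiv_naturality_right := by intros; rfl }

instance : (cofaceFunctor ω σ ξ i).PreservesEpimorphisms where
  preserves f hf := (epi_iff_surjective _).2 fun α => (epi_iff_surjective f).1 hf (restVertex i α)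

lemma projective_facet {X : ModFac ω σ ξ} (hX : Projective X) (i : ι) : Projective (X.facet i) :=
  (facetAdjunction ω σ ξ i).map_projective X hX

end coface

end ModFac

/-! ### Module factorizations with projective facets -/

namespace ModFac

open ExactCat

variable {A : Type u} [Ring A] {ι : Type} [LinearOrder ι]
variable {ω : ι → A} {σ : ι → A ≃+* A} {ξ : ι → ι → Aˣ} [TypeData ω σ ξ] [Finite ι]

/-- A module factorization with projective facet has no extensions by one which is constant in the
direction of the facet. -/
lemma ext_of_bijective {i : ι} {X U : ModFac ω σ ξ} (hX : Projective (X.facet i))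
    (hU : ∀ α β (h : IsEdge i α β), Function.Bijective (U.d i α β h)) (n : ℕ) :
    Subsingleton (Abelian.Ext.{u} X U (n + 1)) := by
  let η : U ⟶ coface (U.facet i) := toCoface (𝟙 (U.facet i))
  have hb : ∀ α, Function.Bijective (Hom.app η α) := by
    intro α
    change Function.Bijective (U.facetProj i α)
    rcases hα : α i with _ | _
    · rw [show ⇑(U.facetProj i α) = _ from funext (U.facetProj_of_false hα)]
      exact hU _ _ _
    · rw [show ⇑(U.facetProj i α) = _ from funext (U.facetProj_of_true hα)]
      exact ⟨U.cast_injective _, U.cast_surjective _⟩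
  have : Mono η := (mono_iff_injective η).2 fun α => (hb α).1
  have : Epi η := (epi_iff_surjective η).2 fun α => (hb α).2
  have : IsIso η := isIso_of_mono_of_epi η
  refine ext_retract_right (asIso η).retract ?_
  refine (ext_adjunction (facetAdjunction ω σ ξ i) (fun S hS => facetFunctor_shortExact i hS)
    (fun P hP => projective_facet hP i) (U.facet i) n X).1 ?_
  have : Projective ((facetFunctor ω σ ξ i).obj X) := hX
  exact ⟨fun a b => by rw [Abelian.Ext.eq_zero_of_projective a, Abelian.Ext.eq_zero_of_projective b]⟩

variable {P : ObjectProperty (ModuleCat.{u} A)} (hP : FrobClass P) (hT : IsTwistClosed P)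

include hP hT

lemma isZeroType_iff (X : ModFac ω σ ξ) : IsZeroType ω σ ξ P X ↔
    HasComponents ω σ ξ P X ∧ ∀ i, Projective (X.facet i) := by
  unfold IsZeroType
  constructor
  · rintro ⟨h, h'⟩
    refine ⟨h, fun i => ?_⟩
    have := h' i
    rw [conflations_eq] at this
    exact ((frobClass_hasComponents hP hT).isProj_iff _).1 this
  · rintro ⟨h, h'⟩
    refine ⟨h, fun i => ?_⟩
    rw [conflations_eq]
    exact ((frobClass_hasComponents hP hT).isProj_iff _).2 (h' i)

/-- The module factorizations of zero type with components in a Frobenius class form a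
Frobenius class. -/
theorem frobClass_isZeroType : FrobClass (IsZeroType ω σ ξ P) := by
  have hF := frobClass_hasComponents (ω := ω) (σ := σ) (ξ := ξ) hP hT
  refine ⟨fun X hX => ?_, fun S hS h₁ h₃ => ?_, fun {X Y} r h => ?_, fun X hX => ?_,
    fun X hX => ?_, fun S hS h₃ Q hQ hQ' f => ?_⟩
  · exact (isZeroType_iff hP hT X).2 ⟨hF.zero X hX, fun i =>
      ((facetFunctor ω σ ξ i).map_isZero hX).projective⟩
  · rw [isZeroType_iff hP hT] at h₁ h₃ ⊢
    exact ⟨hF.ext S hS h₁.1 h₃.1, fun i => frobClass_projective.ext _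
      (facetFunctor_shortExact i hS) (h₁.2 i) (h₃.2 i)⟩
  · rw [isZeroType_iff hP hT] at h ⊢
    exact ⟨hF.retract r h.1, fun i => projective_of_retract (r.map (facetFunctor ω σ ξ i)) (h.2 i)⟩
  · rw [isZeroType_iff hP hT] at hX
    obtain ⟨K, W, i, p, w, hS, hW, hW', hK⟩ := hF.cover X hX.1
    refine ⟨K, W, i, p, w, hS, hW, (isZeroType_iff hP hT W).2 ⟨hW', projective_facet hW⟩,
      (isZeroType_iff hP hT K).2 ⟨hK, fun k => ?_⟩⟩
    exact frobClass_projective.kernel (facetFunctor_shortExact k hS) (projective_facet hW k)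
      (hX.2 k)
  · rw [isZeroType_iff hP hT] at hX
    obtain ⟨W, Z, i, p, w, hS, hW, hW', hZ⟩ := hF.hull X hX.1
    refine ⟨W, Z, i, p, w, hS, hW, (isZeroType_iff hP hT W).2 ⟨hW', projective_facet hW⟩,
      (isZeroType_iff hP hT Z).2 ⟨hZ, fun k => ?_⟩⟩
    have hk := facetFunctor_shortExact k hS
    obtain ⟨r⟩ := retract_X₃_of_split hk ((frobClass_hasComponents hP hT).extend _ hk
      (fun α => hZ _) (X.facet k) (fun α => hX.1 _) (hX.2 k) (𝟙 _))
    exact projective_of_retract r (projective_facet hW k)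
  · rw [isZeroType_iff hP hT] at h₃ hQ
    exact hF.extend S hS h₃.1 Q hQ.1 hQ' f

end ModFac

/-! ### Regularity -/

namespace ModFac

open ExactCat

variable {A : Type u} [Ring A] {n : ℕ}
variable {ω : Fin n → A} {σ : Fin n → A ≃+* A} {ξ : Fin n → Fin n → Aˣ}

section layer

variable (X : ModFac ω σ ξ)

/-- The elements of a component that come from the neighbouring component in direction `i`; all
elements, if the component is an initial vertex of an edge in this direction. -/
def layer (i : Fin n) (α : Fin n → Bool) : Submodule A (X.X α) :=
  if h : α i = true then LinearMap.range (X.d i _ _ (isEdge_toggle' h)).hom else ⊤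

lemma layer_of_false {i : Fin n} {α : Fin n → Bool} (h : α i = false) : X.layer i α = ⊤ := by
  rw [layer, dif_neg (by simp [h])]

lemma mem_layer_iff {i : Fin n} {α β : Fin n → Bool} (h : IsEdge i α β) (x : X.X β) :
    x ∈ X.layer i β ↔ ∃ y, X.d i α β h y = x := by
  have e : toggle i β = α := by rw [← h.toggle_eq, toggle_toggle]
  subst e
  rw [layer, dif_pos h.2.1]
  rfl

lemma d_mem_layer {i j : Fin n} {α β : Fin n → Bool} (h : IsEdge j α β) {x : X.X α}
    (hx : x ∈ X.layer i α) : X.d j α β h x ∈ X.layer i β := by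
  rcases eq_or_ne i j with rfl | hij
  · exact (X.mem_layer_iff h _).2 ⟨x, rfl⟩
  · rcases hα : α i with _ | _
    · rw [X.layer_of_false ((h.2.2 i hij).symm.trans hα)]
      trivial
    · have hβ := (h.2.2 i hij).symm.trans hα
      obtain ⟨y, rfl⟩ := (X.mem_layer_iff (isEdge_toggle' hα) x).1 hx
      exact (X.mem_layer_iff (isEdge_toggle' hβ) _).2
        ⟨X.d j _ _ (h.toggle_ne hij.symm) y, X.d_d _ _ _ _ _ _ _ _ _ _ hij.symm _⟩

lemma e_mem_layer {i j : Fin n} {α β : Fin n → Bool} (h : IsEdge j α β) {x : X.X β}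
    (hx : x ∈ X.layer i β) : X.e j α β h x ∈ X.layer i α := by
  rcases eq_or_ne i j with rfl | hij
  · rw [X.layer_of_false h.1]
    trivial
  · rcases hα : α i with _ | _
    · rw [X.layer_of_false hα]
      trivial
    · have hβ := (h.2.2 i hij).symm.trans hα
      obtain ⟨y, rfl⟩ := (X.mem_layer_iff (isEdge_toggle' hβ) x).1 hx
      exact (X.mem_layer_iff (isEdge_toggle' hα) _).2
        ⟨X.e j _ _ (h.toggle_ne hij.symm) y, X.d_e_comm _ _ _ _ _ _ _ _ _ _ hij.symm _⟩

lemma app_mem_layer {X Y : ModFac ω σ ξ} (f : X ⟶ Y) {i : Fin n} {α : Fin n → Bool} {x : X.X α}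
    (hx : x ∈ X.layer i α) : Hom.app f α x ∈ Y.layer i α := by
  rcases hα : α i with _ | _
  · rw [layer_of_false _ hα]
    trivial
  · obtain ⟨y, rfl⟩ := (X.mem_layer_iff (isEdge_toggle' hα) x).1 hx
    exact (Y.mem_layer_iff (isEdge_toggle' hα) _).2 ⟨Hom.app f _ y, f.app_d _ _ _ _ _⟩

lemma omega_smul_mem_layer (i : Fin n) {α : Fin n → Bool} (x : X.X α) :
    ω i • x ∈ X.layer i α := by
  rcases hα : α i with _ | _
  · rw [layer_of_false _ hα]
    trivial
  · exact (X.mem_layer_iff (isEdge_toggle' hα) _).2 ⟨_, X.d_e _ _ _ _ _⟩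

/-- The sum of the first `k` submodules `layer`. -/
def lower (k : ℕ) (α : Fin n → Bool) : Submodule A (X.X α) :=
  ⨆ (i : Fin n) (_ : (i : ℕ) < k), X.layer i α

lemma layer_le_lower {i : Fin n} {k : ℕ} (hi : (i : ℕ) < k) (α : Fin n → Bool) :
    X.layer i α ≤ X.lower k α := le_iSup₂_of_le i hi le_rfl

lemma lower_zero (α : Fin n → Bool) : X.lower 0 α = ⊥ := by simp [lower]

lemma lower_succ {k : ℕ} (hk : k < n) (α : Fin n → Bool) :
    X.lower (k + 1) α = X.lower k α ⊔ X.layer ⟨k, hk⟩ α := by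
  refine le_antisymm (iSup₂_le fun i hi => ?_) (sup_le (iSup₂_le fun i hi => ?_) ?_)
  · rcases Nat.lt_succ_iff_lt_or_eq.1 hi with h | h
    · exact (X.layer_le_lower h α).trans le_sup_left
    · have : i = ⟨k, hk⟩ := Fin.ext h
      subst this
      exact le_sup_right
  · exact X.layer_le_lower (hi.trans k.lt_succ_self) α
  · exact X.layer_le_lower (i := ⟨k, hk⟩) k.lt_succ_self α

lemma lower_eq_top {i : Fin n} {k : ℕ} (hi : (i : ℕ) < k) {α : Fin n → Bool}
    (h : X.layer i α = ⊤) : X.lower k α = ⊤ :=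
  top_le_iff.1 (h.symm.le.trans (X.layer_le_lower hi α))

lemma d_mem_lower {k : ℕ} {j : Fin n} {α β : Fin n → Bool} (h : IsEdge j α β) {x : X.X α}
    (hx : x ∈ X.lower k α) : X.d j α β h x ∈ X.lower k β := by
  have : X.lower k α ≤ (X.lower k β).comap (X.d j α β h).hom :=
    iSup₂_le fun i hi y hy => X.layer_le_lower hi β (X.d_mem_layer h hy)
  exact this hx

lemma e_mem_lower {k : ℕ} {j : Fin n} {α β : Fin n → Bool} (h : IsEdge j α β) {x : X.X β}
    (hx : x ∈ X.lower k β) : X.e j α β h x ∈ X.lower k α := by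
  have : X.lower k β ≤ (X.lower k α).comap (X.e j α β h) :=
    iSup₂_le fun i hi y hy => X.layer_le_lower hi α (X.e_mem_layer h hy)
  exact this hx

lemma app_mem_lower {X Y : ModFac ω σ ξ} (f : X ⟶ Y) {k : ℕ} {α : Fin n → Bool} {x : X.X α}
    (hx : x ∈ X.lower k α) : Hom.app f α x ∈ Y.lower k α := by
  have : X.lower k α ≤ (Y.lower k α).comap (Hom.app f α).hom :=
    iSup₂_le fun i hi y hy => Y.layer_le_lower hi α (app_mem_layer f hy)
  exact this hx

lemma exists_mem_lower {X Y : ModFac ω σ ξ} {f : X ⟶ Y}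
    (hf : ∀ α, Function.Surjective (Hom.app f α)) {k : ℕ} {α : Fin n → Bool} {y : Y.X α}
    (hy : y ∈ Y.lower k α) : ∃ x ∈ X.lower k α, Hom.app f α x = y := by
  have : Y.lower k α ≤ (X.lower k α).map (Hom.app f α).hom := by
    refine iSup₂_le fun i hi y hy => ?_
    rcases hα : α i with _ | _
    · obtain ⟨x, rfl⟩ := hf α y
      refine ⟨x, X.layer_le_lower hi α ?_, rfl⟩
      rw [layer_of_false _ hα]
      trivial
    · obtain ⟨z, rfl⟩ := (Y.mem_layer_iff (isEdge_toggle' hα) y).1 hy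
      obtain ⟨x, rfl⟩ := hf _ z
      exact ⟨X.d i _ _ (isEdge_toggle' hα) x, X.layer_le_lower hi α
        ((X.mem_layer_iff (isEdge_toggle' hα) _).2 ⟨x, rfl⟩), (f.app_d _ _ _ _ _).symm⟩
  exact this hy

lemma omega_smul_mem_lower {i : Fin n} {k : ℕ} (hi : (i : ℕ) < k) {α : Fin n → Bool} (x : X.X α) :
    ω i • x ∈ X.lower k α := X.layer_le_lower hi α (X.omega_smul_mem_layer i x)

/-- `lower`, as a subobject. -/
def lowerFac (k : ℕ) : X.SubFac where
  N := X.lower k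
  d_mem _ _ _ h _ hx := X.d_mem_lower h hx
  e_mem _ _ _ h _ hx := X.e_mem_lower h hx

end layer

/-- The maps `d` in the first `k` directions are injective modulo the images of the preceding
ones. -/
def RegularUpTo (k : ℕ) (X : ModFac ω σ ξ) : Prop :=
  ∀ j : Fin n, (j : ℕ) < k → ∀ α β (h : IsEdge j α β) (x : X.X α),
    X.d j α β h x ∈ X.lower j β → x ∈ X.lower j α

lemma RegularUpTo.mono {k l : ℕ} (hkl : k ≤ l) {X : ModFac ω σ ξ} (h : RegularUpTo l X) :
    RegularUpTo k X := fun j hj => h j (hj.trans_le hkl)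

lemma regularUpTo_zero (X : ModFac ω σ ξ) : RegularUpTo 0 X := fun _ hj =>
  absurd hj (Nat.not_lt_zero _)

/-- A short exact sequence with regular end term induces short exact sequences of the
subobjects `lower`. -/
lemma mem_lower_of_shortExact {S : ShortComplex (ModFac ω σ ξ)} (hS : S.ShortExact) {k : ℕ}
    (hk : k ≤ n) (h : RegularUpTo k S.X₃) {α : Fin n → Bool} {x : S.X₁.X α}
    (hx : Hom.app S.f α x ∈ S.X₂.lower k α) : x ∈ S.X₁.lower k α := by
  rw [shortExact_iff] at hS
  obtain ⟨h₁, h₃, h₂⟩ := hS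
  induction k generalizing α x with
  | zero =>
    rw [lower_zero, Submodule.mem_bot] at hx ⊢
    exact h₁ α (hx.trans (map_zero _).symm)
  | succ k ih =>
    have hkn : k < n := hk
    rcases hα : α ⟨k, hkn⟩ with _ | _
    · rw [S.X₁.lower_eq_top (i := ⟨k, hkn⟩) k.lt_succ_self (S.X₁.layer_of_false hα)]
      trivial
    · rw [lower_succ _ hkn] at hx ⊢
      obtain ⟨u, hu, v, hv, huv⟩ := Submodule.mem_sup.1 hx
      obtain ⟨y, rfl⟩ := (mem_layer_iff _ (isEdge_toggle' hα) v).1 hv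
      have hg : Hom.app S.g _ y ∈ S.X₃.lower k (toggle ⟨k, hkn⟩ α) := by
        refine h ⟨k, hkn⟩ k.lt_succ_self _ _ (isEdge_toggle' hα) _ ?_
        have e : Hom.app S.g α (Hom.app S.f α x) = 0 := app_apply_eq S.zero α x
        rw [← huv, map_add, ← S.g.app_d] at e
        rw [eq_neg_of_add_eq_zero_right e]
        exact neg_mem (app_mem_lower S.g hu)
      obtain ⟨y', hy', hyy'⟩ := exists_mem_lower h₃ hg
      obtain ⟨x', hx'⟩ := h₂ _ (y - y') (by rw [map_sub, hyy', sub_self])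
      have hmem : x - S.X₁.d _ _ _ (isEdge_toggle' hα) x' ∈ S.X₁.lower k α := by
        refine ih hkn.le (h.mono k.le_succ) ?_
        rw [map_sub, ← huv, ← S.f.app_d, hx', map_sub]
        have e : ∀ a b c : S.X₂.X α, a + b - (b - c) = a + c := fun a b c => by abel
        rw [e]
        exact add_mem hu (S.X₂.d_mem_lower _ hy')
      exact Submodule.mem_sup.2 ⟨_, hmem, _,
        (mem_layer_iff _ (isEdge_toggle' hα) _).2 ⟨x', rfl⟩, sub_add_cancel _ _⟩

lemma RegularUpTo.of_shortExact {S : ShortComplex (ModFac ω σ ξ)} (hS : S.ShortExact) {k : ℕ}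
    (h₂ : RegularUpTo (k + 1) S.X₂) (h₃ : RegularUpTo k S.X₃) : RegularUpTo (k + 1) S.X₁ := by
  intro j hj α β h x hx
  refine mem_lower_of_shortExact hS j.2.le (h₃.mono (Nat.lt_succ_iff.1 hj)) ?_
  refine h₂ j hj α β h _ ?_
  rw [S.f.app_d]
  exact app_mem_lower S.f hx

lemma RegularUpTo.of_jointly {k : ℕ} {X : ModFac ω σ ξ} {J : Type*} [Fintype J]
    {Y : J → ModFac ω σ ξ} (p : ∀ j, X ⟶ Y j) (s : ∀ j, Y j ⟶ X)
    (hps : ∀ α x, ∑ j, Hom.app (s j) α (Hom.app (p j) α x) = x)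
    (h : ∀ j, RegularUpTo k (Y j)) : RegularUpTo k X := by
  intro i hi α β he x hx
  rw [← hps α x]
  refine sum_mem fun j _ => app_mem_lower _ ?_
  refine h j i hi α β he _ ?_
  rw [(p j).app_d]
  exact app_mem_lower (p j) hx

lemma RegularUpTo.of_retract {k : ℕ} {X Y : ModFac ω σ ξ} (r : Retract X Y)
    (h : RegularUpTo k Y) : RegularUpTo k X :=
  RegularUpTo.of_jointly (J := Unit) (fun _ => r.i) (fun _ => r.r)
    (fun α x => (Fintype.sum_unique _).trans (app_apply_eq r.retract α x)) fun _ => h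

attribute [local instance] Abelian.hasFiniteBiproducts

open Classical in
lemma biproduct_total_apply {J : Type} [Fintype J] (Y : J → ModFac ω σ ξ) (α : Fin n → Bool)
    (x : (⨁ Y).X α) :
    ∑ j, Hom.app (biproduct.ι Y j) α (Hom.app (biproduct.π Y j) α x) = x := by
  have e : ∀ (s : Finset J),
      Hom.app (∑ j ∈ s, biproduct.π Y j ≫ biproduct.ι Y j : ⨁ Y ⟶ ⨁ Y) α x =
      ∑ j ∈ s, Hom.app (biproduct.ι Y j) α (Hom.app (biproduct.π Y j) α x) := by
    intro s
    induction s using Finset.induction_on with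
    | empty => rfl
    | insert a s ha ih =>
      rw [Finset.sum_insert ha, Finset.sum_insert ha, ← ih]
      rfl
  rw [← e]
  exact app_apply_eq (biproduct.total (f := Y)) α x

/-- An element of a projective module which a member of a regular sequence multiplies into a
submodule generated by multiples of the preceding members lies in this submodule. -/
lemma mem_of_omega_smul_mem (hreg : IsRegularSeq ω) {M : ModuleCat.{u} A} (hM : Projective M)
    (j : Fin n) (K : Submodule A M)
    (h₁ : ∀ f : M →ₗ[A] A, ∀ x ∈ K, f x ∈ (TwoSidedIdeal.span {a | ∃ i, i < j ∧ ω i = a}).asIdeal)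
    (h₂ : ∀ i < j, ∀ x : M, ω i • x ∈ K) {x : M} (hx : ω j • x ∈ K) : x ∈ K := by
  set I := (TwoSidedIdeal.span {a | ∃ i, i < j ∧ ω i = a}) with hI
  have hIK : ∀ a ∈ I.asIdeal, ∀ y : M, a • y ∈ K := by
    have key : I ≤ (Module.annihilator A (M ⧸ K)).toTwoSided := by
      rw [hI, TwoSidedIdeal.span_le]
      rintro _ ⟨i, hi, rfl⟩
      simp only [SetLike.mem_coe, Ideal.mem_toTwoSided, Module.mem_annihilator]
      intro m
      obtain ⟨y, rfl⟩ := Submodule.mkQ_surjective K m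
      rw [← map_smul, Submodule.mkQ_apply, Submodule.Quotient.mk_eq_zero]
      exact h₂ i hi y
    intro a ha y
    have := Module.mem_annihilator.1 (Ideal.mem_toTwoSided.1 (key (TwoSidedIdeal.mem_asIdeal.1 ha)))
      (K.mkQ y)
    rwa [← map_smul, Submodule.mkQ_apply, Submodule.Quotient.mk_eq_zero] at this
  have : Module.Projective A M := (IsProjective.iff_projective M).2 hM
  obtain ⟨s, hs⟩ := (Module.projective_def' (R := A) (P := M)).1 inferInstance
  have hc : ∀ m : M, s x m ∈ I.asIdeal := by
    intro m
    have e := h₁ (Finsupp.lapply m ∘ₗ s) _ hx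
    have e' : (Finsupp.lapply m ∘ₗ s) (ω j • x) = ω j * s x m := by simp
    rw [e'] at e
    have hr := (hreg j).1.left
    rw [← Ideal.Quotient.eq_zero_iff_mem] at e ⊢
    rw [map_mul] at e
    refine hr (e.trans (mul_zero _).symm)
  have hx' : x = (s x).sum fun m a => a • m := by
    have := congrArg (fun f => f x) hs
    simpa [Finsupp.linearCombination_apply] using this.symm
  rw [hx']
  exact sum_mem fun m _ => hIK _ (hc m) m

/-- In every direction, either all maps `d` or all maps `e` are bijective. -/
def IsPure (U : ModFac ω σ ξ) : Prop :=
  ∀ i, (∀ α β h, Function.Bijective (U.d i α β h)) ∨ ∀ α β h, Function.Bijective (U.e i α β h)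

/-- Pure module factorizations with projective components are regular. At a vertex where `lower j` is
not everything, it is generated by the images of multiplication by the preceding `ω i`, while the map
`d` in direction `j` is bijective or multiplication by `ω j`, up to a bijection. In the second case
regularity of the sequence applies. -/
lemma regularUpTo_of_isPure (hreg : IsRegularSeq ω) {U : ModFac ω σ ξ}
    (hU : ∀ α, Projective (U.X α)) (h : IsPure U) : RegularUpTo n U := by
  intro j _ α β he x hx
  by_cases hex : ∃ i, i < j ∧ U.layer i α = ⊤
  · obtain ⟨i, hi, hi'⟩ := hex
    rw [U.lower_eq_top (i := i) hi hi']
    trivial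
  push Not at hex
  have hα : ∀ i < j, α i = true := fun i hi => by
    by_contra hc
    exact hex i hi (U.layer_of_false (Bool.eq_false_of_not_eq_true hc))
  have hbij : ∀ i < j, ∀ α β h, Function.Bijective (U.e i α β h) := fun i hi => by
    refine (h i).resolve_left fun hc => hex i hi (eq_top_iff.2 fun y _ => ?_)
    exact (U.mem_layer_iff (isEdge_toggle' (hα i hi)) y).2 ((hc _ _ _).2 y)
  have hlayer : ∀ γ, (∀ i < j, γ i = true) → ∀ i < j, ∀ y ∈ U.layer i γ, ∃ z, ω i • z = y := by
    intro γ hγ i hi y hy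
    obtain ⟨z, rfl⟩ := (U.mem_layer_iff (isEdge_toggle' (hγ i hi)) y).1 hy
    obtain ⟨w, rfl⟩ := (hbij i hi _ _ (isEdge_toggle' (hγ i hi))).2 z
    exact ⟨w, (U.d_e _ _ _ _ _).symm⟩
  rcases h j with hd | hej
  · have hle : U.lower j β ≤ (U.lower j α).map (U.d j α β he).hom := by
      refine iSup₂_le fun i hi y hy => ?_
      obtain ⟨z, rfl⟩ := hlayer β (fun i hi => (he.2.2 i (ne_of_lt hi)).symm.trans (hα i hi)) i hi
        y hy
      obtain ⟨w, rfl⟩ := (hd _ _ he).2 z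
      exact ⟨ω i • w, U.omega_smul_mem_lower hi w, map_smul _ _ _⟩
    obtain ⟨y, hy, hxy⟩ := hle hx
    rwa [← (hd _ _ he).1 hxy]
  · obtain ⟨y, rfl⟩ := (hej _ _ he).2 x
    rw [U.d_e] at hx
    refine U.e_mem_lower he (mem_of_omega_smul_mem hreg (hU β) j _ (fun f => ?_)
      (fun i hi z => U.omega_smul_mem_lower hi z) hx)
    have hle : U.lower j β ≤
        Submodule.comap f (TwoSidedIdeal.span {a | ∃ i, i < j ∧ ω i = a}).asIdeal := by
      refine iSup₂_le fun i hi z hz => ?_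
      obtain ⟨w, rfl⟩ := hlayer β (fun i hi => (he.2.2 i (ne_of_lt hi)).symm.trans (hα i hi)) i hi
        z hz
      rw [Submodule.mem_comap, map_smul, smul_eq_mul, TwoSidedIdeal.mem_asIdeal]
      exact TwoSidedIdeal.mul_mem_right _ _ _ (TwoSidedIdeal.subset_span ⟨i, hi, rfl⟩)
    exact fun z hz => hle hz

/-- A shift interchanges the maps `d` and `e` in one direction, and changes the others by bijections. -/
lemma IsPure.shift {U : ModFac ω σ ξ} (hU : IsPure U) {i : Fin n} (D : ShiftData ω σ ξ i) :
    IsPure (D.shift U) := by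
  intro j
  by_cases hj : j = i
  · subst hj
    refine (hU j).symm.imp (fun he α β h => ?_) fun hd α β h => ?_
    · have e : ∀ x, (D.shift U).d j α β h x =
          (D.of U β ∘ U.e j _ _ h.toggle_same ∘ (D.of U α).symm) x := fun x => by
        obtain ⟨x, rfl⟩ := (D.of U α).surjective x
        exact (D.shift_d_same U h x).trans (by simp)
      rw [show ⇑((D.shift U).d j α β h) = _ from funext e]
      exact (D.of U β).bijective.comp ((he _ _ _).comp (D.of U α).symm.bijective)
    · have e : ∀ x, (D.shift U).e j α β h x =
          (D.of U α ∘ U.d j _ _ h.toggle_same ∘ (D.of U β).symm) x := fun x => by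
        obtain ⟨x, rfl⟩ := (D.of U β).surjective x
        exact (D.shift_e_same U h x).trans (by simp)
      rw [show ⇑((D.shift U).e j α β h) = _ from funext e]
      exact (D.of U α).bijective.comp ((hd _ _ _).comp (D.of U β).symm.bijective)
  · refine (hU j).imp (fun hd α β h => ?_) fun he α β h => ?_
    · have e : ∀ x, (D.shift U).d j α β h x =
          (D.of U β ∘ U.d j _ _ (h.toggle_ne hj) ∘ (D.of U α).symm) x := fun x => by
        obtain ⟨x, rfl⟩ := (D.of U α).surjective x
        exact (D.shift_d_ne U hj h x).trans (by simp)
      rw [show ⇑((D.shift U).d j α β h) = _ from funext e]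
      exact (D.of U β).bijective.comp ((hd _ _ _).comp (D.of U α).symm.bijective)
    · have e : ∀ x, (D.shift U).e j α β h x =
          (D.of U α ∘ (fun y => D.v j (α i) • y) ∘ U.e j _ _ (h.toggle_ne hj) ∘
            (D.of U β).symm) x := fun x => by
        obtain ⟨x, rfl⟩ := (D.of U β).surjective x
        exact (D.shift_e_ne U hj h x).trans (by simp [Units.smul_def])
      rw [show ⇑((D.shift U).e j α β h) = _ from funext e]
      exact (D.of U α).bijective.comp ((MulAction.bijective _).comp
        ((he _ _ _).comp (D.of U β).symm.bijective))

/-- A generator is a direct sum of pure module factorizations with projective components. -/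
lemma IsGen.exists_pure [TypeData ω σ ξ] {P : ObjectProperty (ModuleCat.{u} A)}
    {U : ModFac ω σ ξ} (hU : IsGen P U) :
    ∃ (J : Type) (_ : Fintype J) (Y : J → ModFac ω σ ξ) (p : ∀ j, U ⟶ Y j) (s : ∀ j, Y j ⟶ U),
      (∀ α x, ∑ j, Hom.app (s j) α (Hom.app (p j) α x) = x) ∧ (∀ j, IsPure (Y j)) ∧
        ∀ j α, Projective ((Y j).X α) := by
  induction hU with
  | const M hM _ =>
    exact ⟨Unit, inferInstance, fun _ => ModFac.const ω σ ξ M, fun _ => 𝟙 _, fun _ => 𝟙 _,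
      fun α x => Fintype.sum_unique _, fun _ i => .inl fun _ _ _ => Function.bijective_id,
      fun _ _ => hM⟩
  | @shift i D U _ ih =>
    obtain ⟨J, hJ, Y, p, s, hps, hY, hYP⟩ := ih
    refine ⟨J, hJ, fun j => D.shift (Y j), fun j => D.functor.map (p j),
      fun j => D.functor.map (s j), fun α x => ?_, fun j => (hY j).shift D,
      fun j => D.hasComponents_shift isTwistClosed_projective (hYP j)⟩
    obtain ⟨x, rfl⟩ := (D.of U α).surjective x
    refine Eq.trans ?_ (congrArg (D.of U α) (hps _ x))
    exact (map_sum (D.of U α) _ _).symm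
  | @sum J hJ U _ ih =>
    have := Fintype.ofFinite J
    choose K hK Y p s hps hY hYP using ih
    refine ⟨Σ j, K j, inferInstance, fun k => Y k.1 k.2, fun k => biproduct.π U k.1 ≫ p k.1 k.2,
      fun k => s k.1 k.2 ≫ biproduct.ι U k.1, fun α x => ?_, fun k => hY _ _, fun k => hYP _ _⟩
    rw [Fintype.sum_sigma]
    refine Eq.trans (Finset.sum_congr rfl fun j _ => ?_) (biproduct_total_apply U α x)
    refine Eq.trans ?_ (congrArg _ (hps j α (Hom.app (biproduct.π U j) α x)))
    exact (map_sum (Hom.app (biproduct.ι U j) α).hom _ _).symm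

lemma regularUpTo_of_projective [TypeData ω σ ξ] (hreg : IsRegularSeq ω) {X : ModFac ω σ ξ}
    (hX : Projective X) : RegularUpTo n X := by
  obtain ⟨U, g, hU, hg⟩ := exists_gen_cover (P := ⊤) X fun α =>
    ⟨Projective.over (X.X α), Projective.π _, inferInstance, trivial, inferInstance⟩
  obtain ⟨J, _, Y, p, s, hps, hY, hYP⟩ := hU.exists_pure
  exact RegularUpTo.of_retract
    ⟨Projective.factorThru (𝟙 X) g, g, Projective.factorThru_comp _ _⟩
    (RegularUpTo.of_jointly p s hps fun j => regularUpTo_of_isPure hreg (hYP j) (hY j))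

/-- Module factorizations with components in a Frobenius class are regular. -/
lemma regularUpTo_of_hasComponents [TypeData ω σ ξ] (hreg : IsRegularSeq ω)
    {P : ObjectProperty (ModuleCat.{u} A)} (hP : FrobClass P) (hT : IsTwistClosed P)
    {X : ModFac ω σ ξ} (hX : HasComponents ω σ ξ P X) : RegularUpTo n X := by
  have key : ∀ k ≤ n, ∀ X : ModFac ω σ ξ, HasComponents ω σ ξ P X → RegularUpTo k X := by
    intro k
    induction k with
    | zero => exact fun _ X _ => regularUpTo_zero X
    | succ k ih =>
      intro hk X hX
      obtain ⟨W, Z, i, p, w, hS, hW, -, hZ⟩ := (frobClass_hasComponents hP hT).hull X hX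
      exact RegularUpTo.of_shortExact hS ((regularUpTo_of_projective hreg hW).mono hk)
        (ih (k.le_succ.trans hk) Z hZ)
  exact key n le_rfl X hX

end ModFac

/-! ### The total cokernel -/

namespace ModFac

open ExactCat

section sky

variable {A : Type u} [Ring A] {ι : Type} {ω : ι → A}

/-- A set of vertices without paths of length two. -/
def IsThin (S : Set (ι → Bool)) : Prop :=
  ∀ i j α β γ, IsEdge i α β → IsEdge j β γ → α ∈ S → γ ∉ S

lemma isThin_singleton (v : ι → Bool) : IsThin ({v} : Set (ι → Bool)) := by
  rintro i j α β γ h h' rfl hγ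
  have hij : i ≠ j := fun e => by
    subst e
    exact absurd (h.2.1.symm.trans h'.1) (by simp)
  have e : γ i = true := (h'.2.2 i hij).symm.trans h.2.1
  rw [Set.mem_singleton_iff.1 hγ, h.1] at e
  exact absurd e (by simp)

lemma omega_mem_ideal (i : ι) : ω i ∈ ideal ω :=
  TwoSidedIdeal.mem_asIdeal.2 (TwoSidedIdeal.subset_span ⟨i, rfl⟩)

lemma omega_smul_eq_zero (M : ModuleCat.{u} (A ⧸ ideal ω)) (i : ι)
    (x : (ModuleCat.restrictScalars.{u} (Ideal.Quotient.mk (ideal ω))).obj M) : ω i • x = 0 := by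
  change Ideal.Quotient.mk (ideal ω) (ω i) • (show M from x) = 0
  rw [Ideal.Quotient.eq_zero_iff_mem.2 (omega_mem_ideal i), zero_smul]

open Classical in
/-- The map between modules of functions on proofs which is constant, if the first proposition
holds, and zero otherwise. -/
noncomputable def extendFun (p q : Prop) (M : ModuleCat.{u} A) :
    (PLift p → M) →ₗ[A] (PLift q → M) :=
  if h : p then LinearMap.pi fun _ => LinearMap.proj ⟨h⟩ else 0

lemma extendFun_pos {p : Prop} (hp : p) {q : Prop} {M : ModuleCat.{u} A} (f : PLift p → M)
    (x : PLift q) : extendFun p q M f x = f ⟨hp⟩ := by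
  rw [extendFun, dif_pos hp]
  rfl

lemma extendFun_neg {p : Prop} (hp : ¬ p) {q : Prop} {M : ModuleCat.{u} A} (f : PLift p → M)
    (x : PLift q) : extendFun p q M f x = 0 := by
  rw [extendFun, dif_neg hp]
  rfl

variable [LinearOrder ι] (σ : ι → A ≃+* A) (ξ : ι → ι → Aˣ)
variable {S : Set (ι → Bool)} (hS : IsThin S)

include hS

/-- The module factorization with components `M` at the vertices in `S` and zero elsewhere. Its
maps `d` are the identity maps of `M` along the edges within `S`, its maps `e` are zero. A
component is given as a module of functions on the proofs that its vertex is in `S`. -/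
@[reducible]
noncomputable def skyObj (M : ModuleCat.{u} (A ⧸ ideal ω)) : ModFac ω σ ξ where
  X α := ModuleCat.of A (PLift (α ∈ S) →
    (ModuleCat.restrictScalars.{u} (Ideal.Quotient.mk (ideal ω))).obj M)
  d _ α β _ := ModuleCat.ofHom (extendFun (α ∈ S) (β ∈ S) _)
  e _ _ _ _ := 0
  e_d i _ _ _ x := funext fun h => (omega_smul_eq_zero M i (x h)).symm
  d_e i α _ _ x := by
    refine (map_zero _).trans ?_
    exact funext fun h => (omega_smul_eq_zero M i (x h)).symm
  d_d i j α β γ δ h₁ h₂ h₃ h₄ _ x := by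
    funext hδ
    have : α ∉ S := fun h => hS i j α β δ h₁ h₄ h hδ.down
    have e : ∀ β, extendFun (α ∈ S) (β ∈ S) _ x = 0 := fun β =>
      funext fun _ => extendFun_neg this _ _
    change extendFun (β ∈ S) (δ ∈ S) _ (extendFun (α ∈ S) (β ∈ S) _ x) hδ =
      extendFun (γ ∈ S) (δ ∈ S) _ (extendFun (α ∈ S) (γ ∈ S) _ x) hδ
    rw [e, e, map_zero, map_zero]
  d_e_comm i j _ _ _ _ _ _ h₃ _ _ x := (map_zero _).trans rfl
  e_e i j _ _ _ _ _ _ _ _ _ x := smul_zero _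

/-- The functor `skyObj`. -/
@[reducible]
noncomputable def sky : ModuleCat.{u} (A ⧸ ideal ω) ⥤ ModFac ω σ ξ where
  obj M := skyObj σ ξ hS M
  map {M N} f :=
    { app := fun α => ModuleCat.ofHom (LinearMap.compLeft
        ((ModuleCat.restrictScalars.{u} (Ideal.Quotient.mk (ideal ω))).map f).hom (PLift (α ∈ S)))
      app_d := fun i α β h x => by
        funext hβ
        by_cases hα : α ∈ S
        · exact (extendFun_pos hα _ _).trans (congrArg f (extendFun_pos hα _ hβ).symm)
        · have e : (skyObj σ ξ hS M).d i α β h x hβ = 0 := extendFun_neg hα _ hβ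
          exact (extendFun_neg hα _ _).trans
            ((map_zero f.hom).symm.trans (congrArg f e.symm))
      app_e := fun i α β h x => (map_zero _).symm }

end sky

section TCok

variable {A : Type u} [Ring A] {n : ℕ}
variable {ω : Fin n → A} {σ : Fin n → A ≃+* A} {ξ : Fin n → Fin n → Aˣ}

lemma edgeRange_eq (X : ModFac ω σ ξ) : X.edgeRange = X.lower n fun _ => true := by
  refine le_antisymm (iSup_le fun i => iSup_le fun α => iSup_le fun h => ?_)
    (iSup₂_le fun i _ x hx => ?_)
  · rintro _ ⟨x, rfl⟩
    exact X.layer_le_lower i.2 _ ((X.mem_layer_iff h _).2 ⟨x, rfl⟩)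
  · have h : IsEdge i _ (fun _ => true) := isEdge_toggle' rfl
    obtain ⟨y, rfl⟩ := (X.mem_layer_iff h x).1 hx
    exact Submodule.mem_iSup_of_mem i (Submodule.mem_iSup_of_mem _
      (Submodule.mem_iSup_of_mem h ⟨y, rfl⟩))

/-- The class of an element in the total cokernel. -/
def tcokMk (X : ModFac ω σ ξ) : (X.X fun _ => true) →ₗ[A]
    (ModuleCat.restrictScalars.{u} (Ideal.Quotient.mk (ideal ω))).obj ((TCok ω σ ξ).obj X) :=
  X.edgeRange.mkQ

lemma tcokMk_surjective (X : ModFac ω σ ξ) : Function.Surjective X.tcokMk :=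
  Submodule.mkQ_surjective _

lemma tcokMk_eq_zero_iff (X : ModFac ω σ ξ) (x : X.X fun _ => true) :
    X.tcokMk x = 0 ↔ x ∈ X.lower n fun _ => true := by
  rw [← edgeRange_eq]
  exact Submodule.Quotient.mk_eq_zero _

instance : (TCok ω σ ξ).Additive where
  map_add {X Y f g} := by
    ext x
    obtain ⟨x, rfl⟩ := X.tcokMk_surjective x
    rfl

/-- `sky` at the last vertex. -/
noncomputable abbrev skyTop (ω : Fin n → A) (σ : Fin n → A ≃+* A) (ξ : Fin n → Fin n → Aˣ) :
    ModuleCat.{u} (A ⧸ ideal ω) ⥤ ModFac ω σ ξ := sky σ ξ (isThin_singleton fun _ => true)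

/-- The transpose of a homomorphism from a total cokernel. -/
noncomputable def toSky {X : ModFac ω σ ξ} {N : ModuleCat.{u} (A ⧸ ideal ω)}
    (φ : (TCok ω σ ξ).obj X ⟶ N) : X ⟶ (skyTop ω σ ξ).obj N where
  app α := ModuleCat.ofHom (LinearMap.pi fun h : PLift (α ∈ ({fun _ => true} : Set (Fin n → Bool))) =>
    ((ModuleCat.restrictScalars.{u} (Ideal.Quotient.mk (ideal ω))).map φ).hom ∘ₗ
      X.tcokMk ∘ₗ X.cast h.down)
  app_d i α β h x := by
    funext hβ
    obtain rfl : β = fun _ => true := hβ.down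
    have hα : α ∉ ({fun _ => true} : Set (Fin n → Bool)) := fun hα => by
      have := congrFun hα i
      rw [h.1] at this
      exact absurd this (by simp)
    have e : X.tcokMk (X.d i α _ h x) = 0 := (X.tcokMk_eq_zero_iff _).2
      (X.layer_le_lower i.2 _ ((X.mem_layer_iff h _).2 ⟨x, rfl⟩))
    exact (extendFun_neg hα _ _).trans ((congrArg φ e).trans (map_zero φ.hom)).symm
  app_e i α β h x := by
    funext hα
    have := congrFun hα.down i
    rw [h.1] at this
    exact absurd this (by simp)

lemma skyTop_hom_ext {X : ModFac ω σ ξ} {N : ModuleCat.{u} (A ⧸ ideal ω)}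
    {f g : X ⟶ (skyTop ω σ ξ).obj N}
    (h : ∀ x, Hom.app f (fun _ => true) x ⟨rfl⟩ = Hom.app g (fun _ => true) x ⟨rfl⟩) : f = g := by
  refine hom_ext' fun α x => funext fun hα => ?_
  obtain rfl : α = fun _ => true := hα.down
  exact h x

/-- The transpose of a morphism to `skyTop N`. -/
noncomputable def fromSky {X : ModFac ω σ ξ} {N : ModuleCat.{u} (A ⧸ ideal ω)}
    (g : X ⟶ (skyTop ω σ ξ).obj N) : (TCok ω σ ξ).obj X ⟶ N :=
  let l : (X.X fun _ => true) →ₗ[A]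
      (ModuleCat.restrictScalars.{u} (Ideal.Quotient.mk (ideal ω))).obj N :=
    LinearMap.proj (R := A)
      (φ := fun _ : PLift ((fun _ => true) ∈ ({fun _ => true} : Set (Fin n → Bool))) =>
        (ModuleCat.restrictScalars.{u} (Ideal.Quotient.mk (ideal ω))).obj N) ⟨rfl⟩ ∘ₗ
      (Hom.app g fun _ => true).hom
  have hl : X.edgeRange ≤ LinearMap.ker l := by
    refine iSup_le fun i => iSup_le fun α => iSup_le fun h => ?_
    rintro _ ⟨x, rfl⟩
    have hα : α ∉ ({fun _ => true} : Set (Fin n → Bool)) := fun hα => by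
      have := congrFun hα i
      rw [h.1] at this
      exact absurd this (by simp)
    have e := congrFun (g.app_d i α _ h x) ⟨rfl⟩
    exact e.symm.trans (extendFun_neg hα _ _)
  ModuleCat.ofHom
    { toFun := X.edgeRange.liftQ l hl
      map_add' := map_add (X.edgeRange.liftQ l hl)
      map_smul' := fun b x => by
        obtain ⟨a, rfl⟩ := Ideal.Quotient.mk_surjective b
        exact map_smul (X.edgeRange.liftQ l hl) a x }

variable (ω σ ξ) in
/-- The total cokernel is left adjoint to `skyTop`. -/
noncomputable def tcokAdjunction : TCok ω σ ξ ⊣ skyTop ω σ ξ :=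
  Adjunction.mkOfHomEquiv
    { homEquiv := fun X N =>
        { toFun := toSky
          invFun := fromSky
          left_inv := fun φ => by
            ext x
            obtain ⟨x, rfl⟩ := X.tcokMk_surjective x
            rfl
          right_inv := fun g => skyTop_hom_ext fun x => rfl }
      homEquiv_naturality_left_symm := fun {X X' N} f g => by
        ext x
        obtain ⟨x, rfl⟩ := X.tcokMk_surjective x
        rfl
      homEquiv_naturality_right := fun f g => skyTop_hom_ext fun x => rfl }

/-- The canonical short exact sequence that ends with the total cokernel. -/
lemma shortExact_tcok (Y : ModFac ω σ ξ) :
    ∃ w : (Y.lowerFac n).incl ≫ toSky (𝟙 ((TCok ω σ ξ).obj Y)) = 0,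
      (ShortComplex.mk _ _ w).ShortExact := by
  refine ⟨skyTop_hom_ext fun x => ?_, (shortExact_iff _).2 ⟨(Y.lowerFac n).incl_injective,
    fun α z => ?_, fun α y hy => ?_⟩⟩
  · exact (Y.tcokMk_eq_zero_iff _).2 ((Y.lowerFac n).incl_mem x)
  · by_cases hα : α = fun _ => true
    · subst hα
      obtain ⟨x, hx⟩ := Y.tcokMk_surjective (z ⟨rfl⟩)
      exact ⟨x, funext fun _ => hx⟩
    · exact ⟨0, funext fun h => absurd h.down hα⟩
  · refine (Y.lowerFac n).exists_incl ?_
    change y ∈ Y.lower n α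
    by_cases hα : α = fun _ => true
    · subst hα
      exact (Y.tcokMk_eq_zero_iff y).1 (congrFun hy ⟨rfl⟩)
    · obtain ⟨i, hi⟩ : ∃ i, α i = false := by
        by_contra hc
        push Not at hc
        exact hα (funext fun i => Bool.eq_true_of_not_eq_false (hc i))
      rw [Y.lower_eq_top i.2 (Y.layer_of_false hi)]
      trivial

/-- The total cokernel is exact on short exact sequences with regular end term. -/
lemma tcok_shortExact {S : ShortComplex (ModFac ω σ ξ)} (hS : S.ShortExact)
    (h : RegularUpTo n S.X₃) : (S.map (TCok ω σ ξ)).ShortExact := by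
  obtain ⟨h₁, h₃, h₂⟩ := (shortExact_iff S).1 hS
  refine (shortExact_mk_iff _ _ _).2 ⟨?_, fun z => ?_, fun y hy => ?_⟩
  · refine (injective_iff_map_eq_zero ((TCok ω σ ξ).map S.f).hom).2 fun x hx => ?_
    obtain ⟨x, rfl⟩ := S.X₁.tcokMk_surjective x
    exact (tcokMk_eq_zero_iff _ _).2 (mem_lower_of_shortExact hS le_rfl h
      ((tcokMk_eq_zero_iff _ _).1 hx))
  · obtain ⟨z, rfl⟩ := S.X₃.tcokMk_surjective z
    obtain ⟨y, rfl⟩ := h₃ _ z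
    exact ⟨S.X₂.tcokMk y, rfl⟩
  · obtain ⟨y, rfl⟩ := S.X₂.tcokMk_surjective y
    obtain ⟨y', hy', hyy'⟩ := exists_mem_lower h₃ ((tcokMk_eq_zero_iff _ _).1 hy)
    obtain ⟨x, hx⟩ := h₂ _ (y - y') (by rw [map_sub, hyy', sub_self])
    refine ⟨S.X₁.tcokMk x, ?_⟩
    refine (congrArg S.X₂.tcokMk hx).trans ?_
    rw [map_sub, (tcokMk_eq_zero_iff _ _).2 hy', sub_zero]

end TCok

end ModFac

/-! ### Extensions and total cokernels -/

namespace ExactCat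

open Abelian

/-- In a Frobenius class, projective objects are injective relative to the class in all degrees, by
dimension shifting. -/
lemma FrobClass.ext_of_projective {C : Type u} [Category.{v} C] [Abelian C] [HasExt.{u'} C]
    {P : ObjectProperty C} (hP : FrobClass P) {Q : C} (hQ : Projective Q) (hQP : P Q) (m : ℕ) :
    ∀ X : C, P X → Subsingleton (Ext.{u'} X Q (m + 1)) := by
  induction m with
  | zero =>
    intro X hX
    obtain ⟨K, W, i, p, w, hS, hW, hWP, hK⟩ := hP.cover X hX
    exact ext_one_of_extend hS (HasProjectiveDimensionLT.subsingleton W 1 1 le_rfl Q)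
      fun f => hP.extend _ hS hX Q hQP hQ f
  | succ m ih =>
    intro X hX
    obtain ⟨K, W, i, p, w, hS, hW, hWP, hK⟩ := hP.cover X hX
    exact ext_contra_X₃ hS (ih K hK) (HasProjectiveDimensionLT.subsingleton W 1 _ (by lia) Q)

end ExactCat

namespace ModFac

open ExactCat

variable {A : Type u} [Ring A] {n : ℕ}
variable {ω : Fin n → A} {σ : Fin n → A ≃+* A} {ξ : Fin n → Fin n → Aˣ}

lemma exists_lowerFac_succ (Y : ModFac ω σ ξ) (k : ℕ) :
    ∃ f : (Y.lowerFac k).toModFac ⟶ (Y.lowerFac (k + 1)).toModFac,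
      f ≫ (Y.lowerFac (k + 1)).incl = (Y.lowerFac k).incl :=
  exists_lift (Y.lowerFac (k + 1)).incl_injective _ fun α z => (Y.lowerFac (k + 1)).exists_incl
    ((iSup₂_le fun _ hi => Y.layer_le_lower (hi.trans k.lt_succ_self) α :
      Y.lower k α ≤ Y.lower (k + 1) α) ((Y.lowerFac k).incl_mem z))

/-- The successive quotients by the subobjects `lower` of a regular module factorization with
projective components resolve one another. -/
lemma hasProjectiveDimensionLE_quot {Y : ModFac ω σ ξ} (hP : ∀ α, Projective (Y.X α))
    (hY : RegularUpTo n Y) : ∀ k ≤ n, ∀ α,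
      HasProjectiveDimensionLE ((Y.lowerFac k).quot.X α) k := by
  intro k
  induction k with
  | zero =>
    intro _ α
    have hb : Function.Bijective (Hom.app (Y.lowerFac 0).proj α).hom := by
      refine ⟨(injective_iff_map_eq_zero _).2 fun x hx => ?_, (Y.lowerFac 0).proj_surjective α⟩
      have := ((Y.lowerFac 0).proj_eq_zero_iff x).1 hx
      change x ∈ Y.lower 0 α at this
      rwa [lower_zero, Submodule.mem_bot] at this
    have := hP α
    exact hasProjectiveDimensionLT_of_iso
      (LinearEquiv.toModuleIso (LinearEquiv.ofBijective _ hb)) 1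
  | succ k ih =>
    intro hk α
    rcases hα : α ⟨k, hk⟩ with _ | _
    · have : IsZero ((Y.lowerFac (k + 1)).quot.X α) := by
        rw [IsZero.iff_id_eq_zero]
        ext x
        obtain ⟨x, rfl⟩ := (Y.lowerFac (k + 1)).proj_surjective α x
        refine ((Y.lowerFac (k + 1)).proj_eq_zero_iff x).2 ?_
        change x ∈ Y.lower (k + 1) α
        rw [Y.lower_eq_top (i := ⟨k, hk⟩) k.lt_succ_self (Y.layer_of_false hα)]
        trivial
      have := this.hasProjectiveDimensionLT_zero
      exact hasProjectiveDimensionLT_of_ge _ 0 _ (Nat.zero_le _)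
    · have h := isEdge_toggle' hα
      obtain ⟨q, hq⟩ := exists_desc (Y.lowerFac k).proj_surjective (Y.lowerFac (k + 1)).proj
        fun α x hx => ((Y.lowerFac (k + 1)).proj_eq_zero_iff x).2
          ((iSup₂_le fun _ hi => Y.layer_le_lower (hi.trans k.lt_succ_self) α :
            Y.lower k α ≤ Y.lower (k + 1) α) (((Y.lowerFac k).proj_eq_zero_iff x).1 hx))
      have hq' : ∀ α x, Hom.app q α (Hom.app (Y.lowerFac k).proj α x) =
        Hom.app (Y.lowerFac (k + 1)).proj α x := fun α x => app_apply_eq hq α x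
      have hw : (Y.lowerFac k).quot.d _ _ _ h ≫ Hom.app q α = 0 := by
        ext x
        obtain ⟨x, rfl⟩ := (Y.lowerFac k).proj_surjective _ x
        change Hom.app q α ((Y.lowerFac k).quot.d _ _ _ h (Hom.app (Y.lowerFac k).proj _ x)) = 0
        rw [Hom.app_d, hq']
        exact ((Y.lowerFac (k + 1)).proj_eq_zero_iff _).2 (Y.layer_le_lower (i := ⟨k, hk⟩)
          k.lt_succ_self _ ((Y.mem_layer_iff h _).2 ⟨x, rfl⟩))
      have hS : (ShortComplex.mk _ _ hw).ShortExact := by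
        rw [shortExact_mk_iff]
        refine ⟨(injective_iff_map_eq_zero ((Y.lowerFac k).quot.d _ _ _ h).hom).2 fun x hx => ?_,
          fun z => ?_, fun y hy => ?_⟩
        · obtain ⟨x, rfl⟩ := (Y.lowerFac k).proj_surjective _ x
          refine ((Y.lowerFac k).proj_eq_zero_iff x).2 (hY ⟨k, hk⟩ hk _ _ h x ?_)
          exact ((Y.lowerFac k).proj_eq_zero_iff _).1 ((Hom.app_d _ _ _ _ h x).symm.trans hx)
        · obtain ⟨z, rfl⟩ := (Y.lowerFac (k + 1)).proj_surjective _ z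
          exact ⟨_, hq' α z⟩
        · obtain ⟨y, rfl⟩ := (Y.lowerFac k).proj_surjective _ y
          rw [hq'] at hy
          have hy' : y ∈ Y.lower (k + 1) α := ((Y.lowerFac (k + 1)).proj_eq_zero_iff _).1 hy
          rw [lower_succ _ hk] at hy'
          obtain ⟨a, ha, b, hb, rfl⟩ := Submodule.mem_sup.1 hy'
          obtain ⟨w, rfl⟩ := (Y.mem_layer_iff h b).1 hb
          refine ⟨Hom.app (Y.lowerFac k).proj _ w, ?_⟩
          rw [Hom.app_d, map_add, ((Y.lowerFac k).proj_eq_zero_iff a).2 ha, zero_add]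
      exact hS.hasProjectiveDimensionLT_X₃ (k + 1) (ih (k.le_succ.trans hk) _)
        (@hasProjectiveDimensionLT_of_ge _ _ _ _ (k + 1) _ (by lia)
          (ih (k.le_succ.trans hk) α))

/-- The total cokernel of a regular module factorization with projective components has finite
projective dimension. -/
lemma hasProjectiveDimensionLE_tcok {Y : ModFac ω σ ξ} (hP : ∀ α, Projective (Y.X α))
    (hY : RegularUpTo n Y) : HasProjectiveDimensionLE
      ((ModuleCat.restrictScalars.{u} (Ideal.Quotient.mk (ideal ω))).obj
        ((TCok ω σ ξ).obj Y)) n := by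
  have := hasProjectiveDimensionLE_quot hP hY n le_rfl fun _ => true
  refine @hasProjectiveDimensionLT_of_iso _ _ _ _ _ (LinearEquiv.toModuleIso ?_) (n + 1) this
  exact Submodule.quotEquivOfEq _ _ Y.edgeRange_eq.symm

lemma tcok_projective {W : ModFac ω σ ξ} (hW : Projective W) :
    Projective ((TCok ω σ ξ).obj W) := by
  have : (skyTop ω σ ξ).PreservesEpimorphisms := ⟨fun f hf => (epi_iff_surjective _).2 fun α y => by
    choose x hx using fun h => (ModuleCat.epi_iff_surjective f).1 hf (y h)
    exact ⟨x, funext hx⟩⟩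
  exact (tcokAdjunction ω σ ξ).map_projective W hW

variable [TypeData ω σ ξ]

/-- A module factorization with projective facets has no extensions by the subobjects `lower` of a
regular one: in direction `k`, the `k`-th subquotient has bijective maps `d`. -/
lemma ext_lowerFac {X Y : ModFac ω σ ξ} (hX : ∀ i, Projective (X.facet i))
    (hY : RegularUpTo n Y) (m : ℕ) : ∀ k ≤ n,
      Subsingleton (Abelian.Ext.{u} X (Y.lowerFac k).toModFac (m + 1)) := by
  intro k
  induction k with
  | zero =>
    intro _
    refine ext_of_isZero_right _ ?_
    rw [IsZero.iff_id_eq_zero]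
    refine hom_ext' fun α x => (Y.lowerFac 0).incl_injective α ?_
    have h : ∀ x, Hom.app (Y.lowerFac 0).incl α x = 0 := fun x => by
      have := (Y.lowerFac 0).incl_mem x
      change _ ∈ Y.lower 0 α at this
      rwa [lower_zero, Submodule.mem_bot] at this
    exact (h _).trans (h _).symm
  | succ k ih =>
    intro hk
    obtain ⟨f, hf⟩ := Y.exists_lowerFac_succ k
    have hf' : ∀ α x, Hom.app (Y.lowerFac (k + 1)).incl α (Hom.app f α x) =
      Hom.app (Y.lowerFac k).incl α x := fun α x => app_apply_eq hf α x
    have hmono : Mono f := (mono_iff_injective f).2 fun α x y hxy => by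
      refine (Y.lowerFac k).incl_injective α ?_
      rw [← hf', ← hf', hxy]
    have hS := shortExact_cokernel f
    obtain ⟨-, hπ, hker⟩ := (shortExact_iff _).1 hS
    have hzero : ∀ α x, Hom.app (cokernel.π f) α (Hom.app f α x) = 0 := fun α x =>
      app_apply_eq (cokernel.condition f) α x
    refine ext_co_X₂ hS (ih (k.le_succ.trans hk)) (ext_of_bijective (hX ⟨k, hk⟩) ?_ m)
    intro α β h
    constructor
    · refine (injective_iff_map_eq_zero ((cokernel f).d _ α β h).hom).2 fun c hc => ?_
      obtain ⟨x, rfl⟩ := hπ α c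
      obtain ⟨z, hz⟩ := hker β _ ((Hom.app_d _ _ _ _ h x).symm.trans hc)
      have hx : Hom.app (Y.lowerFac (k + 1)).incl α x ∈ Y.lower k α := by
        refine hY ⟨k, hk⟩ hk α β h _ ?_
        rw [Hom.app_d]
        rw [← show Hom.app f β z = _ from hz, hf']
        exact (Y.lowerFac k).incl_mem z
      obtain ⟨z', hz'⟩ := (Y.lowerFac k).exists_incl hx
      have : x = Hom.app f α z' := (Y.lowerFac (k + 1)).incl_injective α (by rw [hf', hz'])
      rw [this]
      exact hzero α z'
    · intro c
      obtain ⟨y, rfl⟩ := hπ β c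
      have hy : _ ∈ Y.lower (k + 1) β := (Y.lowerFac (k + 1)).incl_mem y
      rw [lower_succ _ hk] at hy
      obtain ⟨a, ha, b, hb, hab⟩ := Submodule.mem_sup.1 hy
      obtain ⟨w, rfl⟩ := (Y.mem_layer_iff h b).1 hb
      have hw : w ∈ Y.lower (k + 1) α := by
        rw [Y.lower_eq_top (i := ⟨k, hk⟩) k.lt_succ_self (Y.layer_of_false h.1)]
        trivial
      obtain ⟨w', hw'⟩ := (Y.lowerFac (k + 1)).exists_incl hw
      obtain ⟨a', ha'⟩ := (Y.lowerFac k).exists_incl ha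
      refine ⟨Hom.app (cokernel.π f) α w', ?_⟩
      have e : y = Hom.app f β a' + (Y.lowerFac (k + 1)).toModFac.d _ α β h w' := by
        refine (Y.lowerFac (k + 1)).incl_injective β ?_
        rw [map_add, hf', ha', ← Hom.app_d, hw', hab]
      rw [Hom.app_d]
      refine Eq.trans ?_ (congrArg (Hom.app (cokernel.π f) β) e).symm
      rw [map_add, hzero, zero_add]

/-- Every projective module is a direct summand of a total cokernel. -/
lemma exists_retract_tcok {Q : ModuleCat.{u} (A ⧸ ideal ω)} (hQ : Projective Q) :
    ∃ W : ModFac ω σ ξ, Projective W ∧ Nonempty (Retract Q ((TCok ω σ ξ).obj W)) := by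
  let W := Projective.over ((skyTop ω σ ξ).obj Q)
  let π : W ⟶ (skyTop ω σ ξ).obj Q := Projective.π _
  have : Epi (fromSky π) := (ModuleCat.epi_iff_surjective _).2 fun q => by
    obtain ⟨x, hx⟩ := (epi_iff_surjective π).1 inferInstance (fun _ => true) fun _ => q
    exact ⟨W.tcokMk x, congrFun hx ⟨rfl⟩⟩
  exact ⟨W, inferInstance, ⟨⟨Projective.factorThru (𝟙 Q) (fromSky π), fromSky π,
    Projective.factorThru_comp _ _⟩⟩⟩

section

variable (hreg : IsRegularSeq ω)
include hreg

/-- Projective modules over the quotient ring have finite projective dimension over `A`. -/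
lemma hasProjectiveDimensionLE_of_projective (σ : Fin n → A ≃+* A) (ξ : Fin n → Fin n → Aˣ)
    [TypeData ω σ ξ] {Q : ModuleCat.{u} (A ⧸ ideal ω)}
    (hQ : Projective Q) : HasProjectiveDimensionLE
      ((ModuleCat.restrictScalars.{u} (Ideal.Quotient.mk (ideal ω))).obj Q) n := by
  obtain ⟨W, hW, ⟨r⟩⟩ := exists_retract_tcok (σ := σ) (ξ := ξ) hQ
  have := hasProjectiveDimensionLE_tcok (projective_component hW)
    (regularUpTo_of_projective hreg hW)
  exact (r.map (ModuleCat.restrictScalars.{u} (Ideal.Quotient.mk (ideal ω)))).hasProjectiveDimensionLT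
    (n + 1)

lemma ext_skyTop {X : ModFac ω σ ξ} (hX : GF0 ω σ ξ X) {Q : ModuleCat.{u} (A ⧸ ideal ω)}
    (hQ : Projective Q) (m : ℕ) :
    Subsingleton (Abelian.Ext.{u} X ((skyTop ω σ ξ).obj Q) (m + 1)) := by
  obtain ⟨W, hW, ⟨r⟩⟩ := exists_retract_tcok (σ := σ) (ξ := ξ) hQ
  refine ext_retract_right (r.map (skyTop ω σ ξ)) ?_
  obtain ⟨w, hS⟩ := shortExact_tcok W
  rw [GF0, isZeroType_iff (frobClass_isGProj A) isTwistClosed_isGProj] at hX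
  exact ext_co_X₃ hS ((frobClass_hasComponents (frobClass_isGProj A)
    isTwistClosed_isGProj).ext_of_projective hW (fun α => isGProj_of_projective
      (projective_component hW α)) m X hX.1)
    (ext_lowerFac hX.2 (regularUpTo_of_projective hreg hW) (m + 1) n le_rfl)

/-- The total cokernel of a module factorization of zero type is Gorenstein projective. -/
theorem isGProj_tcok {X : ModFac ω σ ξ} (hX : GF0 ω σ ξ X) :
    IsGProj (A ⧸ ideal ω) ((TCok ω σ ξ).obj X) := by
  have hF := frobClass_isZeroType (ω := ω) (σ := σ) (ξ := ξ) (frobClass_isGProj A)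
    isTwistClosed_isGProj
  have hR : ∀ X, GF0 ω σ ξ X → RegularUpTo n X := fun X hX =>
    regularUpTo_of_hasComponents hreg (frobClass_isGProj A) isTwistClosed_isGProj hX.1
  refine le_isGProj_of_ext (W := fun M => ∃ X, GF0 ω σ ξ X ∧ M = (TCok ω σ ξ).obj X) ?_ ?_ _
    ⟨X, hX, rfl⟩
  · intro M hM Q hQ m
    induction m generalizing M with
    | zero =>
      obtain ⟨X, hX, rfl⟩ := hM
      obtain ⟨K, W, i, p, w, hS, hW, hWP, hK⟩ := hF.cover X hX
      have := tcok_projective hW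
      refine ext_one_of_extend (tcok_shortExact hS (hR X hX))
        (HasProjectiveDimensionLT.subsingleton ((TCok ω σ ξ).obj W) 1 1 le_rfl Q) fun f => ?_
      obtain ⟨g, hg⟩ := extend_of_ext hS (ext_skyTop hreg hX hQ 0) (toSky f)
      refine ⟨fromSky g, ?_⟩
      ext x
      obtain ⟨x, rfl⟩ := K.tcokMk_surjective x
      exact congrFun (app_apply_eq hg _ x) ⟨rfl⟩
    | succ m ih =>
      obtain ⟨X, hX, rfl⟩ := hM
      obtain ⟨K, W, i, p, w, hS, hW, hWP, hK⟩ := hF.cover X hX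
      have := tcok_projective hW
      exact ext_contra_X₃ (tcok_shortExact hS (hR X hX)) (ih _ ⟨K, hK, rfl⟩)
        (HasProjectiveDimensionLT.subsingleton ((TCok ω σ ξ).obj W) 1 _ (by lia) Q)
  · rintro M ⟨X, hX, rfl⟩
    obtain ⟨W, Z, i, p, w, hS, hW, hWP, hZ⟩ := hF.hull X hX
    exact ⟨_, _, _, _, _, tcok_shortExact hS (hR Z hZ), tcok_projective hW, Z, hZ, rfl⟩

variable {P : ObjectProperty (ModuleCat.{u} A)} (hP : FrobClass P) (hT : IsTwistClosed P)
include hP hT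

/-- The obstruction to lifting a morphism of total cokernels lies in `Ext 1` of `X` by the kernel of
`Y ⟶ skyTop (TCok Y)`, which vanishes by `ext_lowerFac`. -/
theorem tcok_full {X Y : ModFac ω σ ξ} (hX : IsZeroType ω σ ξ P X) (hY : IsZeroType ω σ ξ P Y)
    (g : (TCok ω σ ξ).obj X ⟶ (TCok ω σ ξ).obj Y) : ∃ f : X ⟶ Y, (TCok ω σ ξ).map f = g := by
  obtain ⟨w, hS⟩ := shortExact_tcok Y
  obtain ⟨f, hf⟩ := lift_of_ext hS (ext_lowerFac ((isZeroType_iff hP hT X).1 hX).2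
    (regularUpTo_of_hasComponents hreg hP hT hY.1) 0 n le_rfl) (toSky g)
  refine ⟨f, ?_⟩
  ext x
  obtain ⟨x, rfl⟩ := X.tcokMk_surjective x
  exact congrFun (app_apply_eq hf _ x) ⟨rfl⟩

/-- A morphism whose total cokernel factors through a projective module factors through a
projective module factorization. -/
theorem exists_factor_of_tcok (hle : P ≤ IsGProj A) {X Y : ModFac ω σ ξ}
    (hX : IsZeroType ω σ ξ P X) (hY : IsZeroType ω σ ξ P Y) (f : X ⟶ Y)
    {Q : ModuleCat.{u} (A ⧸ ideal ω)} (hQ : Projective Q) (s : (TCok ω σ ξ).obj X ⟶ Q)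
    (t : Q ⟶ (TCok ω σ ξ).obj Y) (h : (TCok ω σ ξ).map f = s ≫ t) :
    ∃ (I : ModFac ω σ ξ) (_ : IsZeroType ω σ ξ P I) (_ : Projective I) (s : X ⟶ I) (t : I ⟶ Y),
      f = s ≫ t := by
  obtain ⟨I, Z, i, p, w, hS, hI, hIP, hZ⟩ := (frobClass_isZeroType hP hT).hull X hX
  have hZ' := (isZeroType_iff hP hT Z).1 hZ
  have hZ'' : GF0 ω σ ξ Z := (isZeroType_iff (frobClass_isGProj A) isTwistClosed_isGProj Z).2
    ⟨fun α => hle _ (hZ'.1 α), hZ'.2⟩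
  obtain ⟨g, hg⟩ := extend_of_ext hS (ext_skyTop hreg hZ'' hQ 0) (toSky s)
  obtain ⟨w', hS'⟩ := shortExact_tcok Y
  have : Epi (toSky (𝟙 ((TCok ω σ ξ).obj Y))) := hS'.epi_g
  -- `f` and the composite `i ≫ l` through a projective object have the same total cokernel, so that
  -- their difference takes values in the kernel and extends along `i`
  let l : I ⟶ Y := Projective.factorThru (g ≫ (skyTop ω σ ξ).map t) (toSky (𝟙 _))
  have hl : l ≫ toSky (𝟙 _) = g ≫ (skyTop ω σ ξ).map t := Projective.factorThru_comp _ _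
  have hz : (f - i ≫ l) ≫ toSky (𝟙 _) = 0 := by
    rw [Preadditive.sub_comp, Category.assoc, hl, ← Category.assoc, show i ≫ g = toSky s from hg,
      sub_eq_zero]
    refine skyTop_hom_ext fun x => ?_
    exact congrArg (fun (k : (TCok ω σ ξ).obj X ⟶ (TCok ω σ ξ).obj Y) => k.hom (X.tcokMk x)) h
  obtain ⟨k, hk⟩ := KernelFork.IsLimit.lift' hS'.fIsKernel (f - i ≫ l) hz
  obtain ⟨k', hk'⟩ := extend_of_ext hS (ext_lowerFac hZ'.2
    (regularUpTo_of_hasComponents hreg hP hT hY.1) 0 n le_rfl) k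
  refine ⟨I, hIP, hI, i, l + k' ≫ (Y.lowerFac n).incl, ?_⟩
  have hk'' : k ≫ (Y.lowerFac n).incl = f - i ≫ l := hk
  rw [Preadditive.comp_add, ← Category.assoc, show i ≫ k' = k from hk', hk'']
  abel

end

end ModFac

/-! ### Modules as total cokernels -/

namespace ModFac

open ExactCat

variable {A : Type u} [Ring A] {n : ℕ}
variable {ω : Fin n → A} {σ : Fin n → A ≃+* A} {ξ : Fin n → Fin n → Aˣ}

variable (n) in
/-- The vertex whose first `k` coordinates are `true`. -/
def stair (k : ℕ) : Fin n → Bool := fun i => decide ((i : ℕ) < k)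

lemma stair_of_lt {k : ℕ} {i : Fin n} (h : (i : ℕ) < k) : stair n k i = true := by simp [stair, h]

lemma stair_of_le {k : ℕ} {i : Fin n} (h : k ≤ (i : ℕ)) : stair n k i = false := by
  simp [stair, h]

lemma isEdge_stair {k : ℕ} (hk : k < n) : IsEdge ⟨k, hk⟩ (stair n k) (stair n (k + 1)) := by
  refine ⟨stair_of_le le_rfl, stair_of_lt k.lt_succ_self, fun j hj => ?_⟩
  have : (j : ℕ) ≠ k := fun h => hj (Fin.ext h)
  simp only [stair, decide_eq_decide]
  lia

/-- The module factorization `Z` is concentrated in the vertex `stair n k` with value `M`, up to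
the first `k` maps `d`. -/
structure IsStage (k : ℕ) (Z : ModFac ω σ ξ) (M : ModuleCat.{u} A) : Prop where
  regular : RegularUpTo k Z
  lower_eq_top : ∀ α, α ≠ stair n k → Z.lower k α = ⊤
  exists_map : ∃ q : Z.X (stair n k) →ₗ[A] M, Function.Surjective q ∧
    ∀ x, q x = 0 ↔ x ∈ Z.lower k (stair n k)

/-- A syzygy of a stage, with respect to a cover which is generated by its maps `d` in the first
directions, is a stage in the next direction. -/
lemma IsStage.succ {k : ℕ} (hk : k < n) {S : ShortComplex (ModFac ω σ ξ)} (hS : S.ShortExact)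
    {M : ModuleCat.{u} A} (h : IsStage k S.X₃ M) (hreg : RegularUpTo n S.X₂)
    (htop : ∀ α, S.X₂.lower (k + 1) α = ⊤) : IsStage (k + 1) S.X₁ M := by
  obtain ⟨h₁, h₃, h₂⟩ := (shortExact_iff S).1 hS
  have hfg : ∀ α x, Hom.app S.g α (Hom.app S.f α x) = 0 := fun α x => app_apply_eq S.zero α x
  have hlow : ∀ α (x : S.X₁.X α), Hom.app S.f α x ∈ S.X₂.lower k α → x ∈ S.X₁.lower k α :=
    fun α x hx => mem_lower_of_shortExact hS hk.le h.regular hx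
  -- An element `u + d w` of the kernel lies in `lower (k + 1)` as soon as `w` is mapped
  -- to `lower k`.
  have key : ∀ α β (he : IsEdge ⟨k, hk⟩ α β) (x : S.X₁.X β) (u : S.X₂.X β) (w : S.X₂.X α),
      u ∈ S.X₂.lower k β → Hom.app S.f β x = u + S.X₂.d _ α β he w →
      Hom.app S.g α w ∈ S.X₃.lower k α → x ∈ S.X₁.lower (k + 1) β := by
    intro α β he x u w hu hx hw
    obtain ⟨w', hw', hww'⟩ := exists_mem_lower h₃ hw
    obtain ⟨z, hz⟩ := h₂ α (w - w') (by rw [map_sub, hww', sub_self])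
    rw [lower_succ _ hk]
    refine Submodule.mem_sup.2 ⟨x - S.X₁.d _ α β he z, hlow _ _ ?_, _,
      (mem_layer_iff _ he _).2 ⟨z, rfl⟩, sub_add_cancel _ _⟩
    rw [map_sub, ← S.f.app_d, hz, hx, map_sub]
    have e : ∀ a b c : S.X₂.X β, a + b - (b - c) = a + c := fun a b c => by abel
    rw [e]
    exact add_mem hu (S.X₂.d_mem_lower _ hw')
  have hdec : ∀ α β (he : IsEdge ⟨k, hk⟩ α β) (x : S.X₂.X β), ∃ u ∈ S.X₂.lower k β,
      ∃ w, x = u + S.X₂.d _ α β he w := by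
    intro α β he x
    have hx : x ∈ S.X₂.lower (k + 1) β := by rw [htop]; trivial
    rw [lower_succ _ hk] at hx
    obtain ⟨u, hu, y, hy, rfl⟩ := Submodule.mem_sup.1 hx
    obtain ⟨w, rfl⟩ := (mem_layer_iff _ he y).1 hy
    exact ⟨u, hu, w, rfl⟩
  refine ⟨.of_shortExact hS (hreg.mono hk) h.regular, fun α hα => ?_, ?_⟩
  · rcases hαk : α ⟨k, hk⟩ with _ | _
    · exact S.X₁.lower_eq_top (i := ⟨k, hk⟩) k.lt_succ_self (S.X₁.layer_of_false hαk)
    · refine eq_top_iff.2 fun x _ => ?_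
      have he := isEdge_toggle' hαk
      obtain ⟨u, hu, w, hw⟩ := hdec _ _ he (Hom.app S.f α x)
      refine key _ _ he x u w hu hw ?_
      rw [h.lower_eq_top _ fun hc => hα ?_]
      · trivial
      · rw [← (isEdge_stair hk).toggle_eq, ← hc, toggle_toggle]
  · obtain ⟨q, hq, hq'⟩ := h.exists_map
    have he := isEdge_stair hk
    -- The map `d` induces an isomorphism modulo `lower k`.
    let δ : (S.X₂.X (stair n k) ⧸ S.X₂.lower k (stair n k)) →ₗ[A]
        (S.X₂.X (stair n (k + 1)) ⧸ S.X₂.lower k (stair n (k + 1))) :=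
      Submodule.mapQ _ _ (S.X₂.d _ _ _ he).hom fun x hx => S.X₂.d_mem_lower he hx
    have hδ : Function.Bijective δ := by
      refine ⟨(injective_iff_map_eq_zero δ).2 fun x hx => ?_, fun y => ?_⟩
      · obtain ⟨x, rfl⟩ := Submodule.mkQ_surjective _ x
        exact (Submodule.Quotient.mk_eq_zero _).2
          (hreg ⟨k, hk⟩ hk _ _ he x ((Submodule.Quotient.mk_eq_zero _).1 hx))
      · obtain ⟨y, rfl⟩ := Submodule.mkQ_surjective _ y
        obtain ⟨u, hu, w, rfl⟩ := hdec _ _ he y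
        refine ⟨Submodule.mkQ _ w, ?_⟩
        rw [map_add, Submodule.mkQ_apply _ u, (Submodule.Quotient.mk_eq_zero _).2 hu, zero_add]
        rfl
    let ψ : (S.X₂.X (stair n k) ⧸ S.X₂.lower k (stair n k)) →ₗ[A] M :=
      Submodule.liftQ _ (q ∘ₗ (Hom.app S.g (stair n k)).hom) fun x hx =>
        (hq' _).2 (app_mem_lower S.g hx)
    let q' : S.X₁.X (stair n (k + 1)) →ₗ[A] M := ψ ∘ₗ
      (LinearEquiv.ofBijective δ hδ).symm.toLinearMap ∘ₗ
      Submodule.mkQ _ ∘ₗ (Hom.app S.f (stair n (k + 1))).hom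
    have hval : ∀ x u w, u ∈ S.X₂.lower k (stair n (k + 1)) →
        Hom.app S.f (stair n (k + 1)) x = u + S.X₂.d _ _ _ he w →
        q' x = q (Hom.app S.g (stair n k) w) := by
      intro x u w hu hx
      have e : (LinearEquiv.ofBijective δ hδ).symm
          (Submodule.mkQ _ (Hom.app S.f (stair n (k + 1)) x)) = Submodule.mkQ _ w := by
        rw [LinearEquiv.symm_apply_eq, hx, map_add, Submodule.mkQ_apply _ u,
          (Submodule.Quotient.mk_eq_zero _).2 hu, zero_add]
        rfl
      exact congrArg ψ e
    refine ⟨q', fun m => ?_, fun x => ?_⟩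
    · obtain ⟨y, rfl⟩ := hq m
      obtain ⟨w, rfl⟩ := h₃ _ y
      have hmem : Hom.app S.g _ (S.X₂.d _ _ _ he w) ∈ S.X₃.lower k (stair n (k + 1)) := by
        rw [h.lower_eq_top _ fun hc => ?_]
        · trivial
        · have := congrFun hc ⟨k, hk⟩
          rw [he.1, he.2.1] at this
          exact absurd this (by simp)
      obtain ⟨u, hu, hu'⟩ := exists_mem_lower h₃ hmem
      obtain ⟨x, hx⟩ := h₂ _ (-u + S.X₂.d _ _ _ he w) (by
        rw [map_add, map_neg, hu', neg_add_cancel])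
      exact ⟨x, hval x (-u) w (neg_mem hu) hx⟩
    · obtain ⟨u, hu, w, hw⟩ := hdec _ _ he (Hom.app S.f _ x)
      rw [hval x u w hu hw, hq']
      refine ⟨key _ _ he x u w hu hw, fun hx => ?_⟩
      rw [lower_succ _ hk] at hx
      obtain ⟨a, ha, b, hb, rfl⟩ := Submodule.mem_sup.1 hx
      obtain ⟨z, rfl⟩ := (mem_layer_iff _ he b).1 hb
      have e : Hom.app S.f _ (a + S.X₁.d _ _ _ he z) =
          Hom.app S.f _ a + S.X₂.d _ _ _ he (Hom.app S.f _ z) := by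
        rw [map_add, S.f.app_d]
      have e₁ := hval _ _ _ (app_mem_lower S.f ha) e
      rw [hval _ u w hu hw, hfg, map_zero] at e₁
      exact (hq' _).1 e₁

end ModFac

/-! ### Syzygies -/

namespace ExactCat

open CategoryTheory.Abelian Opposite

section Syzygy

variable {C : Type u} [Category.{v} C] [Abelian C]

/-- `K` is a `k`-th syzygy of `M`, formed with arbitrary projective objects. -/
inductive IsSyzygy (M : C) : ℕ → C → Prop
  | zero {K : C} (e : K ≅ M) : IsSyzygy M 0 K
  | succ {k : ℕ} (S : ShortComplex C) : S.ShortExact → Projective S.X₂ → IsSyzygy M k S.X₃ →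
      IsSyzygy M (k + 1) S.X₁

lemma IsSyzygy.exists [EnoughProjectives C] (M : C) (k : ℕ) : ∃ K, IsSyzygy M k K := by
  induction k with
  | zero => exact ⟨M, .zero (Iso.refl M)⟩
  | succ k ih =>
    obtain ⟨K, hK⟩ := ih
    obtain ⟨S, hS, rfl, hP⟩ := exists_syzygy K
    exact ⟨S.X₁, .succ S hS hP hK⟩

lemma IsSyzygy.ext [HasExt.{w} C] {M K : C} {k : ℕ} (h : IsSyzygy M k K) {Y : C} {m : ℕ}
    (hM : Subsingleton (Ext.{w} M Y (m + 1 + k))) : Subsingleton (Ext.{w} K Y (m + 1)) := by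
  induction h generalizing m with
  | zero e => exact ext_retract_left e.retract hM
  | succ S hS hP _ ih =>
    refine ext_contra_X₁ hS (Ext.subsingleton_of_projective _ _ _) (ih (m := m + 1) ?_)
    convert hM using 2
    lia

lemma IsSyzygy.hasProjectiveDimensionLE {M K : C} {k : ℕ} (h : IsSyzygy M k K) {j : ℕ}
    (hM : HasProjectiveDimensionLE M (k + j)) : HasProjectiveDimensionLE K j := by
  induction h generalizing j with
  | zero e =>
    rw [zero_add] at hM
    exact hasProjectiveDimensionLT_of_iso e.symm (j + 1)
  | @succ k S hS hP _ ih =>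
    have := ih (j := j + 1) (by convert hM using 1; lia)
    exact hS.hasProjectiveDimensionLT_X₁ (j + 1) (hasProjectiveDimensionLT_of_ge _ 1 _ (by lia)) this

/-- The horseshoe lemma, for coverings. -/
lemma exists_horseshoe_cover {S : ShortComplex C} (hS : S.ShortExact) {P₁ C₁ P₃ C₃ : C}
    {i₁ : C₁ ⟶ P₁} {p₁ : P₁ ⟶ S.X₁} {w₁ : i₁ ≫ p₁ = 0}
    (h₁ : (ShortComplex.mk i₁ p₁ w₁).ShortExact) (hP₁ : Projective P₁)
    {i₃ : C₃ ⟶ P₃} {p₃ : P₃ ⟶ S.X₃} {w₃ : i₃ ≫ p₃ = 0}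
    (h₃ : (ShortComplex.mk i₃ p₃ w₃).ShortExact) (hP₃ : Projective P₃) :
    ∃ (P Z : C) (j : Z ⟶ P) (q : P ⟶ S.X₂) (w : j ≫ q = 0)
      (a : C₁ ⟶ Z) (b : Z ⟶ C₃) (w' : a ≫ b = 0), Projective P ∧
      (ShortComplex.mk j q w).ShortExact ∧ (ShortComplex.mk a b w').ShortExact := by
  have := hS.epi_g
  obtain ⟨Z, j, q, w, a, b, w', h, h'⟩ := exists_horseshoe hS.op h₃.op h₁.op
    (Projective.factorThru p₃ S.g).op (congrArg Quiver.Hom.op (Projective.factorThru_comp p₃ S.g))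
  have i₁ : Injective (op P₁) := Injective.projective_iff_injective_op.1 hP₁
  have i₃ : Injective (op P₃) := Injective.projective_iff_injective_op.1 hP₃
  have : Injective (op (op P₃ ⊞ op P₁).unop) := inferInstanceAs (Injective (op P₃ ⊞ op P₁))
  exact ⟨_, Z.unop, q.unop, j.unop, _, b.unop, a.unop, _,
    Injective.projective_iff_injective_op.2 this, h.unop, h'.unop⟩

/-- Syzygies of the outer terms of a short exact sequence are the outer terms of a short exact
sequence of syzygies. -/
lemma IsSyzygy.exists_shortExact (k : ℕ) {S : ShortComplex C} (hS : S.ShortExact) {K₁ K₃ : C}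
    (h₁ : IsSyzygy S.X₁ k K₁) (h₃ : IsSyzygy S.X₃ k K₃) :
    ∃ (L : C) (a : K₁ ⟶ L) (b : L ⟶ K₃) (w : a ≫ b = 0),
      (ShortComplex.mk a b w).ShortExact ∧ IsSyzygy S.X₂ k L := by
  induction k generalizing K₁ K₃ with
  | zero =>
    obtain ⟨e₁⟩ := h₁
    obtain ⟨e₃⟩ := h₃
    refine ⟨S.X₂, e₁.hom ≫ S.f, S.g ≫ e₃.inv, by simp [S.zero_assoc], ?_, .zero (Iso.refl _)⟩
    exact shortExact_of_isos hS e₁.symm (Iso.refl _) e₃.symm (by simp) (by simp) _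
  | succ k ih =>
    obtain ⟨⟩ | ⟨S₁, hS₁, hP₁, h₁⟩ := h₁
    obtain ⟨⟩ | ⟨S₃, hS₃, hP₃, h₃⟩ := h₃
    obtain ⟨L, a, b, w, hL, hL'⟩ := ih h₁ h₃
    obtain ⟨P, Z, j, q, w, a', b', w', hP, h, h'⟩ := exists_horseshoe_cover hL hS₁ hP₁ hS₃ hP₃
    exact ⟨Z, a', b', w', h', .succ _ h hP hL'⟩

end Syzygy

end ExactCat

namespace ModFac

open ExactCat

section

variable {A : Type u} [Ring A] {ι : Type} [LinearOrder ι]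
variable {ω : ι → A} {σ : ι → A ≃+* A} {ξ : ι → ι → Aˣ}

/-- A module is isomorphic to the module of functions to it on the proofs of a true proposition. -/
def funIso {p : Prop} (h : p) (N : ModuleCat.{u} A) : ModuleCat.of A (PLift p → N) ≅ N where
  hom := ModuleCat.ofHom (LinearMap.proj ⟨h⟩)
  inv := ModuleCat.ofHom (LinearMap.pi fun _ => LinearMap.id)

lemma subsingleton_sky (σ : ι → A ≃+* A) (ξ : ι → ι → Aˣ) {S : Set (ι → Bool)} (hS : IsThin S)
    (M : ModuleCat.{u} (A ⧸ ideal ω)) {α : ι → Bool} (h : α ∉ S) :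
    Subsingleton ((skyObj σ ξ hS M).X α) :=
  ⟨fun _ _ => funext fun h' => absurd h'.down h⟩

lemma projective_of_subsingleton {X : ModFac ω σ ξ} (h : ∀ α, Subsingleton (X.X α)) :
    Projective X :=
  ⟨fun _ _ _ => ⟨0, hom_ext' fun α x => by
    rw [(h α).elim x 0]
    exact (map_zero _).trans (map_zero _).symm⟩⟩

end

variable {A : Type u} [Ring A] {n : ℕ}
variable {ω : Fin n → A} {σ : Fin n → A ≃+* A} {ξ : Fin n → Fin n → Aˣ}

/-- The module factorization with component `M` at `(0, …, 0)` and zero elsewhere. -/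
noncomputable abbrev skyBot (σ : Fin n → A ≃+* A) (ξ : Fin n → Fin n → Aˣ) :
    ModuleCat.{u} (A ⧸ ideal ω) ⥤ ModFac ω σ ξ := sky σ ξ (isThin_singleton (stair n 0))

lemma stair_zero_apply (i : Fin n) : stair n 0 i = false := stair_of_le (Nat.zero_le _)

lemma subsingleton_skyBot (M : ModuleCat.{u} (A ⧸ ideal ω)) {α : Fin n → Bool}
    (h : α ≠ stair n 0) : Subsingleton (((skyBot σ ξ).obj M).X α) :=
  subsingleton_sky σ ξ (isThin_singleton _) M h

lemma projective_facet_skyBot (M : ModuleCat.{u} (A ⧸ ideal ω)) (i : Fin n) :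
    Projective (((skyBot σ ξ).obj M).facet i) :=
  projective_of_subsingleton fun β => subsingleton_skyBot (σ := σ) (ξ := ξ) M fun h => by
    have := congrFun h i
    rw [facetVertex_self, stair_zero_apply] at this
    exact absurd this (by simp)

lemma isStage_skyBot (M : ModuleCat.{u} (A ⧸ ideal ω)) : IsStage 0 ((skyBot σ ξ).obj M)
    ((ModuleCat.restrictScalars.{u} (Ideal.Quotient.mk (ideal ω))).obj M) where
  regular := regularUpTo_zero _
  lower_eq_top α hα := by
    have := subsingleton_skyBot (σ := σ) (ξ := ξ) M hα
    exact Subsingleton.elim _ _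
  exists_map := by
    let e := funIso (Set.mem_singleton (stair n 0))
      ((ModuleCat.restrictScalars.{u} (Ideal.Quotient.mk (ideal ω))).obj M)
    refine ⟨e.hom.hom, e.toLinearEquiv.surjective, fun x => ?_⟩
    rw [lower_zero, Submodule.mem_bot]
    exact e.toLinearEquiv.map_eq_zero_iff

/-- The top component of a module factorization, modulo the images of all maps `d` into it, is its
total cokernel. -/
lemma tcok_iso (Z : ModFac ω σ ξ) (M : ModuleCat.{u} (A ⧸ ideal ω))
    (q : (Z.X fun _ => true) →ₗ[A]
      (ModuleCat.restrictScalars.{u} (Ideal.Quotient.mk (ideal ω))).obj M)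
    (hq : Function.Surjective q) (hq' : ∀ x, q x = 0 ↔ x ∈ Z.lower n fun _ => true) :
    Nonempty ((TCok ω σ ξ).obj Z ≅ M) := by
  have hle : Z.edgeRange ≤ LinearMap.ker q := fun x hx => (hq' x).2 (Z.edgeRange_eq ▸ hx)
  let f : Z.TCokType →ₗ[A ⧸ ideal ω] M :=
    { toFun := Submodule.liftQ Z.edgeRange q hle
      map_add' := fun x y => map_add (Submodule.liftQ Z.edgeRange q hle) x y
      map_smul' := fun b x => by
        obtain ⟨a, rfl⟩ := Ideal.Quotient.mk_surjective b
        exact map_smul (Submodule.liftQ Z.edgeRange q hle) a x }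
  have hf : ∀ x, f (Z.tcokMk x) = q x := fun _ => rfl
  refine ⟨(LinearEquiv.ofBijective f ⟨(injective_iff_map_eq_zero f).2 fun x hx => ?_,
    fun y => ?_⟩).toModuleIso⟩
  · obtain ⟨x, rfl⟩ := Z.tcokMk_surjective x
    exact (Z.tcokMk_eq_zero_iff x).2 ((hq' x).1 hx)
  · obtain ⟨x, rfl⟩ := hq y
    exact ⟨Z.tcokMk x, rfl⟩

attribute [local instance] Abelian.hasFiniteBiproducts

variable [TypeData ω σ ξ]

/-- A stage has a projective cover which is generated by its maps `d` in the first directions. -/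
lemma IsStage.exists_cover {k : ℕ} (hk : k < n) {Z : ModFac ω σ ξ} {M : ModuleCat.{u} A}
    (h : IsStage k Z M) {P : ObjectProperty (ModuleCat.{u} A)} (hP : FrobClass P)
    (hT : IsTwistClosed P)
    (hZ : ∀ α, ∃ (M : ModuleCat.{u} A) (p : M ⟶ Z.X α), Projective M ∧ P M ∧ Epi p) :
    ∃ (W : ModFac ω σ ξ) (g : W ⟶ Z), Epi g ∧ Projective W ∧ HasComponents ω σ ξ P W ∧
      ∀ α, W.lower (k + 1) α = ⊤ := by
  let J := {α : Fin n → Bool // ∃ i : Fin n, (i : ℕ) < k + 1 ∧ α i = false}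
  have : Finite J := Subtype.finite
  choose M p hM hM' hp using hZ
  obtain ⟨U, g, hU, hg, hd⟩ := exists_gen_epi (P := P) Z (J := J) (fun j => j.1)
    (fun j => M j.1) (fun j => hM j.1) (fun j => hM' j.1) (fun j => p j.1)
  have hgen : IsGen P (⨁ U) := .sum U hU
  have hcov : ∀ α (i : Fin n), (i : ℕ) < k + 1 → α i = false → Function.Surjective (Hom.app g α) := by
    intro α i hi hα x
    obtain ⟨x, rfl⟩ := (ModuleCat.epi_iff_surjective _).1 (hp α) x
    exact hg ⟨α, i, hi, hα⟩ x
  refine ⟨⨁ U, g, (epi_iff_surjective g).2 fun α => ?_, hgen.projective,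
    hgen.hasComponents le_rfl hP hT, fun α => eq_top_iff.2 fun x _ => ?_⟩
  · by_cases hα : ∃ i : Fin n, (i : ℕ) < k + 1 ∧ α i = false
    · obtain ⟨i, hi, hα⟩ := hα
      exact hcov α i hi hα
    · have hα' : ∀ i : Fin n, (i : ℕ) < k + 1 → α i = true := by simpa using hα
      have htop := h.lower_eq_top α fun e => by
        have := congrFun e ⟨k, hk⟩
        rw [hα' ⟨k, hk⟩ k.lt_succ_self, stair_of_le (i := ⟨k, hk⟩) le_rfl] at this
        exact absurd this (by simp)
      have hle : Z.lower k α ≤ LinearMap.range (Hom.app g α).hom := by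
        refine iSup₂_le fun i hi x hx => ?_
        have he := isEdge_toggle' (hα' i (by lia))
        obtain ⟨y, rfl⟩ := (Z.mem_layer_iff he x).1 hx
        obtain ⟨y, rfl⟩ := hcov _ i (by lia) he.1 y
        exact ⟨_, (g.app_d _ _ _ he y).symm⟩
      intro x
      exact hle (htop ▸ Submodule.mem_top)
  · have := Fintype.ofFinite J
    rw [← biproduct_total_apply U α x]
    refine sum_mem fun j _ => app_mem_lower _ ?_
    obtain ⟨i, hi, hj⟩ := j.2
    have htop : (U j).layer i α = ⊤ := by
      rcases hα : α i with _ | _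
      · exact (U j).layer_of_false hα
      · have he := isEdge_toggle' hα
        exact eq_top_iff.2 fun y _ => ((U j).mem_layer_iff he y).2 (hd j i hj _ _ he y)
    rw [ModFac.lower_eq_top (U j) hi htop]
    trivial

/-- Modules over the quotient are total cokernels of module factorizations whose components are
projective, with the possible exception of one component which is a syzygy of the module. -/
theorem exists_tcok_iso (hreg : IsRegularSeq ω) {P 𝒦 : ObjectProperty (ModuleCat.{u} A)}
    (hP : FrobClass P) (hT : IsTwistClosed P)
    (hcover : ∀ X, 𝒦 X → ∃ (M : ModuleCat.{u} A) (p : M ⟶ X), Projective M ∧ P M ∧ Epi p)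
    (hker : ∀ S : ShortComplex (ModuleCat.{u} A), S.ShortExact → P S.X₂ → 𝒦 S.X₃ → 𝒦 S.X₁)
    (M : ModuleCat.{u} (A ⧸ ideal ω)) (hM : HasComponents ω σ ξ 𝒦 ((skyBot σ ξ).obj M)) :
    ∃ Z : ModFac ω σ ξ, (∀ i, Projective (Z.facet i)) ∧
      (∀ α, α ≠ stair n 0 → Projective (Z.X α)) ∧
      IsSyzygy ((ModuleCat.restrictScalars.{u} (Ideal.Quotient.mk (ideal ω))).obj M) n
        (Z.X (stair n 0)) ∧
      HasComponents ω σ ξ 𝒦 Z ∧ Nonempty ((TCok ω σ ξ).obj Z ≅ M) := by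
  let rM := (ModuleCat.restrictScalars.{u} (Ideal.Quotient.mk (ideal ω))).obj M
  -- `Z` is a `k`-th syzygy of `skyBot M`, whose facets and components vanish except for `M` itself
  have key : ∀ k ≤ n, ∃ Z : ModFac ω σ ξ, (∀ i, Projective (Z.facet i)) ∧
      (∀ α, α ≠ stair n 0 → Projective (Z.X α)) ∧ IsSyzygy rM k (Z.X (stair n 0)) ∧
      HasComponents ω σ ξ 𝒦 Z ∧ IsStage k Z rM := by
    intro k
    induction k with
    | zero =>
      refine fun _ => ⟨(skyBot σ ξ).obj M, projective_facet_skyBot M, fun α hα => ?_,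
        .zero (funIso (Set.mem_singleton (stair n 0)) rM), hM, isStage_skyBot M⟩
      have := subsingleton_skyBot (σ := σ) (ξ := ξ) M hα
      exact (ModuleCat.isZero_of_subsingleton _).projective
    | succ k ih =>
      intro hk
      obtain ⟨Z, hZf, hZp, hZs, hZ𝒦, hZ⟩ := ih (by lia)
      obtain ⟨W, g, hg, hW, hWP, hW'⟩ := hZ.exists_cover hk hP hT fun α => hcover _ (hZ𝒦 α)
      have hS := shortExact_kernel g
      have hev := (shortExact_iff_ev _).1 hS
      exact ⟨kernel g,
        fun i => frobClass_projective.kernel (facetFunctor_shortExact i hS) (projective_facet hW i)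
          (hZf i),
        fun α hα => frobClass_projective.kernel (hev α) (projective_component hW α) (hZp α hα),
        .succ _ (hev (stair n 0)) (projective_component hW _) hZs,
        fun α => hker _ (hev α) (hWP α) (hZ𝒦 α),
        hZ.succ hk hS (regularUpTo_of_projective hreg hW) hW'⟩
  obtain ⟨Z, hZf, hZp, hZs, hZ𝒦, hZ⟩ := key n le_rfl
  refine ⟨Z, hZf, hZp, hZs, hZ𝒦, ?_⟩
  have hst : ∀ v, v = stair n n → ∃ q : Z.X v →ₗ[A] rM, Function.Surjective q ∧
      ∀ x, q x = 0 ↔ x ∈ Z.lower n v := by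
    rintro _ rfl
    exact hZ.exists_map
  obtain ⟨q, hq, hq'⟩ := hst _ (funext fun i => (stair_of_lt i.2).symm)
  exact tcok_iso Z M q hq hq'

end ModFac

/-! ### Syzygies of Gorenstein projective modules over the quotient -/

namespace ModFac

open ExactCat CategoryTheory.Abelian

section sky

variable {A : Type u} [Ring A] {ι : Type} {ω : ι → A}

lemma isTorsionBySet_ideal {E : ModuleCat.{u} A} (hE : ∀ i, ∀ x : E, ω i • x = 0) :
    Module.IsTorsionBySet A E (ideal ω) := by
  rw [Module.isTorsionBySet_iff_subset_annihilator]
  have key : TwoSidedIdeal.span (Set.range ω) ≤ (Module.annihilator A E).toTwoSided := by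
    rw [TwoSidedIdeal.span_le]
    rintro _ ⟨i, rfl⟩
    exact Ideal.mem_toTwoSided.2 (Module.mem_annihilator.2 (hE i))
  exact fun a ha => Ideal.mem_toTwoSided.1 (key (TwoSidedIdeal.mem_asIdeal.1 ha))

/-- An extension of modules over the quotient, as modules over the ring, is an extension over the
quotient if it is annihilated by the elements `ω i`. -/
lemma exists_retraction {M N : ModuleCat.{u} (A ⧸ ideal ω)} (h : Subsingleton (Ext.{u} M N 1))
    {E : ModuleCat.{u} A} (hE : ∀ i, ∀ x : E, ω i • x = 0)
    {f : (ModuleCat.restrictScalars.{u} (Ideal.Quotient.mk (ideal ω))).obj N ⟶ E}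
    {g : E ⟶ (ModuleCat.restrictScalars.{u} (Ideal.Quotient.mk (ideal ω))).obj M}
    {w : f ≫ g = 0} (hS : (ShortComplex.mk f g w).ShortExact) : ∃ r, f ≫ r = 𝟙 _ := by
  let _ : Module (A ⧸ ideal ω) E := (isTorsionBySet_ideal hE).module
  let f₀ : (ModuleCat.restrictScalars.{u} (Ideal.Quotient.mk (ideal ω))).obj N →ₗ[A] E := f.hom
  let g₀ : E →ₗ[A] (ModuleCat.restrictScalars.{u} (Ideal.Quotient.mk (ideal ω))).obj M := g.hom
  let f' : N →ₗ[A ⧸ ideal ω] E :=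
    { toFun := f₀
      map_add' := fun x y => map_add f₀ x y
      map_smul' := fun b x => by
        obtain ⟨a, rfl⟩ := Ideal.Quotient.mk_surjective b
        exact f₀.map_smul a x }
  let g' : E →ₗ[A ⧸ ideal ω] M :=
    { toFun := g₀
      map_add' := fun x y => map_add g₀ x y
      map_smul' := fun b x => by
        obtain ⟨a, rfl⟩ := Ideal.Quotient.mk_surjective b
        exact g₀.map_smul a x }
  obtain ⟨h₁, h₃, h₂⟩ := (shortExact_mk_iff f g w).1 hS
  have w' : ModuleCat.ofHom f' ≫ ModuleCat.ofHom g' = 0 := by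
    ext x
    exact congrArg (fun k => k.hom x) w
  obtain ⟨r, hr⟩ := extend_of_ext ((shortExact_mk_iff _ _ w').2 ⟨h₁, h₃, h₂⟩) h (𝟙 N)
  let r₀ : E ⟶ (ModuleCat.restrictScalars.{u} (Ideal.Quotient.mk (ideal ω))).obj N :=
    (ModuleCat.restrictScalars.{u} (Ideal.Quotient.mk (ideal ω))).map r
  refine ⟨r₀, ?_⟩
  ext x
  exact congrArg (fun k => k.hom x) hr

lemma extendFun_bijective {p q : Prop} (h : p ↔ q) (M : ModuleCat.{u} A) :
    Function.Bijective (extendFun p q M) := by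
  refine ⟨fun x y hxy => funext fun hp => ?_, fun y => ⟨fun hp => y ⟨h.1 hp.down⟩,
    funext fun hq => extendFun_pos (h.2 hq.down) _ _⟩⟩
  rw [← extendFun_pos hp.down x ⟨h.1 hp.down⟩, hxy, extendFun_pos hp.down]

section pair

variable [LinearOrder ι] {σ : ι → A ≃+* A} {ξ : ι → ι → Aˣ}

variable {i : ι} {v v' : ι → Bool}

/-- The two ends of an edge do not support a composite of two maps `d`. -/
lemma isThin_pair (hv : IsEdge i v v') : IsThin ({v, v'} : Set (ι → Bool)) := by
  have hne : ∀ (j k : ι) (α β γ : ι → Bool), IsEdge j α β → IsEdge k β γ →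
      j ≠ k ∧ α j = false ∧ γ j = true ∧ α k = false ∧ γ k = true := by
    intro j k α β γ h h'
    have hjk : j ≠ k := fun e => by
      subst e
      exact absurd (h.2.1.symm.trans h'.1) (by simp)
    exact ⟨hjk, h.1, (h'.2.2 j hjk).symm.trans h.2.1, (h.2.2 k hjk.symm).trans h'.1, h'.2.1⟩
  rintro j k α β γ h h' hα hγ
  obtain ⟨hjk, h₁, h₂, h₃, h₄⟩ := hne j k α β γ h h'
  rcases hα with rfl | rfl <;> rcases hγ with rfl | rfl
  · exact absurd (h₁.symm.trans h₂) (by simp)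
  · have hj : j = i := by_contra fun e => absurd (h₁.symm.trans ((hv.2.2 j e).trans h₂)) (by simp)
    have hk : k = i := by_contra fun e => absurd (h₃.symm.trans ((hv.2.2 k e).trans h₄)) (by simp)
    exact hjk (hj.trans hk.symm)
  · by_cases hj : j = i
    · rw [hj, hv.1] at h₂
      exact absurd h₂ (by simp)
    · exact absurd (h₁.symm.trans ((hv.2.2 j hj).symm.trans h₂)) (by simp)
  · exact absurd (h₁.symm.trans h₂) (by simp)

lemma not_isEdge_pair (hv : IsEdge i v v') {j : ι} {α β : ι → Bool} (h : IsEdge j α β)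
    (h' : α = v' ∧ β ∈ ({v, v'} : Set (ι → Bool)) ∨ α ∈ ({v, v'} : Set (ι → Bool)) ∧ β = v) :
    False := by
  have hj : ∀ γ, ¬ IsEdge j γ γ := fun γ h => absurd (h.1.symm.trans h.2.1) (by simp)
  have hvv : ¬ IsEdge j v' v := fun h => by
    by_cases e : j = i
    · subst e
      exact absurd (h.1.symm.trans hv.2.1) (by simp)
    · exact absurd (h.1.symm.trans ((hv.2.2 j e).symm.trans h.2.1)) (by simp)
  rcases h' with ⟨rfl, rfl | rfl⟩ | ⟨rfl | rfl, rfl⟩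
  exacts [hvv h, hj _ h, hj _ h, hvv h]

/-- A module placed at both ends of an edge is an extension of the same module placed at the source by
the one placed at the target. -/
lemma shortExact_sky_pair (hv : IsEdge i v v') (N : ModuleCat.{u} (A ⧸ ideal ω)) :
    ∃ (f : skyObj σ ξ (isThin_singleton v') N ⟶ skyObj σ ξ (isThin_pair hv) N)
      (g : skyObj σ ξ (isThin_pair hv) N ⟶ skyObj σ ξ (isThin_singleton v) N) (w : f ≫ g = 0),
      (ShortComplex.mk f g w).ShortExact := by
  have hvv : v ≠ v' := fun e => absurd (hv.2.1.symm.trans ((congrFun e i).symm.trans hv.1))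
    (by simp)
  let f : skyObj σ ξ (isThin_singleton v') N ⟶ skyObj σ ξ (isThin_pair hv) N :=
    { app := fun α => ModuleCat.ofHom (extendFun _ _ _)
      app_d := fun j α β h x => by
        funext hβ
        by_cases hα : α = v'
        · exact (not_isEdge_pair hv h (.inl ⟨hα, hβ.down⟩)).elim
        · have hx : x = 0 := (subsingleton_sky σ ξ (isThin_singleton v') N hα).elim _ _
          subst hx
          simp only [map_zero]
      app_e := fun j α β h x => (map_zero _).symm }
  let g : skyObj σ ξ (isThin_pair hv) N ⟶ skyObj σ ξ (isThin_singleton v) N :=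
    { app := fun α => ModuleCat.ofHom (extendFun _ _ _)
      app_d := fun j α β h x => by
        funext hβ
        by_cases hα : α ∈ ({v, v'} : Set (ι → Bool))
        · exact (not_isEdge_pair hv h (.inr ⟨hα, hβ.down⟩)).elim
        · have hx : x = 0 := (subsingleton_sky σ ξ (isThin_pair hv) N hα).elim _ _
          subst hx
          simp only [map_zero]
      app_e := fun j α β h x => (map_zero _).symm }
  have hf : ∀ α x hα, Hom.app f α x hα = extendFun _ _ _ x hα := fun _ _ _ => rfl
  have hg : ∀ α x hα, Hom.app g α x hα = extendFun _ _ _ x hα := fun _ _ _ => rfl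
  refine ⟨f, g, hom_ext' fun α x => funext fun hα => ?_, ?_⟩
  · have : α ∉ ({v'} : Set (ι → Bool)) := fun h => hvv (hα.down.symm.trans h)
    have hx : x = 0 := (subsingleton_sky σ ξ (isThin_singleton v') N this).elim _ _
    rw [hx, map_zero]
    rfl
  · rw [shortExact_iff]
    refine ⟨fun α => (injective_iff_map_eq_zero _).2 fun x hx => funext fun h => ?_,
      fun α y => ⟨extendFun _ _ _ y, funext fun h => ?_⟩,
      fun α y hy => ⟨extendFun _ _ _ y, funext fun h => ?_⟩⟩
    · exact (extendFun_pos h.down x ⟨Or.inr h.down⟩).symm.trans (congrFun hx _)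
    · exact (extendFun_pos (Or.inl h.down) _ _).trans (extendFun_pos h.down _ _)
    · by_cases hα : α = v'
      · exact (extendFun_pos hα _ _).trans (extendFun_pos h.down _ _)
      · refine (extendFun_neg hα _ _).trans ?_
        have hα' : α = v := h.down.resolve_right hα
        exact (congrFun hy ⟨hα'⟩).symm.trans (extendFun_pos h.down _ _)

/-- A module placed at both ends of an edge has bijective maps `d` in the direction of the edge, so
that `ext_of_bijective` applies to it. -/
lemma sky_pair_bijective (hv : IsEdge i v v') (N : ModuleCat.{u} (A ⧸ ideal ω)) (α β : ι → Bool)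
    (h : IsEdge i α β) : Function.Bijective ((skyObj σ ξ (isThin_pair hv) N).d i α β h) := by
  refine extendFun_bijective ⟨?_, ?_⟩ _
  · rintro (rfl | rfl)
    · exact Or.inr (funext fun j => by
        by_cases hj : j = i
        · rw [hj, h.2.1, hv.2.1]
        · rw [← h.2.2 j hj, hv.2.2 j hj])
    · exact absurd (h.1.symm.trans hv.2.1) (by simp)
  · rintro (rfl | rfl)
    · exact absurd (h.2.1.symm.trans hv.1) (by simp)
    · exact Or.inl (funext fun j => by
        by_cases hj : j = i
        · rw [hj, h.1, hv.1]
        · rw [h.2.2 j hj, hv.2.2 j hj])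

end pair

end sky

variable {A : Type u} [Ring A] {n : ℕ}
variable {ω : Fin n → A} {σ : Fin n → A ≃+* A} {ξ : Fin n → Fin n → Aˣ} [TypeData ω σ ξ]

/-- Extensions between modules placed at the bottom vertex are extensions over the quotient ring: the
middle term has no other components, so that `ω i = e ∘ d` acts as zero on it. -/
lemma ext_one_skyBot {M N : ModuleCat.{u} (A ⧸ ideal ω)} (h : Subsingleton (Ext.{u} M N 1)) :
    Subsingleton (Ext.{u} ((skyBot σ ξ).obj M) ((skyBot σ ξ).obj N) 1) := by
  refine ext_one_of_split fun S hS e₁ e₃ => ?_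
  obtain @⟨X₁, X, X₃, f, g, w⟩ := S
  obtain rfl : X₁ = _ := e₁
  obtain rfl : X₃ = _ := e₃
  obtain ⟨h₁, h₃, h₂⟩ := (shortExact_iff _).1 hS
  have hsub : ∀ α, α ≠ stair n 0 → Subsingleton (X.X α) := by
    intro α hα
    have s₁ := subsingleton_skyBot (σ := σ) (ξ := ξ) N hα
    have s₃ := subsingleton_skyBot (σ := σ) (ξ := ξ) M hα
    refine subsingleton_of_forall_eq 0 fun x => ?_
    obtain ⟨y, rfl⟩ := h₂ α x (s₃.elim _ _)
    rw [s₁.elim y 0]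
    exact map_zero _
  have hE : ∀ i, ∀ x : X.X (stair n 0), ω i • x = 0 := by
    intro i x
    -- `ω i • x = e (d x)`, and `d x` lies in a zero component
    have he := isEdge_toggle (i := i) (α := stair n 0) (stair_zero_apply i)
    rw [← X.e_d i _ _ he x, (hsub _ fun e => ?_).elim (X.d i _ _ he x) 0, map_zero]
    have := he.2.1
    rw [e, stair_zero_apply] at this
    exact absurd this (by simp)
  have hα₀ : stair n 0 ∈ ({stair n 0} : Set (Fin n → Bool)) := rfl
  let rN := (ModuleCat.restrictScalars.{u} (Ideal.Quotient.mk (ideal ω))).obj N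
  let rM := (ModuleCat.restrictScalars.{u} (Ideal.Quotient.mk (ideal ω))).obj M
  obtain ⟨r, hr⟩ := exists_retraction (f := (funIso hα₀ rN).inv ≫ Hom.app f _)
    (g := Hom.app g _ ≫ (funIso hα₀ rM).hom) (w := by
      have := congrArg (fun k => Hom.app k (stair n 0)) w
      rw [Category.assoc, ← Category.assoc (Hom.app f _)]
      exact (congrArg (fun k => (funIso hα₀ rN).inv ≫ k ≫ (funIso hα₀ rM).hom) this).trans
        (by simp)) h hE
    (shortExact_of_isos ((shortExact_iff_ev _).1 hS (stair n 0)) (funIso hα₀ rN) (Iso.refl _)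
      (funIso hα₀ rM) (by simp; rfl) (by simp; rfl) _)
  let ρ : X ⟶ (skyBot σ ξ).obj N :=
    { app := fun α => ModuleCat.ofHom (LinearMap.pi fun h => r.hom ∘ₗ X.cast h.down)
      app_d := fun i α β h x => funext fun hβ => by
        have := h.2.1
        rw [hβ.down, stair_zero_apply] at this
        exact absurd this (by simp)
      app_e := fun i α β h x => funext fun hα => by
        have : Subsingleton (X.X β) := hsub β fun e => by
          have := h.2.1
          rw [e, stair_zero_apply] at this
          exact absurd this (by simp)
        rw [Subsingleton.elim x 0]
        simp only [map_zero] }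
  refine ⟨ρ, hom_ext' fun α x => funext fun hα => ?_⟩
  obtain rfl : α = stair n 0 := hα.down
  have e : r.hom (Hom.app f _ ((funIso hα₀ rN).inv.hom (x hα))) = x hα :=
    congrArg (fun (k : rN ⟶ rN) => k.hom (x hα)) hr
  have hx : (funIso hα₀ rN).inv.hom (x hα) = x :=
    funext fun h => congrArg x (Subsingleton.elim hα h)
  change r.hom (X.cast hα.down (Hom.app f _ x)) = x hα
  exact (congrArg r.hom (X.cast_rfl _)).trans
    ((congrArg (fun z => r.hom (Hom.app f _ z)) hx).symm.trans e)

/-- Moving the target of `Ext` one step up the stairs raises the degree by one, because the module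
placed at both ends of the step has no `Ext` groups. -/
lemma ext_skyBot_sky {M N : ModuleCat.{u} (A ⧸ ideal ω)} (h : Subsingleton (Ext.{u} M N 1)) :
    ∀ k ≤ n, Subsingleton (Ext.{u} ((skyBot σ ξ).obj M)
      (skyObj σ ξ (isThin_singleton (stair n k)) N) (k + 1)) := by
  intro k
  induction k with
  | zero => exact fun _ => ext_one_skyBot h
  | succ k ih =>
    intro hk
    obtain ⟨f, g, w, hS⟩ := shortExact_sky_pair (σ := σ) (ξ := ξ) (isEdge_stair hk) N
    exact ext_co_X₁ hS (ext_of_bijective (projective_facet_skyBot M ⟨k, hk⟩)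
      (sky_pair_bijective (isEdge_stair hk) N) _) (ih (by lia))

section

variable (hreg : IsRegularSeq ω) (σ ξ)
include hreg σ ξ

/-- Over `A`, a Gorenstein projective module over the quotient has no extensions by projective modules
in degrees above `n`. In degree `n + 1`, such extensions vanish together with those of `skyBot M`
by a projective module factorization `R`, hence with those by `TCok R` placed at the top vertex,
hence with the extensions of `M` by the projective module `TCok R` over the quotient. -/
lemma ext_restrictScalars {M : ModuleCat.{u} (A ⧸ ideal ω)}
    (hM : IsGProj (A ⧸ ideal ω) M)
    {Q : ModuleCat.{u} A} (hQ : Projective Q) (m : ℕ) : Subsingleton (Ext.{u}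
      ((ModuleCat.restrictScalars.{u} (Ideal.Quotient.mk (ideal ω))).obj M) Q (n + m + 1)) := by
  induction m generalizing M with
  | zero =>
    obtain ⟨R, hR, -, hR'⟩ := exists_gen_cohom (ω := ω) (σ := σ) (ξ := ξ) (P := fun _ => True)
      (stair n 0) Q hQ trivial
    have hRP : Projective R := hR.projective
    refine ext_retract_left (funIso (Set.mem_singleton (stair n 0)) _).symm.retract
      ((hR' ((skyBot σ ξ).obj M) n).2 ?_)
    obtain ⟨w, hw⟩ := shortExact_tcok R
    refine ext_co_X₂ hw (ext_lowerFac (projective_facet_skyBot M)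
      (regularUpTo_of_projective hreg hRP) n n le_rfl) ?_
    have key : ∀ v, v = stair n n → Subsingleton (Ext.{u} ((skyBot σ ξ).obj M)
        (skyObj σ ξ (isThin_singleton v) ((TCok ω σ ξ).obj R)) (n + 1)) := by
      rintro _ rfl
      exact ext_skyBot_sky (hM.ext (tcok_projective hRP) 0) n le_rfl
    exact key _ (funext fun i => (stair_of_lt i.2).symm)
  | succ m ih =>
    obtain ⟨M', hM', L, i, p, w, hS, hL, -⟩ := hM.exists_cover
    have := hasProjectiveDimensionLE_of_projective hreg σ ξ hL
    exact ext_contra_X₃ (shortExact_restrictScalars _ hS) (ih hM')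
      (HasProjectiveDimensionLT.subsingleton
        ((ModuleCat.restrictScalars.{u} (Ideal.Quotient.mk (ideal ω))).obj L) (n + 1) _ (by lia) Q)

/-- Gorenstein projective modules over the quotient have Gorenstein projective `n`-th syzygies
over the ring. -/
theorem isGProj_of_isSyzygy {M : ModuleCat.{u} (A ⧸ ideal ω)}
    (hM : IsGProj (A ⧸ ideal ω) M)
    {K : ModuleCat.{u} A} (hK : IsSyzygy
      ((ModuleCat.restrictScalars.{u} (Ideal.Quotient.mk (ideal ω))).obj M) n K) :
    IsGProj A K := by
  refine le_isGProj_of_ext (W := fun K => ∃ M, IsGProj (A ⧸ ideal ω) M ∧ IsSyzygy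
    ((ModuleCat.restrictScalars.{u} (Ideal.Quotient.mk (ideal ω))).obj M) n K) ?_ ?_ _ ⟨M, hM, hK⟩
  · rintro K ⟨M, hM, hK⟩ Q hQ m
    refine hK.ext ?_
    have := ext_restrictScalars σ ξ hreg hM hQ m
    convert this using 2
    lia
  · rintro K ⟨M, hM, hK⟩
    obtain ⟨N, hN, L, i, p, w, hS, hL, -⟩ := hM.exists_hull
    obtain ⟨K', hK'⟩ := IsSyzygy.exists
      ((ModuleCat.restrictScalars.{u} (Ideal.Quotient.mk (ideal ω))).obj N) n
    obtain ⟨P, a, b, w', hT, hP⟩ := IsSyzygy.exists_shortExact n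
      (shortExact_restrictScalars (Ideal.Quotient.mk (ideal ω)) hS) hK hK'
    have := hasProjectiveDimensionLE_of_projective hreg σ ξ hL
    exact ⟨P, K', a, b, w', hT, (projective_iff_hasProjectiveDimensionLE_zero P).2
      (hP.hasProjectiveDimensionLE this), N, hN, hK'⟩

end

end ModFac

/-! ### Finitely generated Gorenstein projective modules of finite projective dimension -/

section Finite

variable {R : Type u} [Ring R]

/-- A homomorphism from a finitely generated module to a projective module factors through a
finitely generated projective module. -/
lemma exists_factor_of_finite {M L : ModuleCat.{u} R} (hM : Module.Finite R M) (hL : Projective L)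
    (f : M ⟶ L) : ∃ (F : ModuleCat.{u} R) (g : M ⟶ F) (h : F ⟶ L), IsFGProj R F ∧ g ≫ h = f := by
  have hL' : Module.Projective R L := (IsProjective.iff_projective L).2 hL
  obtain ⟨s, hs⟩ := Module.projective_def'.1 hL'
  obtain ⟨G, hG⟩ := hM.fg_top
  classical
  let T : Finset L := G.biUnion fun x => (s (f x)).support
  have hT : ∀ x, (s ∘ₗ f.hom) x ∈ Finsupp.supported R R (T : Set L) := by
    intro x
    have hx : x ∈ Submodule.span R (G : Set M) := hG ▸ Submodule.mem_top
    refine (Submodule.span_le (p := (Finsupp.supported R R (T : Set L)).comap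
      (s ∘ₗ f.hom))).2 (fun y hy => ?_) hx
    exact (Finsupp.mem_supported R _).2
      (Finset.coe_subset.2 (Finset.subset_biUnion_of_mem (fun x => (s (f x)).support) hy))
  let e := Finsupp.supportedEquivFinsupp (M := R) (R := R) (T : Set L)
  refine ⟨ModuleCat.of R (Finsupp.supported R R (T : Set L)),
    ModuleCat.ofHom ((s ∘ₗ f.hom).codRestrict _ hT),
    ModuleCat.ofHom ((Finsupp.linearCombination R id) ∘ₗ Submodule.subtype _),
    ⟨(IsProjective.iff_projective _).1 (Module.Projective.of_equiv e.symm),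
      Module.Finite.equiv e.symm⟩, ?_⟩
  ext x
  exact LinearMap.congr_fun hs (f x)

lemma exists_finite_cover {M : ModuleCat.{u} R} (hM : Module.Finite R M) :
    ∃ (F : ModuleCat.{u} R) (p : F ⟶ M), Projective F ∧ IsFGProj R F ∧ Epi p := by
  obtain ⟨m, f, hf⟩ := Module.Finite.exists_fin' R M
  have h : Projective (ModuleCat.of R (Fin m → R)) :=
    (IsProjective.iff_projective _).1 inferInstance
  exact ⟨ModuleCat.of R (Fin m → R), ModuleCat.ofHom f, h, ⟨h, inferInstanceAs
    (Module.Finite R (Fin m → R))⟩, (ModuleCat.epi_iff_surjective _).2 hf⟩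

lemma finite_of_shortExact_left [IsNoetherianRing R] {S : ShortComplex (ModuleCat.{u} R)}
    (hS : S.ShortExact) (h : Module.Finite R S.X₂) : Module.Finite R S.X₁ :=
  have := isNoetherian_of_isNoetherianRing_of_finite R S.X₂
  Module.Finite.of_injective S.f.hom hS.moduleCat_injective_f

lemma finite_of_epi {M N : ModuleCat.{u} R} (f : M ⟶ N) [Epi f] (h : Module.Finite R M) :
    Module.Finite R N :=
  Module.Finite.of_surjective f.hom ((ModuleCat.epi_iff_surjective f).1 inferInstance)

/-- Finite generation is not affected by restriction along a surjective ring homomorphism. The rings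
need not be commutative. -/
lemma finite_restrictScalars_iff {S : Type u} [Ring S] {f : R →+* S}
    (hf : Function.Surjective f) (M : ModuleCat.{u} S) :
    Module.Finite R ((ModuleCat.restrictScalars.{u} f).obj M) ↔ Module.Finite S M := by
  constructor
  · intro h
    have : RingHomSurjective f := ⟨hf⟩
    let g : ((ModuleCat.restrictScalars.{u} f).obj M) →ₛₗ[f] M :=
      { toFun := fun x => x, map_add' := fun _ _ => rfl, map_smul' := fun _ _ => rfl }
    exact Module.Finite.of_surjective g fun x => ⟨x, rfl⟩
  · intro h
    obtain ⟨m, g, hg⟩ := Module.Finite.exists_fin' S M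
    let g' : (Fin m → R) →ₗ[R] (ModuleCat.restrictScalars.{u} f).obj M :=
      ∑ j, (LinearMap.toSpanSingleton R ((ModuleCat.restrictScalars.{u} f).obj M)
        (g (Pi.single j 1))) ∘ₗ LinearMap.proj j
    refine Module.Finite.of_surjective g' fun y => ?_
    obtain ⟨x, rfl⟩ := hg y
    choose z hz using fun j => hf (x j)
    refine ⟨z, ?_⟩
    rw [LinearMap.sum_apply]
    have hx : x = ∑ j, x j • (Pi.single j 1 : Fin m → S) := by
      simpa using (pi_eq_sum_univ' x)
    conv_rhs => rw [hx, map_sum]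
    refine Finset.sum_congr rfl fun j _ => ?_
    rw [map_smul, ← hz]
    rfl

end Finite

namespace ExactCat

variable {C : Type u} [Category.{v} C] [Abelian C] {S : ShortComplex C}

lemma exists_hasProjectiveDimensionLE_X₁ (hS : S.ShortExact)
    (h₂ : ∃ d : ℕ, HasProjectiveDimensionLE S.X₂ d)
    (h₃ : ∃ d : ℕ, HasProjectiveDimensionLE S.X₃ d) :
    ∃ d : ℕ, HasProjectiveDimensionLE S.X₁ d := by
  obtain ⟨a, ha⟩ := h₂
  obtain ⟨b, hb⟩ := h₃
  exact ⟨a + b, hS.hasProjectiveDimensionLT_X₁ _ (hasProjectiveDimensionLT_of_ge _ (a + 1) _ (by lia))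
    (hasProjectiveDimensionLT_of_ge _ (b + 1) _ (by lia))⟩

lemma exists_hasProjectiveDimensionLE_X₂ (hS : S.ShortExact)
    (h₁ : ∃ d : ℕ, HasProjectiveDimensionLE S.X₁ d)
    (h₃ : ∃ d : ℕ, HasProjectiveDimensionLE S.X₃ d) :
    ∃ d : ℕ, HasProjectiveDimensionLE S.X₂ d := by
  obtain ⟨a, ha⟩ := h₁
  obtain ⟨b, hb⟩ := h₃
  exact ⟨a + b, hS.hasProjectiveDimensionLT_X₂ _ (hasProjectiveDimensionLT_of_ge _ (a + 1) _ (by lia))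
    (hasProjectiveDimensionLT_of_ge _ (b + 1) _ (by lia))⟩

lemma exists_hasProjectiveDimensionLE_X₃ (hS : S.ShortExact)
    (h₁ : ∃ d : ℕ, HasProjectiveDimensionLE S.X₁ d)
    (h₂ : ∃ d : ℕ, HasProjectiveDimensionLE S.X₂ d) :
    ∃ d : ℕ, HasProjectiveDimensionLE S.X₃ d := by
  obtain ⟨a, ha⟩ := h₁
  obtain ⟨b, hb⟩ := h₂
  exact ⟨a + b + 1, hS.hasProjectiveDimensionLT_X₃ _
    (hasProjectiveDimensionLT_of_ge _ (a + 1) _ (by lia))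
    (hasProjectiveDimensionLT_of_ge _ (b + 1) _ (by lia))⟩

end ExactCat

namespace ModFac

open ExactCat

variable {A : Type u} [Ring A] {n : ℕ}
variable {ω : Fin n → A} {σ : Fin n → A ≃+* A} {ξ : Fin n → Fin n → Aˣ} [TypeData ω σ ξ]

lemma isGProjFin_tcok (hreg : IsRegularSeq ω) {X : ModFac ω σ ξ} (hX : MF0 ω σ ξ X) (hle : MF0 ω σ ξ ≤ GF0 ω σ ξ) :
    IsGProjFin (Ideal.Quotient.mk (ideal ω)) ((TCok ω σ ξ).obj X) :=
  ⟨isGProj_tcok hreg (hle _ hX),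
    (finite_restrictScalars_iff Ideal.Quotient.mk_surjective _).1
      (have := (hX.1 fun _ => true).2
      Module.Finite.of_surjective X.tcokMk X.tcokMk_surjective),
    n, hasProjectiveDimensionLE_tcok (fun α => (hX.1 α).1)
      (regularUpTo_of_hasComponents hreg (frobClass_isFGProj A) isTwistClosed_isFGProj hX.1)⟩

section

variable (σ ξ) (hreg : IsRegularSeq ω)
include σ ξ hreg

/-- The finitely generated Gorenstein projective modules of finite projective dimension over the ring
form a Frobenius class. The embedding into a projective module provided by Gorenstein projectivity
factors through a finitely generated one, and the cokernel remains Gorenstein projective. -/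
theorem frobClass_isGProjFin [IsNoetherianRing A] :
    FrobClass (IsGProjFin (Ideal.Quotient.mk (ideal ω))) := by
  have hB : IsNoetherianRing (A ⧸ ideal ω) :=
    isNoetherianRing_of_surjective A _ _ Ideal.Quotient.mk_surjective
  have hpd : ∀ Q : ModuleCat.{u} (A ⧸ ideal ω), Projective Q → ∃ d : ℕ, HasProjectiveDimensionLE
      ((ModuleCat.restrictScalars.{u} (Ideal.Quotient.mk (ideal ω))).obj Q) d := fun Q hQ =>
    ⟨n, hasProjectiveDimensionLE_of_projective hreg σ ξ hQ⟩
  have hF := frobClass_isGProj (A ⧸ ideal ω)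
  have hproj : ∀ Q, IsFGProj (A ⧸ ideal ω) Q → IsGProjFin (Ideal.Quotient.mk (ideal ω)) Q :=
    fun Q hQ => ⟨isGProj_of_projective hQ.1, hQ.2, hpd Q hQ.1⟩
  refine ⟨fun X hX => hproj X ((frobClass_isFGProj _).zero X hX), fun S hS h₁ h₃ =>
    ⟨hF.ext S hS h₁.1 h₃.1, finite_of_shortExact hS h₁.2.1 h₃.2.1,
      exists_hasProjectiveDimensionLE_X₂ (shortExact_restrictScalars _ hS) h₁.2.2 h₃.2.2⟩,
    fun r h => ?_, fun X hX => ?_, fun X hX => ?_,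
    fun S hS h₃ Q hQ hQ' f => hF.extend S hS h₃.1 Q hQ.1 hQ' f⟩
  · obtain ⟨d, hd⟩ := h.2.2
    exact ⟨hF.retract r h.1, finite_of_retract r h.2.1, d,
      (r.map (ModuleCat.restrictScalars.{u} (Ideal.Quotient.mk (ideal ω)))).hasProjectiveDimensionLT
        (d + 1)⟩
  · obtain ⟨F, p, hFp, hF', hp⟩ := exists_finite_cover hX.2.1
    have hS := shortExact_kernel p
    exact ⟨_, F, _, p, _, hS, hFp, hproj F hF', hF.kernel hS (isGProj_of_projective hFp) hX.1,
      finite_of_shortExact_left hS hF'.2, exists_hasProjectiveDimensionLE_X₁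
        (shortExact_restrictScalars _ hS) (hpd F hFp) hX.2.2⟩
  · obtain ⟨N, hN, L, i, p, w, hT, hL, -⟩ := hX.1.exists_hull
    obtain ⟨F, g, h, hF', rfl⟩ := exists_factor_of_finite hX.2.1 hL i
    have := hT.mono_f
    have hg : Mono g := mono_of_mono g h
    have hS := shortExact_cokernel g
    exact ⟨F, _, g, _, _, hS, hF'.1, hproj F hF',
      hF.cokernel_of_comp hS (isGProj_of_projective hF'.1) h hT hN, finite_of_epi (cokernel.π g) hF'.2,
      exists_hasProjectiveDimensionLE_X₃ (shortExact_restrictScalars _ hS) hX.2.2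
        (hpd F hF'.1)⟩

/-- The total-cokernel functor is dense on Gorenstein projective modules. -/
theorem exists_GF0_tcok_iso {M : ModuleCat.{u} (A ⧸ ideal ω)} (hM : IsGProj (A ⧸ ideal ω) M) :
    ∃ X : ModFac ω σ ξ, GF0 ω σ ξ X ∧ Nonempty ((TCok ω σ ξ).obj X ≅ M) := by
  obtain ⟨Z, hZf, hZp, hZs, -, hZ⟩ := exists_tcok_iso (σ := σ) (ξ := ξ) hreg
    (𝒦 := fun _ => True) (frobClass_projective (C := ModuleCat.{u} A)) isTwistClosed_projective
    (fun X _ => ⟨_, Projective.π X, inferInstance, inferInstance, inferInstance⟩)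
    (fun _ _ _ _ => trivial) M fun _ => trivial
  refine ⟨Z, (isZeroType_iff (frobClass_isGProj A) isTwistClosed_isGProj Z).2
    ⟨fun α => ?_, hZf⟩, hZ⟩
  by_cases hα : α = stair n 0
  · subst hα
    -- the only component which need not be projective is an `n`-th syzygy of `M`
    exact isGProj_of_isSyzygy σ ξ hreg hM hZs
  · exact isGProj_of_projective (hZp α hα)

/-- The total-cokernel functor on matrix factorizations is dense on finitely generated Gorenstein
projective modules of finite projective dimension over the ring. -/
theorem exists_MF0_tcok_iso [IsNoetherianRing A] {M : ModuleCat.{u} (A ⧸ ideal ω)}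
    (hM : IsGProjFin (Ideal.Quotient.mk (ideal ω)) M) :
    ∃ X : ModFac ω σ ξ, MF0 ω σ ξ X ∧ Nonempty ((TCok ω σ ξ).obj X ≅ M) := by
  let 𝒦 : ObjectProperty (ModuleCat.{u} A) := fun X =>
    Module.Finite A X ∧ ∃ d : ℕ, HasProjectiveDimensionLE X d
  let rM := (ModuleCat.restrictScalars.{u} (Ideal.Quotient.mk (ideal ω))).obj M
  obtain ⟨d, hd⟩ := hM.2.2
  have hrM : Module.Finite A rM :=
    (finite_restrictScalars_iff Ideal.Quotient.mk_surjective M).2 hM.2.1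
  obtain ⟨Z, hZf, hZp, hZs, hZ𝒦, hZ⟩ := exists_tcok_iso (σ := σ) (ξ := ξ) hreg (𝒦 := 𝒦)
    (frobClass_isFGProj A) isTwistClosed_isFGProj (fun X hX => exists_finite_cover hX.1)
    (fun S hS h₂ h₃ => ⟨finite_of_shortExact_left hS h₂.2,
      exists_hasProjectiveDimensionLE_X₁ hS
        ⟨0, (projective_iff_hasProjectiveDimensionLE_zero _).1 h₂.1⟩ h₃.2⟩) M (fun α => by
      by_cases hα : α = stair n 0
      · subst hα
        let e : ((skyBot σ ξ).obj M).X (stair n 0) ≅ rM :=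
          funIso (Set.mem_singleton (stair n 0)) rM
        exact ⟨finite_of_retract e.retract hrM, d, hasProjectiveDimensionLT_of_iso e.symm (d + 1)⟩
      · have := subsingleton_skyBot (σ := σ) (ξ := ξ) M hα
        have h0 := ModuleCat.isZero_of_subsingleton (((skyBot σ ξ).obj M).X α)
        exact ⟨inferInstance, 0, (projective_iff_hasProjectiveDimensionLE_zero _).1
          h0.projective⟩)
  refine ⟨Z, (isZeroType_iff (frobClass_isFGProj A) isTwistClosed_isFGProj Z).2
    ⟨fun α => ⟨?_, (hZ𝒦 α).1⟩, hZf⟩, hZ⟩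
  by_cases hα : α = stair n 0
  · subst hα
    obtain ⟨d, hd⟩ := (hZ𝒦 (stair n 0)).2
    -- Gorenstein projective modules of finite projective dimension are projective
    exact (isGProj_of_isSyzygy σ ξ hreg hM.1 hZs).projective hd
  · exact hZp α hα

end

/-! ### The stable equivalence -/

section

variable (hreg : IsRegularSeq ω) {P : ObjectProperty (ModuleCat.{u} A)} (hP : FrobClass P)
  (hT : IsTwistClosed P) {P' : ObjectProperty (ModuleCat.{u} (A ⧸ ideal ω))} (hP' : FrobClass P')
  (h : ∀ X : (IsZeroType ω σ ξ P).FullSubcategory, P' ((TCok ω σ ξ).obj X.obj))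

instance : (P'.lift ((IsZeroType ω σ ξ P).ι ⋙ TCok ω σ ξ) h).Additive where
  map_add {_ _ f g} := ObjectProperty.hom_ext _ ((TCok ω σ ξ).map_add (f := f.hom) (g := g.hom))

include hP hT hP'

lemma isProj_lift_tcok (X : (IsZeroType ω σ ξ P).FullSubcategory)
    (hX : IsProj (shortExactIn (IsZeroType ω σ ξ P)) X) : IsProj (shortExactIn P')
      ((P'.lift ((IsZeroType ω σ ξ P).ι ⋙ TCok ω σ ξ) h).obj X) :=
  (hP'.isProj_iff _).2 (tcok_projective (((frobClass_isZeroType hP hT).isProj_iff X).1 hX))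

include hreg

/-- The total-cokernel functor induces a triangle equivalence between the stable categories of two
Frobenius classes which correspond to each other. -/
theorem isTriangleEquivalence_tcok (hle : P ≤ IsGProj A)
    (hd : ∀ M, P' M → ∃ X : ModFac ω σ ξ, IsZeroType ω σ ξ P X ∧
      Nonempty ((TCok ω σ ξ).obj X ≅ M)) :
    IsTriangleEquivalence (frobClass_isZeroType hP hT).isFrobenius hP'.isFrobenius
      (stableFunctor (P'.lift ((IsZeroType ω σ ξ P).ι ⋙ TCok ω σ ξ) h)
        (isProj_lift_tcok hP hT hP' h)) := by
  have hF := frobClass_isZeroType (ω := ω) (σ := σ) (ξ := ξ) hP hT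
  refine ⟨?_, hF.isTriangleFunctor hP' _ _ fun S hS => ?_⟩
  · have := stableFunctor_full (E := shortExactIn (IsZeroType ω σ ξ P)) (E' := shortExactIn P')
      (P'.lift ((IsZeroType ω σ ξ P).ι ⋙ TCok ω σ ξ) h) (isProj_lift_tcok hP hT hP' h)
      fun X Y g => by
        obtain ⟨f, hf⟩ := tcok_full hreg hP hT X.2 Y.2 g.hom
        exact ⟨ObjectProperty.homMk f, ObjectProperty.hom_ext _ hf⟩
    have := stableFunctor_faithful (E := shortExactIn (IsZeroType ω σ ξ P)) (E' := shortExactIn P')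
      (P'.lift ((IsZeroType ω σ ξ P).ι ⋙ TCok ω σ ξ) h) (isProj_lift_tcok hP hT hP' h)
      hF.isFrobenius hP'.isFrobenius fun X Y f Q hQ s t hst => by
        obtain ⟨I, hI, hI', s', t', hf⟩ := exists_factor_of_tcok hreg hP hT hle X.2 Y.2 f.hom
          ((hP'.isProj_iff Q).1 hQ) s.hom t.hom (congrArg (fun f => f.hom) hst)
        exact ⟨⟨I, hI⟩, (hF.isProj_iff _).2 hI', ObjectProperty.homMk s',
          ObjectProperty.homMk t', ObjectProperty.hom_ext _ hf⟩
    have := stableFunctor_essSurj (E := shortExactIn (IsZeroType ω σ ξ P)) (E' := shortExactIn P')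
      (P'.lift ((IsZeroType ω σ ξ P).ι ⋙ TCok ω σ ξ) h) (isProj_lift_tcok hP hT hP' h)
      fun M => by
        obtain ⟨X, hX, ⟨e⟩⟩ := hd M.obj M.2
        exact ⟨⟨X, hX⟩, ⟨P'.isoMk e⟩⟩
    exact {}
  · have hS' := tcok_shortExact (S := S.map (IsZeroType ω σ ξ P).ι) hS
      (regularUpTo_of_hasComponents hreg hP hT S.X₃.2.1)
    exact hS'

end

end ModFac

theorem theoremC {A : Type u} [Ring A] (n : ℕ) (ω : Fin n → A) (σ : Fin n → A ≃+* A)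
    (ξ : Fin n → Fin n → Aˣ) (htype : IsFacType σ ξ) (hreg : IsRegularSeq ω)
    (hω : IsOfFacType ω σ ξ) :
    ∃ (hGF : ExactCat.IsFrobenius (ModFac.conflations (ModFac.GF0 ω σ ξ)))
      (hB : ExactCat.IsFrobenius (modConflations (IsGProj (A ⧸ ModFac.ideal ω))))
      (hTCok : ∀ X : (ModFac.GF0 ω σ ξ).FullSubcategory,
        IsGProj (A ⧸ ModFac.ideal ω) ((ModFac.TCok ω σ ξ).obj X.obj))
      (F : ExactCat.Stable (ModFac.conflations (ModFac.GF0 ω σ ξ)) ⥤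
        ExactCat.Stable (modConflations (IsGProj (A ⧸ ModFac.ideal ω)))),
      ExactCat.IsInducedBy _ _ F
        ((IsGProj (A ⧸ ModFac.ideal ω)).lift
          ((ModFac.GF0 ω σ ξ).ι ⋙ ModFac.TCok ω σ ξ) hTCok) ∧
      ExactCat.IsTriangleEquivalence hGF hB F ∧
      (IsNoetherianRing A →
        ∃ (hMF : ExactCat.IsFrobenius (ModFac.conflations (ModFac.MF0 ω σ ξ)))
          (hB' : ExactCat.IsFrobenius
            (modConflations (IsGProjFin (Ideal.Quotient.mk (ModFac.ideal ω)))))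
          (hTCok' : ∀ X : (ModFac.MF0 ω σ ξ).FullSubcategory,
            IsGProjFin (Ideal.Quotient.mk (ModFac.ideal ω)) ((ModFac.TCok ω σ ξ).obj X.obj))
          (F' : ExactCat.Stable (ModFac.conflations (ModFac.MF0 ω σ ξ)) ⥤
            ExactCat.Stable (modConflations (IsGProjFin (Ideal.Quotient.mk (ModFac.ideal ω))))),
          ExactCat.IsInducedBy _ _ F'
            ((IsGProjFin (Ideal.Quotient.mk (ModFac.ideal ω))).lift
              ((ModFac.MF0 ω σ ξ).ι ⋙ ModFac.TCok ω σ ξ) hTCok') ∧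
          ExactCat.IsTriangleEquivalence hMF hB' F' ∧
          ∃ (hle : ModFac.MF0 ω σ ξ ≤ ModFac.GF0 ω σ ξ)
            (hle' : IsGProjFin (Ideal.Quotient.mk (ModFac.ideal ω)) ≤
              IsGProj (A ⧸ ModFac.ideal ω))
            (J : ExactCat.Stable (ModFac.conflations (ModFac.MF0 ω σ ξ)) ⥤
              ExactCat.Stable (ModFac.conflations (ModFac.GF0 ω σ ξ)))
            (J' : ExactCat.Stable
                (modConflations (IsGProjFin (Ideal.Quotient.mk (ModFac.ideal ω)))) ⥤
              ExactCat.Stable (modConflations (IsGProj (A ⧸ ModFac.ideal ω)))),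
            ExactCat.IsInducedBy _ _ J (ObjectProperty.ιOfLE hle) ∧ J.Full ∧ J.Faithful ∧
            ExactCat.IsInducedBy _ _ J' (ObjectProperty.ιOfLE hle') ∧ J'.Full ∧ J'.Faithful ∧
            Nonempty (J ⋙ F ≅ F' ⋙ J')) := by
  have : ModFac.TypeData ω σ ξ := .of_isFacType htype hω
  have hGF := ModFac.frobClass_isZeroType (ω := ω) (σ := σ) (ξ := ξ) (frobClass_isGProj A)
    isTwistClosed_isGProj
  have hB := frobClass_isGProj (A ⧸ ModFac.ideal ω)
  have hG : ∀ X : (ModFac.GF0 ω σ ξ).FullSubcategory, IsGProj (A ⧸ ModFac.ideal ω) ((ModFac.TCok ω σ ξ).obj X.obj) :=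
    fun X => ModFac.isGProj_tcok hreg X.2
  rw [ModFac.conflations_eq, ModFac.conflations_eq]
  refine ⟨hGF.isFrobenius, hB.isFrobenius, hG, ExactCat.stableFunctor _
    (ModFac.isProj_lift_tcok (frobClass_isGProj A) isTwistClosed_isGProj hB hG),
    ExactCat.stableFunctor_isInducedBy _ _, ModFac.isTriangleEquivalence_tcok hreg
      (frobClass_isGProj A) isTwistClosed_isGProj hB hG le_rfl
      fun M hM => ModFac.exists_GF0_tcok_iso σ ξ hreg hM, fun hA => ?_⟩
  have hMF := ModFac.frobClass_isZeroType (ω := ω) (σ := σ) (ξ := ξ) (frobClass_isFGProj A)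
    isTwistClosed_isFGProj
  have hB' := ModFac.frobClass_isGProjFin σ ξ hreg
  have hFG : IsFGProj A ≤ IsGProj A := fun M hM => isGProj_of_projective hM.1
  have hle : ModFac.MF0 ω σ ξ ≤ ModFac.GF0 ω σ ξ := fun X hX =>
    (ModFac.isZeroType_iff (frobClass_isGProj A) isTwistClosed_isGProj X).2 ⟨fun α => hFG _ (hX.1 α),
      ((ModFac.isZeroType_iff (frobClass_isFGProj A) isTwistClosed_isFGProj X).1 hX).2⟩
  have hle' : IsGProjFin (Ideal.Quotient.mk (ModFac.ideal ω)) ≤ IsGProj (A ⧸ ModFac.ideal ω) := fun M hM => hM.1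
  have hM : ∀ X : (ModFac.MF0 ω σ ξ).FullSubcategory,
      IsGProjFin (Ideal.Quotient.mk (ModFac.ideal ω)) ((ModFac.TCok ω σ ξ).obj X.obj) :=
    fun X => ModFac.isGProjFin_tcok hreg X.2 hle
  refine ⟨hMF.isFrobenius, hB'.isFrobenius, hM, ExactCat.stableFunctor _
    (ModFac.isProj_lift_tcok (frobClass_isFGProj A) isTwistClosed_isFGProj hB' hM),
    ExactCat.stableFunctor_isInducedBy _ _, ModFac.isTriangleEquivalence_tcok hreg
      (frobClass_isFGProj A) isTwistClosed_isFGProj hB' hM hFG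
      fun M hM => ModFac.exists_MF0_tcok_iso σ ξ hreg hM, hle, hle',
    ExactCat.stableFunctor (ObjectProperty.ιOfLE hle) (ExactCat.ιOfLE_isProj hMF hGF hle),
    ExactCat.stableFunctor (ObjectProperty.ιOfLE hle') (ExactCat.ιOfLE_isProj hB' hB hle'),
    ExactCat.stableFunctor_isInducedBy _ _, (hMF.full_faithful_ιOfLE hGF hle).1,
    (hMF.full_faithful_ιOfLE hGF hle).2, ExactCat.stableFunctor_isInducedBy _ _,
    (hB'.full_faithful_ιOfLE hB hle').1, (hB'.full_faithful_ιOfLE hB hle').2, ⟨?_⟩⟩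
  exact CategoryTheory.Quotient.natIsoLift _ (Iso.refl _)
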